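/- **Setting.** A restricted Boltzmann machine (RBM) $(J,f,g)$ with $n$ visible and $m$ latent nodes has the law $P(X=x,Y=y)=\frac1Z\exp(x^{\mathsf T}Jy+f^{\mathsf T}x+g^{\mathsf T}y)$ on $\{\pm1\}^n\times\{\pm1\}^m$. It is *locally consistent* if for each latent node $j$ all $J_{ij}$ are $\ge 0$ or all $J_{ij}$ are $\le 0$ (the external fields $f,g$ are arbitrary), and *$(\alpha,\beta)$-non-degenerate* if $|J_{ij}|\ge\alpha$ whenever $J_{ij}\ne0$, $\sum_j|J_{ij}|+|f_i|\le\beta$ for all $i$, and $\sum_i|J_{ij}|+|g_j|\le\beta$ for all $j$. The *two-hop neighborhood* $\mathcal N_2(u)$ of a visible node $u$ is the smallest set $S\subseteq[n]\setminus\{u\}$ such that, conditioned on $X_S$, $X_u$ is independent of $X_v$ for every visible $v\notin S\cup\{u\}$. For samples $x^1,\dots,x^H\in\{\pm1\}^n$, let $\widehat{\mathrm{Cov}}^{\mathrm{avg}}(u,v|S)$ be the average, over the empirical distribution of $x_S$, of the empirical conditional covariance of $X_u$ and $X_v$ given $x_S$. The *greedy algorithm* for $u$ with threshold $\tau$ starts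 with $S=\emptyset$; as long as $\max_{v\notin S\cup\{u\}}\widehat{\mathrm{Cov}}^{\mathrm{avg}}(u,v|S)\ge\tau$, it adds a maximizer $v$ to $S$; finally it returns the set of those $v\in S$ with $\widehat{\mathrm{Cov}}^{\mathrm{avg}}(u,v|S\setminus\{v\})\ge\tau$. *Quantum query access* to the samples means that for each $i\in[H]$ the map $|j\rangle|\bar0\rangle\mapsto|j\rangle|x^i_j\rangle$, $j\in[n]$, can be applied in unit time. The computational model is a classical random access machine controlling a quantum memory with a universal gate set, in which basic arithmetic operations on registers take unit time. **Theorem.** There are a quantum algorithm (a single program, with input $n,H,u,\tau,\zeta$ and quantum query access to $H$ samples) and universal constants $C,K>0$ such that the following holds. Let $0<\alpha\le\beta$, $0<\zeta<1$, $\tau=\alpha^2e^{-12\beta}$, $T^*=8/\tau^2$, $\delta=\frac12e^{-2\beta}$, consider an $(\alpha,\beta)$-non-degenerate locally consistent RBM with $n$ visible nodes, let $u$ be a visible node, and suppose that $$H\ \ge\ C\,\bigl(\log(1/\zeta)+T^*\log n\bigr)\,\frac{2^{2T^*}}{\tau^2\delta^{2T^*}} .$$ Then 1. on any $H$ samples,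 and for all measurement outcomes, the algorithm runs in time at most $K\bigl(H{T^*}^2+H\sqrt n\,T^*\log(T^*/\zeta)\bigr)$; 2. on any $H$ samples, with probability at least $1-\zeta/2$ over the measurements, it returns a set that the greedy algorithm for $u$ with threshold $\tau$ can return (for some way of breaking ties between maximizers); 3. on $H$ independent samples of the visible nodes of the RBM, it returns $\mathcal N_2(u)$ with probability at least $1-\zeta$ over the samples and the measurements. -/

import Mathlib

noncomputable section

/-! ### Restricted Boltzmann machines -/

/-- Configurations in `{±1}^n`. -/
abbrev SpinConfig (n : ℕ) : Type := Fin n → ℤˣ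

/-- The real number `±1` given by a spin. -/
def spin (s : ℤˣ) : ℝ := ((s : ℤ) : ℝ)

/-- An RBM `(J, f, g)` with `n` visible and `m` latent nodes. -/
structure RBM (n m : ℕ) where
  /-- interaction matrix -/
  J : Matrix (Fin n) (Fin m) ℝ
  /-- external fields of the visible nodes -/
  f : Fin n → ℝ
  /-- external fields of the latent nodes -/
  g : Fin m → ℝ

namespace RBM

variable {n m : ℕ}

/-- The unnormalized weight `exp (xᵀ J y + fᵀ x + gᵀ y)`. -/
def weight (R : RBM n m) (x : SpinConfig n) (y : SpinConfig m) : ℝ :=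
  Real.exp ((∑ i, ∑ j, spin (x i) * R.J i j * spin (y j))
    + (∑ i, R.f i * spin (x i)) + ∑ j, R.g j * spin (y j))

/-- The partition function. -/
def Z (R : RBM n m) : ℝ := ∑ x : SpinConfig n, ∑ y : SpinConfig m, R.weight x y

/-- `P(X = x, Y = y)`. -/
def prob (R : RBM n m) (x : SpinConfig n) (y : SpinConfig m) : ℝ := R.weight x y / R.Z

/-- `P(X = x)`, the law of the visible nodes. -/
def visibleProb (R : RBM n m) (x : SpinConfig n) : ℝ := ∑ y, R.prob x y

open Classical in
/-- The probability of an event that depends on the visible nodes. -/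
def pr (R : RBM n m) (E : SpinConfig n → Prop) : ℝ :=
  ∑ x : SpinConfig n, if E x then R.visibleProb x else 0

/-- Conditioned on `X_S`, the variables `X_i` and `X_j` are independent: for every value `a_S` of
`X_S` one has `P(X_i = s, X_j = t | a_S) = P(X_i = s | a_S) P(X_j = t | a_S)`, here with the
(positive) denominators cleared. -/
def CondIndep (R : RBM n m) (i j : Fin n) (S : Finset (Fin n)) : Prop :=
  ∀ (a : SpinConfig n) (s t : ℤˣ),
    R.pr (fun x => (∀ k ∈ S, x k = a k) ∧ x i = s ∧ x j = t) * R.pr (fun x => ∀ k ∈ S, x k = a k)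
      = R.pr (fun x => (∀ k ∈ S, x k = a k) ∧ x i = s)
        * R.pr (fun x => (∀ k ∈ S, x k = a k) ∧ x j = t)

/-- `N` is the two-hop neighborhood of `i`: the smallest set `S` of visible nodes other than `i`
such that conditioned on `X_S`, `X_i` is independent of `X_j` for every visible
`j ∉ S ∪ {i}`. -/
def IsTwoHopNeighborhood (R : RBM n m) (i : Fin n) (N : Finset (Fin n)) : Prop :=
  IsLeast {S : Finset (Fin n) | i ∉ S ∧ ∀ j, j ∉ S → j ≠ i → R.CondIndep i j S} N

/-- `(α, β)`-non-degeneracy. -/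
structure NonDegenerate (R : RBM n m) (α β : ℝ) : Prop where
  lower : ∀ i j, R.J i j ≠ 0 → α ≤ |R.J i j|
  visible : ∀ i, ∑ j, |R.J i j| + |R.f i| ≤ β
  latent : ∀ j, ∑ i, |R.J i j| + |R.g j| ≤ β

/-- Local consistency: the interactions of each latent node all have the same sign. -/
def LocallyConsistent (R : RBM n m) : Prop :=
  ∀ j, (∀ i, 0 ≤ R.J i j) ∨ (∀ i, R.J i j ≤ 0)

/-- The probability of drawing the list of samples `x` in `H` independent draws of the visible
nodes. -/
def samplesProb (R : RBM n m) {H : ℕ} (x : Fin H → SpinConfig n) : ℝ :=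
  ∏ k, R.visibleProb (x k)

end RBM

/-! ### The empirical average conditional covariance and the greedy algorithm -/

section Greedy

variable {n H : ℕ}

/-- The indices of the samples that agree with the `k`-th sample on `S`. -/
def agreeing (x : Fin H → SpinConfig n) (S : Finset (Fin n)) (k : Fin H) : Finset (Fin H) :=
  {l | ∀ w ∈ S, x l w = x k w}

/-- The empirical conditional expectation of `h` given `X_S = x_S^k`. -/
def empCondMean (x : Fin H → SpinConfig n) (S : Finset (Fin n)) (h : SpinConfig n → ℝ)
    (k : Fin H) : ℝ :=
  (∑ l ∈ agreeing x S k, h (x l)) / (agreeing x S k).card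

/-- The empirical conditional covariance of `X_u` and `X_v` given `X_S = x_S^k`. -/
def empCondCov (x : Fin H → SpinConfig n) (u v : Fin n) (S : Finset (Fin n)) (k : Fin H) : ℝ :=
  empCondMean x S (fun z => spin (z u) * spin (z v)) k
    - empCondMean x S (fun z => spin (z u)) k * empCondMean x S (fun z => spin (z v)) k

/-- The empirical average conditional covariance of `X_u` and `X_v` given `X_S`. -/
def empAvgCov (x : Fin H → SpinConfig n) (u v : Fin n) (S : Finset (Fin n)) : ℝ :=
  (∑ k, empCondCov x u v S k) / H

/-- `GreedyLoop x u τ S T`: the main loop of the greedy algorithm for the node `u` with threshold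
`τ`, entered with the set `S`, can end with the set `T`. As long as the maximal empirical average
conditional covariance of `u` with a node outside `S ∪ {u}` is at least `τ`, a maximizer is added
to `S`. -/
inductive GreedyLoop (x : Fin H → SpinConfig n) (u : Fin n) (τ : ℝ) :
    Finset (Fin n) → Finset (Fin n) → Prop
  | finish (S : Finset (Fin n)) (h : ∀ v, v ∉ S → v ≠ u → empAvgCov x u v S < τ) :
      GreedyLoop x u τ S S
  | step (S T : Finset (Fin n)) (v : Fin n) (hS : v ∉ S) (hu : v ≠ u)
      (hmax : ∀ w, w ∉ S → w ≠ u → empAvgCov x u w S ≤ empAvgCov x u v S)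
      (hτ : τ ≤ empAvgCov x u v S) (h : GreedyLoop x u τ (insert v S) T) :
      GreedyLoop x u τ S T

/-- The pruning step: keep the nodes of `T` whose empirical average conditional covariance with
`u`, given the rest of `T`, is at least `τ`. -/
def prune (x : Fin H → SpinConfig n) (u : Fin n) (τ : ℝ) (T : Finset (Fin n)) :
    Finset (Fin n) :=
  {v ∈ T | τ ≤ empAvgCov x u v (T.erase v)}

/-- `N` is a result of the greedy algorithm, with ties between maximizers broken in some way. -/
def GreedyResult (x : Fin H → SpinConfig n) (u : Fin n) (τ : ℝ) (N : Finset (Fin n)) : Prop :=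
  ∃ T, GreedyLoop x u τ ∅ T ∧ N = prune x u τ T

end Greedy

/-! ### Quantum algorithms

A classical random access machine controls a quantum memory. Both memories consist of
registers that hold one number each, and an arithmetic operation on registers takes unit time.
Every program uses only finitely many instructions and is independent of the size of the input.
-/

/-- Contents of the registers. -/
abbrev Registers : Type := ℕ → ℝ

/-- A state vector of the quantum memory: a finite superposition of contents of the registers. -/
abbrev QState : Type := Registers →₀ ℂ

/-- The address of a register: a constant, or the number stored in a classical register. -/
inductive Addr
  | direct (k : ℕ)
  | indirect (k : ℕ)

/-- The address denoted when the classical memory is `mem`. -/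
def Addr.eval (mem : Registers) : Addr → ℕ
  | direct k => k
  | indirect k => ⌊mem k⌋₊

/-- Basic arithmetic operations. -/
inductive ArithOp
  | plus
  | minus
  | times
  | divide
  | le

/-- The result of an operation; a comparison gives `1` for true and `0` for false. -/
def ArithOp.eval : ArithOp → ℝ → ℝ → ℝ
  | plus, a, b => a + b
  | minus, a, b => a - b
  | times, a, b => a * b
  | divide, a, b => a / b
  | le, a, b => if a ≤ b then 1 else 0

/-- Quantum gates. A flag `inv` set to `true` denotes the inverse gate. -/
inductive QGate
  /-- Hadamard gate on the qubit spanned by the contents `0` and `1` of the register `q` -/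
  | hadamard (q : Addr)
  /-- `π/8`-gate on the same qubit -/
  | phase (q : Addr)
  /-- controlled negation of `t`, with control `a` -/
  | cnot (a t : Addr)
  /-- adds the content of the classical register `r` to the quantum register `t` -/
  | load (inv : Bool) (t r : Addr)
  /-- adds the result of an operation on the quantum registers `a`, `b` to the register `t` -/
  | arith (inv : Bool) (o : ArithOp) (t a b : Addr)
  /-- sample query: if the classical register `i` holds `k` and the quantum register `j` holds
  `v`, the value of node `v` in the `k`-th sample is added to the quantum register `t` -/
  | query (inv : Bool) (i j t : Addr)

/-- The value of node `b` in the `a`-th sample, and `0` if there is no such sample or node.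
Samples and nodes are numbered from `0`. -/
def sampleValue {n H : ℕ} (x : Fin H → SpinConfig n) (a b : ℝ) : ℝ :=
  ∑ k : Fin H, ∑ v : Fin n,
    if a = ((k : ℕ) : ℝ) ∧ b = ((v : ℕ) : ℝ) then spin (x k v) else 0

/-- `c` with `d` added to (or, if `inv` is set, subtracted from) the register `t`. -/
def shiftReg (inv : Bool) (c : Registers) (t : ℕ) (d : ℝ) : Registers :=
  Function.update c t (if inv then c t - d else c t + d)

/-- The image of the basis vector `c` under a gate. A gate whose target register coincides with
one of its source registers acts as the identity. -/
def QGate.onBasis {n H : ℕ} (x : Fin H → SpinConfig n) (mem : Registers) :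
    QGate → Registers → QState
  | hadamard q, c =>
      if c (q.eval mem) = 0 then
        ((Real.sqrt 2 : ℂ)⁻¹) •
          (Finsupp.single c 1 + Finsupp.single (Function.update c (q.eval mem) 1) 1)
      else if c (q.eval mem) = 1 then
        ((Real.sqrt 2 : ℂ)⁻¹) •
          (Finsupp.single (Function.update c (q.eval mem) 0) 1 - Finsupp.single c 1)
      else Finsupp.single c 1
  | phase q, c =>
      Finsupp.single c (if c (q.eval mem) = 1 then Complex.exp (Real.pi / 4 * Complex.I) else 1)
  | cnot a t, c =>
      if a.eval mem ≠ t.eval mem ∧ c (a.eval mem) = 1 then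
        Finsupp.single (Function.update c (t.eval mem) (1 - c (t.eval mem))) 1
      else Finsupp.single c 1
  | load inv t r, c =>
      Finsupp.single (shiftReg inv c (t.eval mem) (mem (r.eval mem))) 1
  | arith inv o t a b, c =>
      if t.eval mem = a.eval mem ∨ t.eval mem = b.eval mem then Finsupp.single c 1
      else Finsupp.single
        (shiftReg inv c (t.eval mem) (o.eval (c (a.eval mem)) (c (b.eval mem)))) 1
  | query inv i j t, c =>
      if t.eval mem = j.eval mem then Finsupp.single c 1
      else Finsupp.single
        (shiftReg inv c (t.eval mem) (sampleValue x (mem (i.eval mem)) (c (j.eval mem)))) 1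

/-- The linear action of a gate on state vectors. -/
def QGate.apply {n H : ℕ} (x : Fin H → SpinConfig n) (mem : Registers) (G : QGate)
    (ψ : QState) : QState :=
  ψ.sum fun c z => z • G.onBasis x mem c

/-- Programs. -/
inductive QProg
  /-- stores the constant `k` in the classical register `r` -/
  | const (r : Addr) (k : ℕ)
  /-- stores the result of an operation on the classical registers `a`, `b` in `r` -/
  | arith (o : ArithOp) (r a b : Addr)
  /-- applies a quantum gate -/
  | gate (G : QGate)
  /-- measures the quantum register `q`, and stores the outcome in the classical register `r` -/
  | measure (q r : Addr)
  /-- sequential composition -/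
  | seq (p q : QProg)
  /-- runs `p` if the content of the classical register `a` is at most that of `b`, and otherwise
  runs `q` -/
  | ifLe (a b : Addr) (p q : QProg)
  /-- runs `p` as many times as the classical register `r` says on entry -/
  | loop (r : Addr) (p : QProg)

/-- A branch of a computation: the classical memory, the quantum state projected onto the
measurement outcomes so far and not renormalized, and the number of steps done so far. The square
of the norm of the quantum state is the probability of the branch. -/
structure QBranch where
  mem : Registers
  state : QState
  time : ℕ

/-- The probability of a branch. -/
def QBranch.prob (b : QBranch) : ℝ := b.state.sum fun _ z => ‖z‖ ^ 2

/-- Counts one step. -/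
def QBranch.tick (b : QBranch) : QBranch := ⟨b.mem, b.state, b.time + 1⟩

/-- The branches in which a program ends when it is started in a given branch and queries the
samples `x`. Every instruction, every test and every iteration of a loop takes one step. -/
def QProg.run {n H : ℕ} (x : Fin H → SpinConfig n) : QProg → QBranch → Multiset QBranch
  | const r k, b => {⟨Function.update b.mem (r.eval b.mem) (k : ℝ), b.state, b.time + 1⟩}
  | arith o r a c, b =>
      {⟨Function.update b.mem (r.eval b.mem)
          (o.eval (b.mem (a.eval b.mem)) (b.mem (c.eval b.mem))), b.state, b.time + 1⟩}
  | gate G, b => {⟨b.mem, G.apply x b.mem b.state, b.time + 1⟩}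
  | measure q r, b =>
      (b.state.support.image fun c => c (q.eval b.mem)).val.map fun a =>
        ⟨Function.update b.mem (r.eval b.mem) a,
          b.state.filter (fun c => c (q.eval b.mem) = a), b.time + 1⟩
  | seq p q, b => (run x p b).bind (run x q)
  | ifLe a c p q, b =>
      if b.mem (a.eval b.mem) ≤ b.mem (c.eval b.mem) then run x p b.tick else run x q b.tick
  | loop r p, b =>
      (fun s : Multiset QBranch => s.bind fun b' => run x p b'.tick)^[⌊b.mem (r.eval b.mem)⌋₊]
        {b.tick}

/-- The initial branch: the classical registers `0, …, 4` hold the number `n` of visible nodes, the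
number `H` of samples, the node `u`, the threshold `τ` and the error probability `ζ`; all other
registers, classical and quantum, hold `0`. -/
def QBranch.initial {n : ℕ} (H : ℕ) (u : Fin n) (τ ζ : ℝ) : QBranch where
  mem
    | 0 => n
    | 1 => H
    | 2 => (u : ℕ)
    | 3 => τ
    | 4 => ζ
    | _ => 0
  state := Finsupp.single (fun _ => 0) 1
  time := 0

/-- The set of nodes that a computation returns, as a list: the classical register `0` holds its
length, the register `1` the address of its first entry, and the entries follow one another. -/
def QBranch.output (n : ℕ) (b : QBranch) : Finset (Fin n) :=
  {v | ∃ i ∈ Finset.range ⌊b.mem 0⌋₊, b.mem (⌊b.mem 1⌋₊ + i) = ((v : ℕ) : ℝ)}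

/-- The branches in which the program `A` ends on the samples `x` and the input `u, τ, ζ`. -/
def QProg.outcomes {n H : ℕ} (A : QProg) (x : Fin H → SpinConfig n) (u : Fin n) (τ ζ : ℝ) :
    Multiset QBranch :=
  A.run x (QBranch.initial H u τ ζ)

open Classical in
/-- The probability, over the measurements, that the set returned by `A` satisfies `E`. -/
def QProg.outputProb {n H : ℕ} (A : QProg) (x : Fin H → SpinConfig n) (u : Fin n) (τ ζ : ℝ)
    (E : Finset (Fin n) → Prop) : ℝ :=
  (((A.outcomes x u τ ζ).filter fun b => E (b.output n)).map QBranch.prob).sum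

end

/-! The proof has a statistical half and a computational half, joined by one identity for empirical
covariances.

Statistics. Given the latent spins, the visible spins are independent with means `tanh` of their
local fields. Fixing `X_S` and summing over the other visible spins leaves a weight on the latent
cube. Local consistency allows the latent spins to be flipped so that all couplings become
nonnegative; the weight is then log-supermodular, for all external fields and all values of `X_S`,
and the means are increasing. The FKG inequality, applied after subtracting from each mean a
multiple of a common latent spin, bounds the conditional covariance of `u` with any node that shares
a latent neighbor with it from below by `α² e^{-6β}` (`covNum_ge`). Once `S` contains all these
nodes, `u` is independent of the rest (`condIndep_of_coupled_subset`), so they form the two-hop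
neighborhood. Hoeffding's inequality and a union bound over all sets of at most `1/τ²` nodes make
the empirical covariances accurate up to less than `τ²`. Since `τ + τ² ≤ α² e^{-6β}`, comparison
with `τ` then separates neighbors from the nodes that pruning must remove
(`greedyResult_eq_coupled`). No larger sets occur: the residual sum of squares of `X_u` given `X_S`
starts at most at `H`, and each insertion lowers it by at least `τ² H` (`rss_insert_le`).

The identity. `H` times the empirical average covariance of `u` and `v` given `S` equals `∑ k, W k *
x^k_v`, where `W k` is the residual of `X_u` in the `k`-th sample (`sum_empCondCov`). The weights do
not depend on `v`. They are computed classically in time `O(H |S|)`, by sorting the samples into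
classes according to a base-3 code of `x_S`. The score of `v` is then a sum over `H` queries that
can be evaluated in superposition, and undone.

Search. The maximizer is found by Grover iterations with an increasing threshold, in the manner of
Dürr and Høyer. With `N` basis states, of which `t ≤ N/2` beat the current threshold, a random
number of iterations below `2^k` followed by a measurement leaves an expected number of better nodes
of at most `7t/8 + N/(8·4^k)`. Sixteen such rounds on each level `k`, up to `2^k` of order `√n`,
leave an expected number of at most `1/2` (`spec_climb`). By Markov's inequality such a climb misses
the maximum with probability at most `1/2`, and `O(log (T/ζ))` climbs reduce this to `ζ/(2T)` for
each of the at most `T` iterations of the main loop.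

Verification of the program. A run is a multiset of unnormalized branches, and the gates are
isometries, so that total probability is conserved (`QProg.wt_one_run`). `Det` describes pieces of
the program with a single branch. `Spec` combines an assertion about every branch, which carries the
running time, with a bound for the expectation of a function of the final branch, which carries the
progress of the search and the probability of error. Expectations are composed backwards, as weakest
preconditions are. -/

noncomputable section

/-! ### Spins and product sums -/

theorem spin_eq_one_or (s : ℤˣ) : spin s = 1 ∨ spin s = -1 := by
  rcases Int.units_eq_one_or s with rfl | rfl <;> simp [spin]

@[simp] theorem spin_one : spin 1 = 1 := by simp [spin]

@[simp] theorem spin_neg (s : ℤˣ) : spin (-s) = -spin s := by simp [spin]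

@[simp] theorem spin_mul_self (s : ℤˣ) : spin s * spin s = 1 := by
  rcases spin_eq_one_or s with h | h <;> simp [h]

@[simp] theorem abs_spin (s : ℤˣ) : |spin s| = 1 := by
  rcases spin_eq_one_or s with h | h <;> simp [h]

theorem spin_injective : Function.Injective spin := by
  intro s t h
  rcases Int.units_eq_one_or s with rfl | rfl <;> rcases Int.units_eq_one_or t with rfl | rfl <;>
    first | rfl | (simp at h; norm_num at h)

theorem sum_units (φ : ℤˣ → ℝ) : ∑ s, φ s = φ 1 + φ (-1) := by
  have : (Finset.univ : Finset ℤˣ) = {1, -1} := by decide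
  rw [this, Finset.sum_pair (by decide)]

theorem sum_prod_config {n : ℕ} (ψ : Fin n → ℤˣ → ℝ) :
    ∑ x : SpinConfig n, ∏ i, ψ i (x i) = ∏ i, ∑ s, ψ i s := by
  rw [Finset.prod_univ_sum, Fintype.piFinset_univ]

/-! ### Covariances of monotone functions under log-supermodular weights -/

section FKG

variable {m : ℕ}

/-- The sign `±1` of a Boolean. -/
def pm (b : Bool) : ℝ := if b then 1 else -1

@[simp] theorem pm_true : pm true = 1 := rfl
@[simp] theorem pm_false : pm false = -1 := rfl

theorem pm_mul_self (b : Bool) : pm b * pm b = 1 := by cases b <;> simp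

theorem pm_mono {a b : Bool} (h : a ≤ b) : pm a ≤ pm b := by
  cases a <;> cases b <;> first | exact absurd h (by decide) | norm_num

theorem pm_inf_add_sup (a b : Bool) : pm (a ⊓ b) + pm (a ⊔ b) = pm a + pm b := by
  cases a <;> cases b <;> simp

/-- The Fortuin–Kasteleyn–Ginibre inequality without sign conditions on the functions. -/
theorem fkg_cov (μ F G : (Fin m → Bool) → ℝ) (hμ₀ : 0 ≤ μ)
    (hμ : ∀ a b, μ a * μ b ≤ μ (a ⊓ b) * μ (a ⊔ b)) (hF : Monotone F) (hG : Monotone G) :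
    (∑ b, μ b * F b) * ∑ b, μ b * G b ≤ (∑ b, μ b) * ∑ b, μ b * (F b * G b) := by
  -- The inequality that is applied requires nonnegative functions. Subtracting the value at `⊥`,
  -- the minimum of a monotone function, achieves this and does not change covariances.
  have key := fkg (μ := μ) (f := fun b => F b - F ⊥) (g := fun b => G b - G ⊥) hμ₀
    (fun b => sub_nonneg.2 (hF bot_le)) (fun b => sub_nonneg.2 (hG bot_le))
    (fun a b h => sub_le_sub_right (hF h) _) (fun a b h => sub_le_sub_right (hG h) _) hμ
  have e1 : ∑ b, μ b * (F b - F ⊥) = ∑ b, μ b * F b - (∑ b, μ b) * F ⊥ := by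
    simp [mul_sub, Finset.sum_mul]
  have e2 : ∑ b, μ b * (G b - G ⊥) = ∑ b, μ b * G b - (∑ b, μ b) * G ⊥ := by
    simp [mul_sub, Finset.sum_mul]
  have e3 : ∑ b, μ b * ((F b - F ⊥) * (G b - G ⊥)) = ∑ b, μ b * (F b * G b)
      - (∑ b, μ b * F b) * G ⊥ - (∑ b, μ b * G b) * F ⊥ + (∑ b, μ b) * (F ⊥ * G ⊥) := by
    simp only [Finset.sum_mul, ← Finset.sum_sub_distrib, ← Finset.sum_add_distrib]
    exact Finset.sum_congr rfl fun b _ => by ring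
  rw [e1, e2, e3] at key
  nlinarith [key]

/-- Only pairs `a ≤ b` with `a j = false` and `b j = true` need an argument: on the way through
`Function.update b j false`, the last flip alone raises `F` by `2 * κ`, which pays for the change of
`κ * pm (b j)`. -/
theorem monotone_sub_pm (F : (Fin m → Bool) → ℝ) (hF : Monotone F) (j : Fin m) (κ : ℝ)
    (hκ : ∀ b, 2 * κ ≤ F (Function.update b j true) - F (Function.update b j false)) :
    Monotone fun b => F b - κ * pm (b j) := by
  intro a b hab
  have hj := hab j
  rcases ha : a j with _ | _ <;> rcases hb : b j with _ | _
  · simpa [ha, hb] using hF hab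
  · have h1 : a ≤ Function.update b j false := by
      intro i
      by_cases hi : i = j
      · subst hi; simp [ha]
      · simpa [hi] using hab i
    have h2 := hκ b
    have h3 : Function.update b j true = b := by rw [← hb]; simp
    rw [h3] at h2
    have := hF h1
    simp only [ha, hb, pm_true, pm_false]
    linarith
  · rw [ha, hb] at hj
    exact absurd (show (true : Bool) ≤ false from hj) (by decide)
  · simpa [ha, hb] using hF hab

/-- Both `F` and `G` stay monotone after subtracting `κ` times the `j`-th spin. Two applications of
FKG give `Cov(F, G) ≥ κ Cov(pm, G) ≥ κ² Var(pm)`, here multiplied by the square of the total mass.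
-/
theorem cov_ge_of_increments (μ F G : (Fin m → Bool) → ℝ) (hμ₀ : 0 ≤ μ)
    (hμ : ∀ a b, μ a * μ b ≤ μ (a ⊓ b) * μ (a ⊔ b)) (hF : Monotone F) (hG : Monotone G)
    (j : Fin m) (κ : ℝ) (hκ₀ : 0 ≤ κ)
    (hκF : ∀ b, 2 * κ ≤ F (Function.update b j true) - F (Function.update b j false))
    (hκG : ∀ b, 2 * κ ≤ G (Function.update b j true) - G (Function.update b j false)) :
    κ ^ 2 * ((∑ b, μ b) ^ 2 - (∑ b, μ b * pm (b j)) ^ 2) ≤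
      (∑ b, μ b) * (∑ b, μ b * (F b * G b)) - (∑ b, μ b * F b) * ∑ b, μ b * G b := by
  have hp : Monotone fun b : Fin m → Bool => pm (b j) := fun a b h => pm_mono (h j)
  have h1 := fkg_cov μ _ G hμ₀ hμ (monotone_sub_pm F hF j κ hκF) hG
  have h2 := fkg_cov μ _ _ hμ₀ hμ hp (monotone_sub_pm G hG j κ hκG)
  have e1 : ∑ b, μ b * (F b - κ * pm (b j)) = ∑ b, μ b * F b - κ * ∑ b, μ b * pm (b j) := by
    rw [Finset.mul_sum, ← Finset.sum_sub_distrib]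
    exact Finset.sum_congr rfl fun b _ => by ring
  have e2 : ∑ b, μ b * (G b - κ * pm (b j)) = ∑ b, μ b * G b - κ * ∑ b, μ b * pm (b j) := by
    rw [Finset.mul_sum, ← Finset.sum_sub_distrib]
    exact Finset.sum_congr rfl fun b _ => by ring
  have e3 : ∑ b, μ b * ((F b - κ * pm (b j)) * G b)
      = ∑ b, μ b * (F b * G b) - κ * ∑ b, μ b * (pm (b j) * G b) := by
    rw [Finset.mul_sum, ← Finset.sum_sub_distrib]
    exact Finset.sum_congr rfl fun b _ => by ring
  have e4 : ∑ b, μ b * (pm (b j) * (G b - κ * pm (b j)))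
      = ∑ b, μ b * (pm (b j) * G b) - κ * ∑ b, μ b := by
    rw [Finset.mul_sum, ← Finset.sum_sub_distrib]
    exact Finset.sum_congr rfl fun b _ => by
      have := pm_mul_self (b j)
      linear_combination (-(μ b * κ)) * this
  simp only [e1, e2, e3, e4] at h1 h2
  nlinarith [mul_le_mul_of_nonneg_left h2 hκ₀]

end FKG

/-! ### Hyperbolic functions -/

/-- By the product formula, with the sum of the arguments fixed, the product grows with the distance
between them. This is the log-supermodularity of `cosh` of a modular increasing function. -/
theorem cosh_mul_cosh_le {p q r s : ℝ} (h : p + q = r + s) (hr : p ≤ r) (hr' : r ≤ q) :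
    Real.cosh r * Real.cosh s ≤ Real.cosh p * Real.cosh q := by
  have e : ∀ a b : ℝ, 2 * (Real.cosh a * Real.cosh b) = Real.cosh (a + b) + Real.cosh (a - b) := by
    intro a b; rw [Real.cosh_add, Real.cosh_sub]; ring
  have h1 : Real.cosh (r - s) ≤ Real.cosh (p - q) := by
    rw [Real.cosh_le_cosh, abs_le]
    rw [abs_of_nonpos (by linarith : p - q ≤ 0)]
    constructor <;> linarith
  have := e r s
  have := e p q
  rw [h] at this
  linarith

theorem cosh_le_exp_of_abs_le {x β : ℝ} (h : |x| ≤ β) : Real.cosh x ≤ Real.exp β := by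
  rw [← Real.cosh_abs, Real.cosh_eq]
  have h1 : Real.exp |x| ≤ Real.exp β := Real.exp_le_exp.2 h
  have h2 : Real.exp (-|x|) ≤ Real.exp β :=
    Real.exp_le_exp.2 (by linarith [abs_nonneg x])
  linarith

/-- The difference equals `sinh (x - y) / (cosh x * cosh y)`, where `sinh t ≥ t` for `t ≥ 0` and
each `cosh` is at most `e^β`. -/
theorem tanh_sub_tanh_ge {x y β : ℝ} (hx : |x| ≤ β) (hy : |y| ≤ β) (hxy : y ≤ x) :
    (x - y) * Real.exp (-2 * β) ≤ Real.tanh x - Real.tanh y := by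
  have hcx := Real.cosh_pos x
  have hcy := Real.cosh_pos y
  have e : Real.tanh x - Real.tanh y = Real.sinh (x - y) / (Real.cosh x * Real.cosh y) := by
    rw [Real.tanh_eq_sinh_div_cosh, Real.tanh_eq_sinh_div_cosh, Real.sinh_sub]
    field_simp
  rw [e, le_div_iff₀ (by positivity)]
  have h1 : x - y ≤ Real.sinh (x - y) := Real.self_le_sinh_iff.2 (by linarith)
  have h2 : Real.cosh x * Real.cosh y ≤ Real.exp β * Real.exp β :=
    mul_le_mul (cosh_le_exp_of_abs_le hx) (cosh_le_exp_of_abs_le hy) hcy.le (Real.exp_pos _).le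
  have h3 : Real.exp (-2 * β) * (Real.exp β * Real.exp β) = 1 := by
    rw [← Real.exp_add, ← Real.exp_add]; simp; ring
  calc (x - y) * Real.exp (-2 * β) * (Real.cosh x * Real.cosh y)
      ≤ (x - y) * Real.exp (-2 * β) * (Real.exp β * Real.exp β) :=
        mul_le_mul_of_nonneg_left h2 (mul_nonneg (by linarith) (Real.exp_pos _).le)
    _ = x - y := by rw [mul_assoc, h3, mul_one]
    _ ≤ _ := h1

theorem tanh_mono : Monotone Real.tanh := by
  intro y x h
  have := tanh_sub_tanh_ge (le_max_left |x| |y|) (le_max_right |x| |y|) h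
  have h2 : 0 ≤ (x - y) * Real.exp (-2 * max |x| |y|) :=
    mul_nonneg (by linarith) (Real.exp_pos _).le
  linarith

/-! ### Conditional covariances of a locally consistent RBM -/

namespace RBM

variable {n m : ℕ}

/-- The local field at the visible node `i`. -/
def field (R : RBM n m) (y : SpinConfig m) (i : Fin n) : ℝ := R.f i + ∑ j, R.J i j * spin (y j)

/-- The local field at the latent node `j`. -/
def latentField (R : RBM n m) (x : SpinConfig n) (j : Fin m) : ℝ :=
  R.g j + ∑ i, R.J i j * spin (x i)

/-- Conditional independence of the visible spins given the latent ones. The dual `weight_eq_latent`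
serves to flip or to sum out latent spins. -/
theorem weight_eq_visible (R : RBM n m) (x : SpinConfig n) (y : SpinConfig m) :
    R.weight x y = Real.exp (∑ j, R.g j * spin (y j)) *
      ∏ i, Real.exp (spin (x i) * R.field y i) := by
  rw [← Real.exp_sum, ← Real.exp_add, weight]
  congr 1
  simp only [field, mul_add, Finset.mul_sum, Finset.sum_add_distrib]
  have : ∀ i j, spin (x i) * R.J i j * spin (y j) = spin (x i) * (R.J i j * spin (y j)) :=
    fun i j => by ring
  simp only [this, mul_comm (R.f _)]
  ring

theorem weight_eq_latent (R : RBM n m) (x : SpinConfig n) (y : SpinConfig m) :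
    R.weight x y = Real.exp (∑ i, R.f i * spin (x i)) *
      ∏ j, Real.exp (spin (y j) * R.latentField x j) := by
  rw [← Real.exp_sum, ← Real.exp_add, weight]
  congr 1
  simp only [latentField, mul_add, Finset.mul_sum, Finset.sum_add_distrib]
  have : ∀ i j, spin (y j) * (R.J i j * spin (x i)) = spin (x i) * R.J i j * spin (y j) :=
    fun i j => by ring
  simp only [this, mul_comm (R.g _)]
  rw [Finset.sum_comm (γ := Fin m)]
  ring

theorem weight_pos (R : RBM n m) (x : SpinConfig n) (y : SpinConfig m) : 0 < R.weight x y :=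
  Real.exp_pos _

theorem Z_pos (R : RBM n m) : 0 < R.Z :=
  Finset.sum_pos (fun x _ => Finset.sum_pos (fun y _ => R.weight_pos x y) Finset.univ_nonempty)
    Finset.univ_nonempty

theorem visibleProb_eq (R : RBM n m) (x : SpinConfig n) :
    R.visibleProb x = (∑ y, R.weight x y) / R.Z := by
  simp [visibleProb, prob, Finset.sum_div]

theorem visibleProb_pos (R : RBM n m) (x : SpinConfig n) : 0 < R.visibleProb x := by
  rw [visibleProb_eq]
  exact div_pos (Finset.sum_pos (fun y _ => R.weight_pos x y) Finset.univ_nonempty) R.Z_pos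

theorem sum_visibleProb (R : RBM n m) : ∑ x, R.visibleProb x = 1 := by
  simp only [visibleProb_eq, ← Finset.sum_div]
  exact div_self R.Z_pos.ne'

open Classical in
/-- The integral of `h` over the event `X_S = a_S`. -/
def moment (R : RBM n m) (S : Finset (Fin n)) (a : SpinConfig n) (h : SpinConfig n → ℝ) : ℝ :=
  ∑ x : SpinConfig n, if (∀ k ∈ S, x k = a k) then R.visibleProb x * h x else 0

open Classical in
/-- The weight of the latent configuration `y` restricted to the event `X_S = a_S`. -/
def latentWeight (R : RBM n m) (S : Finset (Fin n)) (a : SpinConfig n) (y : SpinConfig m) : ℝ :=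
  ∑ x : SpinConfig n, if (∀ k ∈ S, x k = a k) then R.weight x y else 0

/-- The factor that the visible node `i` contributes to `latentWeight`. -/
def visibleFactor (S : Finset (Fin n)) (a : SpinConfig n) (i : Fin n) (t : ℝ) : ℝ :=
  if i ∈ S then Real.exp (spin (a i) * t) else 2 * Real.cosh t

open Classical in
-- The sum factors over the visible nodes. A free node contributes `2 cosh` of its field, and `2
-- sinh = 2 cosh * tanh` if it belongs to `U`; a node of `S` is frozen, which is why `U` must avoid
-- `S`.
theorem sum_weight_mul_prod (R : RBM n m) (S U : Finset (Fin n)) (hU : Disjoint U S)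
    (a : SpinConfig n) (y : SpinConfig m) :
    (∑ x : SpinConfig n, if (∀ k ∈ S, x k = a k) then R.weight x y * ∏ i ∈ U, spin (x i) else 0)
      = Real.exp (∑ j, R.g j * spin (y j)) * (∏ i, visibleFactor S a i (R.field y i))
        * ∏ i ∈ U, Real.tanh (R.field y i) := by
  have h1 : ∀ x : SpinConfig n,
      (if (∀ k ∈ S, x k = a k) then R.weight x y * ∏ i ∈ U, spin (x i) else 0)
      = Real.exp (∑ j, R.g j * spin (y j)) * ∏ i,
        ((if i ∈ S → x i = a i then 1 else 0) * Real.exp (spin (x i) * R.field y i)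
          * if i ∈ U then spin (x i) else 1) := by
    intro x
    rw [Finset.prod_mul_distrib, Finset.prod_mul_distrib, Finset.prod_ite_mem,
      Finset.univ_inter, weight_eq_visible, Finset.prod_ite_zero]
    simp only [Finset.mem_univ, forall_const, Finset.prod_const_one]
    split_ifs <;> ring
  simp_rw [h1]
  rw [← Finset.mul_sum, sum_prod_config fun i s => (if i ∈ S → s = a i then 1 else 0) *
    Real.exp (spin s * R.field y i) * if i ∈ U then spin s else 1, mul_assoc]
  congr 1
  have h2 : ∏ i ∈ U, Real.tanh (R.field y i)
      = ∏ i, if i ∈ U then Real.tanh (R.field y i) else 1 := by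
    rw [Finset.prod_ite_mem, Finset.univ_inter]
  rw [h2, ← Finset.prod_mul_distrib]
  refine Finset.prod_congr rfl fun i _ => ?_
  by_cases hS : i ∈ S
  · have hUi : i ∉ U := fun h => Finset.disjoint_left.1 hU h hS
    simp only [visibleFactor, hS, hUi, if_true, if_false, true_imp_iff, mul_one, ite_mul, one_mul,
      zero_mul]
    rw [Finset.sum_ite_eq' Finset.univ (a i), if_pos (Finset.mem_univ _)]
  · by_cases hUi : i ∈ U
    · simp only [visibleFactor, hS, hUi, sum_units, false_imp_iff, if_true, if_false, one_mul,
        spin_neg, spin_one, neg_mul]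
      rw [Real.tanh_eq_sinh_div_cosh, mul_assoc, mul_div_cancel₀ _ (Real.cosh_pos _).ne',
        Real.sinh_eq]
      ring
    · simp only [visibleFactor, hS, hUi, sum_units, false_imp_iff, if_true, if_false, one_mul,
        spin_neg, spin_one, neg_mul]
      rw [Real.cosh_eq]
      ring

theorem latentWeight_eq (R : RBM n m) (S : Finset (Fin n)) (a : SpinConfig n)
    (y : SpinConfig m) : R.latentWeight S a y =
      Real.exp (∑ j, R.g j * spin (y j)) * ∏ i, visibleFactor S a i (R.field y i) := by
  have := R.sum_weight_mul_prod S ∅ (by simp) a y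
  simpa [latentWeight] using this

/-- Conditional moments of visible spins become averages of products of `tanh` under `latentWeight`,
to which FKG on the latent cube applies. Sets `U` with at most two elements suffice for covariances.
-/
theorem moment_prod (R : RBM n m) (S U : Finset (Fin n)) (hU : Disjoint U S)
    (a : SpinConfig n) :
    R.moment S a (fun x => ∏ i ∈ U, spin (x i))
      = (∑ y, R.latentWeight S a y * ∏ i ∈ U, Real.tanh (R.field y i)) / R.Z := by
  classical
  simp only [latentWeight_eq]
  simp only [← sum_weight_mul_prod R S U hU a]
  rw [Finset.sum_comm, Finset.sum_div, moment]
  refine Finset.sum_congr rfl fun x _ => ?_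
  split_ifs
  · rw [visibleProb_eq, ← Finset.sum_mul]; ring
  · simp

/-- The numerator `P(A)² Cov(X_u, X_v | A)` for the event `A = {X_S = a_S}`. -/
def covNum (R : RBM n m) (u v : Fin n) (S : Finset (Fin n)) (a : SpinConfig n) : ℝ :=
  R.moment S a (fun _ => 1) * R.moment S a (fun x => spin (x u) * spin (x v))
    - R.moment S a (fun x => spin (x u)) * R.moment S a (fun x => spin (x v))

theorem moment_one_pos (R : RBM n m) (S : Finset (Fin n)) (a : SpinConfig n) :
    0 < R.moment S a (fun _ => 1) := by
  classical
  refine Finset.sum_pos' (fun x _ => ?_) ⟨a, Finset.mem_univ _, ?_⟩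
  · split_ifs
    · simpa using (R.visibleProb_pos x).le
    · exact le_rfl
  · simpa using R.visibleProb_pos a

/-! ### Change of signs of the latent nodes, and log-supermodularity -/

/-- The configuration of the latent nodes with signs `b` relative to `σ`. -/
def latentOf (σ : SpinConfig m) (b : Fin m → Bool) : SpinConfig m :=
  fun j => if b j then σ j else -σ j

theorem spin_latentOf (σ : SpinConfig m) (b : Fin m → Bool) (j : Fin m) :
    spin (latentOf σ b j) = spin (σ j) * pm (b j) := by
  rcases h : b j <;> simp [latentOf, h]

theorem latentOf_bijective (σ : SpinConfig m) : Function.Bijective (latentOf σ) := by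
  rw [Function.bijective_iff_has_inverse]
  refine ⟨fun y j => decide (y j = σ j), fun b => ?_, fun y => ?_⟩
  · funext j
    have : -σ j ≠ σ j := by rcases Int.units_eq_one_or (σ j) with h | h <;> rw [h] <;> decide
    rcases h : b j <;> simp [latentOf, h, this]
  · funext j
    rcases Int.units_eq_one_or (σ j) with h | h <;> rcases Int.units_eq_one_or (y j) with h' | h'
      <;> simp [latentOf, h, h']

/-- The only place where local consistency is used: a latent node with nonpositive couplings is
flipped, so that all couplings become nonnegative relative to `σ`. -/
theorem LocallyConsistent.exists_signs {R : RBM n m} (hR : R.LocallyConsistent) :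
    ∃ σ : SpinConfig m, ∀ i j, R.J i j * spin (σ j) = |R.J i j| := by
  have : ∀ j, ∃ s : ℤˣ, ∀ i, R.J i j * spin s = |R.J i j| := by
    intro j
    rcases hR j with h | h
    · exact ⟨1, fun i => by simp [abs_of_nonneg (h i)]⟩
    · exact ⟨-1, fun i => by rw [abs_of_nonpos (h i)]; simp⟩
  choose σ hσ using this
  exact ⟨σ, fun i j => hσ j i⟩

theorem field_latentOf (R : RBM n m) {σ : SpinConfig m}
    (hσ : ∀ i j, R.J i j * spin (σ j) = |R.J i j|) (b : Fin m → Bool) (i : Fin n) :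
    R.field (latentOf σ b) i = R.f i + ∑ j, |R.J i j| * pm (b j) := by
  simp only [field, spin_latentOf, ← mul_assoc, hσ]

theorem field_latentOf_mono (R : RBM n m) {σ : SpinConfig m}
    (hσ : ∀ i j, R.J i j * spin (σ j) = |R.J i j|) (i : Fin n) :
    Monotone fun b => R.field (latentOf σ b) i := by
  intro a b h
  simp only [R.field_latentOf hσ]
  gcongr with j
  exact pm_mono (h j)

theorem field_latentOf_inf_add_sup (R : RBM n m) {σ : SpinConfig m}
    (hσ : ∀ i j, R.J i j * spin (σ j) = |R.J i j|) (i : Fin n) (a b : Fin m → Bool) :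
    R.field (latentOf σ (a ⊓ b)) i + R.field (latentOf σ (a ⊔ b)) i
      = R.field (latentOf σ a) i + R.field (latentOf σ b) i := by
  simp only [R.field_latentOf hσ]
  have : ∑ j, |R.J i j| * pm ((a ⊓ b) j) + ∑ j, |R.J i j| * pm ((a ⊔ b) j)
      = ∑ j, |R.J i j| * pm (a j) + ∑ j, |R.J i j| * pm (b j) := by
    rw [← Finset.sum_add_distrib, ← Finset.sum_add_distrib]
    exact Finset.sum_congr rfl fun j _ => by
      rw [← mul_add, ← mul_add, Pi.inf_apply, Pi.sup_apply, pm_inf_add_sup]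
  linarith

/-- The fields are modular and increasing in the signs relative to `σ`. The factors of frozen nodes
and of the external fields are exponentials of modular functions and give equalities; the factors of
free nodes are handled by `cosh_mul_cosh_le`. -/
theorem latentWeight_supermodular (R : RBM n m) {σ : SpinConfig m}
    (hσ : ∀ i j, R.J i j * spin (σ j) = |R.J i j|) (S : Finset (Fin n)) (x : SpinConfig n)
    (a b : Fin m → Bool) :
    R.latentWeight S x (latentOf σ a) * R.latentWeight S x (latentOf σ b)
      ≤ R.latentWeight S x (latentOf σ (a ⊓ b)) * R.latentWeight S x (latentOf σ (a ⊔ b)) := by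
  simp only [latentWeight_eq]
  rw [mul_mul_mul_comm,
    mul_mul_mul_comm (Real.exp (∑ j, R.g j * spin (latentOf σ (a ⊓ b) j))),
    ← Real.exp_add, ← Real.exp_add,
    ← Finset.prod_mul_distrib, ← Finset.prod_mul_distrib]
  have h1 : ∑ j, R.g j * spin (latentOf σ a j) + ∑ j, R.g j * spin (latentOf σ b j)
      = ∑ j, R.g j * spin (latentOf σ (a ⊓ b) j) + ∑ j, R.g j * spin (latentOf σ (a ⊔ b) j) := by
    rw [← Finset.sum_add_distrib, ← Finset.sum_add_distrib]
    refine Finset.sum_congr rfl fun j _ => ?_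
    have := pm_inf_add_sup (a j) (b j)
    simp only [spin_latentOf, Pi.inf_apply, Pi.sup_apply]
    linear_combination (-(R.g j * spin (σ j))) * this
  rw [h1]
  refine mul_le_mul_of_nonneg_left (Finset.prod_le_prod (fun i _ => ?_) fun i _ => ?_)
    (Real.exp_pos _).le
  · unfold visibleFactor
    split_ifs <;> positivity
  · have e := R.field_latentOf_inf_add_sup hσ i a b
    unfold visibleFactor
    split_ifs
    · rw [← Real.exp_add, ← Real.exp_add, ← mul_add, ← mul_add, e]
    · have h1 := R.field_latentOf_mono hσ i (inf_le_left : a ⊓ b ≤ a)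
      have h2 := R.field_latentOf_mono hσ i (le_sup_left : a ≤ a ⊔ b)
      have := cosh_mul_cosh_le e h1 h2
      nlinarith

/-! ### Lower bounds from non-degeneracy -/

theorem abs_field_le (R : RBM n m) {α β : ℝ} (hR : R.NonDegenerate α β) (y : SpinConfig m)
    (i : Fin n) : |R.field y i| ≤ β := by
  refine le_trans ?_ (hR.visible i)
  rw [add_comm, field]
  refine (abs_add_le _ _).trans (add_le_add le_rfl ((Finset.abs_sum_le_sum_abs _ _).trans ?_))
  exact Finset.sum_le_sum fun j _ => by simp [abs_mul]

theorem abs_latentField_le (R : RBM n m) {α β : ℝ} (hR : R.NonDegenerate α β) (x : SpinConfig n)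
    (j : Fin m) : |R.latentField x j| ≤ β := by
  refine le_trans ?_ (hR.latent j)
  rw [add_comm, latentField]
  refine (abs_add_le _ _).trans (add_le_add le_rfl ((Finset.abs_sum_le_sum_abs _ _).trans ?_))
  exact Finset.sum_le_sum fun j _ => by simp [abs_mul]

/-- Only the factor of the latent node `j` changes, and its exponent moves by at most twice
`|latentField| ≤ β`. -/
theorem weight_le_flip (R : RBM n m) {α β : ℝ} (hR : R.NonDegenerate α β) (x : SpinConfig n)
    {y y' : SpinConfig m} (j : Fin m) (h : ∀ k, k ≠ j → y k = y' k) :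
    R.weight x y ≤ Real.exp (2 * β) * R.weight x y' := by
  rw [weight_eq_latent, weight_eq_latent, mul_left_comm]
  refine mul_le_mul_of_nonneg_left ?_ (Real.exp_pos _).le
  rw [← Finset.mul_prod_erase _ _ (Finset.mem_univ j), ← Finset.mul_prod_erase _ _
    (Finset.mem_univ j), ← mul_assoc, ← Real.exp_add]
  rw [Finset.prod_congr rfl fun k hk => by rw [h k (Finset.ne_of_mem_erase hk)]]
  refine mul_le_mul_of_nonneg_right (Real.exp_le_exp.2 ?_)
    (Finset.prod_nonneg fun _ _ => (Real.exp_pos _).le)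
  have h1 := abs_le.1 (R.abs_latentField_le hR x j)
  rcases spin_eq_one_or (y j) with e | e <;> rcases spin_eq_one_or (y' j) with e' | e' <;>
    rw [e, e'] <;> linarith

theorem latentWeight_nonneg (R : RBM n m) (S : Finset (Fin n)) (a : SpinConfig n)
    (y : SpinConfig m) : 0 ≤ R.latentWeight S a y := by
  classical
  exact Finset.sum_nonneg fun x _ => by split_ifs; exacts [(R.weight_pos x y).le, le_rfl]

theorem latentWeight_le_flip (R : RBM n m) {α β : ℝ} (hR : R.NonDegenerate α β)
    (S : Finset (Fin n)) (a : SpinConfig n) {y y' : SpinConfig m} (j : Fin m)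
    (h : ∀ k, k ≠ j → y k = y' k) :
    R.latentWeight S a y ≤ Real.exp (2 * β) * R.latentWeight S a y' := by
  classical
  simp only [latentWeight, Finset.mul_sum]
  refine Finset.sum_le_sum fun x _ => ?_
  split_ifs
  · exact R.weight_le_flip hR x j h
  · simp

/-- A flip of the spin `j` changes each weight by a factor of at most `e^{2β}`, so the masses of its
two values are comparable. The variance is their product, up to normalization, and hence at least
`e^{-2β}` times the square of the larger one. -/
theorem variance_latent_ge (R : RBM n m) {α β : ℝ} (hR : R.NonDegenerate α β)
    (S : Finset (Fin n)) (a : SpinConfig n) (σ : SpinConfig m) (j : Fin m) :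
    Real.exp (-2 * β) * (∑ b, R.latentWeight S a (latentOf σ b)) ^ 2
      ≤ (∑ b, R.latentWeight S a (latentOf σ b)) ^ 2
        - (∑ b, R.latentWeight S a (latentOf σ b) * pm (b j)) ^ 2 := by
  set ν : (Fin m → Bool) → ℝ := fun b => R.latentWeight S a (latentOf σ b) with hν
  let flip : (Fin m → Bool) → (Fin m → Bool) := fun b => Function.update b j (!b j)
  have hinv : Function.Involutive flip := by
    intro b; funext k
    by_cases hk : k = j
    · subst hk; simp [flip]
    · simp [flip, hk]
  have hflip : ∀ b, ν (flip b) ≤ Real.exp (2 * β) * ν b := by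
    intro b
    refine R.latentWeight_le_flip hR S a j fun k hk => ?_
    simp [latentOf, flip, hk]
  have hpm : ∀ b, pm (flip b j) = -pm (b j) := by
    intro b
    rcases h : b j <;> simp [flip, h]
  have hpm1 : ∀ b : Bool, 0 ≤ 1 + pm b ∧ 0 ≤ 1 - pm b := by
    intro b; cases b <;> norm_num
  -- `P` and `Q` are twice the masses of the two values of the `j`-th sign.
  set P := ∑ b, ν b * (1 + pm (b j)) with hP
  set Q := ∑ b, ν b * (1 - pm (b j)) with hQ
  have hPQ : P ≤ Real.exp (2 * β) * Q := by
    rw [hP, ← Equiv.sum_comp hinv.toPerm, hQ, Finset.mul_sum]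
    refine Finset.sum_le_sum fun b _ => ?_
    simp only [Function.Involutive.coe_toPerm, hpm, ← sub_eq_add_neg, ← mul_assoc]
    exact mul_le_mul_of_nonneg_right (hflip b) (hpm1 _).2
  have hQP : Q ≤ Real.exp (2 * β) * P := by
    rw [hQ, ← Equiv.sum_comp hinv.toPerm, hP, Finset.mul_sum]
    refine Finset.sum_le_sum fun b _ => ?_
    simp only [Function.Involutive.coe_toPerm, hpm, sub_neg_eq_add, ← mul_assoc]
    exact mul_le_mul_of_nonneg_right (hflip b) (hpm1 _).1
  have hν0 : ∀ b, 0 ≤ ν b := fun b => R.latentWeight_nonneg S a _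
  have hP0 : 0 ≤ P := Finset.sum_nonneg fun b _ => mul_nonneg (hν0 b) (hpm1 _).1
  have hQ0 : 0 ≤ Q := Finset.sum_nonneg fun b _ => mul_nonneg (hν0 b) (hpm1 _).2
  have e1 : P = ∑ b, ν b + ∑ b, ν b * pm (b j) := by
    simp [hP, mul_add, Finset.sum_add_distrib]
  have e2 : Q = ∑ b, ν b - ∑ b, ν b * pm (b j) := by
    simp [hQ, mul_sub, Finset.sum_sub_distrib]
  have e3 : ∑ b, ν b = (P + Q) / 2 := by rw [e1, e2]; ring
  have e4 : (∑ b, ν b) ^ 2 - (∑ b, ν b * pm (b j)) ^ 2 = P * Q := by rw [e1, e2]; ring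
  rw [e4, e3]
  have he : Real.exp (-2 * β) * Real.exp (2 * β) = 1 := by rw [← Real.exp_add]; simp
  have he0 := Real.exp_pos (-2 * β)
  rcases le_total P Q with h | h
  · have h1 : ((P + Q) / 2) ^ 2 ≤ Q * (Real.exp (2 * β) * P) := by
      nlinarith [mul_le_mul_of_nonneg_left hQP hQ0]
    calc _ ≤ Real.exp (-2 * β) * (Q * (Real.exp (2 * β) * P)) :=
          mul_le_mul_of_nonneg_left h1 he0.le
      _ = Real.exp (-2 * β) * Real.exp (2 * β) * (P * Q) := by ring
      _ = P * Q := by rw [he, one_mul]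
      _ ≤ _ := le_rfl
  · have h1 : ((P + Q) / 2) ^ 2 ≤ P * (Real.exp (2 * β) * Q) := by
      nlinarith [mul_le_mul_of_nonneg_left hPQ hP0]
    calc _ ≤ Real.exp (-2 * β) * (P * (Real.exp (2 * β) * Q)) :=
          mul_le_mul_of_nonneg_left h1 he0.le
      _ = Real.exp (-2 * β) * Real.exp (2 * β) * (P * Q) := by ring
      _ = P * Q := by rw [he, one_mul]
      _ ≤ _ := le_rfl

/-- The visible nodes that share a latent neighbor with `u`. -/
def coupled (R : RBM n m) (u : Fin n) : Finset (Fin n) :=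
  open Classical in {v | v ≠ u ∧ ∃ j, R.J u j ≠ 0 ∧ R.J v j ≠ 0}

theorem mem_coupled {R : RBM n m} {u v : Fin n} :
    v ∈ R.coupled u ↔ v ≠ u ∧ ∃ j, R.J u j ≠ 0 ∧ R.J v j ≠ 0 := by
  simp [coupled]

theorem tanh_field_increment (R : RBM n m) {α β : ℝ} (hα : 0 < α) (hR : R.NonDegenerate α β)
    {σ : SpinConfig m} (hσ : ∀ i j, R.J i j * spin (σ j) = |R.J i j|) (i : Fin n) (j : Fin m)
    (hJ : R.J i j ≠ 0) (b : Fin m → Bool) :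
    2 * (α * Real.exp (-2 * β)) ≤
      Real.tanh (R.field (latentOf σ (Function.update b j true)) i)
        - Real.tanh (R.field (latentOf σ (Function.update b j false)) i) := by
  have e : R.field (latentOf σ (Function.update b j true)) i
      - R.field (latentOf σ (Function.update b j false)) i = 2 * |R.J i j| := by
    rw [R.field_latentOf hσ, R.field_latentOf hσ,
      ← Finset.add_sum_erase _ _ (Finset.mem_univ j),
      ← Finset.add_sum_erase (a := j) _ (fun k => |R.J i k| * pm (Function.update b j false k))
        (Finset.mem_univ j)]
    have : ∀ c, ∑ k ∈ Finset.univ.erase j, |R.J i k| * pm (Function.update b j c k)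
        = ∑ k ∈ Finset.univ.erase j, |R.J i k| * pm (b k) := fun c =>
      Finset.sum_congr rfl fun k hk => by rw [Function.update_of_ne (Finset.ne_of_mem_erase hk)]
    rw [this, this]
    simp
    ring
  have hJα := hR.lower i j hJ
  have := tanh_sub_tanh_ge (R.abs_field_le hR (latentOf σ (Function.update b j true)) i)
    (R.abs_field_le hR (latentOf σ (Function.update b j false)) i) (by linarith [abs_nonneg (R.J i j)])
  rw [e] at this
  nlinarith [Real.exp_pos (-2 * β)]

/-- A latent node `j` adjacent to both `u` and `v` moves both conditional means by at least `2κ`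
with `κ = α e^{-2β}`. The factor `κ²` accounts for `α² e^{-4β}`, and the variance of the spin `j`
for the remaining `e^{-2β}`. -/
theorem covNum_ge (R : RBM n m) {α β : ℝ} (hα : 0 < α) (hR : R.NonDegenerate α β)
    (hL : R.LocallyConsistent) {u v : Fin n} (hv : v ∈ R.coupled u) {S : Finset (Fin n)}
    (huS : u ∉ S) (hvS : v ∉ S) (a : SpinConfig n) :
    α ^ 2 * Real.exp (-6 * β) * R.moment S a (fun _ => 1) ^ 2 ≤ R.covNum u v S a := by
  obtain ⟨hvu, j, huj, hvj⟩ := mem_coupled.1 hv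
  obtain ⟨σ, hσ⟩ := hL.exists_signs
  have e0 := R.moment_prod S ∅ (by simp) a
  have e1 := R.moment_prod S {u} (by simpa) a
  have e2 := R.moment_prod S {v} (by simpa) a
  have e3 := R.moment_prod S {u, v} (by simp [huS, hvS]) a
  simp only [Finset.prod_pair hvu.symm, Finset.prod_singleton, Finset.prod_empty, mul_one]
    at e0 e1 e2 e3
  have key := cov_ge_of_increments (fun b => R.latentWeight S a (latentOf σ b))
    (fun b => Real.tanh (R.field (latentOf σ b) u)) (fun b => Real.tanh (R.field (latentOf σ b) v))
    (fun b => R.latentWeight_nonneg S a _) (R.latentWeight_supermodular hσ S a)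
    (fun _ _ h => tanh_mono (R.field_latentOf_mono hσ u h))
    (fun _ _ h => tanh_mono (R.field_latentOf_mono hσ v h)) j (α * Real.exp (-2 * β))
    (by positivity) (R.tanh_field_increment hα hR hσ u j huj)
    (R.tanh_field_increment hα hR hσ v j hvj)
  have hvar := R.variance_latent_ge hR S a σ j
  have hsum : ∀ φ : SpinConfig m → ℝ, ∑ b, φ (latentOf σ b) = ∑ y, φ y := fun φ =>
    (latentOf_bijective σ).sum_comp φ
  have h0 := hsum (R.latentWeight S a)
  have h1 := hsum (fun y => R.latentWeight S a y * Real.tanh (R.field y u))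
  have h2 := hsum (fun y => R.latentWeight S a y * Real.tanh (R.field y v))
  have h3 := hsum (fun y => R.latentWeight S a y *
    (Real.tanh (R.field y u) * Real.tanh (R.field y v)))
  simp only [h0, h1, h2, h3] at key hvar
  rw [covNum, e0, e1, e2, e3]
  have hZ := R.Z_pos
  have hexp : α ^ 2 * Real.exp (-6 * β)
      = (α * Real.exp (-2 * β)) ^ 2 * Real.exp (-2 * β) := by
    rw [mul_pow, ← Real.exp_nat_mul, mul_assoc, ← Real.exp_add]
    congr 2
    push_cast
    ring
  have h4 : α ^ 2 * Real.exp (-6 * β) * (∑ y, R.latentWeight S a y) ^ 2 ≤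
      (∑ y, R.latentWeight S a y) * (∑ y, R.latentWeight S a y *
          (Real.tanh (R.field y u) * Real.tanh (R.field y v)))
        - (∑ y, R.latentWeight S a y * Real.tanh (R.field y u)) *
          ∑ y, R.latentWeight S a y * Real.tanh (R.field y v) := by
    refine le_trans ?_ key
    rw [hexp, mul_assoc]
    exact mul_le_mul_of_nonneg_left hvar (by positivity)
  have h5 := div_le_div_of_nonneg_right h4 (sq_nonneg R.Z)
  calc _ = α ^ 2 * Real.exp (-6 * β) * (∑ y, R.latentWeight S a y) ^ 2 / R.Z ^ 2 := by ring
    _ ≤ _ := h5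
    _ = _ := by ring

/-! ### The Markov property -/

theorem pr_eq_moment (R : RBM n m) (S : Finset (Fin n)) (a : SpinConfig n) :
    R.pr (fun x => ∀ k ∈ S, x k = a k) = R.moment S a (fun _ => 1) := by
  classical
  simp only [pr, moment, mul_one]
  exact Finset.sum_congr rfl fun x _ => by congr

/-- Every configuration arises twice as `Function.update x u s`, hence the factor `1 / 2`. The spin
at `u` is thus summed separately without splitting the index type. -/
theorem sum_update_spin (u : Fin n) (h : SpinConfig n → ℝ) :
    ∑ x : SpinConfig n, h x = (1 / 2) * ∑ s : ℤˣ, ∑ x : SpinConfig n, h (Function.update x u s) := by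
  have flip : ∀ t : ℤˣ, ∑ x : SpinConfig n, h (Function.update x u (t * x u)) = ∑ x, h x := by
    intro t
    let e : SpinConfig n → SpinConfig n := fun x => Function.update x u (t * x u)
    have he : Function.Involutive e := by
      intro x; funext k
      by_cases hk : k = u
      · subst hk
        simp only [e, Function.update_self, ← mul_assoc]
        rcases Int.units_eq_one_or t with rfl | rfl <;> simp
      · simp [e, hk]
    exact Equiv.sum_comp he.toPerm h
  have h1 : ∀ x : SpinConfig n, h (Function.update x u 1) + h (Function.update x u (-1))
      = h (Function.update x u (1 * x u)) + h (Function.update x u (-1 * x u)) := by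
    intro x
    rcases Int.units_eq_one_or (x u) with e | e <;> simp [e, add_comm]
  rw [sum_units fun s => ∑ x : SpinConfig n, h (Function.update x u s),
    ← Finset.sum_add_distrib, Finset.sum_congr rfl fun x _ => h1 x, Finset.sum_add_distrib,
    flip, flip]
  ring

/-- The factor of `visibleProb` that contains all the interactions of the node `u`. -/
def localFactor (R : RBM n m) (u : Fin n) (x : SpinConfig n) : ℝ :=
  open Classical in
  Real.exp (R.f u * spin (x u)) * ∏ j, if R.J u j ≠ 0 then 2 * Real.cosh (R.latentField x j) else 1

/-- The factor of `visibleProb` that does not depend on the node `u`. -/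
def remoteFactor (R : RBM n m) (u : Fin n) (x : SpinConfig n) : ℝ :=
  open Classical in
  Real.exp (∑ i ∈ Finset.univ.erase u, R.f i * spin (x i)) *
    (∏ j, if R.J u j ≠ 0 then 1 else 2 * Real.cosh (R.latentField x j)) / R.Z

/-- Summing out the latent nodes leaves one factor `2 cosh` of the latent field for each of them.
The factors of nodes adjacent to `u` involve only `u` and `R.coupled u`; the others do not involve
`u`. -/
theorem visibleProb_eq_mul (R : RBM n m) (u : Fin n) (x : SpinConfig n) :
    R.visibleProb x = R.localFactor u x * R.remoteFactor u x := by
  classical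
  have h1 : ∑ y, R.weight x y
      = Real.exp (∑ i, R.f i * spin (x i)) * ∏ j, (2 * Real.cosh (R.latentField x j)) := by
    simp only [weight_eq_latent, ← Finset.mul_sum]
    rw [sum_prod_config fun j s => Real.exp (spin s * R.latentField x j)]
    congr 1
    refine Finset.prod_congr rfl fun j _ => ?_
    rw [sum_units, Real.cosh_eq]
    simp
    ring
  have h2 : ∏ j, (2 * Real.cosh (R.latentField x j))
      = (∏ j, if R.J u j ≠ 0 then 2 * Real.cosh (R.latentField x j) else 1) *
        ∏ j, if R.J u j ≠ 0 then 1 else 2 * Real.cosh (R.latentField x j) := by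
    rw [← Finset.prod_mul_distrib]
    exact Finset.prod_congr rfl fun j _ => by split_ifs <;> simp
  rw [visibleProb_eq, h1, h2, localFactor, remoteFactor,
    ← Finset.add_sum_erase _ _ (Finset.mem_univ u), Real.exp_add]
  ring

theorem latentField_congr (R : RBM n m) (j : Fin m) {x x' : SpinConfig n}
    (h : ∀ i, R.J i j ≠ 0 → x i = x' i) : R.latentField x j = R.latentField x' j := by
  unfold latentField
  congr 1
  refine Finset.sum_congr rfl fun i _ => ?_
  by_cases hi : R.J i j = 0
  · simp [hi]
  · rw [h i hi]

theorem localFactor_congr (R : RBM n m) (u : Fin n) {x x' : SpinConfig n} (hu : x u = x' u)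
    (h : ∀ i ∈ R.coupled u, x i = x' i) : R.localFactor u x = R.localFactor u x' := by
  unfold localFactor
  rw [hu]
  congr 1
  refine Finset.prod_congr rfl fun j _ => ?_
  split_ifs with hj
  · rw [R.latentField_congr j fun i hi => ?_]
    by_cases hiu : i = u
    · rw [hiu, hu]
    · exact h i (mem_coupled.2 ⟨hiu, j, hj, hi⟩)
  · rfl

theorem remoteFactor_update (R : RBM n m) (u : Fin n) (x : SpinConfig n) (s : ℤˣ) :
    R.remoteFactor u (Function.update x u s) = R.remoteFactor u x := by
  unfold remoteFactor
  congr 2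
  · congr 1
    exact Finset.sum_congr rfl fun i hi => by
      rw [Function.update_of_ne (Finset.ne_of_mem_erase hi)]
  · refine Finset.prod_congr rfl fun j _ => ?_
    split_ifs with hj
    · rfl
    · rw [R.latentField_congr j fun i hi => ?_]
      by_cases hiu : i = u
      · subst hiu; exact absurd hi hj
      · simp [hiu]

open Classical in
-- Fixing `X_S` with `R.coupled u ⊆ S` fixes every argument of the local factor except the spin at
-- `u`, whereas the remote factor ignores that spin. So the dependence on `s` is the same for all
-- events `E` of this kind.
theorem pr_split (R : RBM n m) (u : Fin n) {S : Finset (Fin n)} (hS : R.coupled u ⊆ S)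
    (a : SpinConfig n) (E : SpinConfig n → Prop) (hE : ∀ x, E x → ∀ k ∈ S, x k = a k)
    (hEu : ∀ x s, E (Function.update x u s) ↔ E x) (s : ℤˣ) :
    R.pr (fun x => E x ∧ x u = s) = (1 / 2) * R.localFactor u (Function.update a u s) *
        (∑ x, if E x then R.remoteFactor u x else 0) := by
  have huc : u ∉ R.coupled u := fun h => (mem_coupled.1 h).1 rfl
  rw [pr, sum_update_spin u, mul_assoc]
  congr 1
  rw [Finset.sum_eq_single s, Finset.mul_sum]
  · refine Finset.sum_congr rfl fun x _ => ?_
    simp only [hEu, Function.update_self, and_true]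
    split_ifs with h
    · rw [visibleProb_eq_mul _ u, remoteFactor_update]
      congr 1
      refine R.localFactor_congr u (by simp) fun i hi => ?_
      have : i ≠ u := fun h => huc (h ▸ hi)
      simp only [ne_eq, this, not_false_eq_true, Function.update_of_ne]
      exact hE x h i (hS hi)
    · simp
  · intro t _ ht
    refine Finset.sum_eq_zero fun x _ => ?_
    simp [ht]
  · exact fun h => absurd (Finset.mem_univ s) h

theorem pr_eq_add (R : RBM n m) (u : Fin n) (E : SpinConfig n → Prop) :
    R.pr E = R.pr (fun x => E x ∧ x u = 1) + R.pr (fun x => E x ∧ x u = -1) := by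
  classical
  simp only [pr, ← Finset.sum_add_distrib]
  refine Finset.sum_congr rfl fun x _ => ?_
  rcases Int.units_eq_one_or (x u) with h | h <;> by_cases hE : E x <;> simp [h, hE]

/-- By `pr_split`, the spin at `u` has the same law whether or not `x v = t` is imposed on top of
`X_S = a_S`; both sides of the identity become the same product of local and remote sums. -/
theorem condIndep_of_coupled_subset (R : RBM n m) {u v : Fin n} {S : Finset (Fin n)}
    (hS : R.coupled u ⊆ S) (huS : u ∉ S) (hvu : v ≠ u) : R.CondIndep u v S := by
  classical
  intro a s t
  have hA : ∀ x s, (∀ k ∈ S, Function.update x u s k = a k) ↔ ∀ k ∈ S, x k = a k := by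
    intro x s
    refine forall₂_congr fun k hk => ?_
    have : k ≠ u := fun h => huS (h ▸ hk)
    simp [this]
  have hB : ∀ x s, ((∀ k ∈ S, Function.update x u s k = a k) ∧ Function.update x u s v = t) ↔
      (∀ k ∈ S, x k = a k) ∧ x v = t := by
    intro x s
    rw [hA]; simp [hvu]
  have e1 := R.pr_split u hS a (fun x => ∀ k ∈ S, x k = a k) (fun x h => h) hA
  have e2 := R.pr_split u hS a (fun x => (∀ k ∈ S, x k = a k) ∧ x v = t) (fun x h => h.1) hB
  have h1 : R.pr (fun x => (∀ k ∈ S, x k = a k) ∧ x u = s ∧ x v = t)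
      = R.pr (fun x => ((∀ k ∈ S, x k = a k) ∧ x v = t) ∧ x u = s) := by
    congr 1; funext x; exact propext (by tauto)
  rw [h1, R.pr_eq_add u (fun x => ∀ k ∈ S, x k = a k),
    R.pr_eq_add u (fun x => (∀ k ∈ S, x k = a k) ∧ x v = t), e1, e1, e1, e2, e2, e2]
  ring

theorem moment_eq_pr_sub (R : RBM n m) (u : Fin n) (S : Finset (Fin n)) (a : SpinConfig n) :
    R.moment S a (fun x => spin (x u)) = R.pr (fun x => (∀ k ∈ S, x k = a k) ∧ x u = 1)
      - R.pr (fun x => (∀ k ∈ S, x k = a k) ∧ x u = -1) := by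
  classical
  simp only [pr, moment, ← Finset.sum_sub_distrib]
  refine Finset.sum_congr rfl fun x _ => ?_
  rcases Int.units_eq_one_or (x u) with h | h <;>
    by_cases hE : ∀ k ∈ S, x k = a k <;>
    first | (simp [h, eq_true hE]; done) | simp [h, eq_false hE]

theorem covNum_eq_zero_of_condIndep (R : RBM n m) {u v : Fin n} {S : Finset (Fin n)}
    (h : R.CondIndep u v S) (a : SpinConfig n) : R.covNum u v S a = 0 := by
  classical
  have h1 : R.moment S a (fun x => spin (x u) * spin (x v)) =
      R.pr (fun x => (∀ k ∈ S, x k = a k) ∧ x u = 1 ∧ x v = 1)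
      - R.pr (fun x => (∀ k ∈ S, x k = a k) ∧ x u = 1 ∧ x v = -1)
      - R.pr (fun x => (∀ k ∈ S, x k = a k) ∧ x u = -1 ∧ x v = 1)
      + R.pr (fun x => (∀ k ∈ S, x k = a k) ∧ x u = -1 ∧ x v = -1) := by
    simp only [pr, moment, ← Finset.sum_sub_distrib, ← Finset.sum_add_distrib]
    refine Finset.sum_congr rfl fun x _ => ?_
    rcases Int.units_eq_one_or (x u) with h | h <;> rcases Int.units_eq_one_or (x v) with h' | h'
      <;> by_cases hE : ∀ k ∈ S, x k = a k <;>
      first | (simp [h, h', eq_true hE]; done) | simp [h, h', eq_false hE]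
  rw [covNum, h1, moment_eq_pr_sub, moment_eq_pr_sub, ← pr_eq_moment]
  linear_combination h a 1 1 - h a 1 (-1) - h a (-1) 1 + h a (-1) (-1)

/-- The set is admissible by the Markov property. An admissible `S` that misses one of its members
would make a covariance vanish that `covNum_ge` bounds away from zero. -/
theorem isTwoHopNeighborhood_coupled (R : RBM n m) {α β : ℝ} (hα : 0 < α)
    (hR : R.NonDegenerate α β) (hL : R.LocallyConsistent) (u : Fin n) :
    R.IsTwoHopNeighborhood u (R.coupled u) := by
  have huc : u ∉ R.coupled u := fun h => (mem_coupled.1 h).1 rfl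
  refine ⟨⟨huc, fun v _ hvu => R.condIndep_of_coupled_subset subset_rfl huc hvu⟩, ?_⟩
  rintro S ⟨huS, hS⟩ v hv
  by_contra hvS
  have h1 := R.covNum_ge hα hR hL hv huS hvS (fun _ => 1)
  rw [R.covNum_eq_zero_of_condIndep (hS v hvS (mem_coupled.1 hv).1)] at h1
  have h2 := R.moment_one_pos S (fun _ => 1)
  have : 0 < α ^ 2 * Real.exp (-6 * β) * R.moment S (fun _ => 1) (fun _ => 1) ^ 2 := by positivity
  linarith

end RBM

/-! ### Empirical conditional means -/

section Empirical

variable {n H : ℕ} (x : Fin H → SpinConfig n)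

theorem mem_agreeing {S : Finset (Fin n)} {k l : Fin H} :
    l ∈ agreeing x S k ↔ ∀ w ∈ S, x l w = x k w := by
  simp [agreeing]

theorem mem_agreeing_self (S : Finset (Fin n)) (k : Fin H) : k ∈ agreeing x S k := by
  simp [mem_agreeing]

theorem mem_agreeing_comm {S : Finset (Fin n)} {k l : Fin H} :
    l ∈ agreeing x S k ↔ k ∈ agreeing x S l := by
  simp only [mem_agreeing, eq_comm]

theorem agreeing_congr {S : Finset (Fin n)} {k l : Fin H} (h : l ∈ agreeing x S k) :
    agreeing x S l = agreeing x S k := by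
  ext i
  rw [mem_agreeing] at h
  simp only [mem_agreeing]
  exact forall₂_congr fun w hw => by rw [h w hw]

theorem empCondMean_congr {S : Finset (Fin n)} {k l : Fin H} (h : l ∈ agreeing x S k)
    (φ : SpinConfig n → ℝ) : empCondMean x S φ l = empCondMean x S φ k := by
  simp only [empCondMean, agreeing_congr x h]

/-- Averaging over the classes of samples that agree on `S` is self-adjoint. -/
theorem sum_mul_empCondMean (S : Finset (Fin n)) (g : Fin H → ℝ)
    (hg : ∀ k l, l ∈ agreeing x S k → g l = g k) (φ : SpinConfig n → ℝ) :
    ∑ k, g k * empCondMean x S φ k = ∑ k, g k * φ (x k) := by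
  have h1 : ∀ k, g k * empCondMean x S φ k
      = ∑ l, if l ∈ agreeing x S k then g l * φ (x l) / (agreeing x S l).card else 0 := by
    intro k
    rw [empCondMean, ← Finset.sum_filter, Finset.filter_mem_eq_inter, Finset.univ_inter,
      Finset.sum_div, Finset.mul_sum]
    exact Finset.sum_congr rfl fun l hl => by rw [hg k l hl, agreeing_congr x hl]; ring
  simp only [h1]
  -- After the exchange, the sample `l` is counted once for each member of its class, which cancels
  -- the size of the class in the denominator.
  rw [Finset.sum_comm]
  refine Finset.sum_congr rfl fun l _ => ?_
  simp only [mem_agreeing_comm x (l := l)]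
  rw [← Finset.sum_filter, Finset.filter_mem_eq_inter, Finset.univ_inter, Finset.sum_const,
    nsmul_eq_mul]
  have : ((agreeing x S l).card : ℝ) ≠ 0 := by
    exact_mod_cast (Finset.card_pos.2 ⟨l, mem_agreeing_self x S l⟩).ne'
  field_simp

/-- The residual of `X_u` in the `k`-th sample after regression on `X_S`. -/
def regResidual (u : Fin n) (S : Finset (Fin n)) (k : Fin H) : ℝ :=
  spin (x k u) - empCondMean x S (fun z => spin (z u)) k

theorem sum_residual_mul (u : Fin n) (S : Finset (Fin n)) (g : Fin H → ℝ)
    (hg : ∀ k l, l ∈ agreeing x S k → g l = g k) : ∑ k, regResidual x u S k * g k = 0 := by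
  have := sum_mul_empCondMean x S g hg (fun z => spin (z u))
  simp only [regResidual, mul_comm _ (g _), mul_sub, Finset.sum_sub_distrib, this, sub_self]

/-- Averaging over classes is self-adjoint, so the conditional mean can be moved from `X_v` onto the
other factor. The result is linear in the values of `v`, with weights that do not depend on `v`;
this makes the search in superposition possible. -/
theorem sum_empCondCov (u v : Fin n) (S : Finset (Fin n)) :
    ∑ k, empCondCov x u v S k = ∑ k, regResidual x u S k * spin (x k v) := by
  have h1 := sum_mul_empCondMean x S (fun _ => 1) (fun _ _ _ => rfl)
    (fun z => spin (z u) * spin (z v))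
  have h2 := sum_mul_empCondMean x S (fun k => empCondMean x S (fun z => spin (z u)) k)
    (fun k l h => empCondMean_congr x h _) (fun z => spin (z v))
  simp only [one_mul] at h1
  simp only [empCondCov, Finset.sum_sub_distrib, regResidual, sub_mul, h1, h2]

theorem empAvgCov_eq (u v : Fin n) (S : Finset (Fin n)) :
    empAvgCov x u v S = (∑ k, regResidual x u S k * spin (x k v)) / H := by
  rw [empAvgCov, sum_empCondCov]

/-- Nodes already selected have score zero, so the search for a positive maximum need not exclude
them. -/
theorem sum_residual_mul_spin_of_mem {u v : Fin n} {S : Finset (Fin n)} (hv : v ∈ S) :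
    ∑ k, regResidual x u S k * spin (x k v) = 0 :=
  sum_residual_mul x u S _ fun k l h => by rw [(mem_agreeing x).1 h v hv]

/-- The residual sum of squares of `X_u` after regression on `X_S`. -/
def rss (u : Fin n) (S : Finset (Fin n)) : ℝ := ∑ k, regResidual x u S k ^ 2

theorem rss_nonneg (u : Fin n) (S : Finset (Fin n)) : 0 ≤ rss x u S :=
  Finset.sum_nonneg fun _ _ => sq_nonneg _

/-- Pythagoras: the empirical conditional mean is the orthogonal projection of the values of `u`
onto the functions of `x_S`. -/
theorem rss_le (u : Fin n) (S : Finset (Fin n)) (g : Fin H → ℝ)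
    (hg : ∀ k l, l ∈ agreeing x S k → g l = g k) :
    rss x u S ≤ ∑ k, (spin (x k u) - g k) ^ 2 := by
  have h0 := sum_residual_mul x u S (fun k => empCondMean x S (fun z => spin (z u)) k - g k)
    fun k l h => by rw [hg k l h, empCondMean_congr x h]
  have h1 : ∀ k, (spin (x k u) - g k) ^ 2 = regResidual x u S k ^ 2
      + 2 * (regResidual x u S k * (empCondMean x S (fun z => spin (z u)) k - g k))
      + (empCondMean x S (fun z => spin (z u)) k - g k) ^ 2 := by
    intro k; simp only [regResidual]; ring
  simp only [h1, Finset.sum_add_distrib, ← Finset.mul_sum, h0, rss]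
  have : 0 ≤ ∑ k, (empCondMean x S (fun z => spin (z u)) k - g k) ^ 2 :=
    Finset.sum_nonneg fun _ _ => sq_nonneg _
  linarith

theorem rss_le_card (u : Fin n) (S : Finset (Fin n)) : rss x u S ≤ H := by
  refine (rss_le x u S (fun _ => 0) fun _ _ _ => rfl).trans ?_
  simp [sq]

/-- The competitor is the old conditional mean plus `c` times the spin `v`, with `c` the covariance.
As that spin squares to one, this is the optimal multiple, and it gains `H * c ^ 2`. -/
theorem rss_insert_le (hH : 0 < H) (u v : Fin n) (S : Finset (Fin n)) :
    rss x u (insert v S) ≤ rss x u S - H * empAvgCov x u v S ^ 2 := by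
  set c := empAvgCov x u v S with hc
  have hH' : (H : ℝ) ≠ 0 := by positivity
  have h1 := rss_le x u (insert v S)
    (fun k => empCondMean x S (fun z => spin (z u)) k + c * spin (x k v)) fun k l h => by
      rw [mem_agreeing] at h
      rw [empCondMean_congr x ((mem_agreeing x).2 fun w hw => h w (Finset.mem_insert_of_mem hw)),
        h v (Finset.mem_insert_self _ _)]
  refine h1.trans (le_of_eq ?_)
  have h2 : ∀ k, (spin (x k u) - (empCondMean x S (fun z => spin (z u)) k + c * spin (x k v))) ^ 2
      = regResidual x u S k ^ 2 - 2 * c * (regResidual x u S k * spin (x k v)) + c ^ 2 := by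
    intro k
    have := spin_mul_self (x k v)
    simp only [regResidual]
    linear_combination c ^ 2 * this
  have h3 : ∑ k, regResidual x u S k * spin (x k v) = c * H := by
    rw [hc, empAvgCov_eq, div_mul_cancel₀ _ hH']
  simp only [h2, Finset.sum_add_distrib, Finset.sum_sub_distrib, ← Finset.mul_sum, h3, rss]
  simp
  ring

/-- The sets that the main loop reaches are small. -/
theorem greedyLoop_card_le (hH : 0 < H) {u : Fin n} {τ : ℝ} (hτ : 0 < τ) {S T : Finset (Fin n)}
    (h : GreedyLoop x u τ S T) (hS : S.card * τ ^ 2 * H ≤ H - rss x u S) (hu : u ∉ S)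
    (P : Finset (Fin n) → Prop) (hP : P S)
    (hstep : ∀ S v, P S → v ∉ S → v ≠ u → P (insert v S)) :
    T.card * τ ^ 2 ≤ 1 ∧ u ∉ T ∧ P T ∧ ∀ v, v ∉ T → v ≠ u → empAvgCov x u v T < τ := by
  induction h with
  | finish S h =>
    refine ⟨?_, hu, hP, h⟩
    have := rss_nonneg x u S
    have hH' : (0 : ℝ) < H := by positivity
    by_contra! hc
    nlinarith
  | step S T v hvS hvu hmax hcov _ ih =>
    refine ih ?_ ?_ (hstep S v hP hvS hvu)
    · have := rss_insert_le x hH u v S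
      rw [Finset.card_insert_of_notMem hvS]
      push_cast
      have h2 : τ ^ 2 ≤ empAvgCov x u v S ^ 2 := pow_le_pow_left₀ hτ.le hcov 2
      have hH' : (0 : ℝ) < H := by positivity
      nlinarith
    · simp [hu, hvu.symm]

end Empirical

/-! ### Comparison of empirical and true covariances -/

/-- `c` times the covariance determined by the unnormalized moments `e`, `a`, `b`, `c`. -/
def momentCov (e a b c : ℝ) : ℝ := e - a * b / c

/-- Where `|a|, |b| ≤ c`, the expression `a * b / c` changes by at most the change of each variable.
Division by zero gives `0`, which agrees with the limit at `c = 0`, so no positivity is needed. -/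
theorem abs_mul_div_sub_le {a b c a' b' c' : ℝ} (ha : |a| ≤ c) (hb : |b| ≤ c) (ha' : |a'| ≤ c')
    (hb' : |b'| ≤ c') : |a * b / c - a' * b' / c'| ≤ |a - a'| + |b - b'| + |c - c'| := by
  have hc : 0 ≤ c := (abs_nonneg a).trans ha
  have hc' : 0 ≤ c' := (abs_nonneg a').trans ha'
  rcases hc.eq_or_lt with rfl | hc
  · have e1 : a = 0 := by simpa using ha
    have e2 : b = 0 := by simpa using hb
    subst e1 e2
    have : |a' * b' / c'| ≤ |a'| := by
      rcases hc'.eq_or_lt with rfl | hc'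
      · simp
      · rw [abs_div, abs_mul, abs_of_pos hc', div_le_iff₀ hc']
        exact mul_le_mul_of_nonneg_left hb' (abs_nonneg _)
    simp only [zero_mul, zero_div, zero_sub, abs_neg]
    linarith [abs_nonneg b', abs_nonneg c']
  rcases hc'.eq_or_lt with rfl | hc'
  · have e1 : a' = 0 := by simpa using ha'
    have e2 : b' = 0 := by simpa using hb'
    subst e1 e2
    have : |a * b / c| ≤ |a| := by
      rw [abs_div, abs_mul, abs_of_pos hc, div_le_iff₀ hc]
      exact mul_le_mul_of_nonneg_left hb (abs_nonneg _)
    simp only [zero_mul, zero_div, sub_zero]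
    linarith [abs_nonneg b, abs_nonneg c]
  have e : a * b / c - a' * b' / c' = (a - a') * (b / c) + (b - b') * (a' / c')
      - (c - c') * ((b / c) * (a' / c')) := by
    field_simp
    ring
  have h1 : |b / c| ≤ 1 := by rw [abs_div, abs_of_pos hc]; exact (div_le_one hc).2 hb
  have h2 : |a' / c'| ≤ 1 := by rw [abs_div, abs_of_pos hc']; exact (div_le_one hc').2 ha'
  have h3 : |(b / c) * (a' / c')| ≤ 1 := by
    rw [abs_mul]; exact mul_le_one₀ h1 (abs_nonneg _) h2
  have g : ∀ p q : ℝ, |q| ≤ 1 → |p * q| ≤ |p| := fun p q hq => by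
    rw [abs_mul]; exact mul_le_of_le_one_right (abs_nonneg _) hq
  rw [e]
  refine (abs_sub _ _).trans (add_le_add ((abs_add_le _ _).trans (add_le_add ?_ ?_)) ?_)
  exacts [g _ _ h1, g _ _ h2, g _ _ h3]

/-! ### Moments over the patterns of a set of visible nodes -/

section Moments

variable {n m H : ℕ}

/-- The indicator of the event that the configuration restricts to `p` on `S`. -/
def patternInd (S : Finset (Fin n)) (p : S → ℤˣ) (z : SpinConfig n) : ℝ :=
  if (fun w : S => z w) = p then 1 else 0

/-- The empirical integral of `φ` over the event that the configuration restricts to `p`. -/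
def empMoment (x : Fin H → SpinConfig n) (S : Finset (Fin n)) (p : S → ℤˣ)
    (φ : SpinConfig n → ℝ) : ℝ := (∑ k, patternInd S p (x k) * φ (x k)) / H

/-- The integral of `φ` over the event that the configuration restricts to `p`. -/
def RBM.patternMoment (R : RBM n m) (S : Finset (Fin n)) (p : S → ℤˣ)
    (φ : SpinConfig n → ℝ) : ℝ := ∑ z, R.visibleProb z * (patternInd S p z * φ z)

theorem patternInd_nonneg (S : Finset (Fin n)) (p : S → ℤˣ) (z : SpinConfig n) :
    0 ≤ patternInd S p z := by
  unfold patternInd; split_ifs <;> norm_num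

theorem patternInd_le_one (S : Finset (Fin n)) (p : S → ℤˣ) (z : SpinConfig n) :
    patternInd S p z ≤ 1 := by
  unfold patternInd; split_ifs <;> norm_num

theorem sum_patternInd (S : Finset (Fin n)) (z : SpinConfig n) : ∑ p, patternInd S p z = 1 := by
  simp [patternInd]

/-- Grouping the samples by their pattern on `S` turns the average over samples into a sum over all
patterns, of which the law of the RBM has a counterpart. -/
theorem empAvgCov_eq_sum (x : Fin H → SpinConfig n) (u v : Fin n) (S : Finset (Fin n)) :
    empAvgCov x u v S = ∑ p : S → ℤˣ, momentCov
      (empMoment x S p fun z => spin (z u) * spin (z v)) (empMoment x S p fun z => spin (z u))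
      (empMoment x S p fun z => spin (z v)) (empMoment x S p fun _ => 1) := by
  have h1 : ∀ k, empCondCov x u v S k
      = ∑ p : S → ℤˣ, patternInd S p (x k) * empCondCov x u v S k := by
    intro k; rw [← Finset.sum_mul, sum_patternInd, one_mul]
  rw [empAvgCov, Finset.sum_congr rfl fun k _ => h1 k, Finset.sum_comm, Finset.sum_div]
  refine Finset.sum_congr rfl fun p _ => ?_
  have hag : ∀ k, (fun w : S => x k w) = p → ∀ φ : SpinConfig n → ℝ,
      ∑ l ∈ agreeing x S k, φ (x l) = ∑ l, patternInd S p (x l) * φ (x l) := by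
    intro k hk φ
    simp only [patternInd, ite_mul, one_mul, zero_mul]
    rw [← Finset.sum_filter, agreeing]
    refine Finset.sum_congr (Finset.filter_congr fun l _ => ?_) fun _ _ => rfl
    rw [← hk, funext_iff]
    simp
  have hcard : ∀ k, (fun w : S => x k w) = p →
      ((agreeing x S k).card : ℝ) = ∑ l, patternInd S p (x l) := by
    intro k hk
    have := hag k hk fun _ => 1
    simpa using this
  set c := ∑ l, patternInd S p (x l) with hc
  set e := ∑ l, patternInd S p (x l) * (spin (x l u) * spin (x l v)) with he
  set a := ∑ l, patternInd S p (x l) * spin (x l u) with ha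
  set b := ∑ l, patternInd S p (x l) * spin (x l v) with hb
  have h2 : ∀ k, patternInd S p (x k) * empCondCov x u v S k
      = patternInd S p (x k) * (e / c - a / c * (b / c)) := by
    intro k
    by_cases hk : (fun w : S => x k w) = p
    · rw [empCondCov, empCondMean, empCondMean, empCondMean, hcard k hk,
        hag k hk fun z => spin (z u) * spin (z v), hag k hk fun z => spin (z u),
        hag k hk fun z => spin (z v)]
    · simp [patternInd, hk]
  rw [Finset.sum_congr rfl fun k _ => h2 k, ← Finset.sum_mul, ← hc]
  simp only [momentCov, empMoment, ← he, ← ha, ← hb, mul_one, ← hc]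
  -- A pattern that occurs in no sample contributes zero on both sides.
  by_cases hc0 : c = 0
  · have hz : ∀ l, patternInd S p (x l) = 0 := fun l =>
      (Finset.sum_eq_zero_iff_of_nonneg fun l _ => patternInd_nonneg S p (x l)).1 hc0 l
        (Finset.mem_univ l)
    have : e = 0 := by simp [he, hz]
    simp [hc0, this]
  · by_cases hH : (H : ℝ) = 0
    · simp [hH]
    · field_simp

theorem abs_empMoment_le (x : Fin H → SpinConfig n) (S : Finset (Fin n)) (p : S → ℤˣ)
    (φ : SpinConfig n → ℝ) (hφ : ∀ z, |φ z| ≤ 1) :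
    |empMoment x S p φ| ≤ empMoment x S p fun _ => 1 := by
  rw [empMoment, empMoment, abs_div, Nat.abs_cast]
  refine div_le_div_of_nonneg_right ((Finset.abs_sum_le_sum_abs _ _).trans ?_) (Nat.cast_nonneg _)
  refine Finset.sum_le_sum fun k _ => ?_
  rw [abs_mul, abs_of_nonneg (patternInd_nonneg _ _ _)]
  exact mul_le_mul_of_nonneg_left (hφ _) (patternInd_nonneg _ _ _)

theorem RBM.abs_patternMoment_le (R : RBM n m) (S : Finset (Fin n)) (p : S → ℤˣ)
    (φ : SpinConfig n → ℝ) (hφ : ∀ z, |φ z| ≤ 1) :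
    |R.patternMoment S p φ| ≤ R.patternMoment S p fun _ => 1 := by
  rw [RBM.patternMoment]
  refine (Finset.abs_sum_le_sum_abs _ _).trans (Finset.sum_le_sum fun k _ => ?_)
  rw [abs_mul, abs_mul, abs_of_nonneg (patternInd_nonneg _ _ _), abs_of_pos (R.visibleProb_pos _)]
  exact mul_le_mul_of_nonneg_left (mul_le_mul_of_nonneg_left (hφ _) (patternInd_nonneg _ _ _))
    (R.visibleProb_pos _).le

/-- The average conditional covariance of `X_u` and `X_v` given `X_S`. -/
def RBM.avgCov (R : RBM n m) (u v : Fin n) (S : Finset (Fin n)) : ℝ :=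
  ∑ p : S → ℤˣ, momentCov (R.patternMoment S p fun z => spin (z u) * spin (z v))
    (R.patternMoment S p fun z => spin (z u)) (R.patternMoment S p fun z => spin (z v))
    (R.patternMoment S p fun _ => 1)

/-- A configuration that restricts to `p`. -/
def extendPattern (S : Finset (Fin n)) (p : S → ℤˣ) : SpinConfig n :=
  fun i => if h : i ∈ S then p ⟨i, h⟩ else 1

theorem RBM.patternMoment_eq (R : RBM n m) (S : Finset (Fin n)) (p : S → ℤˣ)
    (φ : SpinConfig n → ℝ) : R.patternMoment S p φ = R.moment S (extendPattern S p) φ := by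
  classical
  refine Finset.sum_congr rfl fun z _ => ?_
  have : ((fun w : S => z w) = p) ↔ ∀ k ∈ S, z k = extendPattern S p k := by
    rw [funext_iff, Subtype.forall]
    exact forall₂_congr fun k hk => by simp [extendPattern, hk]
  simp only [patternInd, this]
  by_cases h : ∀ k ∈ S, z k = extendPattern S p k
  · rw [if_pos h, if_pos h, one_mul]
  · rw [if_neg h, if_neg h, zero_mul, mul_zero]

theorem RBM.momentCov_eq (R : RBM n m) (u v : Fin n) (S : Finset (Fin n)) (p : S → ℤˣ) :
    momentCov (R.patternMoment S p fun z => spin (z u) * spin (z v))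
      (R.patternMoment S p fun z => spin (z u)) (R.patternMoment S p fun z => spin (z v))
      (R.patternMoment S p fun _ => 1)
      = R.covNum u v S (extendPattern S p) / R.patternMoment S p fun _ => 1 := by
  simp only [RBM.patternMoment_eq, RBM.covNum, momentCov]
  have := (R.moment_one_pos S (extendPattern S p)).ne'
  field_simp

theorem RBM.avgCov_ge (R : RBM n m) {α β : ℝ} (hα : 0 < α) (hR : R.NonDegenerate α β)
    (hL : R.LocallyConsistent) {u v : Fin n} (hv : v ∈ R.coupled u) {S : Finset (Fin n)}
    (huS : u ∉ S) (hvS : v ∉ S) : α ^ 2 * Real.exp (-6 * β) ≤ R.avgCov u v S := by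
  have h1 : ∑ p : S → ℤˣ, (R.patternMoment S p fun _ => 1) = 1 := by
    simp only [RBM.patternMoment, mul_one]
    rw [Finset.sum_comm]
    simp only [← Finset.mul_sum, sum_patternInd, mul_one, R.sum_visibleProb]
  calc α ^ 2 * Real.exp (-6 * β)
      = ∑ p : S → ℤˣ, α ^ 2 * Real.exp (-6 * β) * R.patternMoment S p fun _ => 1 := by
        rw [← Finset.mul_sum, h1, mul_one]
    _ ≤ R.avgCov u v S := ?_
  refine Finset.sum_le_sum fun p _ => ?_
  rw [R.momentCov_eq, R.patternMoment_eq S p fun _ => 1, le_div_iff₀ (R.moment_one_pos S _)]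
  have := R.covNum_ge hα hR hL hv huS hvS (extendPattern S p)
  linarith

theorem RBM.avgCov_eq_zero (R : RBM n m) {u v : Fin n} {S : Finset (Fin n)}
    (hS : R.coupled u ⊆ S) (huS : u ∉ S) (hvu : v ≠ u) : R.avgCov u v S = 0 := by
  refine Finset.sum_eq_zero fun p _ => ?_
  rw [R.momentCov_eq, R.covNum_eq_zero_of_condIndep (R.condIndep_of_coupled_subset hS huS hvu),
    zero_div]

/-- There are `2 ^ S.card` patterns, and each covariance depends on four moments with Lipschitz
constant one. -/
theorem RBM.abs_empAvgCov_sub_le (R : RBM n m) (x : Fin H → SpinConfig n) (u v : Fin n)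
    (S : Finset (Fin n)) (ε : ℝ)
    (h : ∀ p : S → ℤˣ, ∀ φ ∈ [fun z : SpinConfig n => spin (z u) * spin (z v),
      fun z => spin (z u), fun z => spin (z v), fun _ => 1],
      |empMoment x S p φ - R.patternMoment S p φ| ≤ ε) :
    |empAvgCov x u v S - R.avgCov u v S| ≤ 2 ^ S.card * (4 * ε) := by
  rw [empAvgCov_eq_sum, RBM.avgCov, ← Finset.sum_sub_distrib]
  refine (Finset.abs_sum_le_sum_abs _ _).trans ?_
  have hcard : (Finset.univ : Finset (S → ℤˣ)).card = 2 ^ S.card := by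
    rw [Finset.card_univ, Fintype.card_fun]
    simp
  have h1 : ∀ p ∈ (Finset.univ : Finset (S → ℤˣ)), |momentCov
      (empMoment x S p fun z => spin (z u) * spin (z v)) (empMoment x S p fun z => spin (z u))
      (empMoment x S p fun z => spin (z v)) (empMoment x S p fun _ => 1)
      - momentCov (R.patternMoment S p fun z => spin (z u) * spin (z v))
    (R.patternMoment S p fun z => spin (z u)) (R.patternMoment S p fun z => spin (z v))
    (R.patternMoment S p fun _ => 1)| ≤ 4 * ε := by
    intro p _
    have h1 := h p _ (List.mem_cons_self ..)
    have h2 := h p (fun z => spin (z u)) (by simp)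
    have h3 := h p (fun z => spin (z v)) (by simp)
    have h4 := h p (fun z => 1) (by simp)
    have h5 := abs_mul_div_sub_le
      (abs_empMoment_le x S p (fun z => spin (z u)) fun z => (abs_spin _).le)
      (abs_empMoment_le x S p (fun z => spin (z v)) fun z => (abs_spin _).le)
      (R.abs_patternMoment_le S p (fun z => spin (z u)) fun z => (abs_spin _).le)
      (R.abs_patternMoment_le S p (fun z => spin (z v)) fun z => (abs_spin _).le)
    unfold momentCov
    rw [sub_sub_sub_comm]
    refine (abs_sub _ _).trans ?_
    linarith
  refine (Finset.sum_le_card_nsmul _ _ _ h1).trans (le_of_eq ?_)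
  rw [hcard, nsmul_eq_mul]
  push_cast
  ring

end Moments

/-! ### Concentration -/

namespace RBM

variable {n m H : ℕ}

open Classical in
/-- The probability of an event that depends on the samples. -/
def samplesPr (R : RBM n m) (E : (Fin H → SpinConfig n) → Prop) : ℝ :=
  ∑ x, if E x then R.samplesProb x else 0

theorem samplesProb_nonneg (R : RBM n m) (x : Fin H → SpinConfig n) : 0 ≤ R.samplesProb x :=
  Finset.prod_nonneg fun _ _ => (R.visibleProb_pos _).le

theorem sum_samples_prod (φ : SpinConfig n → ℝ) :
    ∑ x : Fin H → SpinConfig n, ∏ k, φ (x k) = (∑ z, φ z) ^ H := by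
  have := Finset.prod_univ_sum (fun _ : Fin H => (Finset.univ : Finset (SpinConfig n)))
    (fun _ z => φ z)
  rw [Fintype.piFinset_univ] at this
  rw [← this]
  simp

theorem sum_samplesProb (R : RBM n m) : ∑ x : Fin H → SpinConfig n, R.samplesProb x = 1 := by
  simp only [samplesProb]
  rw [sum_samples_prod, R.sum_visibleProb, one_pow]

theorem samplesPr_mono (R : RBM n m) {E F : (Fin H → SpinConfig n) → Prop} (h : ∀ x, E x → F x) :
    R.samplesPr E ≤ R.samplesPr F := by
  classical
  refine Finset.sum_le_sum fun x _ => ?_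
  by_cases hE : E x
  · simp [hE, h x hE]
  · rw [if_neg hE]; split_ifs; exacts [R.samplesProb_nonneg x, le_rfl]

theorem samplesPr_exists_le (R : RBM n m) {ι : Type*} (s : Finset ι)
    (E : ι → (Fin H → SpinConfig n) → Prop) :
    R.samplesPr (fun x => ∃ i ∈ s, E i x) ≤ ∑ i ∈ s, R.samplesPr (E i) := by
  classical
  simp only [samplesPr]
  rw [Finset.sum_comm]
  refine Finset.sum_le_sum fun x _ => ?_
  have h0 : ∀ i ∈ s, 0 ≤ if E i x then R.samplesProb x else 0 := fun i _ => by
    split_ifs; exacts [R.samplesProb_nonneg x, le_rfl]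
  split_ifs with h
  · obtain ⟨i, hi, hE⟩ := h
    have := Finset.single_le_sum h0 hi
    rwa [if_pos hE] at this
  · exact Finset.sum_nonneg h0

theorem exp_le_quadratic {t : ℝ} (ht : |t| ≤ 1) : Real.exp t ≤ 1 + t + t ^ 2 := by
  have := (abs_le.1 (Real.abs_exp_sub_one_sub_id_le ht)).2
  linarith

/-- One-sided Hoeffding inequality. -/
theorem samplesPr_sum_ge_le (R : RBM n m) (φ : SpinConfig n → ℝ) (hφ : ∀ z, |φ z| ≤ 1) {ε : ℝ}
    (hε : 0 ≤ ε) (hε1 : ε ≤ 1) :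
    R.samplesPr (fun x : Fin H → SpinConfig n =>
      ε * H ≤ ∑ k, (φ (x k) - ∑ z, R.visibleProb z * φ z)) ≤ Real.exp (-(ε ^ 2 / 4 * H)) := by
  classical
  set μ := ∑ z, R.visibleProb z * φ z with hμ
  have hμ1 : |μ| ≤ 1 := by
    refine (Finset.abs_sum_le_sum_abs _ _).trans ?_
    rw [← R.sum_visibleProb]
    refine Finset.sum_le_sum fun z _ => ?_
    rw [abs_mul, abs_of_pos (R.visibleProb_pos z)]
    exact mul_le_of_le_one_right (R.visibleProb_pos z).le (hφ z)
  -- With exponential tilt `ε / 2`, each sample costs at most `ε² / 4` in the exponent, against a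
  -- gain of `ε² / 2` from the deviation.
  have hmgf : ∑ z, R.visibleProb z * Real.exp (ε / 2 * (φ z - μ)) ≤ Real.exp (ε ^ 2 / 4) := by
    have h1 : ∀ z, Real.exp (ε / 2 * (φ z - μ))
        ≤ 1 + ε / 2 * (φ z - μ) + (ε / 2) ^ 2 * (1 - 2 * φ z * μ + μ ^ 2) := by
      intro z
      have hz := abs_le.1 (hφ z)
      have hm := abs_le.1 hμ1
      have : |ε / 2 * (φ z - μ)| ≤ 1 := by
        rw [abs_mul, abs_of_nonneg (by linarith : 0 ≤ ε / 2)]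
        have : |φ z - μ| ≤ 2 := by rw [abs_le]; constructor <;> linarith
        nlinarith
      refine (exp_le_quadratic this).trans ?_
      have : φ z ^ 2 ≤ 1 := by nlinarith
      nlinarith [sq_nonneg (ε / 2)]
    calc ∑ z, R.visibleProb z * Real.exp (ε / 2 * (φ z - μ))
        ≤ ∑ z, R.visibleProb z *
          (1 + ε / 2 * (φ z - μ) + (ε / 2) ^ 2 * (1 - 2 * φ z * μ + μ ^ 2)) :=
        Finset.sum_le_sum fun z _ => mul_le_mul_of_nonneg_left (h1 z) (R.visibleProb_pos z).le
      _ = ∑ z, (R.visibleProb z * (1 - ε / 2 * μ + (ε / 2) ^ 2 * (1 + μ ^ 2))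
          + (R.visibleProb z * φ z) * (ε / 2 - (ε / 2) ^ 2 * (2 * μ))) :=
        Finset.sum_congr rfl fun z _ => by ring
      _ = 1 + (ε / 2) ^ 2 * (1 - μ ^ 2) := by
        rw [Finset.sum_add_distrib, ← Finset.sum_mul, ← Finset.sum_mul, ← hμ, R.sum_visibleProb]
        ring
      _ ≤ ε ^ 2 / 4 + 1 := by nlinarith [sq_nonneg μ, sq_nonneg (ε / 2 * μ)]
      _ ≤ _ := Real.add_one_le_exp _
  calc _ ≤ ∑ x : Fin H → SpinConfig n, R.samplesProb x *
        (Real.exp (-(ε / 2 * (ε * H))) * ∏ k, Real.exp (ε / 2 * (φ (x k) - μ))) := by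
        refine Finset.sum_le_sum fun x _ => ?_
        rw [← Real.exp_sum, ← Real.exp_add, ← Finset.mul_sum]
        split_ifs with h
        · refine le_mul_of_one_le_right (R.samplesProb_nonneg x) (Real.one_le_exp ?_)
          nlinarith
        · exact mul_nonneg (R.samplesProb_nonneg x) (Real.exp_pos _).le
    _ = Real.exp (-(ε / 2 * (ε * H))) *
        (∑ z, R.visibleProb z * Real.exp (ε / 2 * (φ z - μ))) ^ H := by
        rw [← sum_samples_prod, Finset.mul_sum]
        refine Finset.sum_congr rfl fun x _ => ?_
        rw [samplesProb, mul_left_comm, Finset.prod_mul_distrib]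
    _ ≤ Real.exp (-(ε / 2 * (ε * H))) * Real.exp (ε ^ 2 / 4) ^ H := by
        refine mul_le_mul_of_nonneg_left (pow_le_pow_left₀ ?_ hmgf H) (Real.exp_pos _).le
        exact Finset.sum_nonneg fun z _ =>
          mul_nonneg (R.visibleProb_pos z).le (Real.exp_pos _).le
    _ = _ := by
        rw [← Real.exp_nat_mul, ← Real.exp_add]
        congr 1
        ring

theorem samplesPr_abs_ge_le (R : RBM n m) (φ : SpinConfig n → ℝ) (hφ : ∀ z, |φ z| ≤ 1) {ε : ℝ}
    (hε : 0 ≤ ε) (hε1 : ε ≤ 1) (hH : 0 < H) :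
    R.samplesPr (fun x : Fin H → SpinConfig n =>
      ε < |(∑ k, φ (x k)) / H - ∑ z, R.visibleProb z * φ z|)
      ≤ 2 * Real.exp (-(ε ^ 2 / 4 * H)) := by
  classical
  have hH' : (0 : ℝ) < H := by positivity
  have h1 := R.samplesPr_sum_ge_le (H := H) φ hφ hε hε1
  have h2 := R.samplesPr_sum_ge_le (H := H) (fun z => -φ z) (by simpa using hφ) hε hε1
  refine le_trans ?_ ((add_le_add h1 h2).trans (by linarith))
  rw [samplesPr, samplesPr, samplesPr, ← Finset.sum_add_distrib]
  refine Finset.sum_le_sum fun x _ => ?_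
  have hp := R.samplesProb_nonneg x
  by_cases h : ε < |(∑ k, φ (x k)) / H - ∑ z, R.visibleProb z * φ z|
  · rw [if_pos h]
    rcases lt_abs.1 h with h | h
    · have : ε * H ≤ ∑ k, (φ (x k) - ∑ z, R.visibleProb z * φ z) := by
        rw [Finset.sum_sub_distrib, Finset.sum_const, Finset.card_univ, Fintype.card_fin,
          nsmul_eq_mul]
        rw [lt_sub_iff_add_lt, lt_div_iff₀ hH'] at h
        linarith
      rw [if_pos this]
      split_ifs <;> linarith
    · have : ε * H ≤ ∑ k, (-φ (x k) - ∑ z, R.visibleProb z * -φ z) := by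
        rw [Finset.sum_sub_distrib, Finset.sum_const, Finset.card_univ, Fintype.card_fin,
          nsmul_eq_mul]
        simp only [mul_neg, Finset.sum_neg_distrib]
        rw [neg_sub, lt_sub_comm, div_lt_iff₀ hH'] at h
        linarith
      rw [if_pos this]
      split_ifs <;> linarith
  · rw [if_neg h]
    split_ifs <;> linarith

/-- A set of at most `s` nodes is obtained by filling `s` places, each with a node or with nothing.
-/
theorem card_small_sets_le (n s : ℕ) :
    ({S : Finset (Fin n) | S.card ≤ s} : Finset (Finset (Fin n))).card ≤ (n + 1) ^ s := by
  classical
  let f : (Fin s → Option (Fin n)) → Finset (Fin n) := fun g => {v | ∃ i, g i = some v}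
  have : ({S : Finset (Fin n) | S.card ≤ s} : Finset (Finset (Fin n)))
      ⊆ Finset.image f Finset.univ := by
    intro S hS
    rw [Finset.mem_filter] at hS
    rw [Finset.mem_image]
    refine ⟨fun i => if h : (i : ℕ) < S.card then some (S.equivFin.symm ⟨i, h⟩ : Fin n) else none,
      Finset.mem_univ _, ?_⟩
    ext v
    simp only [f, Finset.mem_filter, Finset.mem_univ, true_and]
    constructor
    · rintro ⟨i, hi⟩
      split_ifs at hi with h
      · rw [Option.some.injEq] at hi
        rw [← hi]
        exact (S.equivFin.symm ⟨i, h⟩).2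
    · intro hv
      refine ⟨⟨S.equivFin ⟨v, hv⟩, (S.equivFin ⟨v, hv⟩).2.trans_le hS.2⟩, ?_⟩
      simp
  refine (Finset.card_le_card this).trans (Finset.card_image_le.trans ?_)
  simp

/-- With high probability, all empirical average conditional covariances given small sets are
accurate. -/
theorem samplesPr_inaccurate_le (R : RBM n m) (u : Fin n) (s : ℕ) {ε : ℝ} (hε : 0 ≤ ε)
    (hε1 : ε ≤ 1) (hH : 0 < H) :
    R.samplesPr (fun x : Fin H → SpinConfig n => ∃ S : Finset (Fin n), S.card ≤ s ∧ ∃ v, v ≠ u ∧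
      2 ^ S.card * (4 * ε) < |empAvgCov x u v S - R.avgCov u v S|)
      ≤ (n + 1) ^ s * (n - 1) * 2 ^ s * 8 * Real.exp (-(ε ^ 2 / 4 * H)) := by
  classical
  set B := Real.exp (-(ε ^ 2 / 4 * H)) with hB
  have hB0 : 0 ≤ B := (Real.exp_pos _).le
  have h1 : ∀ S : Finset (Fin n), ∀ v, R.samplesPr (fun x : Fin H → SpinConfig n =>
      2 ^ S.card * (4 * ε) < |empAvgCov x u v S - R.avgCov u v S|) ≤ 2 ^ S.card * (8 * B) := by
    intro S v
    let L : List (SpinConfig n → ℝ) := [fun z : SpinConfig n => spin (z u) * spin (z v),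
      fun z => spin (z u), fun z => spin (z v), fun _ => 1]
    let E : (S → ℤˣ) → (Fin H → SpinConfig n) → Prop := fun p x => ∃ i ∈ Finset.range 4,
      ε < |empMoment x S p (L.getD i fun _ => 1) - R.patternMoment S p (L.getD i fun _ => 1)|
    -- Four moments with two tails each.
    have hE : ∀ p, R.samplesPr (E p) ≤ 8 * B := by
      intro p
      refine (R.samplesPr_exists_le _ _).trans ?_
      have : ∀ i ∈ Finset.range 4, R.samplesPr (fun x : Fin H → SpinConfig n =>
          ε < |empMoment x S p (L.getD i fun _ => 1) - R.patternMoment S p (L.getD i fun _ => 1)|)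
          ≤ 2 * B := by
        intro i hi
        refine R.samplesPr_abs_ge_le (fun z => patternInd S p z * L.getD i (fun _ => 1) z)
          (fun z => ?_) hε hε1 hH
        rw [abs_mul, abs_of_nonneg (patternInd_nonneg S p z)]
        refine mul_le_one₀ (patternInd_le_one S p z) (abs_nonneg _) ?_
        rw [Finset.mem_range] at hi
        interval_cases i <;> simp [L, abs_mul]
      refine (Finset.sum_le_card_nsmul _ _ _ this).trans (le_of_eq ?_)
      simp
      ring
    have h2 : R.samplesPr (fun x : Fin H → SpinConfig n =>
        2 ^ S.card * (4 * ε) < |empAvgCov x u v S - R.avgCov u v S|)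
        ≤ R.samplesPr (fun x => ∃ p ∈ Finset.univ, E p x) := by
      refine R.samplesPr_mono fun x hx => ?_
      by_contra hne
      refine absurd (R.abs_empAvgCov_sub_le x u v S ε fun p φ hφ => ?_) (not_le.2 hx)
      by_contra hlt
      refine hne ⟨p, Finset.mem_univ p, ?_⟩
      obtain ⟨i, hi, rfl⟩ := List.mem_iff_getElem.1 hφ
      refine ⟨i, by simpa using hi, ?_⟩
      rw [List.getD_eq_getElem _ _ hi]
      exact not_le.1 hlt
    refine h2.trans ((R.samplesPr_exists_le _ _).trans
      ((Finset.sum_le_card_nsmul _ _ _ fun p _ => hE p).trans (le_of_eq ?_)))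
    rw [Finset.card_univ, Fintype.card_fun, nsmul_eq_mul]
    simp
  have h3 : R.samplesPr (fun x : Fin H → SpinConfig n => ∃ S : Finset (Fin n), S.card ≤ s ∧
      ∃ v, v ≠ u ∧ 2 ^ S.card * (4 * ε) < |empAvgCov x u v S - R.avgCov u v S|)
      ≤ R.samplesPr (fun x : Fin H → SpinConfig n => ∃ i ∈ ({S : Finset (Fin n) | S.card ≤ s} : Finset _) ×ˢ
        Finset.univ.erase u,
        2 ^ i.1.card * (4 * ε) < |empAvgCov x u i.2 i.1 - R.avgCov u i.2 i.1|) := by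
    refine R.samplesPr_mono ?_
    rintro x ⟨S, hS, v, hv, h⟩
    exact ⟨(S, v), by simp [hS, hv], h⟩
  refine h3.trans ((R.samplesPr_exists_le _ _).trans ?_)
  have h4 : ∀ i ∈ ({S : Finset (Fin n) | S.card ≤ s} : Finset (Finset (Fin n))) ×ˢ
      Finset.univ.erase u, R.samplesPr (fun x : Fin H → SpinConfig n =>
        2 ^ i.1.card * (4 * ε) < |empAvgCov x u i.2 i.1 - R.avgCov u i.2 i.1|)
      ≤ 2 ^ s * (8 * B) := by
    intro i hi
    refine (h1 i.1 i.2).trans (mul_le_mul_of_nonneg_right ?_ (by positivity))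
    refine pow_le_pow_right₀ (by norm_num) ?_
    simp only [Finset.mem_product, Finset.mem_filter] at hi
    exact hi.1.2
  refine (Finset.sum_le_card_nsmul _ _ _ h4).trans ?_
  rw [Finset.card_product, Finset.card_erase_of_mem (Finset.mem_univ u), nsmul_eq_mul,
    Finset.card_univ, Fintype.card_fin]
  have hn : 1 ≤ n := Fin.pos u
  have hc : (({S : Finset (Fin n) | S.card ≤ s} : Finset (Finset (Fin n))).card : ℝ)
      ≤ (n + 1) ^ s := by exact_mod_cast card_small_sets_le n s
  push_cast [Nat.cast_sub hn]
  have hn' : (0 : ℝ) ≤ n - 1 := by rw [sub_nonneg]; exact_mod_cast hn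
  calc _ ≤ ((n : ℝ) + 1) ^ s * (n - 1) * (2 ^ s * (8 * B)) := by
        refine mul_le_mul_of_nonneg_right (mul_le_mul_of_nonneg_right hc hn') (by positivity)
    _ = _ := by ring

end RBM

/-! ### Correctness of the greedy algorithm on accurate samples -/

/-- When the loop has ended, a missing neighbor would have true covariance at least `τ + τ²`, hence
empirical covariance above `τ`; so `T` contains all neighbors. In the pruning step the same bound
keeps every neighbor. A non-neighbor is dropped, because the rest of `T` still contains the
neighborhood: its true covariance is zero and its empirical one below `τ² ≤ τ`. -/
theorem greedyResult_eq_coupled {n m H : ℕ} (R : RBM n m) {α β τ : ℝ} (hα : 0 < α)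
    (hR : R.NonDegenerate α β) (hL : R.LocallyConsistent) (hτ : 0 < τ) (hτ1 : τ ≤ 1)
    (hgap : τ + τ ^ 2 ≤ α ^ 2 * Real.exp (-6 * β)) (hH : 0 < H) {s : ℕ}
    (hs : ∀ c : ℕ, c * τ ^ 2 ≤ 1 → c ≤ s) (x : Fin H → SpinConfig n) (u : Fin n)
    (hacc : ∀ S : Finset (Fin n), S.card ≤ s → ∀ v, v ≠ u →
      |empAvgCov x u v S - R.avgCov u v S| < τ ^ 2) {N : Finset (Fin n)}
    (hN : GreedyResult x u τ N) : N = R.coupled u := by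
  obtain ⟨T, hT, rfl⟩ := hN
  obtain ⟨hcard, huT, -, hfin⟩ := greedyLoop_card_le x hH hτ hT
    (by simpa using rss_le_card x u ∅) (by simp) (fun _ => True) trivial (fun _ _ _ _ _ => trivial)
  have hTs := hs _ hcard
  have hsub : R.coupled u ⊆ T := by
    intro v hv
    by_contra hvT
    have hvu := (RBM.mem_coupled.1 hv).1
    have h1 := R.avgCov_ge hα hR hL hv huT hvT
    have h2 := abs_lt.1 (hacc T hTs v hvu)
    have h3 := hfin v hvT hvu
    linarith [h2.1]
  have hsmall : ∀ v, (T.erase v).card ≤ s := fun v =>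
    (Finset.card_le_card (Finset.erase_subset _ _)).trans hTs
  have hu' : ∀ v, u ∉ T.erase v := fun v h => huT (Finset.mem_of_mem_erase h)
  ext v
  rw [prune, Finset.mem_filter]
  constructor
  · rintro ⟨hvT, hcov⟩
    by_contra hvN
    have hvu : v ≠ u := fun h => huT (h ▸ hvT)
    have h1 := R.avgCov_eq_zero (S := T.erase v) (v := v)
      (fun w hw => Finset.mem_erase.2 ⟨fun h => hvN (h ▸ hw), hsub hw⟩) (hu' v) hvu
    have h2 := abs_lt.1 (hacc _ (hsmall v) v hvu)
    rw [h1] at h2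
    nlinarith [h2.2]
  · intro hv
    have hvu := (RBM.mem_coupled.1 hv).1
    refine ⟨hsub hv, ?_⟩
    have h1 := R.avgCov_ge hα hR hL hv (hu' v) (Finset.notMem_erase v T)
    have h2 := abs_lt.1 (hacc _ (hsmall v) v hvu)
    linarith [h2.1]

/-! ### State vectors -/

/-- The squared norm of a state vector. -/
def QState.normSq (ψ : QState) : ℝ := ψ.sum fun _ z => ‖z‖ ^ 2

/-- The superposition of the basis vectors `f v`, `v ∈ s`, with amplitudes `a v`. -/
def family {ι : Type*} (s : Finset ι) (f : ι → Registers) (a : ι → ℂ) : QState :=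
  ∑ v ∈ s, Finsupp.single (f v) (a v)

section States

variable {ι : Type*}

theorem QState.normSq_eq_sum {ψ : QState} {s : Finset Registers} (h : ψ.support ⊆ s) :
    QState.normSq ψ = ∑ c ∈ s, ‖ψ c‖ ^ 2 :=
  Finsupp.sum_of_support_subset _ h _ fun _ _ => by simp

theorem family_apply {s : Finset ι} {f : ι → Registers} (hf : Set.InjOn f s) (a : ι → ℂ) {v : ι}
    (hv : v ∈ s) : family s f a (f v) = a v := by
  rw [family, Finsupp.finsetSum_apply, Finset.sum_eq_single v]
  · simp
  · intro w hw hne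
    rw [Finsupp.single_eq_of_ne]
    exact fun h => hne (hf hw hv h.symm)
  · exact fun h => absurd hv h

theorem family_support_subset [DecidableEq Registers] (s : Finset ι) (f : ι → Registers)
    (a : ι → ℂ) : (family s f a).support ⊆ s.image f := by
  intro c hc
  rw [Finsupp.mem_support_iff] at hc
  by_contra hn
  refine hc ?_
  rw [family, Finsupp.finsetSum_apply]
  refine Finset.sum_eq_zero fun v hv => ?_
  rw [Finsupp.single_eq_of_ne]
  exact fun h => hn (Finset.mem_image.2 ⟨v, hv, h.symm⟩)

theorem normSq_family {s : Finset ι} {f : ι → Registers} (hf : Set.InjOn f s) (a : ι → ℂ) :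
    QState.normSq (family s f a) = ∑ v ∈ s, ‖a v‖ ^ 2 := by
  classical
  rw [QState.normSq_eq_sum (family_support_subset s f a), Finset.sum_image hf]
  exact Finset.sum_congr rfl fun v hv => by rw [family_apply hf a hv]

theorem family_congr {s : Finset ι} {f g : ι → Registers} (h : ∀ v ∈ s, f v = g v) (a : ι → ℂ) :
    family s f a = family s g a :=
  Finset.sum_congr rfl fun v hv => by rw [h v hv]

theorem family_singleton (v : ι) (f : ι → Registers) (a : ι → ℂ) :
    family {v} f a = Finsupp.single (f v) (a v) := by simp [family]

theorem normSq_single (c : Registers) (z : ℂ) : QState.normSq (Finsupp.single c z) = ‖z‖ ^ 2 := by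
  simp [QState.normSq]

theorem family_support (ψ : QState) : family ψ.support id ψ = ψ := by
  conv_rhs => rw [← Finsupp.sum_single ψ]
  rfl

end States

/-! ### Gates are linear isometries -/

namespace QGate

variable {n H : ℕ} (x : Fin H → SpinConfig n) (mem : Registers)

theorem apply_eq_linearCombination (G : QGate) (ψ : QState) :
    G.apply x mem ψ = Finsupp.linearCombination ℂ (G.onBasis x mem) ψ := rfl

theorem apply_single (G : QGate) (c : Registers) (z : ℂ) :
    G.apply x mem (Finsupp.single c z) = z • G.onBasis x mem c := by
  rw [apply_eq_linearCombination, Finsupp.linearCombination_single]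

theorem apply_add (G : QGate) (ψ φ : QState) :
    G.apply x mem (ψ + φ) = G.apply x mem ψ + G.apply x mem φ := by
  simp only [apply_eq_linearCombination, map_add]

theorem apply_smul (G : QGate) (z : ℂ) (ψ : QState) :
    G.apply x mem (z • ψ) = z • G.apply x mem ψ := by
  simp only [apply_eq_linearCombination, map_smul]

theorem apply_sum {ι : Type*} (G : QGate) (s : Finset ι) (ψ : ι → QState) :
    G.apply x mem (∑ v ∈ s, ψ v) = ∑ v ∈ s, G.apply x mem (ψ v) := by
  simp only [apply_eq_linearCombination, map_sum]

theorem apply_family_phase {ι : Type*} (G : QGate) (s : Finset ι) (f g : ι → Registers)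
    (a ω : ι → ℂ) (h : ∀ v ∈ s, G.onBasis x mem (f v) = Finsupp.single (g v) (ω v)) :
    G.apply x mem (family s f a) = family s g fun v => a v * ω v := by
  rw [family, apply_sum]
  exact Finset.sum_congr rfl fun v hv => by simp [apply_single, h v hv]

/-- The map on basis vectors of a gate other than the Hadamard gate. -/
def move : QGate → Registers → Registers
  | hadamard _, c => c
  | phase _, c => c
  | cnot a t, c =>
      if a.eval mem ≠ t.eval mem ∧ c (a.eval mem) = 1 then
        Function.update c (t.eval mem) (1 - c (t.eval mem))
      else c
  | load inv t r, c => shiftReg inv c (t.eval mem) (mem (r.eval mem))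
  | arith inv o t a b, c =>
      if t.eval mem = a.eval mem ∨ t.eval mem = b.eval mem then c
      else shiftReg inv c (t.eval mem) (o.eval (c (a.eval mem)) (c (b.eval mem)))
  | query inv i j t, c =>
      if t.eval mem = j.eval mem then c
      else shiftReg inv c (t.eval mem) (sampleValue x (mem (i.eval mem)) (c (j.eval mem)))

/-- The phase factor on basis vectors of a gate other than the Hadamard gate. -/
def factor : QGate → Registers → ℂ
  | phase q, c => if c (q.eval mem) = 1 then Complex.exp (Real.pi / 4 * Complex.I) else 1
  | _, _ => 1

/-- The gates other than the Hadamard gate. -/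
def IsMonomial : QGate → Prop
  | hadamard _ => False
  | _ => True

theorem onBasis_of_isMonomial {G : QGate} (hG : G.IsMonomial) (c : Registers) :
    G.onBasis x mem c = Finsupp.single (G.move x mem c) (G.factor mem c) := by
  cases G <;> simp only [onBasis, move, factor, IsMonomial] at * <;> split_ifs <;> rfl

theorem norm_factor (G : QGate) (c : Registers) : ‖G.factor mem c‖ = 1 := by
  cases G <;> simp only [factor, norm_one]
  split_ifs
  · have := Complex.norm_exp_ofReal_mul_I (Real.pi / 4)
    push_cast at this
    exact this
  · simp

/-- The shift may depend on the registers, but only on those other than the target. These survive,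
so the shift can be recomputed and undone. -/
theorem shiftReg_injective {c d : Registers} {inv : Bool} {t : ℕ} {a b : ℝ}
    (hab : (∀ r, r ≠ t → c r = d r) → a = b) (h : shiftReg inv c t a = shiftReg inv d t b) :
    c = d := by
  have h1 : ∀ r, r ≠ t → c r = d r := by
    intro r hr
    have := congrFun h r
    simpa [shiftReg, hr] using this
  have h2 := congrFun h t
  simp only [shiftReg, Function.update_self, hab h1] at h2
  funext r
  by_cases hr : r = t
  · subst hr
    split_ifs at h2 <;> linarith
  · exact h1 r hr

theorem move_injective (G : QGate) : Function.Injective (G.move x mem) := by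
  intro c d h
  cases G with
  | hadamard q => exact h
  | phase q => exact h
  | cnot a t =>
    simp only [move] at h
    by_cases hat : a.eval mem = t.eval mem
    · simpa [hat] using h
    · have ha : c (a.eval mem) = d (a.eval mem) := by
        have := congrFun h (a.eval mem)
        split_ifs at this <;> simpa [hat] using this
      rw [ha] at h
      split_ifs at h
      · funext r
        by_cases hr : r = t.eval mem
        · subst hr
          have := congrFun h (t.eval mem)
          simp only [Function.update_self] at this
          linarith
        · simpa [hr] using congrFun h r
      · exact h
  | load inv t r => exact shiftReg_injective (fun _ => rfl) h
  | arith inv o t a b =>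
    simp only [move] at h
    split_ifs at h with hc
    · exact h
    · push Not at hc
      exact shiftReg_injective (fun hr => by rw [hr _ hc.1.symm, hr _ hc.2.symm]) h
  | query inv i j t =>
    simp only [move] at h
    split_ifs at h with hc
    · exact h
    · exact shiftReg_injective (fun hr => by rw [hr _ (Ne.symm hc)]) h

theorem apply_family {ι : Type*} {G : QGate} (hG : G.IsMonomial) (s : Finset ι)
    (f : ι → Registers) (a : ι → ℂ) : G.apply x mem (family s f a)
      = family s (fun v => G.move x mem (f v)) fun v => a v * G.factor mem (f v) :=
  apply_family_phase x mem G s f _ a _ fun v _ => onBasis_of_isMonomial x mem hG (f v)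

theorem normSq_apply_of_isMonomial {G : QGate} (hG : G.IsMonomial) (ψ : QState) :
    QState.normSq (G.apply x mem ψ) = QState.normSq ψ := by
  rw [← family_support ψ, apply_family x mem hG, normSq_family, normSq_family]
  · simp [norm_factor]
  · exact Function.injective_id.injOn
  · exact ((move_injective x mem G).comp Function.injective_id).injOn

/-- The coefficients of a state vector after a Hadamard gate. -/
theorem hadamard_apply_apply (q : Addr) (ψ : QState) (d : Registers) :
    (hadamard q).apply x mem ψ d =
      if d (q.eval mem) = 0 then
        (Real.sqrt 2 : ℂ)⁻¹ * (ψ d + ψ (Function.update d (q.eval mem) 1))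
      else if d (q.eval mem) = 1 then
        (Real.sqrt 2 : ℂ)⁻¹ * (ψ (Function.update d (q.eval mem) 0) - ψ d)
      else ψ d := by
  classical
  set k := q.eval mem with hk
  have key : ∀ (c : Registers) (z w : ℝ), c k = z → (Function.update c k w = d ↔
      d k = w ∧ c = Function.update d k z) := by
    intro c z w hc
    constructor
    · rintro rfl
      refine ⟨by simp, ?_⟩
      rw [Function.update_idem, ← hc, Function.update_eq_self]
    · rintro ⟨h1, h2⟩
      rw [h2, Function.update_idem, ← h1, Function.update_eq_self]
  induction ψ using Finsupp.induction_linear with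
  | zero =>
    have : (hadamard q).apply x mem 0 = 0 := by
      rw [apply_eq_linearCombination, map_zero]
    simp [this]
  | add ψ φ h1 h2 =>
    rw [apply_add, Finsupp.add_apply, h1, h2]
    simp only [Finsupp.add_apply]
    split_ifs <;> ring
  | single c z =>
    rw [apply_single]
    simp only [onBasis, ← hk]
    by_cases h0 : c k = 0
    · have ec1 : c ≠ Function.update d k 1 := by
        intro h; have := congrFun h k; simp [h0] at this
      by_cases hd0 : d k = 0
      · have hne : Function.update c k 1 ≠ d := by
          intro h; have := congrFun h k; simp [hd0] at this
        simp only [h0, hd0, if_true, Finsupp.smul_apply, Finsupp.add_apply, Finsupp.single_apply,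
          smul_eq_mul, if_neg hne, if_neg ec1]
        split_ifs <;> ring
      · by_cases hd1 : d k = 1
        · have hne : c ≠ d := by
            intro h; rw [h, hd1] at h0; exact one_ne_zero h0
          have hiff : (Function.update c k 1 = d) = (c = Function.update d k 0) := by
            rw [key c 0 1 h0]; simp [hd1]
          simp only [h0, hd1, if_true, Finsupp.smul_apply, Finsupp.add_apply, Finsupp.single_apply,
            smul_eq_mul, if_neg hne, one_ne_zero, if_false, hiff]
          split_ifs <;> ring
        · have hne : c ≠ d := by
            intro h; rw [h] at h0; exact hd0 h0
          have hne' : Function.update c k 1 ≠ d := by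
            intro h; have := congrFun h k; rw [Function.update_self] at this; exact hd1 this.symm
          simp [h0, hd0, hd1, hne, hne']
    · by_cases h1 : c k = 1
      · have ec0 : c ≠ Function.update d k 0 := by
          intro h; have := congrFun h k; simp [h1] at this
        by_cases hd0 : d k = 0
        · have hne : c ≠ d := by
            intro h; rw [h, hd0] at h1; exact zero_ne_one h1
          have hiff : (Function.update c k 0 = d) = (c = Function.update d k 1) := by
            rw [key c 1 0 h1]; simp [hd0]
          simp only [h1, hd0, if_true, Finsupp.smul_apply, Finsupp.sub_apply, Finsupp.single_apply,
            smul_eq_mul, if_neg hne, one_ne_zero, if_false, hiff]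
          split_ifs <;> ring
        · by_cases hd1 : d k = 1
          · have hne : Function.update c k 0 ≠ d := by
              intro h; have := congrFun h k; simp [hd1] at this
            simp only [h1, hd1, if_true, Finsupp.smul_apply, Finsupp.sub_apply,
              Finsupp.single_apply, smul_eq_mul, if_neg hne, one_ne_zero, if_false, if_neg ec0]
            split_ifs <;> ring
          · have hne : c ≠ d := by
              intro h; rw [h] at h1; exact hd1 h1
            have hne' : Function.update c k 0 ≠ d := by
              intro h; have := congrFun h k; rw [Function.update_self] at this; exact hd0 this.symm
            simp [h1, hd0, hd1, hne, hne']
      · have hA : d k = 0 → c ≠ d := fun h h' => h0 (h' ▸ h)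
        have hB : d k = 1 → c ≠ d := fun h h' => h1 (h' ▸ h)
        have hC : ∀ w, c k ≠ w → c ≠ Function.update d k w := fun w hw h => hw (by rw [h]; simp)
        by_cases hd0 : d k = 0
        · simp [h0, h1, hd0, hA hd0, hC 1 h1]
        · by_cases hd1 : d k = 1
          · simp [h0, h1, hd1, hB hd1, hC 0 h0]
          · simp [h0, h1, hd0, hd1]

/-- The basis vectors with content `0` or `1` in the register form pairs, on each of which the
parallelogram law applies; all others are fixed. `flip` exchanges the members of a pair, and the
differences of squared moduli cancel along it. -/
theorem normSq_hadamard_apply (q : Addr) (ψ : QState) :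
    QState.normSq ((hadamard q).apply x mem ψ) = QState.normSq ψ := by
  classical
  set k := q.eval mem with hk
  let flip : Registers → Registers := fun c => if c k = 0 ∨ c k = 1 then
    Function.update c k (1 - c k) else c
  have hflip : Function.Involutive flip := by
    intro c
    by_cases h : c k = 0 ∨ c k = 1
    · have h1 : flip c = Function.update c k (1 - c k) := if_pos h
      have h2 : flip (Function.update c k (1 - c k)) =
          Function.update (Function.update c k (1 - c k)) k
            (1 - Function.update c k (1 - c k) k) :=
        if_pos (by rcases h with h | h <;> simp [h])
      rw [h1, h2]
      simp
    · simp [flip, h]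
  set s := ψ.support ∪ ψ.support.image flip with hs
  have hsmem : ∀ c, flip c ∈ s ↔ c ∈ s := by
    have h1 : ∀ c, c ∈ s → flip c ∈ s := by
      intro c hc
      rw [hs, Finset.mem_union, Finset.mem_image] at hc ⊢
      rcases hc with hc | ⟨d, hd, rfl⟩
      · exact Or.inr ⟨c, hc, rfl⟩
      · left; rwa [hflip]
    exact fun c => ⟨fun h => by have := h1 _ h; rwa [hflip] at this, h1 c⟩
  have hz : ∀ c, c ∉ s → ψ c = 0 := fun c hc => by
    by_contra h
    exact hc (Finset.mem_union_left _ (Finsupp.mem_support_iff.2 h))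
  have hval : ∀ c, (hadamard q).apply x mem ψ c = if c k = 0 then
      (Real.sqrt 2 : ℂ)⁻¹ * (ψ c + ψ (flip c)) else if c k = 1 then
      (Real.sqrt 2 : ℂ)⁻¹ * (ψ (flip c) - ψ c) else ψ c := by
    intro c
    rw [hadamard_apply_apply]
    by_cases h0 : c k = 0
    · simp [← hk, h0, flip]
    · by_cases h1 : c k = 1
      · simp [← hk, h1, flip]
      · simp [← hk, h0, h1]
  have hsub : ((hadamard q).apply x mem ψ).support ⊆ s := by
    intro c hc
    by_contra hcs
    refine Finsupp.mem_support_iff.1 hc ?_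
    rw [hval, hz c hcs, hz (flip c) (by rwa [hsmem])]
    simp
  rw [QState.normSq_eq_sum hsub, QState.normSq_eq_sum (Finset.subset_union_left : _ ⊆ s),
    ← sub_eq_zero, ← Finset.sum_sub_distrib]
  have hr : ‖((Real.sqrt 2 : ℝ) : ℂ)⁻¹‖ ^ 2 = 1 / 2 := by
    rw [norm_inv, Complex.norm_real, Real.norm_eq_abs, abs_of_nonneg (Real.sqrt_nonneg 2), inv_pow,
      Real.sq_sqrt (by norm_num)]
    norm_num
  refine Finset.sum_involution (fun c _ => flip c) (fun c _ => ?_) (fun c _ hne heq => hne ?_)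
    (fun c hc => (hsmem c).2 hc) fun c _ => hflip c
  · have hp := parallelogram_law_with_norm ℂ (ψ c) (ψ (flip c))
    have hs : ‖ψ (flip c) - ψ c‖ = ‖ψ c - ψ (flip c)‖ := norm_sub_rev _ _
    have hs' : ‖ψ (flip c) + ψ c‖ = ‖ψ c + ψ (flip c)‖ := by rw [add_comm]
    rw [hval, hval, hflip]
    by_cases h0 : c k = 0
    · have : flip c k = 1 := by simp [flip, h0]
      simp only [h0, this, if_true, one_ne_zero, if_false, norm_mul, mul_pow, hr]
      linarith
    · by_cases h1 : c k = 1
      · have : flip c k = 0 := by simp [flip, h1]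
        simp only [h1, this, if_true, one_ne_zero, if_false, norm_mul, mul_pow, hr, hs, hs']
        linarith
      · have : flip c = c := by simp [flip, h0, h1]
        simp [h0, h1, this]
  · rw [hval]
    by_cases h0 : c k = 0
    · have := congrFun heq k
      simp [flip, h0] at this
    · by_cases h1 : c k = 1
      · have := congrFun heq k
        simp [flip, h1] at this
      · simp [h0, h1]

theorem normSq_apply (G : QGate) (ψ : QState) :
    QState.normSq (G.apply x mem ψ) = QState.normSq ψ := by
  cases G with
  | hadamard q => exact normSq_hadamard_apply x mem q ψ
  | _ => exact normSq_apply_of_isMonomial x mem (by trivial) ψ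

end QGate

/-! ### Weighted sums over branches -/

/-- The integral of `φ` over the branches, weighted with their probabilities. -/
def wt (φ : QBranch → ℝ) (s : Multiset QBranch) : ℝ := (s.map fun b => b.prob * φ b).sum

theorem wt_singleton (φ : QBranch → ℝ) (b : QBranch) : wt φ {b} = b.prob * φ b := by simp [wt]

theorem wt_bind (φ : QBranch → ℝ) (s : Multiset QBranch) (f : QBranch → Multiset QBranch) :
    wt φ (s.bind f) = (s.map fun b => wt φ (f b)).sum := by
  simp [wt, Multiset.map_bind, Multiset.sum_bind]

theorem wt_add (φ χ : QBranch → ℝ) (s : Multiset QBranch) :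
    wt (fun b => φ b + χ b) s = wt φ s + wt χ s := by
  simp [wt, mul_add, Multiset.sum_map_add]

theorem wt_const_mul (k : ℝ) (φ : QBranch → ℝ) (s : Multiset QBranch) :
    wt (fun b => k * φ b) s = k * wt φ s := by
  simp only [wt, mul_left_comm _ k, Multiset.sum_map_mul_left]

theorem QBranch.prob_nonneg (b : QBranch) : 0 ≤ b.prob :=
  Finset.sum_nonneg fun _ _ => sq_nonneg _

theorem wt_mono {φ χ : QBranch → ℝ} {s : Multiset QBranch} (h : ∀ b ∈ s, φ b ≤ χ b) :
    wt φ s ≤ wt χ s :=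
  Multiset.sum_map_le_sum_map _ _ fun b hb => mul_le_mul_of_nonneg_left (h b hb) b.prob_nonneg

/-- Iterations can be started separately in each branch. This allows the first pass of a loop to be
split off in an induction. -/
theorem multiset_bind_iterate {α : Type*} (f : α → Multiset α) (k : ℕ) (s : Multiset α) :
    (fun s : Multiset α => s.bind f)^[k] s = s.bind fun b => (fun s : Multiset α => s.bind f)^[k] {b} := by
  induction k generalizing s with
  | zero =>
    rw [Function.iterate_zero, id]
    exact ((Multiset.bind_singleton s id).trans (Multiset.map_id s)).symm
  | succ k ih =>
    simp only [Function.iterate_succ, Function.comp]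
    rw [ih, Multiset.bind_assoc]
    refine Multiset.bind_congr fun b _ => ?_
    rw [Multiset.singleton_bind, ← ih]

namespace QProg

variable {n H : ℕ} (x : Fin H → SpinConfig n)

theorem normSq_eq_sum_filter (ψ : QState) (k : ℕ) :
    ∑ a ∈ ψ.support.image (fun c => c k), QState.normSq (ψ.filter fun c => c k = a)
      = QState.normSq ψ := by
  classical
  rw [QState.normSq_eq_sum (subset_refl ψ.support), ← Finset.sum_fiberwise_of_maps_to
    (g := fun c : Registers => c k) (t := ψ.support.image fun c => c k)
    fun c hc => Finset.mem_image_of_mem _ hc]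
  refine Finset.sum_congr rfl fun a _ => ?_
  rw [QState.normSq_eq_sum (subset_refl _), Finsupp.support_filter]
  exact Finset.sum_congr rfl fun c hc => by
    rw [Finsupp.filter_apply_pos (fun c : Registers => c k = a) _ (Finset.mem_filter.1 hc).2]

/-- The total probability is conserved. -/
theorem wt_one_run (P : QProg) (b : QBranch) : wt (fun _ => 1) (P.run x b) = b.prob := by
  have hprob : ∀ b : QBranch, b.prob = QState.normSq b.state := fun _ => rfl
  induction P generalizing b with
  | const r k => simp [run, wt_singleton, hprob]
  | arith o r a c => simp [run, wt_singleton, hprob]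
  | gate G => simp [run, wt_singleton, hprob, QGate.normSq_apply]
  | measure q r =>
    simp only [run, wt, mul_one, Multiset.map_map, Function.comp_def]
    exact normSq_eq_sum_filter b.state (q.eval b.mem)
  | seq p q ihp ihq =>
    simp only [run, wt_bind, ihq]
    simpa [wt] using ihp b
  | ifLe a c p q ihp ihq =>
    simp only [run]
    split_ifs
    · exact ihp _
    · exact ihq _
  | loop r p ih =>
    simp only [run]
    generalize ⌊b.mem (r.eval b.mem)⌋₊ = k
    have htick : ∀ b : QBranch, b.tick.prob = b.prob := fun _ => rfl
    rw [← htick b]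
    generalize b.tick = b
    induction k generalizing b with
    | zero => simp [wt_singleton]
    | succ k ihk =>
      rw [Function.iterate_succ, Function.comp_apply, multiset_bind_iterate, wt_bind]
      simp only [ihk, Multiset.singleton_bind]
      have := ih b.tick
      rw [wt] at this
      simpa [htick] using this

end QProg

/-! ### Rules for reasoning about programs -/

section Rules

variable {n H : ℕ} (x : Fin H → SpinConfig n)

/-- Started in the branch `b`, the program `P` ends in a single branch, which satisfies `J`. -/
def Det (P : QProg) (b : QBranch) (J : QBranch → Prop) : Prop := ∃ b', P.run x b = {b'} ∧ J b'

/-- Started in the branch `b`, the program `P` ends in branches that satisfy `J`, and the integral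
of `φ` over them is at most `c` times the probability of `b`. -/
def Spec (P : QProg) (b : QBranch) (J : QBranch → Prop) (φ : QBranch → ℝ) (c : ℝ) : Prop :=
  (∀ b' ∈ P.run x b, J b') ∧ wt φ (P.run x b) ≤ c * b.prob

variable {x} {P Q : QProg} {b : QBranch} {J J' : QBranch → Prop} {φ φ' : QBranch → ℝ} {c c' : ℝ}

theorem Det.mono (h : Det x P b J) (hJ : ∀ b', J b' → J' b') : Det x P b J' := by
  obtain ⟨b', h1, h2⟩ := h
  exact ⟨b', h1, hJ b' h2⟩

theorem Det.const {r : Addr} {k : ℕ}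
    (h : J ⟨Function.update b.mem (r.eval b.mem) (k : ℝ), b.state, b.time + 1⟩) :
    Det x (.const r k) b J := ⟨_, rfl, h⟩

theorem Det.arith {o : ArithOp} {r a d : Addr}
    (h : J ⟨Function.update b.mem (r.eval b.mem)
      (o.eval (b.mem (a.eval b.mem)) (b.mem (d.eval b.mem))), b.state, b.time + 1⟩) :
    Det x (.arith o r a d) b J := ⟨_, rfl, h⟩

theorem Det.gate {G : QGate} (h : J ⟨b.mem, G.apply x b.mem b.state, b.time + 1⟩) :
    Det x (.gate G) b J := ⟨_, rfl, h⟩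

theorem Det.seq (h : Det x P b fun b' => Det x Q b' J) : Det x (.seq P Q) b J := by
  obtain ⟨b1, h1, b2, h2, h3⟩ := h
  exact ⟨b2, by rw [QProg.run, h1, Multiset.singleton_bind, h2], h3⟩

theorem Det.ifLe {a d : Addr}
    (h : if b.mem (a.eval b.mem) ≤ b.mem (d.eval b.mem) then Det x P b.tick J
      else Det x Q b.tick J) : Det x (.ifLe a d P Q) b J := by
  unfold Det at *
  rw [QProg.run]
  split_ifs at h ⊢ <;> exact h

theorem Det.loop {r : Addr} (I : ℕ → QBranch → Prop) (N : ℕ)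
    (hN : ⌊b.mem (r.eval b.mem)⌋₊ = N) (h0 : I 0 b.tick)
    (hstep : ∀ i < N, ∀ b', I i b' → Det x P b'.tick (I (i + 1))) :
    Det x (.loop r P) b (I N) := by
  unfold Det
  rw [QProg.run, hN]
  have : ∀ k ≤ N, ∃ b', (fun s : Multiset QBranch => s.bind fun b' => QProg.run x P b'.tick)^[k]
      {b.tick} = {b'} ∧ I k b' := by
    intro k
    induction k with
    | zero => exact fun _ => ⟨_, rfl, h0⟩
    | succ k ih =>
      intro hk
      obtain ⟨b1, h1, h2⟩ := ih (by omega)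
      obtain ⟨b2, h3, h4⟩ := hstep k (by omega) b1 h2
      exact ⟨b2, by rw [Function.iterate_succ_apply', h1, Multiset.singleton_bind, h3], h4⟩
  exact this N le_rfl

theorem Det.measure_single {q r : Addr} {m : Registers} {d : Registers} {z : ℂ} {t : ℕ}
    (hz : z ≠ 0)
    (h : J ⟨Function.update m (r.eval m) (d (q.eval m)), Finsupp.single d z, t + 1⟩) :
    Det x (.measure q r) ⟨m, Finsupp.single d z, t⟩ J := by
  refine ⟨_, ?_, h⟩
  simp only [QProg.run, Finsupp.support_single, hz, ne_eq, not_false_eq_true, Finset.image_singleton,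
    Finset.singleton_val, Multiset.map_singleton]
  rw [Finsupp.filter_single_of_pos (fun c : Registers => c (q.eval m) = d (q.eval m)) (h := rfl)]

theorem Spec.of_det (h : Det x P b fun b' => J b' ∧ φ b' ≤ c) : Spec x P b J φ c := by
  obtain ⟨b', h1, h2, h3⟩ := h
  have hp := QProg.wt_one_run x P b
  rw [h1, wt_singleton, mul_one] at hp
  refine ⟨fun b'' hb => ?_, ?_⟩
  · rw [h1, Multiset.mem_singleton] at hb
    rwa [hb]
  · rw [h1, wt_singleton, hp, mul_comm]
    exact mul_le_mul_of_nonneg_right h3 b.prob_nonneg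

theorem Spec.mono (h : Spec x P b J φ c) (hJ : ∀ b', J b' → J' b' ∧ φ' b' ≤ φ b')
    (hc : c ≤ c') : Spec x P b J' φ' c' :=
  ⟨fun b' hb => (hJ b' (h.1 b' hb)).1,
    (wt_mono fun b' hb => (hJ b' (h.1 b' hb)).2).trans
      (h.2.trans (mul_le_mul_of_nonneg_right hc b.prob_nonneg))⟩

/-- A bound that holds in every branch. -/
theorem Spec.of_forall (h : ∀ b' ∈ P.run x b, J b') (hφ : ∀ b', J b' → φ b' ≤ c) :
    Spec x P b J φ c := by
  refine ⟨h, (wt_mono fun b' hb => hφ b' (h b' hb)).trans (le_of_eq ?_)⟩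
  have := wt_const_mul c (fun _ => 1) (P.run x b)
  simp only [mul_one] at this
  rw [this, QProg.wt_one_run]

/-- A bound up to an additive constant. -/
theorem Spec.affine (h : Spec x P b J φ c) {k d : ℝ} (hk : 0 ≤ k)
    (hφ : ∀ b', J b' → φ' b' ≤ k * φ b' + d) (hc : k * c + d ≤ c') : Spec x P b J φ' c' := by
  refine ⟨h.1, (wt_mono fun b' hb => hφ b' (h.1 b' hb)).trans ?_⟩
  rw [wt_add, wt_const_mul]
  have h1 := wt_const_mul d (fun _ => 1) (P.run x b)
  simp only [mul_one] at h1
  rw [h1, QProg.wt_one_run]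
  have := mul_le_mul_of_nonneg_left h.2 hk
  have h2 := mul_le_mul_of_nonneg_right hc b.prob_nonneg
  linarith

/-- `φ₁` is a pre-expectation: the bound for `Q` as a function of the branch in which `Q` starts is
what has to be integrated after `P`. -/
theorem Spec.seq (φ₁ : QBranch → ℝ) (h : Spec x P b J φ₁ c)
    (h' : ∀ b', J b' → Spec x Q b' J' φ (φ₁ b')) : Spec x (.seq P Q) b J' φ c := by
  constructor
  · intro b' hb
    rw [QProg.run, Multiset.mem_bind] at hb
    obtain ⟨b1, h1, h2⟩ := hb
    exact (h' b1 (h.1 b1 h1)).1 b' h2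
  · rw [QProg.run, wt_bind]
    refine le_trans (Multiset.sum_map_le_sum_map _ _ fun b1 h1 => (h' b1 (h.1 b1 h1)).2) ?_
    simp only [mul_comm (φ₁ _)]
    exact h.2

theorem Spec.seq_det (h : Det x P b fun b' => Spec x Q b' J φ c) :
    Spec x (.seq P Q) b J φ c := by
  obtain ⟨b', h1, h2⟩ := h
  have hp := QProg.wt_one_run x P b
  rw [h1, wt_singleton, mul_one] at hp
  unfold Spec
  rw [QProg.run, h1, Multiset.singleton_bind, ← hp]
  exact h2

theorem Spec.ifLe {a d : Addr}
    (h : if b.mem (a.eval b.mem) ≤ b.mem (d.eval b.mem) then Spec x P b.tick J φ c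
      else Spec x Q b.tick J φ c) : Spec x (.ifLe a d P Q) b J φ c := by
  unfold Spec at *
  rw [QProg.run]
  split_ifs at h ⊢ <;> exact h

/-- `Φ` is a supermartingale along the passes of the loop, with `Φ 0` at most `c` at the start. -/
theorem Spec.loop {r : Addr} (I : ℕ → QBranch → Prop) (Φ : ℕ → QBranch → ℝ) (N : ℕ)
    (hN : ⌊b.mem (r.eval b.mem)⌋₊ = N) (h0 : I 0 b.tick ∧ Φ 0 b.tick ≤ c)
    (hstep : ∀ i < N, ∀ b', I i b' → Spec x P b'.tick (I (i + 1)) (Φ (i + 1)) (Φ i b')) :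
    Spec x (.loop r P) b (I N) (Φ N) c := by
  unfold Spec
  rw [QProg.run, hN]
  have : ∀ k ≤ N, (∀ b' ∈ (fun s : Multiset QBranch => s.bind fun b' =>
      QProg.run x P b'.tick)^[k] {b.tick}, I k b') ∧ wt (Φ k) ((fun s : Multiset QBranch =>
        s.bind fun b' => QProg.run x P b'.tick)^[k] {b.tick}) ≤ c * b.prob := by
    intro k
    induction k with
    | zero =>
      refine fun _ => ⟨by simpa using h0.1, ?_⟩
      rw [Function.iterate_zero, id, wt_singleton, mul_comm]
      exact mul_le_mul_of_nonneg_right h0.2 b.prob_nonneg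
    | succ k ih =>
      intro hk
      obtain ⟨h1, h2⟩ := ih (by omega)
      rw [Function.iterate_succ_apply']
      constructor
      · intro b' hb
        rw [Multiset.mem_bind] at hb
        obtain ⟨b1, h3, h4⟩ := hb
        exact (hstep k (by omega) b1 (h1 b1 h3)).1 b' h4
      · rw [wt_bind]
        refine le_trans (Multiset.sum_map_le_sum_map _ _ fun b1 h3 =>
          (hstep k (by omega) b1 (h1 b1 h3)).2) (le_trans (le_of_eq ?_) h2)
        rw [wt]
        congr 1
        exact Multiset.map_congr rfl fun b1 _ => mul_comm _ _
  exact this N le_rfl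

/-- Measuring a register that distinguishes the members of a superposition. -/
theorem Spec.measure {ι : Type*} {q r : Addr} {m : Registers} {s : Finset ι} {f : ι → Registers}
    {a : ι → ℂ} {t : ℕ} (hf : Set.InjOn (fun v => f v (q.eval m)) s)
    (hJ : ∀ v ∈ s, a v ≠ 0 →
      J ⟨Function.update m (r.eval m) (f v (q.eval m)), Finsupp.single (f v) (a v), t + 1⟩)
    (hφ : ∑ v ∈ s, ‖a v‖ ^ 2 * φ ⟨Function.update m (r.eval m) (f v (q.eval m)),
      Finsupp.single (f v) (a v), t + 1⟩ ≤ c * ∑ v ∈ s, ‖a v‖ ^ 2) :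
    Spec x (.measure q r) ⟨m, family s f a, t⟩ J φ c := by
  classical
  set k := q.eval m with hk
  have hf' : Set.InjOn f s := fun v hv w hw h => hf hv hw (congrFun h k)
  -- Only values in the support of the state are outcomes, so members of amplitude zero yield no
  -- branch.
  set s' := s.filter fun v => a v ≠ 0 with hs'
  have hmem' : ∀ v, v ∈ s' ↔ v ∈ s ∧ a v ≠ 0 := fun v => Finset.mem_filter
  have hsupp : (family s f a).support = s'.image f := by
    ext c
    rw [Finsupp.mem_support_iff, Finset.mem_image]
    constructor
    · intro h
      have := family_support_subset s f a (Finsupp.mem_support_iff.2 h)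
      obtain ⟨v, hv, rfl⟩ := Finset.mem_image.1 this
      rw [family_apply hf' a hv] at h
      exact ⟨v, (hmem' v).2 ⟨hv, h⟩, rfl⟩
    · rintro ⟨v, hv, rfl⟩
      rw [family_apply hf' a ((hmem' v).1 hv).1]
      exact ((hmem' v).1 hv).2
  have hfilter : ∀ v ∈ s, (family s f a).filter (fun c => c k = f v k)
      = Finsupp.single (f v) (a v) := by
    intro v hv
    ext c
    by_cases hc : c k = f v k
    · rw [Finsupp.filter_apply_pos (fun c : Registers => c k = f v k) _ hc]
      by_cases hcv : c = f v
      · rw [hcv, family_apply hf' a hv, Finsupp.single_eq_same]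
      · rw [Finsupp.single_eq_of_ne hcv]
        by_contra hne
        obtain ⟨w, hw, rfl⟩ := Finset.mem_image.1
          (family_support_subset s f a (Finsupp.mem_support_iff.2 hne))
        exact hcv (congrArg f (hf hw hv hc))
    · rw [Finsupp.filter_apply_neg (fun c : Registers => c k = f v k) _ hc,
        Finsupp.single_eq_of_ne]
      rintro rfl
      exact hc rfl
  have hrun : QProg.run x (.measure q r) ⟨m, family s f a, t⟩ = s'.val.map fun v =>
      (⟨Function.update m (r.eval m) (f v k), Finsupp.single (f v) (a v), t + 1⟩ : QBranch) := by
    have himg : (family s f a).support.image (fun c => c k) = s'.image fun v => f v k := by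
      rw [hsupp, Finset.image_image]; rfl
    have hval : (s'.image fun v => f v k).val = s'.val.map fun v => f v k :=
      Finset.image_val_of_injOn fun v hv w hw h =>
        hf ((hmem' v).1 hv).1 ((hmem' w).1 hw).1 h
    simp only [QProg.run, ← hk]
    have e2 : (Finset.image (fun c : Registers => c k) (family s f a).support).val
        = s'.val.map fun v => f v k := by
      rw [← hval, ← himg]
    convert congrArg (Multiset.map fun a_1 => (⟨Function.update m (r.eval m) a_1,
      Finsupp.filter (fun c : Registers => c k = a_1) (family s f a), t + 1⟩ : QBranch)) e2 using 1
    rw [Multiset.map_map]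
    refine Multiset.map_congr rfl fun v hv => ?_
    rw [Function.comp_apply, hfilter v ((hmem' v).1 hv).1]
  constructor
  · intro b' hb
    rw [hrun, Multiset.mem_map] at hb
    obtain ⟨v, hv, rfl⟩ := hb
    exact hJ v ((hmem' v).1 hv).1 ((hmem' v).1 hv).2
  · have hp : ∀ v, QBranch.prob ⟨Function.update m (r.eval m) (f v k),
        Finsupp.single (f v) (a v), t + 1⟩ = ‖a v‖ ^ 2 := fun v => normSq_single _ _
    have hp' : QBranch.prob ⟨m, family s f a, t⟩ = ∑ v ∈ s, ‖a v‖ ^ 2 := normSq_family hf' a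
    rw [hrun, wt, Multiset.map_map, hp']
    refine le_trans (le_of_eq ?_) hφ
    simp only [Function.comp_def, hp]
    refine Finset.sum_subset (Finset.filter_subset _ _) fun v hv hv' => ?_
    have : a v = 0 := by
      by_contra h
      exact hv' ((hmem' v).2 ⟨hv, h⟩)
    simp [this]

end Rules

/-! ### The quantum subroutines

The classical registers below `20` hold constants of the computation, those from `20` to `49` are
scratch registers of the subroutines, and lists and arrays start at `50`. The quantum registers
`0, …, 8` are work registers, the register `9` always holds `0`, and the qubits that hold the binary
digits of a node start at `10`. -/

instance (k : ℕ) : OfNat Addr k := ⟨.direct k⟩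

@[simp] theorem Addr.eval_ofNat (m : Registers) (k : ℕ) :
    Addr.eval m (no_index (OfNat.ofNat k)) = k := rfl

theorem Addr.eval_indirect (m : Registers) (k : ℕ) : Addr.eval m (.indirect k) = ⌊m k⌋₊ := rfl

infixr:60 ";;" => QProg.seq

namespace Algo

open QProg in
/-- Adds (or subtracts) the weighted sum of the values of node `J` over all samples. -/
def accumulate (inv : Bool) : QProg :=
  const 20 0 ;; arith .plus 21 13 10 ;;
  loop 1 (gate (.query false 20 1 3) ;; gate (.load false 4 (.indirect 21)) ;;
    gate (.arith inv .times 5 3 4) ;; gate (.load true 4 (.indirect 21)) ;;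
    gate (.query true 20 1 3) ;; arith .plus 20 20 9 ;; arith .plus 21 21 12)

open QProg in
/-- Adds (or subtracts) the number with the given binary digits. -/
def decode (inv : Bool) : QProg :=
  const 22 1 ;; arith .plus 23 19 10 ;;
  loop 6 (gate (.load false 8 22) ;; gate (.arith inv .times 0 (.indirect 23) 8) ;;
    gate (.load true 8 22) ;; arith .times 22 22 11 ;; arith .plus 23 23 9)

open QProg in
/-- Computes the score of the node encoded by the qubits. The node `u` is skipped. -/
def evaluate : QProg :=
  decode false ;; gate (.load false 2 2) ;; gate (.arith false .plus 1 0 9) ;;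
  gate (.arith false .le 1 2 0) ;; accumulate false

open QProg in
/-- The inverse of `evaluate`. -/
def unevaluate : QProg :=
  accumulate true ;; gate (.arith true .le 1 2 0) ;; gate (.arith true .plus 1 0 9) ;;
  gate (.load true 2 2) ;; decode true

open QProg in
/-- Changes the sign if the flag is set. -/
def negate : QProg :=
  gate (.phase 7) ;; gate (.phase 7) ;; gate (.phase 7) ;; gate (.phase 7)

open QProg in
/-- Changes the sign of the nodes whose score is at most the best score so far. -/
def markBad : QProg :=
  evaluate ;; gate (.load false 6 28) ;; gate (.arith false .le 7 5 6) ;; negate ;;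
  gate (.arith true .le 7 5 6) ;; gate (.load true 6 28) ;; unevaluate

open QProg in
/-- Changes the sign of the basis vector all of whose qubits are `0`. -/
def markZero : QProg :=
  decode false ;; gate (.arith false .le 7 0 9) ;; negate ;; gate (.arith true .le 7 0 9) ;;
  decode true

open QProg in
/-- Hadamard gates on all qubits, in ascending order. -/
def mixUp : QProg :=
  arith .plus 23 19 10 ;; loop 6 (gate (.hadamard (.indirect 23)) ;; arith .plus 23 23 9)

open QProg in
/-- Hadamard gates on all qubits, in descending order. -/
def mixDown : QProg :=
  arith .plus 23 19 6 ;; loop 6 (arith .minus 23 23 9 ;; gate (.hadamard (.indirect 23)))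

/-- One Grover iteration. -/
def grover : QProg := markBad ;; mixUp ;; markZero ;; mixDown

end Algo

/-! ### Memory -/

/-- The parameters of the computation. -/
structure Params where
  /-- the number of visible nodes -/
  n : ℕ
  /-- the number of samples -/
  H : ℕ
  /-- the node -/
  u : ℕ
  /-- the number of qubits -/
  q : ℕ
  /-- the number of levels of the search -/
  levels : ℕ
  /-- the number of repetitions of the search -/
  reps : ℕ
  /-- the number of iterations of the main loop, before rounding -/
  T : ℝ
  /-- the threshold for scores -/
  thr : ℝ

/-- The address of the array of weights. -/
def Params.base (p : Params) : ℕ := 50 + 2 * p.n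

/-- The constant registers. -/
structure Consts (p : Params) (m : Registers) : Prop where
  r1 : m 1 = p.H
  r2 : m 2 = p.u
  r5 : m 5 = p.T
  r6 : m 6 = p.q
  r7 : m 7 = p.levels
  r8 : m 8 = p.reps
  r9 : m 9 = 1
  r10 : m 10 = 0
  r11 : m 11 = 2
  r12 : m 12 = 3
  r13 : m 13 = p.base
  r14 : m 14 = p.thr
  r15 : m 15 = 16
  r16 : m 16 = ((50 + p.n : ℕ) : ℝ)
  r17 : m 17 = 50
  r19 : m 19 = 10

/-- The memories differ at most in the scratch registers below `K`. -/
def Frame (K : ℕ) (m m' : Registers) : Prop := ∀ r, r < 20 ∨ K ≤ r → m' r = m r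

theorem Frame.refl (K : ℕ) (m : Registers) : Frame K m m := fun _ _ => rfl

theorem Frame.trans {K : ℕ} {m m' m'' : Registers} (h : Frame K m m') (h' : Frame K m' m'') :
    Frame K m m'' := fun r hr => (h' r hr).trans (h r hr)

theorem Frame.mono {K K' : ℕ} (hK : K ≤ K') {m m' : Registers} (h : Frame K m m') :
    Frame K' m m' := fun r hr => h r (by omega)

theorem Frame.update {K : ℕ} {m m' : Registers} (h : Frame K m m') {r : ℕ} (hr : 20 ≤ r ∧ r < K)
    (a : ℝ) : Frame K m (Function.update m' r a) := fun i hi => by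
  rw [Function.update_of_ne (by omega), h i hi]

theorem Consts.frame {p : Params} {K : ℕ} {m m' : Registers} (hc : Consts p m)
    (h : Frame K m m') : Consts p m' := by
  constructor <;> rw [h _ (Or.inl (by norm_num))]
  exacts [hc.r1, hc.r2, hc.r5, hc.r6, hc.r7, hc.r8, hc.r9, hc.r10, hc.r11, hc.r12, hc.r13, hc.r14,
    hc.r15, hc.r16, hc.r17, hc.r19]

/-- The array of weights. -/
def HasWeights (p : Params) (W : ℕ → ℝ) (m : Registers) : Prop :=
  ∀ l < p.H, m (p.base + 3 * l) = W l

theorem HasWeights.frame {p : Params} {W : ℕ → ℝ} {K : ℕ} (hK : K ≤ 50) {m m' : Registers}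
    (hW : HasWeights p W m) (h : Frame K m m') : HasWeights p W m' := fun l hl => by
  rw [h _ (Or.inr (by unfold Params.base; omega)), hW l hl]

/-! ### Configurations of the quantum memory -/

/-- The contents of the quantum memory in terms of the number in the qubits and of the work
registers. -/
def qcfg (v : ℕ) (V J U s w acc y flag pow : ℝ) : Registers
  | 0 => V | 1 => J | 2 => U | 3 => s | 4 => w | 5 => acc | 6 => y | 7 => flag | 8 => pow | 9 => 0
  | r + 10 => if v.testBit r then 1 else 0

section qcfg

variable (v : ℕ) (V J U s w acc y flag pow d : ℝ) (inv : Bool)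

@[simp] theorem qcfg_0 : qcfg v V J U s w acc y flag pow 0 = V := rfl
@[simp] theorem qcfg_1 : qcfg v V J U s w acc y flag pow 1 = J := rfl
@[simp] theorem qcfg_2 : qcfg v V J U s w acc y flag pow 2 = U := rfl
@[simp] theorem qcfg_3 : qcfg v V J U s w acc y flag pow 3 = s := rfl
@[simp] theorem qcfg_4 : qcfg v V J U s w acc y flag pow 4 = w := rfl
@[simp] theorem qcfg_5 : qcfg v V J U s w acc y flag pow 5 = acc := rfl
@[simp] theorem qcfg_6 : qcfg v V J U s w acc y flag pow 6 = y := rfl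
@[simp] theorem qcfg_7 : qcfg v V J U s w acc y flag pow 7 = flag := rfl
@[simp] theorem qcfg_8 : qcfg v V J U s w acc y flag pow 8 = pow := rfl
@[simp] theorem qcfg_9 : qcfg v V J U s w acc y flag pow 9 = 0 := rfl

theorem qcfg_bit (r : ℕ) : qcfg v V J U s w acc y flag pow (10 + r)
    = if v.testBit r then 1 else 0 := by rw [add_comm]; rfl

@[simp] theorem shift_0 : shiftReg inv (qcfg v V J U s w acc y flag pow) 0 d
    = qcfg v (if inv then V - d else V + d) J U s w acc y flag pow := by
  funext r; rcases r with _ | _ | _ | _ | _ | _ | _ | _ | _ | _ | r <;> simp [shiftReg, qcfg]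
@[simp] theorem shift_1 : shiftReg inv (qcfg v V J U s w acc y flag pow) 1 d
    = qcfg v V (if inv then J - d else J + d) U s w acc y flag pow := by
  funext r; rcases r with _ | _ | _ | _ | _ | _ | _ | _ | _ | _ | r <;> simp [shiftReg, qcfg]
@[simp] theorem shift_2 : shiftReg inv (qcfg v V J U s w acc y flag pow) 2 d
    = qcfg v V J (if inv then U - d else U + d) s w acc y flag pow := by
  funext r; rcases r with _ | _ | _ | _ | _ | _ | _ | _ | _ | _ | r <;> simp [shiftReg, qcfg]
@[simp] theorem shift_3 : shiftReg inv (qcfg v V J U s w acc y flag pow) 3 d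
    = qcfg v V J U (if inv then s - d else s + d) w acc y flag pow := by
  funext r; rcases r with _ | _ | _ | _ | _ | _ | _ | _ | _ | _ | r <;> simp [shiftReg, qcfg]
@[simp] theorem shift_4 : shiftReg inv (qcfg v V J U s w acc y flag pow) 4 d
    = qcfg v V J U s (if inv then w - d else w + d) acc y flag pow := by
  funext r; rcases r with _ | _ | _ | _ | _ | _ | _ | _ | _ | _ | r <;> simp [shiftReg, qcfg]
@[simp] theorem shift_5 : shiftReg inv (qcfg v V J U s w acc y flag pow) 5 d
    = qcfg v V J U s w (if inv then acc - d else acc + d) y flag pow := by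
  funext r; rcases r with _ | _ | _ | _ | _ | _ | _ | _ | _ | _ | r <;> simp [shiftReg, qcfg]
@[simp] theorem shift_6 : shiftReg inv (qcfg v V J U s w acc y flag pow) 6 d
    = qcfg v V J U s w acc (if inv then y - d else y + d) flag pow := by
  funext r; rcases r with _ | _ | _ | _ | _ | _ | _ | _ | _ | _ | r <;> simp [shiftReg, qcfg]
@[simp] theorem shift_7 : shiftReg inv (qcfg v V J U s w acc y flag pow) 7 d
    = qcfg v V J U s w acc y (if inv then flag - d else flag + d) pow := by
  funext r; rcases r with _ | _ | _ | _ | _ | _ | _ | _ | _ | _ | r <;> simp [shiftReg, qcfg]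
@[simp] theorem shift_8 : shiftReg inv (qcfg v V J U s w acc y flag pow) 8 d
    = qcfg v V J U s w acc y flag (if inv then pow - d else pow + d) := by
  funext r; rcases r with _ | _ | _ | _ | _ | _ | _ | _ | _ | _ | r <;> simp [shiftReg, qcfg]

end qcfg

/-- The basis vector that encodes `v`, with cleared work registers. -/
def enc (v : ℕ) : Registers := qcfg v 0 0 0 0 0 0 0 0 0

/-! ### Rules for gates on superpositions -/

section

variable {n H : ℕ} {x : Fin H → SpinConfig n} {ι : Type*} {s : Finset ι} {f g : ι → Registers}
  {a : ι → ℂ} {m : Registers} {t : ℕ} {J : QBranch → Prop}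

/-- The gates that permute the basis vectors. -/
def QGate.IsClassical : QGate → Prop
  | hadamard _ => False
  | phase _ => False
  | _ => True

theorem Det.gate_family {G : QGate} (hG : G.IsClassical)
    (h : J ⟨m, family s (fun v => G.move x m (f v)) a, t + 1⟩) :
    Det x (.gate G) ⟨m, family s f a, t⟩ J := by
  refine Det.gate ?_
  have hm : G.IsMonomial := by cases G <;> trivial
  have hf : ∀ c, G.factor m c = 1 := by
    intro c
    cases G <;> first | rfl | exact hG.elim
  simp only [QGate.apply_family x m hm, hf, mul_one]
  exact h

theorem Det.of_family_congr {P : QProg} (hfg : ∀ v ∈ s, f v = g v)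
    (h : Det x P ⟨m, family s g a, t⟩ J) : Det x P ⟨m, family s f a, t⟩ J := by
  rwa [family_congr hfg]

/-- The set of branches with state `ψ` and time `t` whose memory differs from `m` at most in the
scratch registers below `K`. -/
def Ends (K : ℕ) (m : Registers) (ψ : QState) (t : ℕ) (b : QBranch) : Prop :=
  ∃ m', Frame K m m' ∧ b = ⟨m', ψ, t⟩

/-- The weighted sum of the values of node `j`. -/
def score (x : Fin H → SpinConfig n) (W : ℕ → ℝ) (j : ℝ) : ℝ :=
  ∑ l ∈ Finset.range H, W l * sampleValue x (l : ℝ) j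

theorem QBranch.ext' {m m' : Registers} {ψ ψ' : QState} {t t' : ℕ} (h : m = m') (h' : ψ = ψ')
    (h'' : t = t') : (⟨m, ψ, t⟩ : QBranch) = ⟨m', ψ', t'⟩ := by rw [h, h', h'']

variable {p : Params} {W : ℕ → ℝ}

/-- In each pass the weight and the sample value are added to cleared registers, multiplied into the
accumulator, and removed again, so only the sum remains. With `inv` set the same sum is subtracted,
which undoes the computation. A pass takes seven instructions and one step of the loop. -/
theorem det_accumulate (hp : p.H = H) (hc : Consts p m) (hW : HasWeights p W m) (inv : Bool)
    (bits : ι → ℕ) (V J U A : ι → ℝ) :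
    Det x (Algo.accumulate inv) ⟨m, family s (fun v =>
      qcfg (bits v) (V v) (J v) (U v) 0 0 (A v) 0 0 0) a, t⟩
      (Ends 24 m (family s (fun v => qcfg (bits v) (V v) (J v) (U v) 0 0
        (if inv then A v - score x W (J v) else A v + score x W (J v)) 0 0 0) a)
        (t + (8 * H + 3))) := by
  unfold Algo.accumulate
  -- The empty sum is written out to match the loop invariant at `i = 0`.
  refine Det.of_family_congr (g := fun v => qcfg (bits v) (V v) (J v) (U v) 0 0
    (if inv then A v - ∑ l ∈ Finset.range 0, W l * sampleValue x (l : ℝ) (J v) else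
        A v + ∑ l ∈ Finset.range 0, W l * sampleValue x (l : ℝ) (J v)) 0 0 0)
    (fun v _ => by simp) ?_
  refine Det.seq (Det.const (Det.seq (Det.arith ?_)))
  simp only [Addr.eval_ofNat]
  refine (Det.loop (fun i b => ∃ m', Frame 24 m m' ∧ m' 20 = i ∧
    m' 21 = ((p.base + 3 * i : ℕ) : ℝ) ∧ b = ⟨m', family s (fun v => qcfg (bits v) (V v) (J v) (U v)
      0 0 (if inv then A v - ∑ l ∈ Finset.range i, W l * sampleValue x (l : ℝ) (J v) else
        A v + ∑ l ∈ Finset.range i, W l * sampleValue x (l : ℝ) (J v)) 0 0 0) a,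
        t + 3 + 8 * i⟩) H ?_ ?_ ?_).mono ?_
  · simp [hc.r1, hp]
  · refine ⟨_, (((Frame.refl 24 m).update (r := 20) (by norm_num) _).update (r := 21)
      (by norm_num) _), ?_, ?_, rfl⟩
    · simp
    · simp [hc.r13, hc.r10, ArithOp.eval]
  · rintro i hi _ ⟨m', hm, h20, h21, rfl⟩
    have hc' := hc.frame hm
    have hW' : m' (p.base + 3 * i) = W i := hW.frame (by norm_num) hm i (hp ▸ hi)
    refine Det.seq (Det.gate_family trivial (Det.seq (Det.gate_family trivial (Det.seq
      (Det.gate_family trivial (Det.seq (Det.gate_family trivial ?_)))))))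
    refine Det.seq (Det.gate_family trivial (Det.seq (Det.arith (Det.arith ?_))))
    refine ⟨_, (?_ : Frame 24 m _), ?_, ?_,
      QBranch.ext' rfl (family_congr (fun v _ => ?_) a) (by ring)⟩
    · exact (hm.update (r := 20) (by norm_num) _).update (r := 21) (by norm_num) _
    · simp [h20, hc'.r9, ArithOp.eval]
    · simp [h21, hc'.r12, ArithOp.eval]
      ring
    · simp only [QGate.move, Addr.eval_ofNat, Addr.eval_indirect, h20, h21, Nat.floor_natCast, hW',
        qcfg_1, shift_3, ArithOp.eval, Finset.sum_range_succ]
      cases inv <;> norm_num <;> ring_nf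
  · rintro _ ⟨m', hm, -, -, rfl⟩
    exact ⟨m', hm, by rw [QBranch.mk.injEq]; exact ⟨rfl, rfl, by ring⟩⟩

/-- After `i` passes, register `0` has changed by `bits v % 2 ^ i`. The current power of two is kept
in a classical register and is loaded only for the multiplication by the qubit. -/
theorem det_decode (hc : Consts p m) (inv : Bool) (bits : ι → ℕ) (V : ι → ℝ) :
    Det x (Algo.decode inv) ⟨m, family s (fun v => qcfg (bits v) (V v) 0 0 0 0 0 0 0 0) a, t⟩
      (Ends 24 m (family s (fun v => qcfg (bits v) (if inv then V v - (bits v % 2 ^ p.q : ℕ)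
        else V v + (bits v % 2 ^ p.q : ℕ)) 0 0 0 0 0 0 0 0) a) (t + (6 * p.q + 3))) := by
  unfold Algo.decode
  refine Det.of_family_congr (g := fun v => qcfg (bits v) (if inv then V v - (bits v % 2 ^ 0 : ℕ)
    else V v + (bits v % 2 ^ 0 : ℕ)) 0 0 0 0 0 0 0 0) (fun v _ => by simp [Nat.mod_one]) ?_
  refine Det.seq (Det.const (Det.seq (Det.arith ?_)))
  simp only [Addr.eval_ofNat]
  refine (Det.loop (fun i b => ∃ m', Frame 24 m m' ∧ m' 22 = 2 ^ i ∧
    m' 23 = ((10 + i : ℕ) : ℝ) ∧ b = ⟨m', family s (fun v => qcfg (bits v)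
      (if inv then V v - (bits v % 2 ^ i : ℕ) else V v + (bits v % 2 ^ i : ℕ)) 0 0 0 0 0 0 0 0) a,
        t + 3 + 6 * i⟩) p.q ?_ ?_ ?_).mono ?_
  · simp [hc.r6]
  · refine ⟨_, (((Frame.refl 24 m).update (r := 22) (by norm_num) _).update (r := 23)
      (by norm_num) _), ?_, ?_, rfl⟩
    · simp
    · simp [hc.r19, hc.r10, ArithOp.eval]
  · rintro i hi _ ⟨m', hm, h22, h23, rfl⟩
    have hc' := hc.frame hm
    refine Det.seq (Det.gate_family trivial (Det.seq (Det.gate_family trivial (Det.seq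
      (Det.gate_family trivial (Det.seq (Det.arith (Det.arith ?_))))))))
    refine ⟨_, (?_ : Frame 24 m _), ?_, ?_,
      QBranch.ext' rfl (family_congr (fun v _ => ?_) a) (by ring)⟩
    · exact (hm.update (r := 22) (by norm_num) _).update (r := 23) (by norm_num) _
    · simp [h22, hc'.r11, ArithOp.eval, pow_succ]
    · simp [h23, hc'.r9, ArithOp.eval]
      ring
    · have h0 : (0 : ℕ) ≠ 10 + i := by omega
      have h0' : (8 : ℕ) ≠ 10 + i := by omega
      have hmod : ((bits v % 2 ^ (i + 1) : ℕ) : ℝ) = (bits v % 2 ^ i : ℕ)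
          + (if (bits v).testBit i then 1 else 0) * 2 ^ i := by
        rw [Nat.mod_pow_succ, ← Nat.toNat_testBit]
        cases (bits v).testBit i <;> simp
      simp only [QGate.move, Addr.eval_ofNat, Addr.eval_indirect, h22, h23, Nat.floor_natCast,
        shift_8, qcfg_8, qcfg_bit, ArithOp.eval, h0, shift_0, hmod]
      cases inv <;> norm_num <;> ring_nf
  · rintro _ ⟨m', hm, -, -, rfl⟩
    exact ⟨m', hm, by rw [QBranch.mk.injEq]; exact ⟨rfl, rfl, by ring⟩⟩

/-- The node with number `v` among the nodes other than `u`. -/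
def skip (u v : ℕ) : ℕ := if u ≤ v then v + 1 else v

theorem det_evaluate (hp : p.H = H) (hc : Consts p m) (hW : HasWeights p W m) (bits : ι → ℕ)
    (hb : ∀ v ∈ s, bits v < 2 ^ p.q) :
    Det x Algo.evaluate ⟨m, family s (fun v => enc (bits v)) a, t⟩
      (Ends 24 m (family s (fun v => qcfg (bits v) (bits v) (skip p.u (bits v)) p.u 0 0
        (score x W (skip p.u (bits v))) 0 0 0) a) (t + (8 * H + 6 * p.q + 9))) := by
  unfold Algo.evaluate
  refine Det.seq ((det_decode hc false bits (fun _ => 0)).mono ?_)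
  rintro _ ⟨m', hm, rfl⟩
  have hc' := hc.frame hm
  refine Det.seq (Det.gate_family trivial (Det.seq (Det.gate_family trivial (Det.seq
      (Det.gate_family trivial ?_)))))
  refine Det.of_family_congr (g := fun v => qcfg (bits v) (bits v) (skip p.u (bits v)) p.u 0 0
    0 0 0 0) (fun v hv => ?_) ((det_accumulate hp hc' (hW.frame (by norm_num) hm) false bits _ _ _
      _).mono ?_)
  · simp only [QGate.move, Addr.eval_ofNat, hc'.r2, shift_2, shift_1, qcfg_0, qcfg_9,
      ArithOp.eval, Nat.mod_eq_of_lt (hb v hv), skip]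
    by_cases h : p.u ≤ bits v <;> simp [h]
  · rintro _ ⟨m'', hm', rfl⟩
    refine ⟨m'', hm.trans hm', ?_⟩
    rw [QBranch.mk.injEq]
    exact ⟨rfl, by simp, by ring⟩

theorem det_unevaluate (hp : p.H = H) (hc : Consts p m) (hW : HasWeights p W m) (bits : ι → ℕ)
    (hb : ∀ v ∈ s, bits v < 2 ^ p.q) :
    Det x Algo.unevaluate ⟨m, family s (fun v => qcfg (bits v) (bits v) (skip p.u (bits v)) p.u 0 0
        (score x W (skip p.u (bits v))) 0 0 0) a, t⟩
      (Ends 24 m (family s (fun v => enc (bits v)) a) (t + (8 * H + 6 * p.q + 9))) := by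
  unfold Algo.unevaluate
  refine Det.seq ((det_accumulate hp hc hW true bits _ _ _ _).mono ?_)
  rintro _ ⟨m', hm, rfl⟩
  have hc' := hc.frame hm
  refine Det.seq (Det.gate_family trivial (Det.seq (Det.gate_family trivial (Det.seq
      (Det.gate_family trivial ?_)))))
  refine Det.of_family_congr (g := fun v => qcfg (bits v) (bits v) 0 0 0 0 0 0 0 0)
    (fun v hv => ?_) ((det_decode hc' true bits _).mono ?_)
  · simp only [QGate.move, Addr.eval_ofNat, hc'.r2, shift_1, qcfg_0, qcfg_2,
      ArithOp.eval, skip]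
    by_cases h : p.u ≤ bits v <;> simp [h]
  · rintro _ ⟨m'', hm', rfl⟩
    refine ⟨m'', hm.trans hm', ?_⟩
    rw [QBranch.mk.injEq]
    refine ⟨rfl, family_congr (fun v hv => ?_) a, by ring⟩
    simp [Nat.mod_eq_of_lt (hb v hv), enc]

/-- Each of the four phase gates contributes a phase of `π / 4`; together they make the sign that
`negate` needs. -/
theorem exp_quarter_pow : Complex.exp (Real.pi / 4 * Complex.I) * (Complex.exp (Real.pi / 4 *
    Complex.I) * (Complex.exp (Real.pi / 4 * Complex.I) * Complex.exp (Real.pi / 4 * Complex.I)))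
    = -1 := by
  rw [← Complex.exp_add, ← Complex.exp_add, ← Complex.exp_add, ← Complex.exp_pi_mul_I]
  congr 1
  ring

theorem det_negate : Det x Algo.negate ⟨m, family s f a, t⟩ fun b => b = ⟨m, family s f
      (fun v => a v * if f v 7 = 1 then -1 else 1), t + 4⟩ := by
  unfold Algo.negate
  refine Det.seq (Det.gate (Det.seq (Det.gate (Det.seq (Det.gate (Det.gate ?_))))))
  simp only [QGate.apply_family x m (G := .phase 7) trivial, QGate.move]
  rw [QBranch.mk.injEq]
  refine ⟨rfl, ?_, rfl⟩
  congr 1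
  funext v
  simp only [QGate.factor]
  by_cases h : f v 7 = 1
  · have h' : f v (Addr.eval m 7) = 1 := h
    simp only [if_pos h, if_pos h']
    rw [mul_assoc, mul_assoc, mul_assoc, exp_quarter_pow]
  · have h' : ¬ f v (Addr.eval m 7) = 1 := h
    simp only [if_neg h, if_neg h', mul_one]

/-- Compute, flip the sign, and uncompute: the work registers return to zero, and the sign of the
amplitude is the only trace of the comparison with the best score in register `28`. -/
theorem det_markBad (hp : p.H = H) (hc : Consts p m) (hW : HasWeights p W m) (bits : ι → ℕ)
    (hb : ∀ v ∈ s, bits v < 2 ^ p.q) :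
    Det x Algo.markBad ⟨m, family s (fun v => enc (bits v)) a, t⟩
      (Ends 24 m (family s (fun v => enc (bits v)) fun v =>
        a v * if score x W (skip p.u (bits v)) ≤ m 28 then -1 else 1)
        (t + (16 * H + 12 * p.q + 26))) := by
  unfold Algo.markBad
  refine Det.seq ((det_evaluate hp hc hW bits hb).mono ?_)
  rintro _ ⟨m', hm, rfl⟩
  have h28 : m' 28 = m 28 := hm 28 (by norm_num)
  refine Det.seq (Det.gate_family trivial (Det.seq (Det.gate_family trivial (Det.seq ?_))))
  refine det_negate.mono ?_
  rintro _ rfl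
  refine Det.seq (Det.gate_family trivial (Det.seq (Det.gate_family trivial ?_)))
  refine Det.of_family_congr (g := fun v => qcfg (bits v) (bits v) (skip p.u (bits v)) p.u 0 0
        (score x W (skip p.u (bits v))) 0 0 0) (fun v hv => ?_)
    ((det_unevaluate hp (hc.frame hm) (hW.frame (by norm_num) hm) bits hb).mono ?_)
  · simp only [QGate.move, Addr.eval_ofNat, shift_6, shift_7, qcfg_5, qcfg_6, ArithOp.eval]
    simp
  · rintro _ ⟨m'', hm', rfl⟩
    refine ⟨m'', hm.trans hm', ?_⟩
    rw [QBranch.mk.injEq]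
    refine ⟨rfl, ?_, by ring⟩
    congr 1
    funext v
    simp only [QGate.move, Addr.eval_ofNat, shift_6, shift_7, qcfg_5, qcfg_6, ArithOp.eval,
      h28]
    by_cases h : score x W (skip p.u (bits v)) ≤ m 28 <;> simp [h]

theorem det_markZero (hc : Consts p m) (bits : ι → ℕ) (hb : ∀ v ∈ s, bits v < 2 ^ p.q) :
    Det x Algo.markZero ⟨m, family s (fun v => enc (bits v)) a, t⟩
      (Ends 24 m (family s (fun v => enc (bits v)) fun v => a v * if bits v % 2 ^ p.q = 0 then -1 else 1)
        (t + (12 * p.q + 12))) := by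
  unfold Algo.markZero
  refine Det.seq ((det_decode hc false bits (fun _ => 0)).mono ?_)
  rintro _ ⟨m', hm, rfl⟩
  refine Det.seq (Det.gate_family trivial (Det.seq (det_negate.mono ?_)))
  rintro _ rfl
  refine Det.seq (Det.gate_family trivial ?_)
  refine Det.of_family_congr (g := fun v => qcfg (bits v) (bits v) 0 0 0 0 0 0 0 0)
    (fun v hv => ?_) ((det_decode (hc.frame hm) true bits _).mono ?_)
  · simp only [QGate.move, Addr.eval_ofNat, shift_7, qcfg_0, qcfg_9, ArithOp.eval,
      Nat.mod_eq_of_lt (hb v hv)]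
    simp
  · rintro _ ⟨m'', hm', rfl⟩
    refine ⟨m'', hm.trans hm', ?_⟩
    rw [QBranch.mk.injEq]
    refine ⟨rfl, ?_, by ring⟩
    rw [family_congr (g := fun v => enc (bits v))
      (fun v hv => by simp [Nat.mod_eq_of_lt (hb v hv), enc])]
    congr 1
    funext v
    simp only [QGate.move, Addr.eval_ofNat, shift_7, qcfg_0, qcfg_9, ArithOp.eval]
    by_cases h : bits v % 2 ^ p.q = 0
    · simp [h]
    · have : ¬ ((bits v % 2 ^ p.q : ℕ) : ℝ) ≤ 0 := by
        rw [not_le]; exact_mod_cast Nat.pos_of_ne_zero h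
      simp [h, this]

end

/-! ### Hadamard gates on the qubits -/

theorem enc_bit (v r : ℕ) : enc v (10 + r) = if v.testBit r then 1 else 0 := qcfg_bit ..

theorem enc_injective : Function.Injective enc := by
  intro v w h
  refine Nat.eq_of_testBit_eq fun i => ?_
  have := congrFun h (10 + i)
  rw [enc_bit, enc_bit] at this
  by_cases h1 : v.testBit i <;> by_cases h2 : w.testBit i <;> simp_all

theorem enc_update (v i : ℕ) : Function.update (enc v) (10 + i) (if v.testBit i then 0 else 1)
    = enc (v ^^^ 2 ^ i) := by
  funext r
  by_cases hr : r = 10 + i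
  · subst hr
    rw [Function.update_self, enc_bit, Nat.testBit_xor, Nat.testBit_two_pow_self]
    cases v.testBit i <;> simp
  · rw [Function.update_of_ne hr]
    by_cases hr' : r < 10
    · unfold enc
      interval_cases r <;> rfl
    · obtain ⟨j, rfl⟩ := Nat.exists_eq_add_of_le (not_lt.1 hr')
      rw [enc_bit, enc_bit, Nat.testBit_xor, Nat.testBit_two_pow_of_ne (by omega), Bool.xor_false]

theorem xor_two_pow_of_testBit_false {v i : ℕ} (h : v.testBit i = false) :
    v ^^^ 2 ^ i = v + 2 ^ i := by
  refine Nat.eq_of_testBit_eq fun j => ?_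
  rw [Nat.testBit_xor]
  have h2 : v / 2 ^ i % 2 = 0 := by
    have := Nat.toNat_testBit v i
    rw [h] at this
    exact this.symm
  rcases lt_trichotomy j i with hj | rfl | hj
  · rw [Nat.testBit_two_pow_of_ne (by omega), Bool.xor_false, add_comm,
      Nat.testBit_two_pow_add_gt hj]
  · rw [Nat.testBit_two_pow_self, add_comm, Nat.testBit_two_pow_add_eq, h]
    rfl
  · rw [Nat.testBit_two_pow_of_ne (by omega), Bool.xor_false]
    obtain ⟨d, rfl⟩ : ∃ d, j = i + 1 + d := ⟨j - (i + 1), by omega⟩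
    have e : ∀ w : ℕ, w.testBit (i + 1 + d) = (w / 2 ^ (i + 1)).testBit d := fun w => by
      rw [Nat.testBit_div_two_pow, add_comm]
    rw [e, e]
    congr 1
    rw [pow_succ, ← Nat.div_div_eq_div_mul, ← Nat.div_div_eq_div_mul,
      Nat.add_div_right _ (by positivity)]
    omega

/-- The Hadamard gate on the register `r`. -/
def hadamardOn (r : ℕ) (ψ : QState) : QState :=
  (QGate.hadamard (.direct r)).apply (n := 0) (H := 0) (fun _ => 1) 0 ψ

/-- A Hadamard gate ignores the samples and uses the classical memory only for its address, so both
can be replaced by dummies. -/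
theorem hadamard_apply_eq {n H : ℕ} (x : Fin H → SpinConfig n) (m : Registers) (q : Addr)
    (ψ : QState) : (QGate.hadamard q).apply x m ψ = hadamardOn (q.eval m) ψ := rfl

theorem hadamardOn_add (r : ℕ) (ψ φ : QState) :
    hadamardOn r (ψ + φ) = hadamardOn r ψ + hadamardOn r φ := QGate.apply_add ..

theorem hadamardOn_smul (r : ℕ) (z : ℂ) (ψ : QState) :
    hadamardOn r (z • ψ) = z • hadamardOn r ψ := QGate.apply_smul ..

theorem sqrt_two_inv_mul_self : (Real.sqrt 2 : ℂ)⁻¹ * (Real.sqrt 2 : ℂ)⁻¹ = 1 / 2 := by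
  rw [← mul_inv, ← Complex.ofReal_mul, Real.mul_self_sqrt (by norm_num)]
  norm_num

theorem hadamardOn_apply (r : ℕ) (ψ : QState) (d : Registers) : hadamardOn r ψ d =
    if d r = 0 then (Real.sqrt 2 : ℂ)⁻¹ * (ψ d + ψ (Function.update d r 1))
      else if d r = 1 then (Real.sqrt 2 : ℂ)⁻¹ * (ψ (Function.update d r 0) - ψ d)
      else ψ d := QGate.hadamard_apply_apply ..

theorem hadamardOn_hadamardOn (r : ℕ) (ψ : QState) : hadamardOn r (hadamardOn r ψ) = ψ := by
  have h2 := sqrt_two_inv_mul_self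
  ext d
  rw [hadamardOn_apply]
  by_cases h0 : d r = 0
  · have e : Function.update d r 0 = d := by rw [← h0, Function.update_eq_self]
    simp only [hadamardOn_apply, h0, if_true, Function.update_self, one_ne_zero, if_false,
      Function.update_idem, e]
    linear_combination (2 * ψ d) * h2
  · by_cases h1 : d r = 1
    · have e : Function.update d r 1 = d := by rw [← h1, Function.update_eq_self]
      simp only [hadamardOn_apply, h1, if_true, Function.update_self, one_ne_zero, if_false,
        Function.update_idem, e]
      linear_combination (2 * ψ d) * h2
    · simp [hadamardOn_apply, h0, h1]

/-- The effect on coefficients of a Hadamard gate on the `i`-th qubit. -/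
def hadamardCoeff (i : ℕ) (a : ℕ → ℂ) (v : ℕ) : ℂ :=
  (Real.sqrt 2 : ℂ)⁻¹ *
    (if v.testBit i then a (v ^^^ 2 ^ i) - a v else a v + a (v ^^^ 2 ^ i))

theorem family_apply_of_notMem {ι : Type*} {s : Finset ι} {f : ι → Registers} (a : ι → ℂ)
    {d : Registers} (hd : ∀ v ∈ s, f v ≠ d) : family s f a d = 0 := by
  rw [family, Finsupp.finsetSum_apply]
  exact Finset.sum_eq_zero fun v hv => Finsupp.single_eq_of_ne (hd v hv).symm

theorem hadamardOn_family {q i : ℕ} (hi : i < q) (a : ℕ → ℂ) :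
    hadamardOn (10 + i) (family (Finset.range (2 ^ q)) enc a)
      = family (Finset.range (2 ^ q)) enc (hadamardCoeff i a) := by
  have hlt : ∀ v, v ∈ Finset.range (2 ^ q) → v ^^^ 2 ^ i ∈ Finset.range (2 ^ q) := fun v hv =>
    Finset.mem_range.2 (Nat.xor_lt_two_pow (Finset.mem_range.1 hv)
      (Nat.pow_lt_pow_right (by norm_num) hi))
  have hinj : ∀ s : Finset ℕ, Set.InjOn enc (s : Set ℕ) := fun _ => enc_injective.injOn
  ext d
  rw [hadamardOn_apply]
  by_cases hd : ∃ v ∈ Finset.range (2 ^ q), enc v = d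
  · obtain ⟨v, hv, rfl⟩ := hd
    have hu := enc_update v i
    rw [family_apply (hinj _) _ hv, family_apply (hinj _) _ hv, enc_bit, hadamardCoeff]
    by_cases hb : v.testBit i
    · rw [if_pos hb] at hu ⊢
      rw [if_neg one_ne_zero, if_pos rfl, hu, family_apply (hinj _) _ (hlt v hv), if_pos hb]
    · rw [if_neg hb] at hu ⊢
      rw [if_pos rfl, hu, family_apply (hinj _) _ (hlt v hv), if_neg hb]
  · push Not at hd
    have h0 := family_apply_of_notMem (f := enc) a hd
    rw [family_apply_of_notMem (f := enc) (hadamardCoeff i a) hd, h0]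
    -- If `d` is not a code, neither is its neighbor with the other value of the qubit, because
    -- flipping a bit maps codes below `2 ^ q` to such codes.
    have key : ∀ b : ℝ, (d (10 + i) = 1 - b) → (b = 0 ∨ b = 1) →
        ∀ w ∈ Finset.range (2 ^ q), enc w ≠ Function.update d (10 + i) b := by
      intro b hb hb' w hw h
      refine hd _ (hlt w hw) ?_
      rw [← enc_update, h, Function.update_idem]
      have : (if w.testBit i then (0 : ℝ) else 1) = d (10 + i) := by
        have h1 := congrFun h (10 + i)
        rw [Function.update_self, enc_bit] at h1
        rw [hb, ← h1]
        split_ifs <;> norm_num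
      rw [this, Function.update_eq_self]
    split_ifs with h1 h2
    · rw [family_apply_of_notMem _ (key 1 (by rw [h1]; norm_num) (Or.inr rfl))]
      simp
    · rw [family_apply_of_notMem _ (key 0 (by rw [h2]; norm_num) (Or.inl rfl))]
      simp
    · rfl

/-- Hadamard gates on the first `i` qubits, in ascending order. -/
def mixUpState : ℕ → QState → QState
  | 0, ψ => ψ
  | i + 1, ψ => hadamardOn (10 + i) (mixUpState i ψ)

/-- Hadamard gates on the first `i` qubits, in descending order. -/
def mixDownState : ℕ → QState → QState
  | 0, ψ => ψ
  | i + 1, ψ => mixDownState i (hadamardOn (10 + i) ψ)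

theorem mixDownState_add (i : ℕ) (ψ φ : QState) :
    mixDownState i (ψ + φ) = mixDownState i ψ + mixDownState i φ := by
  induction i generalizing ψ φ with
  | zero => rfl
  | succ i ih => simp only [mixDownState, hadamardOn_add, ih]

theorem mixDownState_smul (i : ℕ) (z : ℂ) (ψ : QState) :
    mixDownState i (z • ψ) = z • mixDownState i ψ := by
  induction i generalizing ψ with
  | zero => rfl
  | succ i ih => simp only [mixDownState, hadamardOn_smul, ih]

theorem mixDownState_mixUpState (i : ℕ) (ψ : QState) : mixDownState i (mixUpState i ψ) = ψ := by
  induction i with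
  | zero => rfl
  | succ i ih => rw [mixDownState, mixUpState, hadamardOn_hadamardOn, ih]

theorem testBit_two_pow_mul_even (i k : ℕ) : (2 ^ (i + 1) * k).testBit i = false := by
  rw [Nat.testBit_two_pow_mul]; simp

theorem sum_range_two_pow_succ {M : Type*} [AddCommMonoid M] (i : ℕ) (f : ℕ → M) :
    ∑ w ∈ Finset.range (2 ^ (i + 1)), f w
      = ∑ w ∈ Finset.range (2 ^ i), f w + ∑ w ∈ Finset.range (2 ^ i), f (2 ^ i + w) := by
  rw [pow_succ, mul_two, Finset.sum_range_add]

/-- Only the amplitudes at multiples of `2 ^ i` are tracked. For `i = q` this includes the amplitude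
at `0`, the only one that the diffusion needs, and the induction closes because a multiple of `2 ^
(i + 1)` has a zero `i`-th bit. -/
theorem mixUpState_family (q : ℕ) (a : ℕ → ℂ) : ∀ i ≤ q, ∃ b : ℕ → ℂ,
    mixUpState i (family (Finset.range (2 ^ q)) enc a) = family (Finset.range (2 ^ q)) enc b ∧
    ∀ k, b (2 ^ i * k)
      = (Real.sqrt 2 : ℂ)⁻¹ ^ i * ∑ w ∈ Finset.range (2 ^ i), a (2 ^ i * k + w) := by
  intro i
  induction i with
  | zero => exact fun _ => ⟨a, rfl, fun k => by simp⟩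
  | succ i ih =>
    intro hi
    obtain ⟨b, hb, hb'⟩ := ih (by omega)
    refine ⟨_, by rw [mixUpState, hb, hadamardOn_family (by omega)], fun k => ?_⟩
    have h0 := testBit_two_pow_mul_even i k
    rw [hadamardCoeff, h0, if_neg (by simp), xor_two_pow_of_testBit_false h0]
    have e1 : 2 ^ (i + 1) * k = 2 ^ i * (2 * k) := by ring
    have e2 : 2 ^ (i + 1) * k + 2 ^ i = 2 ^ i * (2 * k + 1) := by ring
    rw [e2, e1, hb', hb', sum_range_two_pow_succ, pow_succ]
    have e3 : ∀ w, 2 ^ i * (2 * k + 1) + w = 2 ^ i * (2 * k) + (2 ^ i + w) := fun w => by ring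
    simp only [e3]
    ring

theorem hadamardOn_single {v i : ℕ} (h : v.testBit i = false) (z : ℂ) :
    hadamardOn (10 + i) (Finsupp.single (enc v) z) = (Real.sqrt 2 : ℂ)⁻¹ •
      (Finsupp.single (enc v) z + Finsupp.single (enc (v + 2 ^ i)) z) := by
  have hu := enc_update v i
  rw [h, if_neg (by simp), xor_two_pow_of_testBit_false h] at hu
  have h0 : enc v (10 + i) = 0 := by rw [enc_bit, h]; simp
  rw [hadamardOn, QGate.apply_single, QGate.onBasis]
  have e : Addr.eval 0 (.direct (10 + i)) = 10 + i := rfl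
  rw [e, if_pos h0, hu, smul_comm, smul_add, Finsupp.smul_single, Finsupp.smul_single, smul_eq_mul,
    mul_one]

/-- The lowest `i` bits of `2 ^ i * k` vanish; Hadamard gates on them spread the vector evenly over
the block of `2 ^ i` numbers starting there. -/
theorem mixDownState_single (i : ℕ) : ∀ k : ℕ, ∀ z : ℂ,
    mixDownState i (Finsupp.single (enc (2 ^ i * k)) z) = (Real.sqrt 2 : ℂ)⁻¹ ^ i •
      ∑ w ∈ Finset.range (2 ^ i), Finsupp.single (enc (2 ^ i * k + w)) z := by
  induction i with
  | zero => intro k z; simp [mixDownState]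
  | succ i ih =>
    intro k z
    have e1 : 2 ^ (i + 1) * k = 2 ^ i * (2 * k) := by ring
    have e2 : 2 ^ (i + 1) * k + 2 ^ i = 2 ^ i * (2 * k + 1) := by ring
    rw [mixDownState, hadamardOn_single (testBit_two_pow_mul_even i k), mixDownState_smul,
      mixDownState_add, e2, e1, ih, ih, sum_range_two_pow_succ, pow_succ, ← smul_add, smul_smul,
      mul_comm]
    have e3 : ∀ w, 2 ^ i * (2 * k + 1) + w = 2 ^ i * (2 * k) + (2 ^ i + w) := fun w => by ring
    simp only [e3]

theorem mixDownState_enc_zero (q : ℕ) (z : ℂ) :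
    mixDownState q (Finsupp.single (enc 0) z) =
      family (Finset.range (2 ^ q)) enc fun _ => (Real.sqrt 2 : ℂ)⁻¹ ^ q * z := by
  have := mixDownState_single q 0 z
  simp only [mul_zero, zero_add] at this
  rw [this, Finset.smul_sum, family]
  exact Finset.sum_congr rfl fun w _ => by rw [Finsupp.smul_single, smul_eq_mul]

theorem family_add {ι : Type*} (s : Finset ι) (f : ι → Registers) (a b : ι → ℂ) :
    family s f a + family s f b = family s f fun v => a v + b v := by
  simp only [family, ← Finset.sum_add_distrib, Finsupp.single_add]

/-- The diffusion operator. -/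
theorem exists_mixUpState_and_mixDownState (q : ℕ) (a : ℕ → ℂ) : ∃ b : ℕ → ℂ,
    mixUpState q (family (Finset.range (2 ^ q)) enc a) = family (Finset.range (2 ^ q)) enc b ∧
    mixDownState q (family (Finset.range (2 ^ q)) enc
        fun v => b v * if v % 2 ^ q = 0 then -1 else 1)
      = family (Finset.range (2 ^ q)) enc
        fun v => a v - 2 * ((∑ w ∈ Finset.range (2 ^ q), a w) / 2 ^ q) := by
  obtain ⟨b, hb, hb'⟩ := mixUpState_family q a q le_rfl
  refine ⟨b, hb, ?_⟩
  have h0 := hb' 0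
  simp only [mul_zero, zero_add] at h0
  -- The sign at zero is the identity minus twice the projection onto the zero vector. Conjugated by
  -- the Hadamard gates, it becomes the identity minus twice the projection onto the uniform
  -- superposition.
  have e : (family (Finset.range (2 ^ q)) enc fun v => b v * if v % 2 ^ q = 0 then -1 else 1)
      = family (Finset.range (2 ^ q)) enc b + (-2 : ℂ) • Finsupp.single (enc 0) (b 0) := by
    have e1 : (-2 : ℂ) • Finsupp.single (enc 0) (b 0)
        = family (Finset.range (2 ^ q)) enc fun v => if v = 0 then -2 * b 0 else 0 := by
      rw [family, Finset.sum_eq_single 0]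
      · simp
      · intro v _ hv; simp [hv]
      · intro h; simp at h
    rw [e1, family_add, family, family]
    refine Finset.sum_congr rfl fun v hv => ?_
    rw [Nat.mod_eq_of_lt (Finset.mem_range.1 hv)]
    congr 1
    split_ifs with h
    · rw [h]; ring
    · ring
  rw [e, mixDownState_add, ← hb, mixDownState_mixUpState, mixDownState_smul, mixDownState_enc_zero,
    h0, family, family, family, Finset.smul_sum, ← Finset.sum_add_distrib]
  refine Finset.sum_congr rfl fun v _ => ?_
  rw [Finsupp.smul_single, ← Finsupp.single_add]
  congr 1
  have h2 : (Real.sqrt 2 : ℂ)⁻¹ ^ q * (Real.sqrt 2 : ℂ)⁻¹ ^ q = 1 / 2 ^ q := by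
    rw [← mul_pow, sqrt_two_inv_mul_self, div_pow, one_pow]
  rw [smul_eq_mul]
  linear_combination (-2 * ∑ w ∈ Finset.range (2 ^ q), a w) * h2

section

variable {n H : ℕ} {x : Fin H → SpinConfig n} {m : Registers} {t : ℕ} {p : Params} {W : ℕ → ℝ}

theorem det_mixUp (hc : Consts p m) (ψ : QState) :
    Det x Algo.mixUp ⟨m, ψ, t⟩ (Ends 24 m (mixUpState p.q ψ) (t + (3 * p.q + 2))) := by
  unfold Algo.mixUp
  refine Det.seq (Det.arith ((Det.loop (fun i b => ∃ m', Frame 24 m m' ∧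
    m' 23 = ((10 + i : ℕ) : ℝ) ∧ b = ⟨m', mixUpState i ψ, t + 2 + 3 * i⟩) p.q ?_ ?_ ?_).mono ?_))
  · simp [hc.r6]
  · refine ⟨_, (Frame.refl 24 m).update (r := 23) (by norm_num) _, ?_, rfl⟩
    simp [hc.r19, hc.r10, ArithOp.eval]
  · rintro i hi _ ⟨m', hm, h23, rfl⟩
    refine Det.seq (Det.gate (Det.arith ?_))
    simp only [QBranch.tick]
    refine ⟨_, (?_ : Frame 24 m _), ?_, QBranch.ext' rfl ?_ (by ring)⟩
    · exact hm.update (r := 23) (by norm_num) _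
    · simp [h23, (hc.frame hm).r9, ArithOp.eval]
      ring
    · simp only [hadamard_apply_eq, Addr.eval_indirect, h23, Nat.floor_natCast]
      rfl
  · rintro _ ⟨m', hm, -, rfl⟩
    exact ⟨m', hm, QBranch.ext' rfl rfl (by ring)⟩

theorem det_mixDown (hc : Consts p m) (ψ : QState) :
    Det x Algo.mixDown ⟨m, ψ, t⟩ (Ends 24 m (mixDownState p.q ψ) (t + (3 * p.q + 2))) := by
  unfold Algo.mixDown
  refine Det.seq (Det.arith ((Det.loop (fun i b => ∃ m' φ, Frame 24 m m' ∧
    m' 23 = 10 + ((p.q - i : ℕ) : ℝ) ∧ mixDownState (p.q - i) φ = mixDownState p.q ψ ∧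
      b = ⟨m', φ, t + 2 + 3 * i⟩) p.q ?_ ?_ ?_).mono ?_))
  · simp [hc.r6]
  · refine ⟨_, ψ, (Frame.refl 24 m).update (r := 23) (by norm_num) _, ?_, rfl, rfl⟩
    simp [hc.r19, hc.r6, ArithOp.eval]
  · rintro i hi _ ⟨m', φ, hm, h23, hφ, rfl⟩
    obtain ⟨d, hd⟩ : ∃ d, p.q - i = d + 1 := ⟨p.q - i - 1, by omega⟩
    have hd' : p.q - (i + 1) = d := by omega
    have h9 := (hc.frame hm).r9
    have hv : Function.update m' 23 (m' 23 - 1) 23 = ((10 + d : ℕ) : ℝ) := by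
      rw [Function.update_self, h23, hd]
      push_cast
      ring
    refine Det.seq (Det.arith (Det.gate ?_))
    simp only [QBranch.tick]
    refine ⟨_, _, (?_ : Frame 24 m _), ?_, ?_, QBranch.ext' rfl rfl (by ring)⟩
    · exact hm.update (r := 23) (by norm_num) _
    · simp only [Addr.eval_ofNat, ArithOp.eval, h9, hv, hd']
      push_cast
      rfl
    · rw [hd', ← hφ, hd, mixDownState]
      simp only [hadamard_apply_eq, Addr.eval_indirect, Addr.eval_ofNat,
        ArithOp.eval, h9, hv, Nat.floor_natCast]
  · rintro _ ⟨m', φ, hm, -, h, rfl⟩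
    rw [Nat.sub_self, mixDownState] at h
    exact ⟨m', hm, QBranch.ext' rfl h (by ring)⟩

/-- The effect of a Grover iteration on coefficients. -/
def groverCoeff (q : ℕ) (bad : ℕ → Prop) [DecidablePred bad] (a : ℕ → ℂ) (v : ℕ) : ℂ :=
  a v * (if bad v then -1 else 1)
    - 2 * ((∑ w ∈ Finset.range (2 ^ q), a w * if bad w then -1 else 1) / 2 ^ q)

/-- Both reflections carry the sign opposite to the usual one: the bad elements are negated instead
of the good ones, and the diffusion is `1 - 2P` instead of `2P - 1`. The two signs cancel. -/
theorem det_grover (hp : p.H = H) (hc : Consts p m) (hW : HasWeights p W m) (a : ℕ → ℂ) :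
    Det x Algo.grover ⟨m, family (Finset.range (2 ^ p.q)) enc a, t⟩
      (Ends 24 m (family (Finset.range (2 ^ p.q)) enc
        (groverCoeff p.q (fun v => score x W (skip p.u v) ≤ m 28) a))
        (t + (16 * H + 30 * p.q + 42))) := by
  have hb : ∀ v ∈ Finset.range (2 ^ p.q), id v < 2 ^ p.q := fun v hv => Finset.mem_range.1 hv
  unfold Algo.grover
  refine Det.seq ((det_markBad hp hc hW id hb).mono ?_)
  rintro _ ⟨m₁, h₁, rfl⟩
  refine Det.seq ((det_mixUp (hc.frame h₁) _).mono ?_)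
  rintro _ ⟨m₂, h₂, rfl⟩
  have h₂' := h₁.trans h₂
  obtain ⟨b, hb1, hb2⟩ := exists_mixUpState_and_mixDownState p.q
    (fun v => a v * if score x W (skip p.u v) ≤ m 28 then -1 else 1)
  simp only [id]
  rw [hb1]
  refine Det.seq ((det_markZero (hc.frame h₂') id hb).mono ?_)
  rintro _ ⟨m₃, h₃, rfl⟩
  have h₃' := h₂'.trans h₃
  refine (det_mixDown (hc.frame h₃') _).mono ?_
  rintro _ ⟨m₄, h₄, rfl⟩
  exact ⟨m₄, h₃'.trans h₄, QBranch.ext' rfl hb2 (by ring)⟩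

end

/-! ### Amplitudes of Grover's algorithm -/

/-- The amplitudes, up to a common factor, of the good and of the bad elements after `j` iterations,
when `t` of `N` elements are good. -/
def groverAmp (t N : ℝ) : ℕ → ℝ × ℝ
  | 0 => (1, 1)
  | j + 1 =>
    let a := groverAmp t N j
    let μ := (t * a.1 - (N - t) * a.2) / N
    (a.1 - 2 * μ, -a.2 - 2 * μ)

/-- The probability to measure a good element after `j` iterations. -/
def groverSuccess (t N : ℝ) (j : ℕ) : ℝ := t * (groverAmp t N j).1 ^ 2 / N

theorem groverAmp_normalized {t N : ℝ} (hN : N ≠ 0) (j : ℕ) :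
    t * (groverAmp t N j).1 ^ 2 + (N - t) * (groverAmp t N j).2 ^ 2 = N := by
  induction j with
  | zero => simp [groverAmp]
  | succ j ih =>
    simp only [groverAmp]
    set a := groverAmp t N j
    have hμ : N * ((t * a.1 - (N - t) * a.2) / N) = t * a.1 - (N - t) * a.2 := by
      field_simp
    set μ := (t * a.1 - (N - t) * a.2) / N
    linear_combination ih + 4 * μ * hμ

/-- With `sin² θ = t / N`, an iteration is a rotation by `2θ`: the two amplitudes are `sin ((2j+1)θ)
/ sin θ` and `cos ((2j+1)θ) / cos θ`. -/
theorem groverSuccess_eq_sin {t N : ℝ} (ht : 0 < t) (htN : t < N) (j : ℕ) :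
    groverSuccess t N j = Real.sin ((2 * j + 1) * Real.arcsin (Real.sqrt (t / N))) ^ 2 := by
  have hN : 0 < N := ht.trans htN
  set θ := Real.arcsin (Real.sqrt (t / N)) with hθ
  have h0 : 0 ≤ t / N := by positivity
  have h1 : t / N < 1 := (div_lt_one hN).2 htN
  have hsin : Real.sin θ = Real.sqrt (t / N) :=
    Real.sin_arcsin (by linarith [Real.sqrt_nonneg (t / N)]) (Real.sqrt_le_one.2 h1.le)
  have hs2 : Real.sin θ ^ 2 = t / N := by rw [hsin, Real.sq_sqrt h0]
  have hs : Real.sin θ ^ 2 * N = t := by rw [hs2]; field_simp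
  have hc : Real.cos θ ^ 2 * N = N - t := by
    have := Real.sin_sq_add_cos_sq θ
    linear_combination N * this - hs
  have key : ∀ j : ℕ, (groverAmp t N j).1 * Real.sin θ = Real.sin ((2 * j + 1) * θ) ∧
      (groverAmp t N j).2 * Real.cos θ = Real.cos ((2 * j + 1) * θ) := by
    intro j
    induction j with
    | zero => simp [groverAmp]
    | succ j ih =>
      obtain ⟨h1, h2⟩ := ih
      simp only [groverAmp]
      set a := groverAmp t N j
      have hμ : (t * a.1 - (N - t) * a.2) / N
          = Real.sin θ * Real.sin ((2 * j + 1) * θ) - Real.cos θ * Real.cos ((2 * j + 1) * θ) := by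
        rw [← h1, ← h2, div_eq_iff hN.ne', ← hc, ← hs]
        ring
      have e : (2 * ((j + 1 : ℕ) : ℝ) + 1) * θ = (2 * j + 1) * θ + 2 * θ := by push_cast; ring
      rw [hμ, e, Real.sin_add, Real.cos_add, Real.sin_two_mul, Real.cos_two_mul, ← h1, ← h2]
      have := Real.sin_sq_add_cos_sq θ
      constructor
      · linear_combination (-2 * a.1 * Real.sin θ) * this
      · ring
  rw [groverSuccess, ← (key j).1, mul_pow, ← hs, hs2]
  field_simp

/-- Multiplication by `2 sin (2θ)` turns each cosine into a difference of consecutive sines. -/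
theorem sum_cos_telescope (θ : ℝ) (M : ℕ) :
    2 * Real.sin (2 * θ) * ∑ j ∈ Finset.range M, Real.cos (2 * ((2 * j + 1) * θ))
      = Real.sin (4 * M * θ) := by
  induction M with
  | zero => simp
  | succ M ih =>
    rw [Finset.sum_range_succ, mul_add, ih]
    have e1 : 4 * (M : ℝ) * θ = 2 * ((2 * M + 1) * θ) - 2 * θ := by ring
    have e2 : 4 * ((M + 1 : ℕ) : ℝ) * θ = 2 * ((2 * M + 1) * θ) + 2 * θ := by push_cast; ring
    rw [e1, e2, Real.sin_sub, Real.sin_add]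
    ring

/-- With a random number of iterations, a good element is found with probability at least `1/4`,
unless there are too few of them. -/
theorem sum_groverSuccess {t N : ℝ} (ht : 0 < t) (htN : 2 * t ≤ N) {M : ℕ} (hM : 0 < M)
    (h : N ≤ 2 * t * M ^ 2) : (M : ℝ) / 4 ≤ ∑ j ∈ Finset.range M, groverSuccess t N j := by
  have hN : 0 < N := by linarith
  simp only [groverSuccess_eq_sin ht (show t < N by linarith)]
  set θ := Real.arcsin (Real.sqrt (t / N)) with hθ
  have h0 : 0 ≤ t / N := by positivity
  have h1 : t / N ≤ 1 / 2 := by rw [div_le_div_iff₀ hN (by norm_num)]; linarith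
  have hsin : Real.sin θ = Real.sqrt (t / N) :=
    Real.sin_arcsin (by linarith [Real.sqrt_nonneg (t / N)]) (Real.sqrt_le_one.2 (by linarith))
  have hs2 : Real.sin θ ^ 2 = t / N := by rw [hsin, Real.sq_sqrt h0]
  have hs0 : 0 ≤ Real.sin θ := hsin ▸ Real.sqrt_nonneg _
  have hc0 : 0 ≤ Real.cos θ := Real.cos_arcsin_nonneg _
  have hc2 : 1 / 2 ≤ Real.cos θ ^ 2 := by
    have := Real.sin_sq_add_cos_sq θ
    linarith
  have hM' : (0 : ℝ) < M := by exact_mod_cast hM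
  -- As `cos² θ ≥ 1/2`, one has `sin² (2θ) = 4 sin² θ cos² θ ≥ 2t/N`, which is at least `1/M²` by
  -- hypothesis.
  have h2 : 1 / (M : ℝ) ≤ Real.sin (2 * θ) := by
    rw [Real.sin_two_mul]
    refine le_of_sq_le_sq ?_ (by positivity)
    rw [mul_pow, mul_pow, hs2, div_pow, one_pow]
    have : 1 / (M : ℝ) ^ 2 ≤ 2 * (t / N) := by
      rw [div_le_iff₀ (by positivity), mul_div_assoc', div_mul_eq_mul_div, le_div_iff₀ hN]
      linarith
    nlinarith
  have h3 := sum_cos_telescope θ M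
  have h4 : ∀ j : ℕ, Real.sin ((2 * j + 1) * θ) ^ 2
      = 1 / 2 - Real.cos (2 * ((2 * j + 1) * θ)) / 2 := fun j => by
    rw [Real.sin_sq_eq_half_sub]
  simp only [h4, Finset.sum_sub_distrib, ← Finset.sum_div]
  rw [Finset.sum_const, Finset.card_range, nsmul_eq_mul]
  set S := ∑ j ∈ Finset.range M, Real.cos (2 * ((2 * j + 1) * θ))
  -- By telescoping, `2 sin (2θ) S` is a sine and hence at most one. The average of `sin²` is
  -- therefore at least `1/2 - 1/4`.
  have h5 : S ≤ M / 2 := by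
    by_contra hS
    push Not at hS
    have h6 : Real.sin (4 * M * θ) ≤ 1 := Real.sin_le_one _
    have h7 : 1 / (M : ℝ) * (M / 2) < Real.sin (2 * θ) * S :=
      (mul_lt_mul_of_pos_left hS (by positivity)).trans_le
        (mul_le_mul_of_nonneg_right h2 (by linarith))
    have h8 : 1 / (M : ℝ) * (M / 2) = 1 / 2 := by field_simp
    linarith
  linarith

/-- If `N ≤ 2t·4^k`, the average probability of success is at least `1/4`, and a success removes
half of the better elements in expectation, so at least `t/8` are lost. Otherwise `t` is so small
that `t/8` is covered by the additive term. -/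
theorem sum_mul_one_sub_groverSuccess {t N : ℝ} (ht : 0 ≤ t) (htN : 2 * t ≤ N) (k : ℕ) :
    (∑ j ∈ Finset.range (2 ^ k), (t - groverSuccess t N j * (t / 2))) / 2 ^ k
      ≤ 7 / 8 * t + N / (8 * 4 ^ k) := by
  have hk : (0 : ℝ) < 2 ^ k := by positivity
  have h4 : (4 : ℝ) ^ k = (2 ^ k) ^ 2 := by rw [← pow_mul, mul_comm, pow_mul]; norm_num
  rw [Finset.sum_sub_distrib, Finset.sum_const, Finset.card_range, nsmul_eq_mul, ← Finset.sum_mul]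
  push_cast
  rcases ht.eq_or_lt with rfl | ht'
  · simp
    positivity
  · have hN : 0 < N := by linarith
    have hnn : 0 ≤ N / (8 * 4 ^ k) := by positivity
    rw [div_le_iff₀ hk]
    by_cases h : N ≤ 2 * t * (2 ^ k) ^ 2
    · have := sum_groverSuccess ht' htN (M := 2 ^ k) (by positivity) (by push_cast; exact h)
      push_cast at this
      nlinarith [mul_nonneg hnn hk.le]
    · push Not at h
      have h0 : 0 ≤ ∑ j ∈ Finset.range (2 ^ k), groverSuccess t N j :=
        Finset.sum_nonneg fun j _ => by unfold groverSuccess; positivity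
      have h5 : t / 8 ≤ N / (8 * 4 ^ k) := by
        rw [h4, le_div_iff₀ (by positivity)]
        nlinarith
      nlinarith [mul_le_mul_of_nonneg_right h5 hk.le, mul_nonneg h0 ht]

/-- Of the two orders of a pair at most one is counted. So a uniformly chosen element of `G` is
beaten on average by at most half of `G`, with or without ties. -/
theorem card_pairs_lt {ι : Type*} (G : Finset ι) (g : ι → ℝ) :
    2 * ∑ v ∈ G, (G.filter fun w => g v < g w).card ≤ G.card ^ 2 := by
  have h1 : ∑ v ∈ G, (G.filter fun w => g v < g w).card
      = ∑ v ∈ G, ∑ w ∈ G, if g v < g w then 1 else 0 :=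
    Finset.sum_congr rfl fun v _ => Finset.card_filter ..
  have h2 : ∑ v ∈ G, (G.filter fun w => g v < g w).card
      = ∑ v ∈ G, ∑ w ∈ G, if g w < g v then 1 else 0 := by rw [h1, Finset.sum_comm]
  calc _ = ∑ v ∈ G, ∑ w ∈ G, ((if g v < g w then 1 else 0) + if g w < g v then 1 else 0) := by
        simp only [Finset.sum_add_distrib]
        rw [two_mul]
        nth_rewrite 1 [h1]
        rw [h2]
    _ ≤ ∑ v ∈ G, ∑ w ∈ G, 1 := by
        refine Finset.sum_le_sum fun v _ => Finset.sum_le_sum fun w _ => ?_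
        split_ifs with h3 h4
        · exact absurd h3 h4.le.not_gt
        all_goals simp
    _ = _ := by simp [sq]

/-- The number of elements that are better than `y`. -/
def better (q : ℕ) (g : ℕ → ℝ) (y : ℝ) : ℕ := ((Finset.range (2 ^ q)).filter fun v => y < g v).card

theorem better_anti {q : ℕ} {g : ℕ → ℝ} {y y' : ℝ} (h : y ≤ y') : better q g y' ≤ better q g y :=
  Finset.card_le_card fun v hv => by
    rw [Finset.mem_filter] at hv ⊢
    exact ⟨hv.1, h.trans_lt hv.2⟩

/-- The amplitude of an element after `j` iterations. -/
def groverState (q : ℕ) (g : ℕ → ℝ) (y : ℝ) (c : ℂ) (j v : ℕ) : ℂ :=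
  c * ((if g v ≤ y then (groverAmp (better q g y) (2 ^ q) j).2
    else (groverAmp (better q g y) (2 ^ q) j).1 : ℝ) : ℂ)

section Search

variable {q : ℕ} {g : ℕ → ℝ} {y : ℝ} {c : ℂ}

theorem sum_range_good_bad (A B : ℝ) :
    ∑ v ∈ Finset.range (2 ^ q), (if g v ≤ y then B else A)
      = better q g y * A + (2 ^ q - better q g y) * B := by
  have h : ∀ v, (if g v ≤ y then B else A) = B + if y < g v then A - B else 0 := fun v => by
    by_cases h : g v ≤ y
    · simp [h, not_lt.2 h]
    · simp [h, not_le.1 h]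
  simp only [h, Finset.sum_add_distrib]
  rw [← Finset.sum_filter, Finset.sum_const, Finset.sum_const, Finset.card_range, better]
  simp only [nsmul_eq_mul]
  push_cast
  ring

theorem groverCoeff_groverState (j : ℕ) :
    groverCoeff q (fun v => g v ≤ y) (groverState q g y c j) = groverState q g y c (j + 1) := by
  funext v
  have h : ∀ w, groverState q g y c j w * (if g w ≤ y then -1 else 1)
      = c * ((if g w ≤ y then -(groverAmp (better q g y) (2 ^ q) j).2
          else (groverAmp (better q g y) (2 ^ q) j).1 : ℝ) : ℂ) := fun w => by
    unfold groverState
    split_ifs <;> push_cast <;> ring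
  simp only [groverCoeff, h]
  rw [← Finset.mul_sum, ← Complex.ofReal_sum, sum_range_good_bad]
  unfold groverState
  simp only [groverAmp]
  split_ifs <;> push_cast <;> ring

theorem normSq_groverState (j v : ℕ) : ‖groverState q g y c j v‖ ^ 2 =
    ‖c‖ ^ 2 * (if g v ≤ y then (groverAmp (better q g y) (2 ^ q) j).2 ^ 2
      else (groverAmp (better q g y) (2 ^ q) j).1 ^ 2) := by
  rw [groverState, norm_mul, mul_pow, Complex.norm_real, Real.norm_eq_abs, sq_abs]
  split_ifs <;> rfl

theorem sum_normSq_groverState (j : ℕ) :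
    ∑ v ∈ Finset.range (2 ^ q), ‖groverState q g y c j v‖ ^ 2 = ‖c‖ ^ 2 * 2 ^ q := by
  simp only [normSq_groverState]
  rw [← Finset.mul_sum, sum_range_good_bad, groverAmp_normalized (by positivity)]

/-- The expected number of better elements after a measurement. -/
theorem sum_normSq_mul_better (j : ℕ) :
    ∑ v ∈ Finset.range (2 ^ q), ‖groverState q g y c j v‖ ^ 2 *
        (better q g (if g v ≤ y then y else g v) : ℝ)
      ≤ (better q g y - groverSuccess (better q g y) (2 ^ q) j * (better q g y / 2)) *
        ∑ v ∈ Finset.range (2 ^ q), ‖groverState q g y c j v‖ ^ 2 := by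
  have hn := groverAmp_normalized (t := better q g y) (N := 2 ^ q) (by positivity) j
  rw [sum_normSq_groverState]
  simp only [normSq_groverState]
  set t : ℝ := ((better q g y : ℕ) : ℝ) with ht
  set α := (groverAmp t (2 ^ q) j).1 with hα
  set γ := (groverAmp t (2 ^ q) j).2 with hγ
  have hs : groverSuccess t (2 ^ q) j * 2 ^ q = t * α ^ 2 := by
    rw [groverSuccess, ← hα]; field_simp
  have e : ∀ v, ‖c‖ ^ 2 * (if g v ≤ y then γ ^ 2 else α ^ 2) *
      (better q g (if g v ≤ y then y else g v) : ℝ) = ‖c‖ ^ 2 * ((if g v ≤ y then γ ^ 2 * t else 0)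
        + α ^ 2 * if y < g v then (better q g (g v) : ℝ) else 0) := by
    intro v
    by_cases h : g v ≤ y
    · simp [h, not_lt.2 h, ht]; ring
    · simp [h, not_le.1 h]; ring
  simp only [e]
  rw [← Finset.mul_sum, Finset.sum_add_distrib, sum_range_good_bad, ← Finset.mul_sum,
    ← Finset.sum_filter]
  -- All better elements have the same amplitude, so a good outcome is uniform among the `t` of
  -- them, and `card_pairs_lt` applies.
  have hp : ∑ v ∈ (Finset.range (2 ^ q)).filter (fun v => y < g v), (better q g (g v) : ℝ)
      ≤ t ^ 2 / 2 := by
    have := card_pairs_lt ((Finset.range (2 ^ q)).filter fun v => y < g v) g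
    rw [le_div_iff₀ (by norm_num), mul_comm, ht]
    rw [← better] at this
    refine le_trans (le_of_eq ?_) (Nat.cast_le (α := ℝ).2 this |>.trans (le_of_eq (by push_cast; rfl)))
    push_cast
    congr 1
    refine Finset.sum_congr rfl fun v hv => ?_
    rw [better]
    congr 2
    ext w
    simp only [Finset.mem_filter] at hv ⊢
    exact ⟨fun h => ⟨⟨h.1, hv.2.trans h.2⟩, h.2⟩, fun h => ⟨h.1.1, h.2⟩⟩
  have hp' := mul_le_mul_of_nonneg_left hp (sq_nonneg α)
  have hc := sq_nonneg ‖c‖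
  rw [mul_comm _ (‖c‖ ^ 2 * 2 ^ q), mul_assoc]
  refine mul_le_mul_of_nonneg_left ?_ hc
  have : (2 : ℝ) ^ q * (t - groverSuccess t (2 ^ q) j * (t / 2))
      = t * (t * α ^ 2 + (2 ^ q - t) * γ ^ 2) - t * α ^ 2 * (t / 2) := by
    rw [hn]
    linear_combination (-t / 2) * hs
  rw [this]
  nlinarith

end Search

/-! ### The search for a node of maximal score -/

namespace Algo

open QProg in
/-- Stores a random number with as many binary digits as register `30` says. -/
def toss : QProg :=
  const 24 0 ;; loop 30 (gate (.hadamard 7) ;; measure 7 25 ;; gate (.load true 7 25) ;;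
    arith .times 24 24 11 ;; arith .plus 24 24 25)

open QProg in
/-- Resets the qubits. -/
def clear : QProg :=
  arith .plus 23 19 10 ;;
  loop 6 (measure (.indirect 23) 25 ;; gate (.load true (.indirect 23) 25) ;; arith .plus 23 23 9)

open QProg in
/-- Reads out the node that was measured, together with its score. -/
def readout : QProg :=
  measure 1 26 ;; measure 5 27 ;; unevaluate ;; clear ;;
  ifLe 27 28 (const 20 0) (arith .plus 28 27 10 ;; arith .plus 29 26 10)

open QProg in
/-- One measurement after a random number of Grover iterations. -/
def round : QProg :=
  toss ;; mixDown ;; loop 24 grover ;; evaluate ;; measure 0 25 ;; readout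

open QProg in
/-- Rounds with increasing numbers of Grover iterations. -/
def climb : QProg := const 30 0 ;; loop 7 (loop 15 round ;; arith .plus 30 30 9)

open QProg in
/-- Finds a node with maximal positive score. -/
def maximize : QProg := const 28 0 ;; loop 8 climb

end Algo

/-- The work registers of the quantum memory are cleared, up to a phase. -/
def Cleared (b : QBranch) : Prop := ∃ z : ℂ, z ≠ 0 ∧ b.state = Finsupp.single (enc 0) z

section

variable {n H : ℕ} {x : Fin H → SpinConfig n} {m : Registers} {t : ℕ} {p : Params} {W : ℕ → ℝ}

theorem Finset.sum_range_two_mul {M : Type*} [AddCommMonoid M] (N : ℕ) (f : ℕ → M) :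
    ∑ w ∈ Finset.range N, f w + ∑ w ∈ Finset.range N, f (N + w)
      = ∑ w ∈ Finset.range (2 * N), f w := by rw [two_mul, Finset.sum_range_add]

/-- The configuration with a coin in the flag register. -/
def coin (b : ℕ) : Registers := qcfg 0 0 0 0 0 0 0 0 b 0

/-- The most significant bit is drawn first. After `i` tosses the pending expectation is the average
of `f` over the block of numbers that begin with the bits drawn so far. The flag register is reset
by subtracting the measured bit. -/
theorem spec_toss (hc : Consts p m) {k : ℕ} (hk : m 30 = k) {z : ℂ} (hz : z ≠ 0) (f : ℕ → ℝ) :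
    Spec x Algo.toss ⟨m, Finsupp.single (enc 0) z, t⟩
      (fun b => ∃ j : ℕ, j < 2 ^ k ∧ b.mem 24 = j ∧ Frame 26 m b.mem ∧ Cleared b ∧
        b.time = t + (6 * k + 2))
      (fun b => f ⌊b.mem 24⌋₊) ((∑ j ∈ Finset.range (2 ^ k), f j) / 2 ^ k) := by
  unfold Algo.toss
  refine Spec.seq_det (Det.const ?_)
  refine (Spec.loop (fun i b => ∃ j : ℕ, j < 2 ^ i ∧ b.mem 24 = j ∧ Frame 26 m b.mem ∧ Cleared b ∧
    b.time = t + 2 + 6 * i) (fun i b => (∑ w ∈ Finset.range (2 ^ (k - i)),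
      f (⌊b.mem 24⌋₊ * 2 ^ (k - i) + w)) / 2 ^ (k - i)) k ?_ ?_ ?_).mono ?_ le_rfl
  · simp [hk]
  · refine ⟨⟨0, by simp, by simp [QBranch.tick], (Frame.refl 26 m).update (r := 24) (by norm_num) _,
      ⟨z, hz, rfl⟩, rfl⟩, ?_⟩
    simp [QBranch.tick]
  · rintro i hi ⟨m', ψ, t'⟩ ⟨j, hj, h24, hm, ⟨z, hz, rfl : ψ = _⟩, rfl : t' = _⟩
    change m' 24 = _ at h24
    change Frame 26 m m' at hm
    have hc' := hc.frame hm
    obtain ⟨d, hd⟩ : ∃ d, k - i = d + 1 := ⟨k - i - 1, by omega⟩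
    have hd' : k - (i + 1) = d := by omega
    simp only [QBranch.tick, hd, hd', h24, Nat.floor_natCast]
    refine Spec.seq_det (Det.gate ?_)
    have hstate : (QGate.hadamard 7).apply x m' (Finsupp.single (enc 0) z)
        = family (Finset.range 2) coin fun _ => z * (Real.sqrt 2 : ℂ)⁻¹ := by
      rw [QGate.apply_single]
      have h7 : enc 0 (Addr.eval m' 7) = 0 := rfl
      have h1 : Function.update (enc 0) (Addr.eval m' 7) 1 = coin 1 := by
        funext r
        rcases r with _ | _ | _ | _ | _ | _ | _ | _ | _ | _ | r <;>
          simp [coin, enc, qcfg]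
      have h0 : enc 0 = coin 0 := by simp [coin, enc]
      rw [QGate.onBasis, if_pos h7, h1, h0, family, Finset.sum_range_succ, Finset.sum_range_one]
      simp
    rw [hstate]
    refine Spec.seq (J := fun b => ∃ v : ℕ, v < 2 ∧ b.mem = Function.update m' 25 (v : ℝ) ∧
      (∃ z', z' ≠ 0 ∧ b.state = Finsupp.single (coin v) z') ∧ b.time = t + 2 + 6 * i + 3)
      (fun b => (∑ w ∈ Finset.range (2 ^ d), f ((2 * j + ⌊b.mem 25⌋₊) * 2 ^ d + w)) / 2 ^ d)
      (Spec.measure ?_ ?_ ?_) ?_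
    · intro v _ w _ h
      have : ((v : ℕ) : ℝ) = (w : ℕ) := h
      exact_mod_cast this
    · intro v hv ha
      exact ⟨v, Finset.mem_range.1 hv, rfl, ⟨_, ha, rfl⟩, rfl⟩
    · rw [Finset.sum_range_succ, Finset.sum_range_one, Finset.sum_range_succ, Finset.sum_range_one]
      have c0 : coin 0 (Addr.eval m' 7) = 0 := by simp [coin]
      have c1 : coin 1 (Addr.eval m' 7) = 1 := by simp [coin]
      simp only [Addr.eval_ofNat] at c0 c1
      simp only [Addr.eval_ofNat, c0, c1, Function.update_self, Nat.floor_zero, Nat.floor_one]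
      rw [pow_succ' (2 : ℕ) d, ← Finset.sum_range_two_mul]
      have e1 : ∀ w, j * (2 * 2 ^ d) + w = (2 * j + 0) * 2 ^ d + w := fun w => by ring
      have e2 : ∀ w, j * (2 * 2 ^ d) + (2 ^ d + w) = (2 * j + 1) * 2 ^ d + w := fun w => by ring
      simp only [e2, e1]
      refine le_of_eq ?_
      field_simp
      ring
    · rintro ⟨m₁, ψ, t₁⟩ ⟨v, hv, rfl : m₁ = _, ⟨z', hz', rfl : ψ = _⟩, rfl : t₁ = _⟩
      refine Spec.of_det (Det.seq (Det.gate ?_))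
      simp only [QGate.apply_single, QGate.onBasis, Addr.eval_ofNat, Function.update_self]
      have hcoin : shiftReg true (coin v) 7 (v : ℝ) = enc 0 := by
        simp [coin, enc]
      rw [hcoin]
      refine Det.seq (Det.arith (Det.arith ?_))
      have hval : ((2 * j + v : ℕ) : ℝ) = m' 24 * m' 11 + v := by
        rw [h24, hc'.r11]; push_cast; ring
      simp only [Addr.eval_ofNat, ArithOp.eval]
      refine ⟨⟨2 * j + v, by rw [pow_succ]; omega, ?_, ?_, ⟨z', hz', by simp⟩, by ring⟩, ?_⟩
      · simp [hval]
      · exact ((hm.update (r := 25) (by norm_num) _).update (r := 24) (by norm_num) _).update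
          (r := 24) (by norm_num) _
      · have hfl : ⌊2 * (j : ℝ) + v⌋₊ = 2 * j + v := by exact_mod_cast Nat.floor_natCast (2 * j + v)
        simp [← hval, hfl]
  · rintro b ⟨j, hj, h24, hm, hcl, ht⟩
    exact ⟨⟨j, hj, h24, hm, hcl, by rw [ht]; ring⟩, by simp⟩

/-- All measurements here act on a basis vector and are deterministic. After `i` passes the lowest
`i` bits of `v` have been erased, which leaves `2 ^ i * (v / 2 ^ i)`. -/
theorem det_clear (hc : Consts p m) {v : ℕ} (hv : v < 2 ^ p.q) {z : ℂ} (hz : z ≠ 0) :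
    Det x Algo.clear ⟨m, Finsupp.single (enc v) z, t⟩ fun b => Frame 26 m b.mem ∧ Cleared b ∧
      b.time = t + (4 * p.q + 2) := by
  unfold Algo.clear
  refine Det.seq (Det.arith ((Det.loop (fun i b => ∃ m', Frame 26 m m' ∧
    m' 23 = ((10 + i : ℕ) : ℝ) ∧ b = ⟨m', Finsupp.single (enc (2 ^ i * (v / 2 ^ i))) z,
      t + 2 + 4 * i⟩) p.q ?_ ?_ ?_).mono ?_))
  · simp [hc.r6]
  · refine ⟨_, (?_ : Frame 26 m _), ?_, QBranch.ext' rfl ?_ rfl⟩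
    · exact (Frame.refl 26 m).update (r := 23) (by norm_num) _
    · simp [hc.r19, hc.r10, ArithOp.eval]
    · simp
  · rintro i hi _ ⟨m', hm, h23, rfl⟩
    refine Det.seq (Det.measure_single hz (Det.seq (Det.gate (Det.arith ?_))))
    have hf : ⌊m' 23⌋₊ = 10 + i := by rw [h23, Nat.floor_natCast]
    refine ⟨_, (?_ : Frame 26 m _), ?_, QBranch.ext' rfl ?_ (by simp; ring)⟩
    · exact (hm.update (r := 25) (by norm_num) _).update (r := 23) (by norm_num) _
    · simp [h23, (hc.frame hm).r9, ArithOp.eval]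
      ring
    · simp only [QGate.apply_single, QGate.onBasis, Addr.eval_ofNat, Addr.eval_indirect,
        Function.update_self, hf]
      have e23 : ∀ a : ℝ, Function.update m' 25 a 23 = m' 23 := fun a => by simp
      simp only [e23, hf]
      rw [Finsupp.smul_single, smul_eq_mul, mul_one]
      congr 1
      funext r
      by_cases hr : r = 10 + i
      · subst hr
        have : (2 ^ (i + 1) * (v / 2 ^ (i + 1))).testBit i = false := testBit_two_pow_mul_even _ _
        simp [shiftReg, enc_bit, this]
      · by_cases hr' : r < 10
        · rw [shiftReg, Function.update_of_ne hr]
          unfold enc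
          interval_cases r <;> rfl
        · obtain ⟨j, rfl⟩ := Nat.exists_eq_add_of_le (not_lt.1 hr')
          have hji : j ≠ i := by omega
          rw [shiftReg, Function.update_of_ne hr, enc_bit, enc_bit, Nat.testBit_two_pow_mul,
            Nat.testBit_two_pow_mul, Nat.testBit_div_two_pow, Nat.testBit_div_two_pow]
          rcases lt_or_ge j i with h | h
          · rw [decide_eq_false (by omega), decide_eq_false (by omega)]
            rfl
          · rw [decide_eq_true (by omega), decide_eq_true (by omega), Nat.sub_add_cancel h,
              Nat.sub_add_cancel (by omega)]
  · rintro _ ⟨m', hm, -, rfl⟩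
    rw [Nat.div_eq_of_lt hv, mul_zero]
    exact ⟨hm, ⟨z, hz, rfl⟩, by ring⟩

/-- The score of the `v`-th node. -/
def nodeScore (x : Fin H → SpinConfig n) (p : Params) (W : ℕ → ℝ) (v : ℕ) : ℝ :=
  score x W (skip p.u v)

/-- The memory holds a node and its score. -/
def Holds (x : Fin H → SpinConfig n) (p : Params) (W : ℕ → ℝ) (m : Registers) : Prop :=
  0 ≤ m 28 ∧ (m 28 = 0 ∨ ∃ v < 2 ^ p.q, m 29 = skip p.u v ∧ m 28 = nodeScore x p W v)

/-- The state is a single basis vector, so reading out the node and its score does not disturb it;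
the computation is then undone, the qubits are cleared, and the quantum memory can be reused. -/
theorem det_readout (hp : p.H = H) (hc : Consts p m) (hW : HasWeights p W m)
    (hs : Holds x p W m) {v : ℕ} (hv : v < 2 ^ p.q) {z : ℂ} (hz : z ≠ 0) :
    Det x Algo.readout ⟨m, Finsupp.single (qcfg v v (skip p.u v) p.u 0 0 (nodeScore x p W v) 0 0 0)
        z, t⟩ fun b => Frame 30 m b.mem ∧ Cleared b ∧ Holds x p W b.mem ∧
      b.mem 28 = (if nodeScore x p W v ≤ m 28 then m 28 else nodeScore x p W v) ∧
      b.time ≤ t + (8 * H + 10 * p.q + 16) := by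
  unfold Algo.readout
  refine Det.seq (Det.measure_single hz (Det.seq (Det.measure_single hz (Det.seq ?_))))
  have hm : Frame 28 m (Function.update (Function.update m 26 (skip p.u v : ℝ)) 27
      (nodeScore x p W v)) := ((Frame.refl 28 m).update (r := 26) (by norm_num) _).update
        (r := 27) (by norm_num) _
  set m₁ := Function.update (Function.update m 26 (skip p.u v : ℝ)) 27 (nodeScore x p W v) with hm₁
  have h26 : m₁ 26 = skip p.u v := by simp [hm₁]
  have h27 : m₁ 27 = nodeScore x p W v := by simp [hm₁]
  have hun := det_unevaluate (x := x) (t := t + 1 + 1) (s := {v}) (a := fun _ => z) hp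
    (hc.frame hm) (hW.frame (by norm_num) hm) id (fun w hw => by
      rw [Finset.mem_singleton] at hw; subst hw; exact hv)
  rw [family_singleton, family_singleton] at hun
  refine hun.mono ?_
  rintro _ ⟨m₂, h₂, rfl⟩
  refine Det.seq ((det_clear (hc.frame (hm.trans (h₂.mono (by norm_num)))) hv hz).mono ?_)
  rintro ⟨m₃, ψ, t₃⟩ ⟨h₃ : Frame 26 m₂ m₃, hcl, ht⟩
  have h₃' : Frame 26 m₁ m₃ := (h₂.mono (by norm_num)).trans h₃
  have hf : Frame 28 m m₃ := hm.trans (h₃'.mono (by norm_num))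
  have e26 : m₃ 26 = skip p.u v := by rw [h₃' 26 (by norm_num), h26]
  have e27 : m₃ 27 = nodeScore x p W v := by rw [h₃' 27 (by norm_num), h27]
  have e28 : m₃ 28 = m 28 := hf 28 (by norm_num)
  have e29 : m₃ 29 = m 29 := hf 29 (by norm_num)
  have hc₃ := hc.frame hf
  simp only at ht
  refine Det.ifLe ?_
  simp only [Addr.eval_ofNat, e27, e28, QBranch.tick]
  split_ifs with hle
  · refine Det.const ?_
    have hu : ∀ r, 28 ≤ r → Function.update m₃ 20 ((0 : ℕ) : ℝ) r = m₃ r := fun r hr => by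
      rw [Function.update_of_ne (by omega)]
    refine ⟨(hf.mono (by norm_num)).update (r := 20) (by norm_num) _, hcl, ?_, ?_, ?_⟩
    · simp only [Holds, Addr.eval_ofNat, hu 28 le_rfl, hu 29 (by norm_num), e28, e29]
      exact hs
    · simp only [Addr.eval_ofNat, hu 28 le_rfl, e28]
    · simp only [ht]; omega
  · refine Det.seq (Det.arith (Det.arith ?_))
    simp only [Addr.eval_ofNat, ArithOp.eval]
    refine ⟨((hf.mono (by norm_num)).update (r := 28) (by norm_num) _).update (r := 29)
      (by norm_num) _, hcl, ?_, ?_, ?_⟩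
    · simp only [Holds]
      simp [e27, e26, hc₃.r10]
      exact ⟨hs.1.trans (not_le.1 hle).le, Or.inr ⟨v, hv, rfl, rfl⟩⟩
    · simp [e27, hc₃.r10]
    · simp only [ht]; omega

/-- The cost of a Grover iteration. -/
def groverCost (H q : ℕ) : ℕ := 16 * H + 30 * q + 43

theorem det_groverLoop (hp : p.H = H) (hc : Consts p m) (hW : HasWeights p W m) {j : ℕ}
    (hj : m 24 = j) (c : ℂ) :
    Det x (.loop 24 Algo.grover) ⟨m, family (Finset.range (2 ^ p.q)) enc fun _ => c, t⟩
      (Ends 24 m (family (Finset.range (2 ^ p.q)) enc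
        (groverState p.q (nodeScore x p W) (m 28) c j)) (t + (groverCost H p.q * j + 1))) := by
  refine (Det.loop (fun i b => Ends 24 m (family (Finset.range (2 ^ p.q)) enc
        (groverState p.q (nodeScore x p W) (m 28) c i)) (t + 1 + groverCost H p.q * i) b) j
          ?_ ?_ ?_).mono ?_
  · simp [hj]
  · refine ⟨m, Frame.refl _ _, QBranch.ext' rfl ?_ (by simp)⟩
    refine congrArg (family (Finset.range (2 ^ p.q)) enc) ?_
    funext v
    simp [groverState, groverAmp]
  · rintro i hi _ ⟨m', hm, rfl⟩
    refine (det_grover hp (hc.frame hm) (hW.frame (by norm_num) hm) _).mono ?_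
    rintro _ ⟨m'', hm', rfl⟩
    refine ⟨m'', hm.trans hm', QBranch.ext' rfl ?_ (by unfold groverCost; ring)⟩
    have h28 : m' 28 = m 28 := hm 28 (by norm_num)
    rw [← groverCoeff_groverState, h28]
    rfl
  · rintro _ ⟨m', hm, rfl⟩
    exact ⟨m', hm, QBranch.ext' rfl rfl (by ring)⟩

/-- The number of nodes with a score better than the one in memory. -/
def remaining (x : Fin H → SpinConfig n) (p : Params) (W : ℕ → ℝ) (b : QBranch) : ℝ :=
  better p.q (nodeScore x p W) (b.mem 28)

/-- Hadamard gates on the zero vector prepare the uniform superposition. The hypothesis `hN`, that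
at most half of the elements are better, is what `sum_groverSuccess` needs to keep `θ` at most
`π/4`. -/
theorem spec_round (hp : p.H = H) (hc : Consts p m) (hW : HasWeights p W m) (hs : Holds x p W m)
    {k : ℕ} (hk : m 30 = k) {z : ℂ} (hz : z ≠ 0)
    (hN : 2 * (better p.q (nodeScore x p W) (m 28) : ℝ) ≤ 2 ^ p.q) :
    Spec x Algo.round ⟨m, Finsupp.single (enc 0) z, t⟩
      (fun b => Frame 30 m b.mem ∧ Cleared b ∧ Holds x p W b.mem ∧ m 28 ≤ b.mem 28 ∧
        b.time ≤ t + (6 * k + groverCost H p.q * (2 ^ k + 1)))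
      (remaining x p W)
      (7 / 8 * better p.q (nodeScore x p W) (m 28) + 2 ^ p.q / (8 * 4 ^ k)) := by
  set y := m 28 with hy
  set g := nodeScore x p W with hg
  unfold Algo.round
  -- The function of the random number `j` is the bound of `sum_normSq_mul_better` for the expected
  -- number of better nodes after `j` iterations.
  refine Spec.seq _ ((spec_toss hc hk hz (fun j => better p.q g y -
    groverSuccess (better p.q g y) (2 ^ p.q) j * (better p.q g y / 2))).mono
      (J' := _) (fun b hb => ⟨hb, le_rfl⟩)
        (sum_mul_one_sub_groverSuccess (Nat.cast_nonneg _) hN k)) ?_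
  rintro ⟨m₁, ψ, t₁⟩ ⟨j, hj, h24, h₁, ⟨z₁, hz₁, rfl : ψ = _⟩, rfl : t₁ = _⟩
  change m₁ 24 = _ at h24
  change Frame 26 m m₁ at h₁
  simp only [h24, Nat.floor_natCast]
  refine Spec.seq_det ((det_mixDown (hc.frame h₁) _).mono ?_)
  rintro _ ⟨m₂, h₂, rfl⟩
  rw [mixDownState_enc_zero]
  have h₂' := h₁.trans (h₂.mono (K' := 26) (by norm_num))
  have h24' : m₂ 24 = j := by rw [h₂ 24 (by norm_num), h24]
  refine Spec.seq_det ((det_groverLoop hp (hc.frame h₂') (hW.frame (by norm_num) h₂') h24' _).mono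
    ?_)
  rintro _ ⟨m₃, h₃, rfl⟩
  have h₃' := h₂'.trans (h₃.mono (K' := 26) (by norm_num))
  have h28 : m₂ 28 = y := h₂' 28 (by norm_num)
  rw [h28]
  refine Spec.seq_det ((det_evaluate hp (hc.frame h₃') (hW.frame (by norm_num) h₃') id
    (fun v hv => Finset.mem_range.1 hv)).mono ?_)
  rintro _ ⟨m₄, h₄, rfl⟩
  have h₄' := h₃'.trans (h₄.mono (K' := 26) (by norm_num))
  have e28 : m₄ 28 = y := h₄' 28 (by norm_num)
  simp only [id]
  refine Spec.seq (J := fun b => ∃ v : ℕ, v < 2 ^ p.q ∧ b.mem = Function.update m₄ 25 (v : ℝ) ∧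
      (∃ z', z' ≠ 0 ∧ b.state = Finsupp.single (qcfg v v (skip p.u v) p.u 0 0 (g v) 0 0 0) z') ∧
      b.time = t + (6 * k + 2) + (3 * p.q + 2) + (groverCost H p.q * j + 1)
        + (8 * H + 6 * p.q + 9) + 1)
      (fun b => better p.q g (if g ⌊b.mem 25⌋₊ ≤ y then y else g ⌊b.mem 25⌋₊))
      (Spec.measure ?_ ?_ ?_) ?_
  · intro v _ w _ h
    have : ((v : ℕ) : ℝ) = (w : ℕ) := h
    exact_mod_cast this
  · intro v hv ha
    exact ⟨v, Finset.mem_range.1 hv, rfl, ⟨_, ha, rfl⟩, rfl⟩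
  · simp only [Addr.eval_ofNat, Function.update_self, qcfg_0, Nat.floor_natCast]
    exact sum_normSq_mul_better j
  · rintro ⟨m₅, ψ, t₅⟩ ⟨v, hv, rfl : m₅ = _, ⟨z', hz', rfl : ψ = _⟩, rfl : t₅ = _⟩
    have h₅ : Frame 26 m (Function.update m₄ 25 (v : ℝ)) := h₄'.update (r := 25) (by norm_num) _
    have hs' : Holds x p W (Function.update m₄ 25 (v : ℝ)) := by
      have e29 : Function.update m₄ 25 (v : ℝ) 29 = m 29 := h₅ 29 (by norm_num)
      have e28 : Function.update m₄ 25 (v : ℝ) 28 = m 28 := h₅ 28 (by norm_num)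
      simp only [Holds, e28, e29]
      exact hs
    refine Spec.of_det ((det_readout hp (hc.frame h₅) (hW.frame (by norm_num) h₅) hs' hv hz').mono
      ?_)
    rintro ⟨m₆, ψ, t₆⟩ ⟨h₆, hcl, hs₆, hy₆, ht₆⟩
    have e28' : Function.update m₄ 25 (v : ℝ) 28 = y := h₅ 28 (by norm_num)
    rw [e28'] at hy₆
    refine ⟨⟨(h₅.mono (by norm_num)).trans h₆, hcl, hs₆, ?_, ?_⟩, ?_⟩
    · rw [hy₆]
      split_ifs with h
      · exact le_rfl
      · exact (not_le.1 h).le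
    · refine ht₆.trans ?_
      have : groverCost H p.q * j ≤ groverCost H p.q * 2 ^ k := Nat.mul_le_mul_left _ hj.le
      have e : groverCost H p.q * (2 ^ k + 1) = groverCost H p.q * 2 ^ k + groverCost H p.q := by
        ring
      rw [e]
      have e2 : groverCost H p.q = 16 * H + 30 * p.q + 43 := rfl
      omega
    · simp only [remaining, Function.update_self, Nat.floor_natCast]
      rw [show m₆ 28 = _ from hy₆]

end

/-! ### Climbing through the levels -/

/-- The cost of a round of level `k`. -/
def roundCost (H q k : ℕ) : ℕ := 6 * k + groverCost H q * (2 ^ k + 1)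

/-- The cost of a climb through the levels. -/
def climbCost (H q levels : ℕ) : ℕ :=
  2 + ∑ k ∈ Finset.range levels, (16 * (roundCost H q k + 1) + 3)

section

variable {n H : ℕ} {x : Fin H → SpinConfig n} {m : Registers} {t : ℕ} {p : Params} {W : ℕ → ℝ}

theorem two_mul_better_le (hhalf : 2 * better p.q (nodeScore x p W) 0 ≤ 2 ^ p.q) {y : ℝ}
    (hy : 0 ≤ y) : 2 * (better p.q (nodeScore x p W) y : ℝ) ≤ 2 ^ p.q := by
  have h := better_anti (q := p.q) (g := nodeScore x p W) hy
  have : 2 * better p.q (nodeScore x p W) y ≤ 2 ^ p.q := by omega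
  exact_mod_cast this

/-- A round acts on the expectation as `e ↦ 7e/8 + E/8`, whose fixed point is `E = N/4^k`. Sixteen
rounds suffice because `(7/8)^16 ≤ 1/8`; the potential is the closed form of the rounds still to
come. -/
theorem spec_level (hp : p.H = H) (hc : Consts p m) (hW : HasWeights p W m) (hs : Holds x p W m)
    (hhalf : 2 * better p.q (nodeScore x p W) 0 ≤ 2 ^ p.q)
    {k : ℕ} (hk : m 30 = k) {z : ℂ} (hz : z ≠ 0) :
    Spec x (.loop 15 Algo.round) ⟨m, Finsupp.single (enc 0) z, t⟩
      (fun b => Frame 30 m b.mem ∧ Cleared b ∧ Holds x p W b.mem ∧ m 28 ≤ b.mem 28 ∧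
        b.time ≤ t + 1 + 16 * (roundCost H p.q k + 1))
      (remaining x p W)
      (1 / 8 * better p.q (nodeScore x p W) (m 28) + 2 ^ p.q / 4 ^ k) := by
  set E : ℝ := 2 ^ p.q / 4 ^ k with hE
  have hE0 : 0 ≤ E := by positivity
  refine (Spec.loop (fun i b => Frame 30 m b.mem ∧ Cleared b ∧ Holds x p W b.mem ∧
      m 28 ≤ b.mem 28 ∧ b.time ≤ t + 1 + i * (roundCost H p.q k + 1))
    (fun i b => (7 / 8) ^ (16 - i) * remaining x p W b + (1 - (7 / 8) ^ (16 - i)) * E) 16 ?_ ?_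
      ?_).mono (c := 1 / 8 * better p.q (nodeScore x p W) (m 28) + E) ?_ le_rfl
  · simp [hc.r15]
  · refine ⟨⟨Frame.refl _ _, ⟨z, hz, rfl⟩, hs, le_rfl, by simp [QBranch.tick]⟩, ?_⟩
    have h1 : ((7 : ℝ) / 8) ^ (16 - 0) ≤ 1 / 8 := by norm_num
    have h2 : (0 : ℝ) ≤ (7 / 8) ^ (16 - 0) := by positivity
    have h3 : (0 : ℝ) ≤ better p.q (nodeScore x p W) (m 28) := Nat.cast_nonneg _
    simp only [remaining, QBranch.tick]
    nlinarith [mul_le_mul_of_nonneg_right h1 h3, mul_nonneg h2 hE0]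
  · rintro i hi ⟨m', ψ, t'⟩ ⟨hm, ⟨z', hz', rfl : ψ = _⟩, hs', hy, ht⟩
    simp only at hm hs' hy ht
    have hk' : m' 30 = k := by rw [hm 30 (by norm_num), hk]
    have hsp := spec_round (x := x) (t := t' + 1) hp (hc.frame hm) (hW.frame (by norm_num) hm) hs'
      hk' hz' (two_mul_better_le hhalf hs'.1)
    obtain ⟨d, hd⟩ : ∃ d, 16 - i = d + 1 := ⟨15 - i, by omega⟩
    have hd' : 16 - (i + 1) = d := by omega
    rw [hd, hd']
    refine (hsp.mono (φ' := remaining x p W) (J' := fun b => Frame 30 m b.mem ∧ Cleared b ∧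
      Holds x p W b.mem ∧ m 28 ≤ b.mem 28 ∧ b.time ≤ t + 1 + (i + 1) * (roundCost H p.q k + 1))
      ?_ le_rfl).affine
      (k := (7 / 8) ^ d) (d := (1 - (7 / 8) ^ d) * E) (by positivity) (fun _ _ => le_rfl) ?_
    · rintro b ⟨h1, h2, h3, h4, h5⟩
      refine ⟨⟨hm.trans h1, h2, h3, hy.trans h4, ?_⟩, le_rfl⟩
      refine h5.trans ?_
      have e : (i + 1) * (roundCost H p.q k + 1)
          = i * (roundCost H p.q k + 1) + roundCost H p.q k + 1 := by ring
      have e' : roundCost H p.q k = 6 * k + groverCost H p.q * (2 ^ k + 1) := rfl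
      rw [e]
      omega
    · have e : (2 : ℝ) ^ p.q / (8 * 4 ^ k) = E / 8 := by rw [hE]; field_simp
      rw [e, pow_succ]
      simp only [remaining]
      linarith
  · rintro b ⟨h1, h2, h3, h4, h5⟩
    exact ⟨⟨h1, h2, h3, h4, h5⟩, by simp⟩

/-- The recursion is `e ↦ e/8 + N/4^k`. With `D = 4N/4^L`, the error made on level `L - 1 - d` is
worth `D/2^d` at the end. The geometric series, together with the initial count of at most `N/2`,
stays below `2D`, and `2D ≤ 1/2` since `16N ≤ 4^L`. -/
theorem spec_climb (hp : p.H = H) (hc : Consts p m) (hW : HasWeights p W m) (hs : Holds x p W m)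
    (hhalf : 2 * better p.q (nodeScore x p W) 0 ≤ 2 ^ p.q) (hlev : 16 * 2 ^ p.q ≤ 4 ^ p.levels)
    {z : ℂ} (hz : z ≠ 0) :
    Spec x Algo.climb ⟨m, Finsupp.single (enc 0) z, t⟩
      (fun b => Frame 31 m b.mem ∧ Cleared b ∧ Holds x p W b.mem ∧ m 28 ≤ b.mem 28 ∧
        b.time ≤ t + climbCost H p.q p.levels)
      (remaining x p W) (1 / 2) := by
  unfold Algo.climb
  refine Spec.seq_det (Det.const ?_)
  have hm₀ : Frame 31 m (Function.update m 30 ((0 : ℕ) : ℝ)) :=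
    (Frame.refl 31 m).update (r := 30) (by norm_num) _
  set L := p.levels with hL
  set D : ℝ := 2 ^ p.q * 4 / 4 ^ L with hD
  have hD0 : 0 ≤ D := by positivity
  refine (Spec.loop (fun i b => Frame 31 m b.mem ∧ b.mem 30 = i ∧ Cleared b ∧ Holds x p W b.mem ∧
      m 28 ≤ b.mem 28 ∧
        b.time ≤ t + 2 + ∑ k ∈ Finset.range i, (16 * (roundCost H p.q k + 1) + 3))
    (fun i b => (1 / 8) ^ (L - i) * remaining x p W b + D * (2 - 2 / 2 ^ (L - i))) L ?_ ?_
      ?_).mono (c := 1 / 2) ?_ le_rfl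
  · simp [hc.r7, ← hL]
  · refine ⟨⟨hm₀, by simp [QBranch.tick], ⟨z, hz, rfl⟩, ?_, ?_, ?_⟩, ?_⟩
    · simpa [Holds, QBranch.tick] using hs
    · simp [QBranch.tick]
    · simp [QBranch.tick]
    · have h1 : ((1 : ℝ) / 8) ^ L = (1 / 4 ^ L) * (1 / 2 ^ L) := by
        rw [div_pow, one_pow, one_div_mul_one_div, ← mul_pow]; norm_num
      have h2 := two_mul_better_le hhalf hs.1
      have h3 : 16 * (2 : ℝ) ^ p.q ≤ 4 ^ L := by exact_mod_cast hlev
      have hr : remaining x p W (QBranch.tick ⟨Function.update m 30 ((0 : ℕ) : ℝ),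
          Finsupp.single (enc 0) z, t + 1⟩) = better p.q (nodeScore x p W) (m 28) := by
        simp [remaining, QBranch.tick]
      simp only [Nat.sub_zero]
      refine le_trans (b := 2 * D) ?_ ?_
      · change _ * remaining x p W (QBranch.tick ⟨Function.update m 30 ((0 : ℕ) : ℝ),
          Finsupp.single (enc 0) z, t + 1⟩) + _ ≤ _
        rw [hr, h1]
        have h4 : 1 / (4 : ℝ) ^ L * (better p.q (nodeScore x p W) (m 28) : ℝ) ≤ 2 * D := by
          rw [hD, one_div_mul_eq_div, mul_div_assoc', div_le_div_iff_of_pos_right (by positivity)]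
          linarith [show (0 : ℝ) < 2 ^ p.q by positivity]
        have h5 : (0 : ℝ) ≤ 1 / 2 ^ L := by positivity
        have e : D * (2 - 2 / 2 ^ L) = 2 * D - 2 * D * (1 / 2 ^ L) := by ring
        rw [e]
        nlinarith [mul_le_mul_of_nonneg_right h4 h5]
      · rw [hD, mul_div_assoc', div_le_div_iff₀ (by positivity) (by norm_num)]
        linarith
  · rintro i hi ⟨m', ψ, t'⟩ ⟨hm, hi30, ⟨z', hz', rfl : ψ = _⟩, hs', hy, ht⟩
    simp only at hm hi30 hs' hy ht
    have hsp := spec_level (x := x) (t := t' + 1) hp (hc.frame hm) (hW.frame (by norm_num) hm) hs'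
      hhalf hi30 hz'
    obtain ⟨d, hd⟩ : ∃ d, L - i = d + 1 := ⟨L - i - 1, by omega⟩
    have hd' : L - (i + 1) = d := by omega
    rw [hd, hd']
    refine Spec.seq _ (hsp.affine
      (k := (1 / 8) ^ d) (d := D * (2 - 2 / 2 ^ d)) (by positivity) (fun _ _ => le_rfl) ?_) ?_
    · have hLi : L = i + d + 1 := by omega
      have e : ((1 : ℝ) / 8) ^ d * (2 ^ p.q / 4 ^ i) = D * (1 / 2 ^ d) := by
        rw [hD, hLi, pow_succ, pow_add, show (8 : ℝ) = 4 * 2 by norm_num, div_pow, mul_pow]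
        field_simp
        rw [one_pow]
      rw [pow_succ, pow_succ, mul_add, e]
      simp only [remaining]
      refine le_of_eq ?_
      field_simp
      ring
    · rintro ⟨m₁, ψ, t₁⟩ ⟨h1, h2, h3, h4, h5⟩
      simp only at h1 h3 h4 h5
      refine Spec.of_det (Det.arith ?_)
      have e30 : m₁ 30 = i := by rw [h1 30 (by norm_num), hi30]
      have e9 : m₁ 9 = 1 := ((hc.frame hm).frame h1).r9
      simp only [Addr.eval_ofNat, ArithOp.eval, e30, e9]
      refine ⟨⟨(hm.trans (h1.mono (by norm_num))).update (r := 30) (by norm_num) _, by simp, h2, ?_,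
        ?_, ?_⟩, ?_⟩
      · simpa [Holds] using h3
      · simpa using hy.trans h4
      · rw [Finset.sum_range_succ]
        omega
      · simp [remaining]
  · rintro b ⟨h1, -, h2, h3, h4, h5⟩
    refine ⟨⟨h1, h2, h3, h4, ?_⟩, by simp⟩
    unfold climbCost
    omega

open Classical in
/-- Indicates that there is a node of better score. -/
def missed (x : Fin H → SpinConfig n) (p : Params) (W : ℕ → ℝ) (b : QBranch) : ℝ :=
  if remaining x p W b = 0 then 0 else 1

/-- Markov's inequality in its simplest form: a count that does not vanish is at least one. -/
theorem missed_le (b : QBranch) : missed x p W b ≤ remaining x p W b := by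
  unfold missed remaining
  split_ifs with h
  · exact h.ge
  · have h1 : better p.q (nodeScore x p W) (b.mem 28) ≠ 0 := fun h' => h (by exact_mod_cast h')
    exact_mod_cast Nat.one_le_iff_ne_zero.2 h1

theorem missed_le_one (b : QBranch) : missed x p W b ≤ 1 := by
  unfold missed
  split_ifs <;> norm_num

/-- Every climb fails with probability at most `1/2`, whatever score it starts from, and the score
in memory never decreases. So each repetition halves the probability of a miss. -/
theorem spec_maximize (hp : p.H = H) (hc : Consts p m) (hW : HasWeights p W m)
    (hhalf : 2 * better p.q (nodeScore x p W) 0 ≤ 2 ^ p.q) (hlev : 16 * 2 ^ p.q ≤ 4 ^ p.levels)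
    {z : ℂ} (hz : z ≠ 0) :
    Spec x Algo.maximize ⟨m, Finsupp.single (enc 0) z, t⟩
      (fun b => Frame 31 m b.mem ∧ Cleared b ∧ Holds x p W b.mem ∧
        b.time ≤ t + 2 + p.reps * (climbCost H p.q p.levels + 1))
      (missed x p W) ((1 / 2) ^ p.reps) := by
  unfold Algo.maximize
  refine Spec.seq_det (Det.const ?_)
  refine (Spec.loop (fun i b => Frame 31 m b.mem ∧ Cleared b ∧ Holds x p W b.mem ∧
      b.time ≤ t + 2 + i * (climbCost H p.q p.levels + 1))
    (fun i b => (1 / 2) ^ (p.reps - i) * missed x p W b) p.reps ?_ ?_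
      ?_).mono (c := (1 / 2) ^ p.reps) ?_ le_rfl
  · simp [hc.r8]
  · refine ⟨⟨(Frame.refl 31 m).update (r := 28) (by norm_num) _, ⟨z, hz, rfl⟩, ?_, ?_⟩, ?_⟩
    · simp [Holds, QBranch.tick]
    · simp [QBranch.tick]
    · rw [Nat.sub_zero]
      exact mul_le_of_le_one_right (by positivity) (missed_le_one _)
  · rintro i hi ⟨m', ψ, t'⟩ ⟨hm, ⟨z', hz', rfl : ψ = _⟩, hs', ht⟩
    simp only at hm hs' ht
    obtain ⟨d, hd⟩ : ∃ d, p.reps - i = d + 1 := ⟨p.reps - i - 1, by omega⟩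
    have hd' : p.reps - (i + 1) = d := by omega
    rw [hd, hd']
    have hsp := (spec_climb (x := x) (t := t' + 1) hp (hc.frame hm) (hW.frame (by norm_num) hm) hs'
      hhalf hlev hz').mono (φ' := remaining x p W) (J' := fun b => (Frame 31 m b.mem ∧ Cleared b ∧
      Holds x p W b.mem ∧ b.time ≤ t + 2 + (i + 1) * (climbCost H p.q p.levels + 1)) ∧
        m' 28 ≤ b.mem 28) (by
        rintro b ⟨h1, h2, h3, h4, h5⟩
        refine ⟨⟨⟨hm.trans h1, h2, h3, ?_⟩, h4⟩, le_rfl⟩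
        rw [Nat.succ_mul]
        omega) le_rfl
    -- If the maximum has been reached already, monotonicity of the score keeps it; otherwise the
    -- expectation bound `1/2` for the climb applies.
    by_cases h0 : remaining x p W ⟨m', Finsupp.single (enc 0) z', t'⟩ = 0
    · refine (Spec.of_forall hsp.1 (φ := fun b => (1 / 2) ^ d * missed x p W b)
        (c := 0) ?_).mono (fun b hb => ⟨hb.1, le_rfl⟩) ?_
      · rintro b ⟨-, hy⟩
        have h1 : (better p.q (nodeScore x p W) (m' 28) : ℝ) = 0 := h0
        have h2 : better p.q (nodeScore x p W) (b.mem 28) = 0 := by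
          have := better_anti (q := p.q) (g := nodeScore x p W) hy
          have h3 : better p.q (nodeScore x p W) (m' 28) = 0 := by exact_mod_cast h1
          omega
        simp [missed, remaining, h2]
      · simp [missed, h0]
    · have h1 : missed x p W ⟨m', Finsupp.single (enc 0) z', t'⟩ = 1 := if_neg h0
      refine (hsp.affine (φ' := fun b => (1 / 2) ^ d * missed x p W b) (k := (1 / 2) ^ d)
        (d := 0) (by positivity) (fun b _ => ?_) ?_).mono (fun b hb => ⟨hb.1, le_rfl⟩) le_rfl
      · rw [add_zero]
        exact mul_le_mul_of_nonneg_left (missed_le b) (by positivity)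
      · simp only [h1]
        rw [pow_succ]
        linarith
  · rintro b ⟨h1, h2, h3, h4⟩
    exact ⟨⟨h1, h2, h3, h4⟩, by simp⟩

end

/-! ### The computation of the weights -/

namespace Algo

open QProg in
/-- Reads the value of the node in register `32` in the sample with the number in register `20`. -/
def readSample : QProg :=
  gate (.load false 1 32) ;; gate (.query false 20 1 3) ;; measure 3 33 ;;
  gate (.query true 20 1 3) ;; gate (.load true 1 32)

open QProg in
/-- Encodes the values of the listed nodes in a sample by a number. -/
def encode : QProg :=
  const 34 0 ;; arith .plus 35 17 10 ;;
  loop 40 (arith .plus 32 (.indirect 35) 10 ;; readSample ;; arith .times 34 34 12 ;;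
    arith .plus 34 34 33 ;; arith .plus 34 34 9 ;; arith .plus 35 35 9)

open QProg in
/-- Computes the addresses of the counter and of the sum for the code of a sample. -/
def locate : QProg :=
  encode ;; arith .times 36 34 12 ;; arith .plus 36 36 13 ;; arith .plus 36 36 9 ;;
  arith .plus 37 36 9

open QProg in
/-- Sets the counters and sums that are used to zero. -/
def reset : QProg :=
  const 20 0 ;;
  loop 1 (locate ;; const (.indirect 36) 0 ;; const (.indirect 37) 0 ;; arith .plus 20 20 9)

open QProg in
/-- Counts the samples with each code, and adds up their values. -/
def tally : QProg :=
  const 20 0 ;;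
  loop 1 (locate ;; arith .plus 32 2 10 ;; readSample ;;
    arith .plus (.indirect 36) (.indirect 36) 9 ;; arith .plus (.indirect 37) (.indirect 37) 33 ;;
    arith .plus 20 20 9)

open QProg in
/-- Stores the deviations from the conditional means. -/
def deviate : QProg :=
  const 20 0 ;; arith .plus 38 13 10 ;;
  loop 1 (locate ;; arith .plus 32 2 10 ;; readSample ;;
    arith .divide 39 (.indirect 37) (.indirect 36) ;; arith .minus (.indirect 38) 33 39 ;;
    arith .plus 20 20 9 ;; arith .plus 38 38 12)

/-- Computes the weights for the list of nodes in memory. -/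
def weights : QProg := reset ;; tally ;; deviate

end Algo

/-- The memories agree outside of the registers from `i` to `j - 1`. -/
def Same (i j : ℕ) (m m' : Registers) : Prop := ∀ r, r < i ∨ j ≤ r → m' r = m r

theorem Same.update {i j : ℕ} {m m' : Registers} (h : Same i j m m') {r : ℕ} (hr : i ≤ r ∧ r < j)
    (a : ℝ) : Same i j m (Function.update m' r a) := fun k hk => by
  rw [Function.update_of_ne (by omega), h k hk]

theorem Same.mono {i j i' j' : ℕ} {m m' : Registers} (h : Same i j m m') (hi : i' ≤ i) (hj : j ≤ j') :
    Same i' j' m m' := fun r hr => h r (by omega)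

theorem Same.consts {p : Params} {i j : ℕ} {m m' : Registers} (h : Same i j m m') (hi : 20 ≤ i)
    (hc : Consts p m) : Consts p m' := hc.frame (K := j) fun r hr => h r (by omega)

/-- The memories agree outside of the scratch registers below `40` and of the arrays. -/
def Outer (p : Params) (m m' : Registers) : Prop := ∀ r, r < 20 ∨ (40 ≤ r ∧ r < p.base) → m' r = m r

theorem Outer.refl (p : Params) (m : Registers) : Outer p m m := fun _ _ => rfl

theorem Outer.update {p : Params} {m m' : Registers} (h : Outer p m m') {r : ℕ}
    (hr : (20 ≤ r ∧ r < 40) ∨ p.base ≤ r) (a : ℝ) : Outer p m (Function.update m' r a) :=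
  fun k hk => by
    rw [Function.update_of_ne (by unfold Params.base at *; omega), h k hk]

theorem Outer.trans {p : Params} {m m' m'' : Registers} (h : Outer p m m') (h' : Outer p m' m'') :
    Outer p m m'' := fun r hr => (h' r hr).trans (h r hr)

theorem Same.outer {p : Params} {i j : ℕ} {m m' : Registers} (h : Same i j m m') (hi : 20 ≤ i)
    (hj : j ≤ 40) : Outer p m m' := fun r hr => h r (by omega)

theorem Frame.outer {p : Params} {K : ℕ} {m m' : Registers} (h : Frame K m m')
    (hj : K ≤ 40) : Outer p m m' := fun r hr => h r (by omega)

theorem Consts.congr {p : Params} {m m' : Registers} (hc : Consts p m)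
    (h : ∀ r < 20, m' r = m r) : Consts p m' := by
  constructor <;> rw [h _ (by norm_num)]
  exacts [hc.r1, hc.r2, hc.r5, hc.r6, hc.r7, hc.r8, hc.r9, hc.r10, hc.r11, hc.r12, hc.r13, hc.r14,
    hc.r15, hc.r16, hc.r17, hc.r19]

theorem Outer.consts {p : Params} {m m' : Registers} (h : Outer p m m') (hc : Consts p m) :
    Consts p m' := hc.congr fun r hr => h r (Or.inl hr)

section

variable {n H : ℕ} {x : Fin H → SpinConfig n} {m : Registers} {ψ : QState} {t : ℕ} {p : Params}
  {J : QBranch → Prop}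

/-- With address and value supplied explicitly, the memory remains a chain of updates at known
addresses. -/
theorem Det.arith_to {o : ArithOp} {r a d : Addr} (A : ℕ) (v : ℝ) (hA : r.eval m = A)
    (hv : o.eval (m (a.eval m)) (m (d.eval m)) = v) (h : J ⟨Function.update m A v, ψ, t + 1⟩) :
    Det x (.arith o r a d) ⟨m, ψ, t⟩ J := Det.arith (by subst hA hv; exact h)

theorem Det.const_to {r : Addr} {k : ℕ} (A : ℕ) (hA : r.eval m = A)
    (h : J ⟨Function.update m A (k : ℝ), ψ, t + 1⟩) : Det x (.const r k) ⟨m, ψ, t⟩ J :=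
  Det.const (by subst hA; exact h)


/-! ### Codes of samples -/

theorem sampleValue_natCast (x : Fin H → SpinConfig n) (k : Fin H) (v : Fin n) :
    sampleValue x ((k : ℕ) : ℝ) ((v : ℕ) : ℝ) = spin (x k v) := by
  rw [sampleValue, Finset.sum_eq_single k, Finset.sum_eq_single v]
  · simp
  · intro w _ hw
    rw [if_neg]
    rintro ⟨-, h⟩
    exact hw (Fin.ext (by exact_mod_cast h.symm))
  · simp
  · intro l _ hl
    refine Finset.sum_eq_zero fun w _ => if_neg ?_
    rintro ⟨h, -⟩
    exact hl (Fin.ext (by exact_mod_cast h.symm))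
  · simp

theorem sampleValue_eq_zero (x : Fin H → SpinConfig n) (a : ℝ) {b : ℝ}
    (hb : ∀ v : Fin n, b ≠ ((v : ℕ) : ℝ)) : sampleValue x a b = 0 :=
  Finset.sum_eq_zero fun _ _ => Finset.sum_eq_zero fun v _ => if_neg fun h => hb v h.2

theorem sampleValue_eq_zero' (x : Fin H → SpinConfig n) {a : ℝ} (b : ℝ)
    (ha : ∀ k : Fin H, a ≠ ((k : ℕ) : ℝ)) : sampleValue x a b = 0 :=
  Finset.sum_eq_zero fun k _ => Finset.sum_eq_zero fun _ _ => if_neg fun h => ha k h.1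

theorem sampleValue_trichotomy (x : Fin H → SpinConfig n) (a b : ℝ) :
    sampleValue x a b = 0 ∨ sampleValue x a b = 1 ∨ sampleValue x a b = -1 := by
  by_cases ha : ∃ k : Fin H, a = ((k : ℕ) : ℝ)
  · by_cases hb : ∃ v : Fin n, b = ((v : ℕ) : ℝ)
    · obtain ⟨k, rfl⟩ := ha
      obtain ⟨v, rfl⟩ := hb
      rw [sampleValue_natCast]
      exact Or.inr (spin_eq_one_or _)
    · push Not at hb
      exact Or.inl (sampleValue_eq_zero x a hb)
  · push Not at ha
    exact Or.inl (sampleValue_eq_zero' x b ha)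

/-- The digit that encodes a value. -/
def digit (s : ℝ) : ℕ := ⌊s + 1⌋₊

theorem cast_digit (x : Fin H → SpinConfig n) (a b : ℝ) :
    (digit (sampleValue x a b) : ℝ) = sampleValue x a b + 1 ∧ digit (sampleValue x a b) < 3 := by
  rcases sampleValue_trichotomy x a b with h | h | h <;> rw [h, digit] <;> norm_num

/-- The code of the values of the first `i` nodes of a list in a sample. -/
def codeOf (x : Fin H → SpinConfig n) (e : ℕ → ℝ) (l : ℕ) : ℕ → ℕ
  | 0 => 0
  | i + 1 => 3 * codeOf x e l i + digit (sampleValue x l (e i))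

/-- The digits are below three, so a code determines its last digit and the preceding code. -/
theorem codeOf_eq_iff (x : Fin H → SpinConfig n) (e : ℕ → ℝ) (l l' i : ℕ) :
    codeOf x e l i = codeOf x e l' i
      ↔ ∀ j < i, sampleValue x (l : ℝ) (e j) = sampleValue x (l' : ℝ) (e j) := by
  induction i with
  | zero => simp [codeOf]
  | succ i ih =>
    obtain ⟨h1, h2⟩ := cast_digit x (l : ℝ) (e i)
    obtain ⟨h1', h2'⟩ := cast_digit x (l' : ℝ) (e i)
    have hd : digit (sampleValue x (l : ℝ) (e i)) = digit (sampleValue x (l' : ℝ) (e i)) ↔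
        sampleValue x (l : ℝ) (e i) = sampleValue x (l' : ℝ) (e i) := by
      constructor
      · intro h
        rw [h, h1'] at h1
        linarith
      · intro h; rw [h]
    rw [codeOf, codeOf, Nat.forall_lt_succ_right, ← ih, ← hd]
    omega

/-! ### Correctness of the subroutines -/

theorem det_readSample {z : ℂ} (hz : z ≠ 0) :
    Det x Algo.readSample ⟨m, Finsupp.single (enc 0) z, t⟩ fun b =>
      b = ⟨Function.update m 33 (sampleValue x (m 20) (m 32)), Finsupp.single (enc 0) z, t + 5⟩ := by
  -- A basis vector is viewed as a family with one member, so that the gate rules for families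
  -- apply.
  have hs : ∀ c, family {()} (fun _ => c) (fun _ => z) = Finsupp.single c z := fun c =>
    family_singleton ..
  unfold Algo.readSample
  rw [← hs]
  refine Det.seq (Det.gate_family trivial (Det.seq (Det.gate_family trivial (Det.seq ?_))))
  rw [hs]
  refine Det.measure_single hz (Det.seq ?_)
  rw [← hs]
  refine Det.gate_family trivial (Det.gate_family trivial ?_)
  rw [hs, hs, QBranch.mk.injEq]
  refine ⟨?_, ?_, rfl⟩
  · simp [QGate.move, enc]
  · simp [QGate.move, enc]

/-- The memory holds the list `e` of `len` nodes. -/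
structure HasList (e : ℕ → ℝ) (len : ℕ) (m : Registers) : Prop where
  length : m 40 = len
  entry : ∀ i < len, m (50 + i) = e i

theorem HasList.congr {e : ℕ → ℝ} {len : ℕ} {m m' : Registers} (h : HasList e len m)
    (hlen : len ≤ p.n) (hm : Outer p m m') : HasList e len m' :=
  ⟨by rw [hm 40 (by unfold Params.base; omega), h.length],
    fun i hi => by rw [hm (50 + i) (by unfold Params.base; omega), h.entry i hi]⟩

theorem det_encode (hc : Consts p m) {e : ℕ → ℝ} {len l : ℕ} (hlen : len ≤ p.n)
    (he : HasList e len m) (hl : m 20 = l) {z : ℂ} (hz : z ≠ 0) :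
    Det x Algo.encode ⟨m, Finsupp.single (enc 0) z, t⟩ fun b => ∃ m', Same 32 36 m m' ∧
      m' 34 = codeOf x e l len ∧ b = ⟨m', Finsupp.single (enc 0) z, t + (11 * len + 3)⟩ := by
  unfold Algo.encode
  refine Det.seq (Det.const_to 34 rfl (Det.seq (Det.arith_to 35 50 rfl ?_ ?_)))
  · simp [ArithOp.eval, hc.r17, hc.r10]
  refine (Det.loop (fun i b => ∃ m', Same 32 36 m m' ∧ m' 35 = ((50 + i : ℕ) : ℝ) ∧
    m' 34 = codeOf x e l i ∧ b = ⟨m', Finsupp.single (enc 0) z, t + 3 + 11 * i⟩) len ?_ ?_ ?_).mono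
      ?_
  · simp [he.length]
  · refine ⟨_, (?_ : Same 32 36 m _), ?_, ?_, QBranch.ext' rfl rfl rfl⟩
    · exact (Same.update (fun _ _ => rfl) (by norm_num) _).update (by norm_num) _
    · simp
    · simp [codeOf]
  · rintro i hi _ ⟨m', hm, h35, h34, rfl⟩
    have hc' := hm.consts (by norm_num) hc
    have he' := he.congr hlen (hm.outer (p := p) (by norm_num) (by norm_num))
    refine Det.seq (Det.arith_to 32 (e i) rfl ?_ (Det.seq ((det_readSample hz).mono ?_)))
    · simp [ArithOp.eval, Addr.eval_indirect, h35, hc'.r10, ← he'.entry i hi, -Nat.cast_add]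
    rintro _ rfl
    have h20 : Function.update m' 32 (e i) 20 = l := by
      rw [Function.update_of_ne (by norm_num), hm 20 (by norm_num), hl]
    rw [h20, Function.update_self]
    refine Det.seq (Det.arith_to 34 (codeOf x e l i * 3) rfl ?_ (Det.seq (Det.arith_to 34
      (codeOf x e l i * 3 + sampleValue x l (e i)) rfl ?_ (Det.seq (Det.arith_to 34
      (codeOf x e l (i + 1) : ℕ) rfl ?_ (Det.arith_to 35 (50 + (i + 1) : ℕ) rfl ?_ ?_))))))
    · simp [ArithOp.eval, h34, hc'.r12]
    · simp [ArithOp.eval]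
    · simp [ArithOp.eval, hc'.r9, codeOf, (cast_digit x _ _).1]
      ring
    · simp [ArithOp.eval, hc'.r9, h35]
      ring
    · refine ⟨_, (?_ : Same 32 36 m _), ?_, ?_, QBranch.ext' rfl rfl (by ring)⟩
      · exact (((((hm.update (by norm_num) _).update (by norm_num) _).update (by norm_num) _).update
          (by norm_num) _).update (by norm_num) _).update (by norm_num) _
      · simp
      · simp
  · rintro _ ⟨m', hm, -, h34, rfl⟩
    exact ⟨m', hm, h34, QBranch.ext' rfl rfl (by ring)⟩

/-- The address of the counter for a code. -/
def Params.slot (p : Params) (κ : ℕ) : ℕ := p.base + 3 * κ + 1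

theorem det_locate (hc : Consts p m) {e : ℕ → ℝ} {len l : ℕ} (hlen : len ≤ p.n)
    (he : HasList e len m) (hl : m 20 = l) {z : ℂ} (hz : z ≠ 0) :
    Det x Algo.locate ⟨m, Finsupp.single (enc 0) z, t⟩ fun b => ∃ m', Same 32 38 m m' ∧
      m' 36 = p.slot (codeOf x e l len) ∧ m' 37 = (p.slot (codeOf x e l len) + 1 : ℕ) ∧
      b = ⟨m', Finsupp.single (enc 0) z, t + (11 * len + 7)⟩ := by
  unfold Algo.locate
  refine Det.seq ((det_encode hc hlen he hl hz).mono ?_)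
  rintro _ ⟨m', hm, h34, rfl⟩
  have hc' := hm.consts (by norm_num) hc
  set κ := codeOf x e l len
  refine Det.seq (Det.arith_to 36 (κ * 3) rfl ?_ (Det.seq (Det.arith_to 36 (κ * 3 + p.base) rfl ?_
    (Det.seq (Det.arith_to 36 (p.slot κ) rfl ?_ (Det.arith_to 37 (p.slot κ + 1 : ℕ) rfl ?_ ?_))))))
  · simp [ArithOp.eval, h34, hc'.r12]
  · simp [ArithOp.eval, hc'.r13]
  · simp [ArithOp.eval, hc'.r9, Params.slot]
    ring
  · simp [ArithOp.eval, hc'.r9]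
  · refine ⟨_, (?_ : Same 32 38 m _), ?_, ?_, QBranch.ext' rfl rfl (by ring)⟩
    · exact ((((hm.mono le_rfl (by norm_num)).update (by norm_num) _).update (by norm_num) _).update
        (by norm_num) _).update (by norm_num) _
    · simp
    · simp

theorem Params.slot_ge (p : Params) (κ : ℕ) : p.base ≤ p.slot κ := by unfold Params.slot; omega

theorem Params.base_ge (p : Params) : 50 ≤ p.base := by unfold Params.base; omega

theorem Params.slot_inj {p : Params} {κ κ' : ℕ} : p.slot κ = p.slot κ' ↔ κ = κ' := by
  unfold Params.slot; omega

/-- Weights, counters and sums occupy the three residue classes of addresses above `p.base` modulo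
three. The tables can therefore be indexed by codes of any size without collisions. -/
theorem Params.slot_ne (p : Params) (κ κ' : ℕ) : p.slot κ ≠ p.slot κ' + 1 := by
  unfold Params.slot; omega

/-- Only the slots that belong to the code of some sample are cleared. The number of possible codes
is exponential in `len`, and the other slots are never read. -/
theorem det_reset (hp : p.H = H) (hc : Consts p m) {e : ℕ → ℝ} {len : ℕ} (hlen : len ≤ p.n)
    (he : HasList e len m) {z : ℂ} (hz : z ≠ 0) :
    Det x Algo.reset ⟨m, Finsupp.single (enc 0) z, t⟩ fun b => ∃ m', Outer p m m' ∧
      (∀ l < H, m' (p.slot (codeOf x e l len)) = 0 ∧ m' (p.slot (codeOf x e l len) + 1) = 0) ∧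
      b = ⟨m', Finsupp.single (enc 0) z, t + (H * (11 * len + 11) + 2)⟩ := by
  unfold Algo.reset
  refine Det.seq (Det.const_to 20 rfl ?_)
  refine (Det.loop (fun i b => ∃ m', Outer p m m' ∧ m' 20 = i ∧
      (∀ l < i, m' (p.slot (codeOf x e l len)) = 0 ∧ m' (p.slot (codeOf x e l len) + 1) = 0) ∧
      b = ⟨m', Finsupp.single (enc 0) z, t + 2 + i * (11 * len + 11)⟩) H ?_ ?_ ?_).mono ?_
  · simp [hc.r1, hp]
  · refine ⟨_, (?_ : Outer p m _), ?_, ?_, QBranch.ext' rfl rfl (by simp)⟩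
    · exact (Outer.refl p m).update (by norm_num) _
    · simp
    · simp
  · rintro i hi _ ⟨m', hm, h20, hz', rfl⟩
    refine Det.seq ((det_locate (hm.consts hc) hlen (he.congr hlen hm) h20 hz).mono ?_)
    rintro _ ⟨m₁, h₁, h36, h37, rfl⟩
    set κ := codeOf x e i len with hκ
    have hb := p.slot_ge κ
    have hb' := p.base_ge
    have hc₁ := (h₁.outer (p := p) (by norm_num) (by norm_num)).consts (hm.consts hc)
    refine Det.seq (Det.const_to (p.slot κ) ?_ (Det.seq (Det.const_to (p.slot κ + 1) ?_
      (Det.arith_to 20 (i + 1 : ℕ) rfl ?_ ?_))))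
    · rw [Addr.eval_indirect, h36, Nat.floor_natCast]
    · rw [Addr.eval_indirect, Function.update_of_ne (by omega), h37, Nat.floor_natCast]
    · have e20 : m₁ 20 = i := by rw [h₁ 20 (by norm_num), h20]
      simp only [Addr.eval_ofNat, ArithOp.eval]
      rw [Function.update_of_ne (by omega), Function.update_of_ne (by omega),
        Function.update_of_ne (by omega), Function.update_of_ne (by omega), e20, hc₁.r9]
      push_cast
      rfl
    · refine ⟨_, (?_ : Outer p m _), by simp, ?_, QBranch.ext' rfl rfl (by ring)⟩
      · exact (((hm.trans (h₁.outer (by norm_num) (by norm_num))).update (by omega) _).update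
          (by omega) _).update (by norm_num) _
      · intro l hl
        have hs := p.slot_ge (codeOf x e l len)
        have hl' : codeOf x e l len ≠ κ → l < i := fun h => by
          rcases Nat.lt_succ_iff_lt_or_eq.1 hl with h' | h'
          · exact h'
          · exact absurd (by rw [h', hκ]) h
        have hn1 := p.slot_ne (codeOf x e l len) κ
        have hn2 := p.slot_ne κ (codeOf x e l len)
        rw [Function.update_of_ne (by omega), Function.update_of_ne (by omega)]
        by_cases h : codeOf x e l len = κ
        · rw [h]
          refine ⟨by simp, ?_⟩
          rw [Function.update_of_ne (by omega), Function.update_self]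
          simp
        · have hne : p.slot (codeOf x e l len) ≠ p.slot κ := fun h' => h (Params.slot_inj.1 h')
          rw [Function.update_of_ne (by omega), Function.update_of_ne (by omega),
            Function.update_of_ne (by omega), Function.update_of_ne (by omega),
            h₁ _ (by omega), h₁ _ (by omega)]
          exact hz' l (hl' h)
  · rintro _ ⟨m', hm, -, h, rfl⟩
    exact ⟨m', hm, h, QBranch.ext' rfl rfl (by ring)⟩

/-- The number of samples among the first `i` with the same code as the sample `l`. -/
def tallyCount (x : Fin H → SpinConfig n) (e : ℕ → ℝ) (len i l : ℕ) : ℝ :=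
  ∑ k ∈ Finset.range i, if codeOf x e k len = codeOf x e l len then 1 else 0

/-- The sum of the values of the node `u` over these samples. -/
def tallySum (x : Fin H → SpinConfig n) (u : ℕ) (e : ℕ → ℝ) (len i l : ℕ) : ℝ :=
  ∑ k ∈ Finset.range i, if codeOf x e k len = codeOf x e l len then sampleValue x k u else 0

theorem det_tally (hp : p.H = H) (hc : Consts p m) {e : ℕ → ℝ} {len : ℕ} (hlen : len ≤ p.n)
    (he : HasList e len m) (h0 : ∀ l < H, m (p.slot (codeOf x e l len)) = 0 ∧
      m (p.slot (codeOf x e l len) + 1) = 0) {z : ℂ} (hz : z ≠ 0) :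
    Det x Algo.tally ⟨m, Finsupp.single (enc 0) z, t⟩ fun b => ∃ m', Outer p m m' ∧
      (∀ l < H, m' (p.slot (codeOf x e l len)) = tallyCount x e len H l ∧
        m' (p.slot (codeOf x e l len) + 1) = tallySum x p.u e len H l) ∧
      b = ⟨m', Finsupp.single (enc 0) z, t + (H * (11 * len + 17) + 2)⟩ := by
  unfold Algo.tally
  refine Det.seq (Det.const_to 20 rfl ?_)
  refine (Det.loop (fun i b => ∃ m', Outer p m m' ∧ m' 20 = i ∧
      (∀ l < H, m' (p.slot (codeOf x e l len)) = tallyCount x e len i l ∧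
        m' (p.slot (codeOf x e l len) + 1) = tallySum x p.u e len i l) ∧
      b = ⟨m', Finsupp.single (enc 0) z, t + 2 + i * (11 * len + 17)⟩) H ?_ ?_ ?_).mono ?_
  · simp [hc.r1, hp]
  · refine ⟨_, (?_ : Outer p m _), ?_, ?_, QBranch.ext' rfl rfl (by simp)⟩
    · exact (Outer.refl p m).update (by norm_num) _
    · simp
    · intro l hl
      have hb := p.slot_ge (codeOf x e l len)
      have hb' := p.base_ge
      dsimp only
      rw [Function.update_of_ne (by omega), Function.update_of_ne (by omega), (h0 l hl).1,
        (h0 l hl).2]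
      simp [tallyCount, tallySum]
  · rintro i hi _ ⟨m', hm, h20, hv, rfl⟩
    refine Det.seq ((det_locate (hm.consts hc) hlen (he.congr hlen hm) h20 hz).mono ?_)
    rintro _ ⟨m₁, h₁, h36, h37, rfl⟩
    set κ := codeOf x e i len with hκ
    have hb := p.slot_ge κ
    have hb' := p.base_ge
    have hc₁ := (h₁.outer (p := p) (by norm_num) (by norm_num)).consts (hm.consts hc)
    have e20 : m₁ 20 = i := by rw [h₁ 20 (by norm_num), h20]
    have ev1 : m₁ (p.slot κ) = tallyCount x e len i i := by rw [h₁ _ (by omega), (hv i hi).1]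
    have ev2 : m₁ (p.slot κ + 1) = tallySum x p.u e len i i := by rw [h₁ _ (by omega), (hv i hi).2]
    refine Det.seq (Det.arith_to 32 p.u rfl ?_ (Det.seq ((det_readSample hz).mono ?_)))
    · simp [ArithOp.eval, hc₁.r2, hc₁.r10]
    rintro _ rfl
    rw [Function.update_self, Function.update_of_ne (by norm_num), e20]
    have e36 : ∀ a b : ℝ, Addr.eval (Function.update (Function.update m₁ 32 a) 33 b) (.indirect 36)
        = p.slot κ := fun a b => by
      rw [Addr.eval_indirect, Function.update_of_ne (by norm_num),
        Function.update_of_ne (by norm_num), h36, Nat.floor_natCast]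
    have e37 : ∀ a b c : ℝ, Addr.eval (Function.update (Function.update (Function.update m₁ 32 a)
        33 b) (p.slot κ) c) (.indirect 37) = p.slot κ + 1 := fun a b c => by
      rw [Addr.eval_indirect, Function.update_of_ne (by omega), Function.update_of_ne (by norm_num),
        Function.update_of_ne (by norm_num), h37, Nat.floor_natCast]
    refine Det.seq (Det.arith_to (p.slot κ) (tallyCount x e len i i + 1) (e36 _ _) ?_ (Det.seq
      (Det.arith_to (p.slot κ + 1) (tallySum x p.u e len i i + sampleValue x i p.u) (e37 _ _ _) ?_
      (Det.arith_to 20 (i + 1 : ℕ) rfl ?_ ?_))))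
    · rw [e36]
      simp only [Addr.eval_ofNat, ArithOp.eval]
      rw [Function.update_of_ne (by omega), Function.update_of_ne (by omega),
        Function.update_of_ne (by omega), Function.update_of_ne (by omega), ev1, hc₁.r9]
    · rw [e37]
      simp only [Addr.eval_ofNat, ArithOp.eval]
      rw [Function.update_of_ne (by omega), Function.update_of_ne (by omega),
        Function.update_of_ne (by omega), Function.update_of_ne (by omega), ev2,
        Function.update_self]
    · simp only [Addr.eval_ofNat, ArithOp.eval]
      rw [Function.update_of_ne (by omega), Function.update_of_ne (by omega),
        Function.update_of_ne (by omega), Function.update_of_ne (by omega),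
        Function.update_of_ne (by omega), Function.update_of_ne (by omega),
        Function.update_of_ne (by omega), Function.update_of_ne (by omega), e20, hc₁.r9]
      push_cast
      rfl
    · refine ⟨_, (?_ : Outer p m _), by simp, ?_, QBranch.ext' rfl rfl (by ring)⟩
      · exact (((((hm.trans (h₁.outer (by norm_num) (by norm_num))).update (by omega) _).update
          (by omega) _).update (by omega) _).update (by omega) _).update (by norm_num) _
      · intro l hl
        have hs := p.slot_ge (codeOf x e l len)
        have hn1 := p.slot_ne (codeOf x e l len) κ
        have hn2 := p.slot_ne κ (codeOf x e l len)
        have t1 : tallyCount x e len (i + 1) l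
            = tallyCount x e len i l + if κ = codeOf x e l len then 1 else 0 :=
          Finset.sum_range_succ ..
        have t2 : tallySum x p.u e len (i + 1) l
            = tallySum x p.u e len i l + if κ = codeOf x e l len then sampleValue x i p.u else 0 :=
          Finset.sum_range_succ ..
        rw [t1, t2]
        -- A sample with the same code shares the slot of the sample `i`, and its tallies are the
        -- same.
        by_cases h : κ = codeOf x e l len
        · have c1 : tallyCount x e len i l = tallyCount x e len i i := by
            simp only [tallyCount, ← h, ← hκ]
          have c2 : tallySum x p.u e len i l = tallySum x p.u e len i i := by
            simp only [tallySum, ← h, ← hκ]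
          rw [← h, if_pos rfl, if_pos rfl, c1, c2]
          constructor
          · rw [Function.update_of_ne (by omega), Function.update_of_ne (by omega),
              Function.update_self]
          · rw [Function.update_of_ne (by omega), Function.update_self]
        · have hne : p.slot (codeOf x e l len) ≠ p.slot κ := fun h' =>
            h (Params.slot_inj.1 h').symm
          rw [if_neg h, if_neg h, add_zero, add_zero]
          rw [Function.update_of_ne (by omega), Function.update_of_ne (by omega),
            Function.update_of_ne (by omega), Function.update_of_ne (by omega),
            Function.update_of_ne (by omega), Function.update_of_ne (by omega),
            Function.update_of_ne (by omega), Function.update_of_ne (by omega),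
            Function.update_of_ne (by omega), Function.update_of_ne (by omega),
            h₁ _ (by omega), h₁ _ (by omega)]
          exact hv l hl
  · rintro _ ⟨m', hm, -, h, rfl⟩
    exact ⟨m', hm, h, QBranch.ext' rfl rfl (by ring)⟩

/-- The deviation of the value of the node `u` in the sample `l` from the conditional mean. -/
def weightOf (x : Fin H → SpinConfig n) (u : ℕ) (e : ℕ → ℝ) (len l : ℕ) : ℝ :=
  sampleValue x l u - tallySum x u e len H l / tallyCount x e len H l

theorem det_deviate (hp : p.H = H) (hc : Consts p m) {e : ℕ → ℝ} {len : ℕ} (hlen : len ≤ p.n)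
    (he : HasList e len m) (h0 : ∀ l < H, m (p.slot (codeOf x e l len)) = tallyCount x e len H l ∧
      m (p.slot (codeOf x e l len) + 1) = tallySum x p.u e len H l) {z : ℂ} (hz : z ≠ 0) :
    Det x Algo.deviate ⟨m, Finsupp.single (enc 0) z, t⟩ fun b => ∃ m', Outer p m m' ∧
      HasWeights p (weightOf x p.u e len) m' ∧
      b = ⟨m', Finsupp.single (enc 0) z, t + (H * (11 * len + 18) + 3)⟩ := by
  unfold Algo.deviate
  refine Det.seq (Det.const_to 20 rfl (Det.seq (Det.arith_to 38 p.base rfl ?_ ?_)))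
  · simp [ArithOp.eval, hc.r13, hc.r10]
  refine (Det.loop (fun i b => ∃ m', Outer p m m' ∧ m' 20 = i ∧ m' 38 = (p.base + 3 * i : ℕ) ∧
      (∀ l < H, m' (p.slot (codeOf x e l len)) = tallyCount x e len H l ∧
        m' (p.slot (codeOf x e l len) + 1) = tallySum x p.u e len H l) ∧
      (∀ l < i, m' (p.base + 3 * l) = weightOf x p.u e len l) ∧
      b = ⟨m', Finsupp.single (enc 0) z, t + 3 + i * (11 * len + 18)⟩) H ?_ ?_ ?_).mono ?_
  · simp [hc.r1, hp]
  · refine ⟨_, (?_ : Outer p m _), ?_, ?_, ?_, ?_, QBranch.ext' rfl rfl (by simp)⟩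
    · exact ((Outer.refl p m).update (by norm_num) _).update (by norm_num) _
    · simp
    · simp
    · intro l hl
      have hb := p.slot_ge (codeOf x e l len)
      have hb' := p.base_ge
      dsimp only
      rw [Function.update_of_ne (by omega), Function.update_of_ne (by omega),
        Function.update_of_ne (by omega), Function.update_of_ne (by omega)]
      exact h0 l hl
    · simp
  · rintro i hi _ ⟨m', hm, h20, h38, hv, hw, rfl⟩
    refine Det.seq ((det_locate (hm.consts hc) hlen (he.congr hlen hm) h20 hz).mono ?_)
    rintro _ ⟨m₁, h₁, h36, h37, rfl⟩
    set κ := codeOf x e i len with hκ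
    have hb := p.slot_ge κ
    have hb' := p.base_ge
    have hc₁ := (h₁.outer (p := p) (by norm_num) (by norm_num)).consts (hm.consts hc)
    have e20 : m₁ 20 = i := by rw [h₁ 20 (by norm_num), h20]
    have e38 : m₁ 38 = (p.base + 3 * i : ℕ) := by rw [h₁ 38 (by norm_num), h38]
    have ev1 : m₁ (p.slot κ) = tallyCount x e len H i := by rw [h₁ _ (by omega), (hv i hi).1]
    have ev2 : m₁ (p.slot κ + 1) = tallySum x p.u e len H i := by
      rw [h₁ _ (by omega), (hv i hi).2]
    refine Det.seq (Det.arith_to 32 p.u rfl ?_ (Det.seq ((det_readSample hz).mono ?_)))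
    · simp [ArithOp.eval, hc₁.r2, hc₁.r10]
    rintro _ rfl
    rw [Function.update_self, Function.update_of_ne (by norm_num), e20]
    have e36 : ∀ a b : ℝ, Addr.eval (Function.update (Function.update m₁ 32 a) 33 b) (.indirect 36)
        = p.slot κ := fun a b => by
      rw [Addr.eval_indirect, Function.update_of_ne (by norm_num),
        Function.update_of_ne (by norm_num), h36, Nat.floor_natCast]
    have e37 : ∀ a b : ℝ, Addr.eval (Function.update (Function.update m₁ 32 a) 33 b) (.indirect 37)
        = p.slot κ + 1 := fun a b => by
      rw [Addr.eval_indirect, Function.update_of_ne (by norm_num),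
        Function.update_of_ne (by norm_num), h37, Nat.floor_natCast]
    refine Det.seq (Det.arith_to 39 (tallySum x p.u e len H i / tallyCount x e len H i) rfl ?_
      (Det.seq (Det.arith_to (p.base + 3 * i) (weightOf x p.u e len i) ?_ ?_
      (Det.seq (Det.arith_to 20 (i + 1 : ℕ) rfl ?_
        (Det.arith_to 38 (p.base + 3 * (i + 1) : ℕ) rfl ?_ ?_))))))
    · rw [e36, e37]
      simp only [ArithOp.eval]
      rw [Function.update_of_ne (by omega), Function.update_of_ne (by omega),
        Function.update_of_ne (by omega), Function.update_of_ne (by omega), ev1, ev2]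
    · rw [Addr.eval_indirect, Function.update_of_ne (by omega), Function.update_of_ne (by norm_num),
        Function.update_of_ne (by norm_num), e38, Nat.floor_natCast]
    · simp [ArithOp.eval, weightOf]
    · simp only [Addr.eval_ofNat, ArithOp.eval]
      rw [Function.update_of_ne (by omega), Function.update_of_ne (by omega),
        Function.update_of_ne (by omega), Function.update_of_ne (by omega),
        Function.update_of_ne (by omega), Function.update_of_ne (by omega),
        Function.update_of_ne (by omega), Function.update_of_ne (by omega), e20, hc₁.r9]
      push_cast
      rfl
    · simp only [Addr.eval_ofNat, ArithOp.eval]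
      rw [Function.update_of_ne (by omega), Function.update_of_ne (by omega),
        Function.update_of_ne (by omega), Function.update_of_ne (by omega),
        Function.update_of_ne (by omega), Function.update_of_ne (by omega),
        Function.update_of_ne (by omega), Function.update_of_ne (by omega),
        Function.update_of_ne (by omega), Function.update_of_ne (by omega), e38, hc₁.r12]
      push_cast
      ring
    · refine ⟨_, (?_ : Outer p m _), by simp, by simp, ?_, ?_, QBranch.ext' rfl rfl (by ring)⟩
      · exact ((((((hm.trans (h₁.outer (by norm_num) (by norm_num))).update (by omega) _).update
          (by omega) _).update (by omega) _).update (by omega) _).update (by norm_num) _).update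
            (by norm_num) _
      · intro l hl
        have hs : p.slot (codeOf x e l len) = p.base + 3 * codeOf x e l len + 1 := rfl
        rw [← (hv l hl).1, ← (hv l hl).2]
        constructor
        · rw [Function.update_of_ne (by omega), Function.update_of_ne (by omega),
            Function.update_of_ne (by omega), Function.update_of_ne (by omega),
            Function.update_of_ne (by omega), Function.update_of_ne (by omega), h₁ _ (by omega)]
        · rw [Function.update_of_ne (by omega), Function.update_of_ne (by omega),
            Function.update_of_ne (by omega), Function.update_of_ne (by omega),
            Function.update_of_ne (by omega), Function.update_of_ne (by omega), h₁ _ (by omega)]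
      · intro l hl
        rw [Function.update_of_ne (by omega), Function.update_of_ne (by omega)]
        by_cases h : l = i
        · rw [h, Function.update_self]
        · rw [Function.update_of_ne (by omega), Function.update_of_ne (by omega),
            Function.update_of_ne (by omega), Function.update_of_ne (by omega), h₁ _ (by omega)]
          exact hw l (by omega)
  · rintro _ ⟨m', hm, -, -, -, h, rfl⟩
    exact ⟨m', hm, fun l hl => h l (hp ▸ hl), QBranch.ext' rfl rfl (by ring)⟩

/-- The cost of computing the weights. -/
def weightCost (H len : ℕ) : ℕ := H * (33 * len + 46) + 7

theorem det_weights (hp : p.H = H) (hc : Consts p m) {e : ℕ → ℝ} {len : ℕ} (hlen : len ≤ p.n)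
    (he : HasList e len m) {z : ℂ} (hz : z ≠ 0) :
    Det x Algo.weights ⟨m, Finsupp.single (enc 0) z, t⟩ fun b => ∃ m', Outer p m m' ∧
      HasWeights p (weightOf x p.u e len) m' ∧
      b = ⟨m', Finsupp.single (enc 0) z, t + weightCost H len⟩ := by
  unfold Algo.weights
  refine Det.seq ((det_reset hp hc hlen he hz).mono ?_)
  rintro _ ⟨m₁, h₁, hv₁, rfl⟩
  refine Det.seq ((det_tally hp (h₁.consts hc) hlen (he.congr hlen h₁) hv₁ hz).mono ?_)
  rintro _ ⟨m₂, h₂, hv₂, rfl⟩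
  have h₂' := h₁.trans h₂
  refine (det_deviate hp (h₂'.consts hc) hlen (he.congr hlen h₂') hv₂ hz).mono ?_
  rintro _ ⟨m₃, h₃, hw, rfl⟩
  exact ⟨m₃, h₂'.trans h₃, hw, QBranch.ext' rfl rfl (by unfold weightCost; ring)⟩

end

/-! ### Weights and empirical covariances -/

section

variable {n H : ℕ} {x : Fin H → SpinConfig n}

theorem sum_range_samples (f : ℕ → ℝ) : ∑ l ∈ Finset.range H, f l = ∑ k : Fin H, f k :=
  (Fin.sum_univ_eq_sum_range f H).symm

/-- The list `e` contains the nodes of the set `S`, and possibly entries that are not nodes. -/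
def Covers (e : ℕ → ℝ) (len : ℕ) (S : Finset (Fin n)) : Prop :=
  ∀ v : Fin n, v ∈ S ↔ ∃ i < len, e i = ((v : ℕ) : ℝ)

/-- An entry that is not a node reads as zero in every sample and separates nothing. The pruning
step relies on this when it deletes a node by overwriting its entry. -/
theorem codeOf_eq_iff_mem_agreeing {e : ℕ → ℝ} {len : ℕ} {S : Finset (Fin n)}
    (he : Covers e len S) (k l : Fin H) :
    codeOf x e l len = codeOf x e k len ↔ l ∈ agreeing x S k := by
  rw [codeOf_eq_iff, mem_agreeing]
  constructor
  · intro h w hw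
    obtain ⟨i, hi, hiw⟩ := (he w).1 hw
    have := h i hi
    rw [hiw, sampleValue_natCast, sampleValue_natCast] at this
    exact spin_injective this
  · intro h i hi
    by_cases hv : ∃ v : Fin n, e i = ((v : ℕ) : ℝ)
    · obtain ⟨v, hv⟩ := hv
      rw [hv, sampleValue_natCast, sampleValue_natCast, h v ((he v).2 ⟨i, hi, hv⟩)]
    · push Not at hv
      rw [sampleValue_eq_zero x _ hv, sampleValue_eq_zero x _ hv]

theorem weightOf_eq {e : ℕ → ℝ} {len : ℕ} {S : Finset (Fin n)} (he : Covers e len S) (u : Fin n)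
    (k : Fin H) : weightOf x u e len k = regResidual x u S k := by
  classical
  rw [weightOf, sampleValue_natCast, regResidual, empCondMean, tallySum, tallyCount,
    sum_range_samples, sum_range_samples]
  simp only [codeOf_eq_iff_mem_agreeing he, sampleValue_natCast]
  rw [← Finset.sum_filter, ← Finset.sum_filter]
  simp only [Finset.filter_mem_eq_inter, Finset.univ_inter, Finset.sum_const, nsmul_eq_mul, mul_one]

/-- This links the search to the greedy algorithm. The factor `H` is the reason why scores are
compared with the threshold `τ * H`. -/
theorem score_weightOf {e : ℕ → ℝ} {len : ℕ} {S : Finset (Fin n)} (he : Covers e len S)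
    (u v : Fin n) (hH : 0 < H) :
    score x (weightOf x u e len) ((v : ℕ) : ℝ) = empAvgCov x u v S * H := by
  rw [score, sum_range_samples, empAvgCov_eq, div_mul_cancel₀ _ (by positivity)]
  exact Finset.sum_congr rfl fun k _ => by rw [weightOf_eq he, sampleValue_natCast]

theorem score_weightOf_of_mem {e : ℕ → ℝ} {len : ℕ} {S : Finset (Fin n)} (he : Covers e len S)
    (u : Fin n) {v : Fin n} (hv : v ∈ S) : score x (weightOf x u e len) ((v : ℕ) : ℝ) = 0 := by
  rw [score, sum_range_samples, ← sum_residual_mul_spin_of_mem (x := x) (u := u) hv]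
  exact Finset.sum_congr rfl fun k _ => by rw [weightOf_eq he, sampleValue_natCast]

theorem score_eq_zero (W : ℕ → ℝ) {j : ℝ} (hj : ∀ v : Fin n, j ≠ ((v : ℕ) : ℝ)) :
    score x W j = 0 :=
  Finset.sum_eq_zero fun l _ => by rw [sampleValue_eq_zero x _ hj, mul_zero]

theorem nodeScore_eq_zero (p : Params) (W : ℕ → ℝ) {v : ℕ} (hv : n ≤ v) : nodeScore x p W v = 0 := by
  refine score_eq_zero W fun w h => ?_
  have : skip p.u v = w := by exact_mod_cast h
  unfold skip at this
  split_ifs at this <;> omega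

/-- Numbers from `n` on encode no node and have score zero, so at most `n` of the `2 ^ q ≥ 2 * n`
elements have positive score. The padding provides the condition `t ≤ N/2` for the Grover rounds. -/
theorem two_mul_better_zero_le {p : Params} (hq : 2 * n ≤ 2 ^ p.q) (W : ℕ → ℝ) :
    2 * better p.q (nodeScore x p W) 0 ≤ 2 ^ p.q := by
  have : better p.q (nodeScore x p W) 0 ≤ (Finset.range n).card := by
    refine Finset.card_le_card fun v hv => ?_
    rw [Finset.mem_filter] at hv
    by_contra h
    rw [Finset.mem_range, not_lt] at h
    rw [nodeScore_eq_zero p W h] at hv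
    exact lt_irrefl _ hv.2
  rw [Finset.card_range] at this
  omega

theorem exists_skip {u v : ℕ} (h : v ≠ u) : ∃ w ≤ v, skip u w = v := by
  rcases lt_or_gt_of_ne h with h | h
  · exact ⟨v, le_rfl, by simp [skip, h]⟩
  · refine ⟨v - 1, by omega, ?_⟩
    unfold skip
    split_ifs <;> omega

theorem skip_ne (u v : ℕ) : skip u v ≠ u := by
  unfold skip
  split_ifs <;> omega

/-- A search that did not miss anything returns the maximum. -/
theorem nodeScore_le_of_missed_eq_zero {p : Params} {W : ℕ → ℝ} {b : QBranch}
    (h : missed x p W b = 0) {v : ℕ} (hv : v < 2 ^ p.q) : nodeScore x p W v ≤ b.mem 28 := by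
  unfold missed remaining at h
  split_ifs at h with h0
  · have : better p.q (nodeScore x p W) (b.mem 28) = 0 := by exact_mod_cast h0
    rw [better, Finset.card_eq_zero, Finset.filter_eq_empty_iff] at this
    exact not_lt.1 (this (Finset.mem_range.2 hv))
  · norm_num at h

end

/-! ### The main loop of the greedy algorithm -/

namespace Algo

open QProg in
/-- One iteration of the main loop. Register `40` holds the number of nodes selected so far, and
register `41` tells whether the selection is complete. -/
def extend : QProg :=
  ifLe 41 10
    (weights ;; maximize ;;
      ifLe 14 28 (arith .plus 35 17 40 ;; arith .plus (.indirect 35) 29 10 ;; arith .plus 40 40 9)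
        (const 41 1))
    (const 20 0)

open QProg in
/-- The main loop. -/
def select : QProg := const 40 0 ;; const 41 0 ;; loop 5 extend

end Algo

/-- The set of nodes that are listed in memory. -/
def listed (n : ℕ) (m : Registers) : Finset (Fin n) :=
  {v | ∃ i ∈ Finset.range ⌊m 40⌋₊, m (50 + i) = ((v : ℕ) : ℝ)}

section

variable {n H : ℕ} {x : Fin H → SpinConfig n} {u : Fin n} {m : Registers} {t : ℕ} {p : Params}

/-- The memory holds a list of different nodes other than `u`. -/
structure Listing (u : Fin n) (m : Registers) (len : ℕ) : Prop where
  length : m 40 = len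
  inj : ∀ i < len, ∀ j < len, m (50 + i) = m (50 + j) → i = j
  node : ∀ i < len, ∃ v : Fin n, v ≠ u ∧ m (50 + i) = ((v : ℕ) : ℝ)

theorem Listing.mem_listed {len : ℕ} (h : Listing u m len) {v : Fin n} :
    v ∈ listed n m ↔ ∃ i < len, m (50 + i) = ((v : ℕ) : ℝ) := by
  simp [listed, h.length]

theorem Listing.lt {len : ℕ} (h : Listing u m len) : len < n := by
  have : Nonempty (Fin n) := ⟨u⟩
  choose! f hf using h.node
  have h1 : (Finset.range len).image (fun i => f i) ⊆ Finset.univ.erase u := by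
    intro v hv
    obtain ⟨i, hi, rfl⟩ := Finset.mem_image.1 hv
    exact Finset.mem_erase.2 ⟨(hf i (Finset.mem_range.1 hi)).1, Finset.mem_univ _⟩
  have h2 := Finset.card_le_card h1
  rw [Finset.card_image_of_injOn, Finset.card_range, Finset.card_erase_of_mem (Finset.mem_univ u),
    Finset.card_univ, Fintype.card_fin] at h2
  · have := u.pos
    omega
  · intro i hi j hj hij
    have hi' := Finset.mem_range.1 hi
    have hj' := Finset.mem_range.1 hj
    refine h.inj i hi' j hj' ?_
    rw [(hf i hi').2, (hf j hj').2]
    have : f i = f j := hij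
    rw [this]

theorem Listing.outer {len : ℕ} (hu : p.n = n) (h : Listing u m len) {m' : Registers}
    (hm : Outer p m m') : Listing u m' len ∧ listed n m' = listed n m := by
  have hl := h.lt
  have h40 : m' 40 = m 40 := hm 40 (by unfold Params.base; omega)
  have he : ∀ i < len, m' (50 + i) = m (50 + i) := fun i hi =>
    hm (50 + i) (by unfold Params.base; omega)
  have h1 : Listing u m' len := by
    refine ⟨h40.trans h.length, fun i hi j hj hij => ?_, fun i hi => ?_⟩
    · rw [he i hi, he j hj] at hij
      exact h.inj i hi j hj hij
    · rw [he i hi]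
      exact h.node i hi
  refine ⟨h1, ?_⟩
  ext v
  rw [h1.mem_listed, h.mem_listed]
  exact exists_congr fun i => and_congr_right fun hi => by rw [he i hi]

theorem Listing.covers {len : ℕ} (h : Listing u m len) :
    Covers (fun i => m (50 + i)) len (listed n m) := fun _ => h.mem_listed

/-- Appending a node to the list. -/
theorem Listing.append {len : ℕ} (h : Listing u m len) {v : Fin n} (hv : v ∉ listed n m)
    (hu : v ≠ u) {m' : Registers} (h40 : m' 40 = (len + 1 : ℕ))
    (hold : ∀ i < len, m' (50 + i) = m (50 + i)) (hnew : m' (50 + len) = ((v : ℕ) : ℝ)) :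
    Listing u m' (len + 1) ∧ listed n m' = insert v (listed n m) := by
  have hv' : ∀ i < len, m (50 + i) ≠ ((v : ℕ) : ℝ) := fun i hi hiv =>
    hv (h.mem_listed.2 ⟨i, hi, hiv⟩)
  have h1 : Listing u m' (len + 1) := by
    refine ⟨h40, fun i hi j hj hij => ?_, fun i hi => ?_⟩
    · rcases Nat.lt_succ_iff_lt_or_eq.1 hi with hi | rfl <;>
        rcases Nat.lt_succ_iff_lt_or_eq.1 hj with hj | rfl
      · rw [hold i hi, hold j hj] at hij
        exact h.inj i hi j hj hij
      · rw [hold i hi, hnew] at hij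
        exact absurd hij (hv' i hi)
      · rw [hold j hj, hnew] at hij
        exact absurd hij.symm (hv' j hj)
      · rfl
    · rcases Nat.lt_succ_iff_lt_or_eq.1 hi with hi | rfl
      · rw [hold i hi]
        exact h.node i hi
      · exact ⟨v, hu, hnew⟩
  refine ⟨h1, ?_⟩
  ext w
  rw [h1.mem_listed, Finset.mem_insert, h.mem_listed]
  constructor
  · rintro ⟨i, hi, hiw⟩
    rcases Nat.lt_succ_iff_lt_or_eq.1 hi with hi | rfl
    · exact Or.inr ⟨i, hi, by rw [← hold i hi, hiw]⟩
    · left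
      rw [hnew] at hiw
      exact Fin.ext (by exact_mod_cast hiw.symm)
  · rintro (rfl | ⟨i, hi, hiw⟩)
    · exact ⟨len, by omega, hnew⟩
    · exact ⟨i, by omega, by rw [hold i hi, hiw]⟩

/-- The parameters suit the samples and the node. -/
structure Params.Valid (p : Params) (H : ℕ) (u : Fin n) (τ : ℝ) : Prop where
  n_eq : p.n = n
  H_eq : p.H = H
  u_eq : p.u = u
  thr_eq : p.thr = τ * H
  qubits : 2 * n ≤ 2 ^ p.q
  levels : 16 * 2 ^ p.q ≤ 4 ^ p.levels
  pos : 0 < H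
  τ_pos : 0 < τ

/-- The state between the iterations of the main loop, after `i` iterations. -/
structure Selecting (m : Registers) (u : Fin n) (i : ℕ) (b : QBranch) (len : ℕ) : Prop where
  const : ∀ r < 20, b.mem r = m r
  cleared : Cleared b
  listing : Listing u b.mem len
  len_le : len ≤ i
  flag : b.mem 41 = 0 ∨ b.mem 41 = 1

/-- The iterations so far agree with the greedy algorithm. -/
structure Faithful (x : Fin H → SpinConfig n) (u : Fin n) (τ : ℝ) (i : ℕ) (m : Registers) :
    Prop where
  loop : ∀ S, GreedyLoop x u τ (listed n m) S → GreedyLoop x u τ ∅ S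
  rss_le : rss x u (listed n m) ≤ H - m 40 * (τ ^ 2 * H)
  done : m 41 = 1 → ∀ v, v ∉ listed n m → v ≠ u → empAvgCov x u v (listed n m) < τ
  going : m 41 = 0 → m 40 = i

/-- The cost of one iteration of the main loop. -/
def Params.extendCost (p : Params) (len : ℕ) : ℕ :=
  weightCost p.H len + p.reps * (climbCost p.H p.q p.levels + 1) + 7

/-- A score of at least the threshold is positive. This rules out padding and nodes already listed,
whose scores vanish, while `u` itself is never encoded; so the maximizer is a legitimate new node.
-/
theorem det_append {τ : ℝ} (hp : p.Valid H u τ) {m₁ : Registers} (hc : Consts p m₁) {len : ℕ}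
    (hl : Listing u m₁ len) (h41 : m₁ 41 = 0) {z : ℂ} (hz : z ≠ 0)
    (hs : Holds x p (weightOf x u (fun i => m₁ (50 + i)) len) m₁) :
    Det x (.ifLe 14 28 (.seq (.arith .plus 35 17 40) (.seq (.arith .plus (.indirect 35) 29 10)
        (.arith .plus 40 40 9))) (.const 41 1)) ⟨m₁, Finsupp.single (enc 0) z, t⟩ fun b =>
      (∀ r < 20, b.mem r = m₁ r) ∧ Cleared b ∧ b.time ≤ t + 4 ∧
      ((p.thr ≤ m₁ 28 ∧ b.mem 41 = 0 ∧ ∃ v : Fin n, v ∉ listed n m₁ ∧ v ≠ u ∧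
          Listing u b.mem (len + 1) ∧ listed n b.mem = insert v (listed n m₁) ∧
          empAvgCov x u v (listed n m₁) * H = m₁ 28) ∨
        (m₁ 28 < p.thr ∧ b.mem 41 = 1 ∧ Listing u b.mem len ∧ listed n b.mem = listed n m₁)) := by
  have hH : (0 : ℝ) < H := by exact_mod_cast hp.pos
  refine Det.ifLe ?_
  simp only [Addr.eval_ofNat, QBranch.tick, hc.r14]
  split_ifs with h
  · have hpos : 0 < m₁ 28 := by
      refine lt_of_lt_of_le ?_ h
      rw [hp.thr_eq]
      exact mul_pos hp.τ_pos hH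
    obtain ⟨w, hw, h29, h28⟩ := hs.2.resolve_left hpos.ne'
    have hnode : ∃ v : Fin n, (skip p.u w : ℝ) = ((v : ℕ) : ℝ) := by
      by_contra hn
      push Not at hn
      have : nodeScore x p (weightOf x u (fun i => m₁ (50 + i)) len) w = 0 :=
        score_eq_zero _ hn
      rw [h28, this] at hpos
      exact lt_irrefl _ hpos
    obtain ⟨v, hv⟩ := hnode
    have hvu : v ≠ u := by
      rintro rfl
      have : skip p.u w = v := by exact_mod_cast hv
      rw [← hp.u_eq] at this
      exact skip_ne _ _ this
    have hvS : v ∉ listed n m₁ := by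
      intro hmem
      rw [h28, nodeScore, hv, score_weightOf_of_mem hl.covers u hmem] at hpos
      exact lt_irrefl _ hpos
    have hlt := hl.lt
    refine Det.seq (Det.arith_to 35 (50 + len : ℕ) rfl ?_ (Det.seq (Det.arith_to (50 + len)
      ((v : ℕ) : ℝ) ?_ ?_ (Det.arith_to 40 (len + 1 : ℕ) rfl ?_ ?_))))
    · simp [ArithOp.eval, hc.r17, hl.length]
    · rw [Addr.eval_indirect, Function.update_self, Nat.floor_natCast]
    · simp [ArithOp.eval, h29, hc.r10, hv]
    · simp only [Addr.eval_ofNat, ArithOp.eval]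
      rw [Function.update_of_ne (by omega), Function.update_of_ne (by omega),
        Function.update_of_ne (by omega), Function.update_of_ne (by omega), hl.length, hc.r9]
      push_cast
      rfl
    · refine ⟨fun r hr => ?_, ⟨z, hz, rfl⟩, by simp only; omega, Or.inl ⟨h, ?_, v, hvS, hvu, ?_⟩⟩
      · dsimp only
        rw [Function.update_of_ne (by omega), Function.update_of_ne (by omega),
          Function.update_of_ne (by omega)]
      · dsimp only
        rw [Function.update_of_ne (by omega), Function.update_of_ne (by omega),
          Function.update_of_ne (by omega), h41]
      · rw [← and_assoc]
        refine ⟨hl.append hvS hvu (by simp) (fun i hi => ?_) ?_, ?_⟩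
        · dsimp only
          rw [Function.update_of_ne (by omega), Function.update_of_ne (by omega),
            Function.update_of_ne (by omega)]
        · dsimp only
          rw [Function.update_of_ne (by omega), Function.update_self]
        · rw [h28, nodeScore, hv, score_weightOf hl.covers u v hp.pos]
  · refine Det.const ?_
    have ho : Outer p m₁ m₁ := Outer.refl _ _
    have hl' : Listing u (Function.update m₁ 41 ((1 : ℕ) : ℝ)) len := by
      refine ⟨by simp [hl.length], fun i hi j hj hij => ?_, fun i hi => ?_⟩
      · rw [Function.update_of_ne (by omega), Function.update_of_ne (by omega)] at hij
        exact hl.inj i hi j hj hij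
      · rw [Function.update_of_ne (by omega)]
        exact hl.node i hi
    refine ⟨fun r hr => ?_, ⟨z, hz, rfl⟩, by simp only; omega, Or.inr ⟨not_le.1 h, by simp, hl', ?_⟩⟩
    · simp only [Addr.eval_ofNat]
      rw [Function.update_of_ne (by omega)]
    · ext w
      simp only [Addr.eval_ofNat]
      rw [hl'.mem_listed, hl.mem_listed]
      exact exists_congr fun i => and_congr_right fun hi => by
        rw [Function.update_of_ne (by omega)]

/-- The field `loop` is stated in terms of continuations: whatever the greedy loop can reach from
the current set, it can reach from `∅`. An iteration thus only has to prepend one `GreedyLoop.step`.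
The maximality required there follows from `hmax`, which covers all nodes other than `u` through
`skip`. -/
theorem Faithful.step {τ : ℝ} (hp : p.Valid H u τ) {i len : ℕ} {m₁ m₂ : Registers}
    (hf : Faithful x u τ i m₁) (hl : Listing u m₁ len) (h41 : m₁ 41 = 0) {y : ℝ}
    (hmax : ∀ v < 2 ^ p.q, nodeScore x p (weightOf x u (fun i => m₁ (50 + i)) len) v ≤ y)
    (h : (p.thr ≤ y ∧ m₂ 41 = 0 ∧ ∃ v : Fin n, v ∉ listed n m₁ ∧ v ≠ u ∧
          Listing u m₂ (len + 1) ∧ listed n m₂ = insert v (listed n m₁) ∧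
          empAvgCov x u v (listed n m₁) * H = y) ∨
        (y < p.thr ∧ m₂ 41 = 1 ∧ Listing u m₂ len ∧ listed n m₂ = listed n m₁)) :
    Faithful x u τ (i + 1) m₂ := by
  have hH : (0 : ℝ) < H := by exact_mod_cast hp.pos
  have hmax' : ∀ w : Fin n, w ≠ u → empAvgCov x u w (listed n m₁) * H ≤ y := by
    intro w hw
    obtain ⟨j, hj, hjw⟩ := exists_skip (u := p.u) (v := w) (by
      rw [hp.u_eq]; exact fun h => hw (Fin.ext h))
    have := hmax j (by have := w.2; have := hp.qubits; omega)
    rwa [nodeScore, hjw, score_weightOf hl.covers u w hp.pos] at this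
  rcases h with ⟨hthr, h41', v, hvS, hvu, hl', hS, hy⟩ | ⟨hthr, h41', hl', hS⟩
  · have hτ : τ ≤ empAvgCov x u v (listed n m₁) := by
      rw [hp.thr_eq, ← hy] at hthr
      exact le_of_mul_le_mul_right hthr hH
    refine ⟨fun S hs => hf.loop S (GreedyLoop.step _ _ v hvS hvu (fun w _ hw => ?_) hτ (hS ▸ hs)), ?_,
      fun h => ?_, fun _ => ?_⟩
    · have := hmax' w hw
      rw [← hy] at this
      exact le_of_mul_le_mul_right this hH
    · rw [hS, hl'.length]
      have h1 := rss_insert_le (x := x) hp.pos u v (listed n m₁)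
      have h2 := hf.rss_le
      rw [hl.length] at h2
      have h3 : τ ^ 2 ≤ empAvgCov x u v (listed n m₁) ^ 2 :=
        pow_le_pow_left₀ hp.τ_pos.le hτ 2
      have h4 := mul_le_mul_of_nonneg_left h3 hH.le
      push_cast
      nlinarith
    · rw [h41'] at h
      norm_num at h
    · have := hf.going h41
      rw [hl.length] at this
      rw [hl'.length]
      push_cast
      rw [this]
  · refine ⟨fun S hs => hf.loop S (hS ▸ hs), ?_, fun _ v hv hvu => ?_, fun h => ?_⟩
    · have := hf.rss_le
      rw [hS, hl'.length]
      rwa [hl.length] at this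
    · rw [hS]
      have := (hmax' v hvu).trans_lt hthr
      rw [hp.thr_eq] at this
      exact lt_of_mul_lt_mul_right this hH.le
    · rw [h41'] at h
      norm_num at h

open Classical in
/-- Indicates that an iteration went wrong. -/
def unfaithful (x : Fin H → SpinConfig n) (u : Fin n) (τ : ℝ) (i : ℕ) (b : QBranch) : ℝ :=
  if Faithful x u τ i b.mem then 0 else 1

theorem unfaithful_le_one (τ : ℝ) (i : ℕ) (b : QBranch) : unfaithful x u τ i b ≤ 1 := by
  unfold unfaithful
  split_ifs <;> norm_num

theorem unfaithful_eq_zero {τ : ℝ} {i : ℕ} {b : QBranch} (h : Faithful x u τ i b.mem) :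
    unfaithful x u τ i b = 0 := if_pos h

/-- A search that misses the maximum, of probability at most `(1/2)^reps`, is the only source of
error. After an earlier error the indicator is already one and nothing has to be shown, so the
errors add up as in a union bound. -/
theorem spec_extend {τ : ℝ} (hp : p.Valid H u τ) (hc : Consts p m) {i len : ℕ} {b : QBranch}
    (hb : Selecting m u i b len) :
    Spec x Algo.extend b
      (fun b' => (∃ len', Selecting m u (i + 1) b' len') ∧ b'.time ≤ b.time + p.extendCost i)
      (unfaithful x u τ (i + 1)) (unfaithful x u τ i b + (1 / 2) ^ p.reps) := by
  obtain ⟨m', ψ, t⟩ := b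
  obtain ⟨hconst, ⟨z, hz, rfl : ψ = _⟩, hl, hlen, hflag⟩ := hb
  simp only at hconst hl hflag
  have hc' : Consts p m' := hc.congr hconst
  have hε : (0 : ℝ) ≤ (1 / 2) ^ p.reps := by positivity
  unfold Algo.extend
  refine Spec.ifLe ?_
  simp only [Addr.eval_ofNat, hc'.r10, QBranch.tick]
  rcases hflag with h41 | h41
  · rw [if_pos h41.le]
    have hn : len ≤ p.n := by rw [hp.n_eq]; exact hl.lt.le
    have he : HasList (fun i => m' (50 + i)) len m' := ⟨hl.length, fun _ _ => rfl⟩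
    refine Spec.seq_det ((det_weights (x := x) (t := t + 1) hp.H_eq hc' hn he hz).mono ?_)
    rintro _ ⟨m₁, h₁, hW, rfl⟩
    rw [hp.u_eq] at hW
    set W := weightOf x u (fun i => m' (50 + i)) len with hWdef
    have hmx := spec_maximize (x := x) (t := t + 1 + weightCost H len) hp.H_eq (h₁.consts hc') hW
      (two_mul_better_zero_le hp.qubits W) hp.levels hz
    have hfin : ∀ b', Frame 31 m₁ b'.mem ∧ Cleared b' ∧ Holds x p W b'.mem ∧
        b'.time ≤ t + 1 + weightCost H len + 2 + p.reps * (climbCost H p.q p.levels + 1) →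
        Det x (.ifLe 14 28 (.seq (.arith .plus 35 17 40) (.seq (.arith .plus (.indirect 35) 29 10)
        (.arith .plus 40 40 9))) (.const 41 1)) b' fun b'' =>
          ((∃ len', Selecting m u (i + 1) b'' len') ∧ b''.time ≤ t + p.extendCost i) ∧
          (Faithful x u τ i m' → missed x p W b' = 0 → Faithful x u τ (i + 1) b''.mem) := by
      rintro ⟨m₂, ψ, t₂⟩ ⟨h₂, ⟨z', hz', rfl : ψ = _⟩, hs, ht⟩
      simp only at h₂ hs ht
      have ho : Outer p m' m₂ := h₁.trans (h₂.outer (by norm_num))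
      obtain ⟨hl₂, hS₂⟩ := hl.outer hp.n_eq ho
      have hlt := hl.lt
      have e41 : m₂ 41 = 0 := by
        rw [ho 41 (by have := p.base_ge; omega), h41]
      have hW₂ : W = weightOf x u (fun i => m₂ (50 + i)) len := by
        have hcov : Covers (fun i => m₂ (50 + i)) len (listed n m') := hS₂ ▸ hl₂.covers
        rw [hWdef]
        funext l
        have hcode : ∀ l k : ℕ, k ≤ len → codeOf x (fun i => m' (50 + i)) l k
            = codeOf x (fun i => m₂ (50 + i)) l k := by
          intro l k
          induction k with
          | zero => exact fun _ => rfl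
          | succ k ih =>
            intro hk
            rw [codeOf, codeOf, ih (by omega),
              ho (50 + k) (by have := hp.n_eq; unfold Params.base; omega)]
        simp only [weightOf, tallySum, tallyCount, hcode _ len le_rfl]
      refine (det_append (x := x) (t := t₂) hp (ho.consts hc') hl₂ e41 hz' (hW₂ ▸ hs)).mono ?_
      rintro b ⟨hb1, hb2, hb3, hb4⟩
      refine ⟨⟨?_, ?_⟩, fun hf hm => ?_⟩
      · have hcst : ∀ r < 20, b.mem r = m r := fun r hr => by
          rw [hb1 r hr, ho r (Or.inl hr), hconst r hr]
        rcases hb4 with ⟨-, h41', v, -, -, hl', -, -⟩ | ⟨-, h41', hl', -⟩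
        · exact ⟨len + 1, hcst, hb2, hl', by omega, Or.inl h41'⟩
        · exact ⟨len, hcst, hb2, hl', by omega, Or.inr h41'⟩
      · have hwc : weightCost H len ≤ weightCost H i := by
          unfold weightCost
          gcongr
        have : p.extendCost i = weightCost H i + p.reps * (climbCost H p.q p.levels + 1) + 7 := by
          unfold Params.extendCost
          rw [hp.H_eq]
        omega
      · have hf₂ : Faithful x u τ i m₂ := by
          have e40 : m₂ 40 = m' 40 := ho 40 (by have := p.base_ge; omega)
          have e41' : m₂ 41 = m' 41 := ho 41 (by have := p.base_ge; omega)
          obtain ⟨f1, f2, f3, f4⟩ := hf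
          constructor
          · rwa [hS₂]
          · rwa [hS₂, e40]
          · rwa [hS₂, e41']
          · rwa [e40, e41']
        exact hf₂.step hp hl₂ e41 (y := m₂ 28)
          (fun v hv => hW₂ ▸ nodeScore_le_of_missed_eq_zero hm hv) hb4
    by_cases hf : Faithful x u τ i m'
    · have h0 : unfaithful x u τ i ⟨m', Finsupp.single (enc 0) z, t⟩ = 0 := if_pos hf
      rw [h0, zero_add]
      refine Spec.seq _ hmx fun b' hb' => Spec.of_det ((hfin b' hb').mono fun b'' hb'' =>
        ⟨hb''.1, ?_⟩)
      unfold missed at hb'' ⊢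
      split_ifs at hb'' ⊢ with hr
      · exact (if_pos (hb''.2 hf rfl)).le
      · exact unfaithful_le_one ..
    · have h0 : unfaithful x u τ i ⟨m', Finsupp.single (enc 0) z, t⟩ = 1 := if_neg hf
      rw [h0]
      refine Spec.mono (φ := unfaithful x u τ (i + 1)) (c := 1) (Spec.seq (fun _ => 1)
        (Spec.of_forall hmx.1 fun _ _ => le_rfl) fun b' hb' => Spec.of_det ((hfin b' hb').mono
          fun b'' hb'' => ⟨hb''.1, unfaithful_le_one ..⟩)) (fun b' hb' => ⟨hb', le_rfl⟩)
            (by linarith)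
  · have hneg : ¬ m' 41 ≤ 0 := by rw [h41]; norm_num
    rw [if_neg hneg]
    have hu : ∀ r, 40 ≤ r → Function.update m' 20 ((0 : ℕ) : ℝ) r = m' r := fun r hr => by
      rw [Function.update_of_ne (by omega)]
    have ho : Outer p m' (Function.update m' 20 ((0 : ℕ) : ℝ)) :=
      (Outer.refl p m').update (by norm_num) _
    obtain ⟨hl₂, hS₂⟩ := hl.outer hp.n_eq ho
    refine Spec.of_det (Det.const ⟨⟨⟨len, ?_, ⟨z, hz, rfl⟩, hl₂, by omega, Or.inr ?_⟩, ?_⟩, ?_⟩)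
    · intro r hr
      simp only [Addr.eval_ofNat]
      rw [Function.update_of_ne (by omega), hconst r hr]
    · simp only [Addr.eval_ofNat]
      rw [hu 41 (by norm_num), h41]
    · simp only [Params.extendCost]
      omega
    · refine le_trans ?_ (le_add_of_nonneg_right hε)
      by_cases hf : Faithful x u τ i m'
      · have : Faithful x u τ (i + 1) (Function.update m' 20 ((0 : ℕ) : ℝ)) := by
          obtain ⟨f1, f2, f3, f4⟩ := hf
          constructor
          · rwa [hS₂]
          · rwa [hS₂, hu 40 le_rfl]
          · rwa [hS₂, hu 41 (by norm_num)]
          · rw [hu 41 (by norm_num), h41]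
            intro h
            norm_num at h
        refine (unfaithful_eq_zero this).le.trans ?_
        unfold unfaithful
        split_ifs <;> norm_num
      · have h0 : unfaithful x u τ i ⟨m', Finsupp.single (enc 0) z, t⟩ = 1 := if_neg hf
        rw [h0]
        exact unfaithful_le_one ..

/-- The potential is the error indicator plus `(1/2)^reps` for every iteration still to come. -/
theorem spec_select {τ : ℝ} (hp : p.Valid H u τ) (hc : Consts p m) {z : ℂ} (hz : z ≠ 0) :
    Spec x Algo.select ⟨m, Finsupp.single (enc 0) z, t⟩
      (fun b => (∃ len, Selecting m u ⌊p.T⌋₊ b len) ∧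
        b.time ≤ t + 3 + ⌊p.T⌋₊ * (p.extendCost ⌊p.T⌋₊ + 1))
      (unfaithful x u τ ⌊p.T⌋₊) (⌊p.T⌋₊ * (1 / 2) ^ p.reps) := by
  unfold Algo.select
  refine Spec.seq_det (Det.const (Spec.seq_det (Det.const ?_)))
  set N := ⌊p.T⌋₊ with hN
  refine (Spec.loop (fun i b => (∃ len, Selecting m u i b len) ∧
        b.time ≤ t + 3 + i * (p.extendCost N + 1))
    (fun i b => unfaithful x u τ i b + ((N - i : ℕ) : ℝ) * (1 / 2) ^ p.reps) N ?_ ?_ ?_).mono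
      (c := N * (1 / 2) ^ p.reps) ?_ le_rfl
  · simp [hc.r5, hN]
  · set m₀ := Function.update (Function.update m 40 ((0 : ℕ) : ℝ)) 41 ((0 : ℕ) : ℝ) with hm₀
    have e40 : m₀ 40 = 0 := by simp [hm₀]
    have e41 : m₀ 41 = 0 := by simp [hm₀]
    have hS : listed n m₀ = ∅ := by
      simp [listed, e40]
    refine ⟨⟨⟨0, fun r hr => ?_, ⟨z, hz, rfl⟩, ⟨by simp [QBranch.tick], ?_, ?_⟩, le_rfl, Or.inl e41⟩,
      ?_⟩, ?_⟩
    · simp only [Addr.eval_ofNat, QBranch.tick]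
      rw [Function.update_of_ne (by omega), Function.update_of_ne (by omega)]
    · simp
    · simp
    · simp [QBranch.tick]
    · have hf : Faithful x u τ 0 m₀ := by
        refine ⟨fun S hs => hS ▸ hs, ?_, fun h => ?_, fun _ => by simpa using e40⟩
        · rw [e40, zero_mul, sub_zero]
          exact rss_le_card ..
        · rw [e41] at h
          norm_num at h
      have h0 : ∀ (ψ : QState) (t : ℕ), unfaithful x u τ 0 ⟨m₀, ψ, t⟩ = 0 := fun _ _ => if_pos hf
      simp only [Addr.eval_ofNat, QBranch.tick, Nat.sub_zero]
      rw [h0, zero_add]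
  · rintro i hi b ⟨⟨len, hb⟩, ht⟩
    have hb' : Selecting m u i b.tick len := ⟨hb.1, hb.2, hb.3, hb.4, hb.5⟩
    refine (spec_extend hp hc hb').affine (k := 1) (d := ((N - (i + 1) : ℕ) : ℝ) * (1 / 2) ^ p.reps)
      (by norm_num) (fun b' _ => by rw [one_mul]) ?_ |>.mono (fun b' h => ⟨⟨h.1, ?_⟩, le_rfl⟩) le_rfl
    · have e : ((N - i : ℕ) : ℝ) = ((N - (i + 1) : ℕ) : ℝ) + 1 := by
        rw [← Nat.cast_succ]
        congr 1
        omega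
      rw [e]
      have : unfaithful x u τ i b.tick = unfaithful x u τ i b := rfl
      rw [this]
      linarith
    · have h1 := h.2
      have h2 : p.extendCost i ≤ p.extendCost N := by
        unfold Params.extendCost weightCost
        gcongr
      have h3 : b.tick.time = b.time + 1 := rfl
      rw [Nat.succ_mul]
      omega
  · rintro b ⟨h1, h2⟩
    exact ⟨⟨h1, h2⟩, by simp⟩

/-- After enough iterations, the list in memory is a result of the main loop. -/
theorem Faithful.greedyLoop {τ : ℝ} {i : ℕ} {m' : Registers} (hf : Faithful x u τ i m')
    (hflag : m' 41 = 0 ∨ m' 41 = 1) (hH : 0 < H) (hi : 1 < i * τ ^ 2) :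
    GreedyLoop x u τ ∅ (listed n m') := by
  rcases hflag with h | h
  -- If no iteration has completed the selection, `i` nodes have been selected, and since `1 < i * τ
  -- ^ 2` the residual sum of squares would be negative.
  · exfalso
    have h1 := hf.rss_le
    have h2 := rss_nonneg (x := x) u (listed n m')
    rw [hf.going h] at h1
    have hH' : (0 : ℝ) < H := by exact_mod_cast hH
    nlinarith [mul_lt_mul_of_pos_right hi hH']
  · exact hf.loop _ (GreedyLoop.finish _ (hf.done h))

end

/-! ### The pruning step -/

namespace Algo

open QProg in
/-- Decides whether to keep the entry of the list with the number in register `42`. -/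
def examine : QProg :=
  arith .plus 43 17 42 ;; arith .plus 44 (.indirect 43) 10 ;; arith .minus (.indirect 43) 10 9 ;;
  weights ;; arith .plus (.indirect 43) 44 10 ;; gate (.load false 1 44) ;; accumulate false ;;
  measure 5 45 ;; accumulate true ;; gate (.load true 1 44) ;; arith .plus 46 16 42 ;;
  ifLe 14 45 (arith .plus (.indirect 46) 44 10) (arith .minus (.indirect 46) 10 9) ;;
  arith .plus 42 42 9

open QProg in
/-- Prunes the list, and returns the result. -/
def pruneList : QProg :=
  const 42 0 ;; loop 40 examine ;; arith .plus 0 40 10 ;; arith .plus 1 16 10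

end Algo

section

variable {n H : ℕ} {x : Fin H → SpinConfig n} {u : Fin n} {m : Registers} {t : ℕ} {p : Params}
  {W : ℕ → ℝ}

theorem det_accumulate_single (hp : p.H = H) (hc : Consts p m) (hW : HasWeights p W m) (inv : Bool)
    (J A : ℝ) (z : ℂ) :
    Det x (Algo.accumulate inv) ⟨m, Finsupp.single (qcfg 0 0 J 0 0 0 A 0 0 0) z, t⟩
      (Ends 24 m (Finsupp.single (qcfg 0 0 J 0 0 0
        (if inv then A - score x W J else A + score x W J) 0 0 0) z) (t + (8 * H + 3))) := by
  have := det_accumulate (x := x) (t := t) (s := {()}) (a := fun _ => z) hp hc hW inv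
    (fun _ => 0) (fun _ => 0) (fun _ => J) (fun _ => 0) (fun _ => A)
  rwa [family_singleton, family_singleton] at this

/-- The score of an entry of a list, given the other entries. -/
def entryScore (x : Fin H → SpinConfig n) (u : ℕ) (e : ℕ → ℝ) (len i : ℕ) : ℝ :=
  score x (weightOf x u (Function.update e i (-1)) len) (e i)

open Classical in
/-- The entry of the list of results. -/
def resultEntry (x : Fin H → SpinConfig n) (p : Params) (e : ℕ → ℝ) (len i : ℕ) : ℝ :=
  if p.thr ≤ entryScore x p.u e len i then e i else -1

/-- The state before the entry `i` is examined. -/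
structure Pruning (x : Fin H → SpinConfig n) (p : Params) (e : ℕ → ℝ) (len : ℕ) (m : Registers)
    (i : ℕ) (m' : Registers) : Prop where
  const : ∀ r < 20, m' r = m r
  length : m' 40 = len
  entry : ∀ j < len, m' (50 + j) = e j
  counter : m' 42 = i
  result : ∀ j < i, m' (50 + p.n + j) = resultEntry x p e len j

/-- The cost of examining an entry. -/
def examineCost (H len : ℕ) : ℕ := weightCost H len + 16 * H + 18

/-- Overwriting the entry by `-1`, which is not a node, has the effect of conditioning on the other
entries only, without moving the list. The entry is restored before its score is computed. -/
theorem det_examine (hp : p.H = H) (hc : Consts p m) {e : ℕ → ℝ} {len i : ℕ} (hlen : len ≤ p.n)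
    (hi : i < len) {m' : Registers} (h : Pruning x p e len m i m') {z : ℂ} (hz : z ≠ 0) :
    Det x Algo.examine ⟨m', Finsupp.single (enc 0) z, t⟩ fun b => ∃ m'',
      Pruning x p e len m (i + 1) m'' ∧
      b = ⟨m'', Finsupp.single (enc 0) z, t + (weightCost H len + 16 * H + 17)⟩ := by
  have hc' : Consts p m' := hc.congr h.const
  have hb : p.base = 50 + 2 * p.n := rfl
  have hs : ∀ c, family {()} (fun _ => c) (fun _ => z) = Finsupp.single c z := fun c =>
    family_singleton ..
  unfold Algo.examine
  refine Det.seq (Det.arith_to 43 (50 + i : ℕ) rfl ?_ (Det.seq (Det.arith_to 44 (e i) rfl ?_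
    (Det.seq (Det.arith_to (50 + i) (-1) ?_ ?_ (Det.seq ?_))))))
  · simp [ArithOp.eval, hc'.r17, h.counter]
  · simp only [ArithOp.eval, Addr.eval_indirect, Addr.eval_ofNat]
    rw [Function.update_self, Nat.floor_natCast, Function.update_of_ne (by omega),
      Function.update_of_ne (by omega), h.entry i hi, hc'.r10, add_zero]
  · rw [Addr.eval_indirect, Function.update_of_ne (by omega), Function.update_self,
      Nat.floor_natCast]
  · simp [ArithOp.eval, hc'.r10, hc'.r9]
  set m₁ := Function.update (Function.update (Function.update m' 43 (50 + i : ℕ)) 44 (e i)) (50 + i)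
    (-1) with hm₁
  have hc₁ : Consts p m₁ := hc'.congr fun r hr => by
    rw [hm₁, Function.update_of_ne (by omega), Function.update_of_ne (by omega),
      Function.update_of_ne (by omega)]
  have he₁ : HasList (Function.update e i (-1)) len m₁ := by
    constructor
    · rw [hm₁, Function.update_of_ne (by omega), Function.update_of_ne (by omega),
        Function.update_of_ne (by omega), h.length]
    · intro j hj
      by_cases hji : j = i
      · rw [hji, hm₁, Function.update_self, Function.update_self]
      · rw [hm₁, Function.update_of_ne (by omega), Function.update_of_ne (by omega),
          Function.update_of_ne (by omega), Function.update_of_ne hji, h.entry j hj]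
  refine (det_weights hp hc₁ hlen he₁ hz).mono ?_
  rintro _ ⟨m₂, h₂, hW, rfl⟩
  set W := weightOf x p.u (Function.update e i (-1)) len with hWdef
  have hc₂ := h₂.consts hc₁
  have e43 : m₂ 43 = (50 + i : ℕ) := by
    rw [h₂ 43 (by omega), hm₁, Function.update_of_ne (by omega), Function.update_of_ne (by omega),
      Function.update_self]
  have e44 : m₂ 44 = e i := by
    rw [h₂ 44 (by omega), hm₁, Function.update_of_ne (by omega), Function.update_self]
  refine Det.seq (Det.arith_to (50 + i) (e i) ?_ ?_ (Det.seq ?_))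
  · rw [Addr.eval_indirect, e43, Nat.floor_natCast]
  · simp [ArithOp.eval, e44, hc₂.r10]
  set m₃ := Function.update m₂ (50 + i) (e i) with hm₃
  have hc₃ : Consts p m₃ := hc₂.congr fun r hr => by rw [hm₃, Function.update_of_ne (by omega)]
  have hW₃ : HasWeights p W m₃ := fun l hl => by
    rw [hm₃, Function.update_of_ne (by omega), hW l hl]
  have e44' : m₃ 44 = e i := by rw [hm₃, Function.update_of_ne (by omega), e44]
  rw [← hs]
  refine Det.gate_family trivial (Det.of_family_congr (g := fun _ => qcfg 0 0 (e i) 0 0 0 0 0 0 0)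
    (fun _ _ => ?_) ?_)
  · simp [QGate.move, enc, e44']
  rw [hs]
  refine Det.seq ((det_accumulate_single hp hc₃ hW₃ false (e i) 0 z).mono ?_)
  rintro _ ⟨m₄, h₄, rfl⟩
  rw [if_neg (by simp), zero_add]
  refine Det.seq (Det.measure_single hz ?_)
  have e5 : qcfg 0 0 (e i) 0 0 0 (score x W (e i)) 0 0 0 (Addr.eval m₄ 5) = entryScore x p.u e len i :=
    rfl
  rw [e5, Addr.eval_ofNat]
  set m₅ := Function.update m₄ 45 (entryScore x p.u e len i) with hm₅
  have hc₅ : Consts p m₅ := (hc₃.frame h₄).congr fun r hr => by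
    rw [hm₅, Function.update_of_ne (by omega)]
  have hW₅ : HasWeights p W m₅ := fun l hl => by
    rw [hm₅, Function.update_of_ne (by omega), hW₃.frame (by norm_num) h₄ l hl]
  refine Det.seq ((det_accumulate_single hp hc₅ hW₅ true (e i) _ z).mono ?_)
  rintro _ ⟨m₆, h₆, rfl⟩
  rw [if_pos rfl, sub_self, ← hs]
  have e44'' : m₆ 44 = e i := by
    rw [h₆ 44 (by omega), hm₅, Function.update_of_ne (by omega), h₄ 44 (by omega), e44']
  have e45 : m₆ 45 = entryScore x p.u e len i := by
    rw [h₆ 45 (by omega), hm₅, Function.update_self]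
  have hrest : ∀ r, 40 ≤ r → r < p.base → r ≠ 43 → r ≠ 44 → r ≠ 45 → m₆ r = m' r := by
    intro r h1 h2 h3 h4 h5
    rw [h₆ r (by omega), hm₅, Function.update_of_ne (by omega), h₄ r (by omega), hm₃]
    by_cases hr : r = 50 + i
    · rw [hr, Function.update_self, h.entry i hi]
    · rw [Function.update_of_ne hr, h₂ r (by omega), hm₁, Function.update_of_ne hr,
        Function.update_of_ne h4, Function.update_of_ne h3]
  have hconst : ∀ r < 20, m₆ r = m' r := by
    intro r hr
    rw [h₆ r (by omega), hm₅, Function.update_of_ne (by omega), h₄ r (by omega), hm₃,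
      Function.update_of_ne (by omega), h₂ r (by omega), hm₁, Function.update_of_ne (by omega),
        Function.update_of_ne (by omega), Function.update_of_ne (by omega)]
  have hc₆ : Consts p m₆ := hc₅.frame h₆
  refine Det.seq (Det.gate_family trivial (Det.of_family_congr (g := fun _ => enc 0)
    (fun _ _ => ?_) ?_))
  · simp [QGate.move, enc, e44'']
  rw [hs]
  have e42 : m₆ 42 = i := by
    rw [hrest 42 (by omega) (by omega) (by omega) (by omega) (by omega), h.counter]
  refine Det.seq (Det.arith_to 46 (50 + p.n + i : ℕ) rfl ?_ (Det.seq ?_))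
  · simp [ArithOp.eval, e42, hc₆.r16]
  have hres : Det x (.ifLe 14 45 (.arith .plus (.indirect 46) 44 10)
      (.arith .minus (.indirect 46) 10 9)) ⟨Function.update m₆ 46 (50 + p.n + i : ℕ),
        Finsupp.single (enc 0) z, t + (weightCost H len + 16 * H + 14)⟩ fun b =>
        b = ⟨Function.update (Function.update m₆ 46 (50 + p.n + i : ℕ)) (50 + p.n + i)
          (resultEntry x p e len i), Finsupp.single (enc 0) z,
            t + (weightCost H len + 16 * H + 16)⟩ := by
    refine Det.ifLe ?_
    have e14 : Function.update m₆ 46 ((50 + p.n + i : ℕ) : ℝ) 14 = p.thr := by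
      rw [Function.update_of_ne (by omega), hc₆.r14]
    have e45' : Function.update m₆ 46 ((50 + p.n + i : ℕ) : ℝ) 45 = entryScore x p.u e len i := by
      rw [Function.update_of_ne (by omega), e45]
    have e46 : Addr.eval (Function.update m₆ 46 ((50 + p.n + i : ℕ) : ℝ)) (.indirect 46)
        = 50 + p.n + i := by
      rw [Addr.eval_indirect, Function.update_self, Nat.floor_natCast]
    simp only [Addr.eval_ofNat, e14, e45', QBranch.tick]
    split_ifs with hle
    · refine Det.arith_to (50 + p.n + i) (e i) e46 ?_ ?_
      · simp [ArithOp.eval, e44'', hc₆.r10]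
      · rw [resultEntry, if_pos hle]
        exact QBranch.ext' rfl rfl (by ring)
    · refine Det.arith_to (50 + p.n + i) (-1) e46 ?_ ?_
      · simp [ArithOp.eval, hc₆.r10, hc₆.r9]
      · rw [resultEntry, if_neg hle]
        exact QBranch.ext' rfl rfl (by ring)
  have ht : t + 1 + 1 + 1 + weightCost H len + 1 + 1 + (8 * H + 3) + 1 + (8 * H + 3) + 1 + 1
      = t + (weightCost H len + 16 * H + 14) := by ring
  rw [ht]
  refine hres.mono ?_
  rintro _ rfl
  refine Det.arith_to 42 (i + 1 : ℕ) rfl ?_ ?_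
  · simp only [Addr.eval_ofNat, ArithOp.eval]
    rw [Function.update_of_ne (by omega), Function.update_of_ne (by omega),
      Function.update_of_ne (by omega), Function.update_of_ne (by omega), e42, hc₆.r9]
    push_cast
    rfl
  · refine ⟨_, ⟨fun r hr => ?_, ?_, fun j hj => ?_, by simp, fun j hj => ?_⟩,
      QBranch.ext' rfl rfl (by ring)⟩
    · rw [Function.update_of_ne (by omega), Function.update_of_ne (by omega),
        Function.update_of_ne (by omega), hconst r hr, h.const r hr]
    · rw [Function.update_of_ne (by omega), Function.update_of_ne (by omega),
        Function.update_of_ne (by omega), hrest 40 (by omega) (by omega) (by omega) (by omega)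
          (by omega), h.length]
    · rw [Function.update_of_ne (by omega), Function.update_of_ne (by omega),
        Function.update_of_ne (by omega), hrest _ (by omega) (by omega) (by omega) (by omega)
          (by omega), h.entry j hj]
    · rw [Function.update_of_ne (by omega)]
      by_cases hji : j = i
      · rw [hji, Function.update_self]
      · rw [Function.update_of_ne (by omega), Function.update_of_ne (by omega),
          hrest _ (by omega) (by omega) (by omega) (by omega) (by omega)]
        exact h.result j (by omega)

theorem det_pruneList (hp : p.H = H) (hc : Consts p m) {e : ℕ → ℝ} {len : ℕ} (hlen : len ≤ p.n)
    (he : HasList e len m) {z : ℂ} (hz : z ≠ 0) :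
    Det x Algo.pruneList ⟨m, Finsupp.single (enc 0) z, t⟩ fun b =>
      b.mem 0 = len ∧ b.mem 1 = (50 + p.n : ℕ) ∧
      (∀ j < len, b.mem (50 + p.n + j) = resultEntry x p e len j) ∧
      b.time = t + (len * examineCost H len + 4) := by
  unfold Algo.pruneList
  refine Det.seq (Det.const_to 42 rfl (Det.seq ((Det.loop (fun i b => ∃ m',
    Pruning x p e len m i m' ∧ b = ⟨m', Finsupp.single (enc 0) z, t + 2 + i * examineCost H len⟩)
      len ?_ ?_ ?_).mono ?_)))
  · simp [he.length]
  · refine ⟨_, ⟨fun r hr => ?_, ?_, fun j hj => ?_, by simp, by simp⟩,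
      QBranch.ext' rfl rfl (by simp)⟩
    · dsimp only
      rw [Function.update_of_ne (by omega)]
    · dsimp only
      rw [Function.update_of_ne (by omega), he.length]
    · dsimp only
      rw [Function.update_of_ne (by omega), he.entry j hj]
  · rintro i hi _ ⟨m', hm, rfl⟩
    refine (det_examine hp hc hlen hi hm hz).mono ?_
    rintro _ ⟨m'', hm', rfl⟩
    exact ⟨m'', hm', QBranch.ext' rfl rfl (by unfold examineCost; ring)⟩
  · rintro _ ⟨m', hm, rfl⟩
    have hc' : Consts p m' := hc.congr hm.const
    refine Det.seq (Det.arith_to 0 len rfl ?_ (Det.arith_to 1 (50 + p.n : ℕ) rfl ?_ ?_))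
    · simp [ArithOp.eval, hm.length, hc'.r10]
    · simp [ArithOp.eval, hc'.r16, hc'.r10]
    · refine ⟨by simp, by simp, fun j hj => ?_, by dsimp only; ring⟩
      dsimp only
      rw [Function.update_of_ne (by omega), Function.update_of_ne (by omega), hm.result j hj]

/-- Rejected entries are reported as `-1`, which is the number of no node and is therefore ignored
in the returned set. Distinctness of the entries ensures that overwriting one of them removes
exactly that node. -/
theorem output_eq_prune {τ : ℝ} (hp : p.Valid H u τ) {len : ℕ} (hl : Listing u m len) {b : QBranch}
    (h0 : b.mem 0 = len) (h1 : b.mem 1 = (50 + p.n : ℕ))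
    (hr : ∀ j < len, b.mem (50 + p.n + j) = resultEntry x p (fun i => m (50 + i)) len j) :
    b.output n = prune x u τ (listed n m) := by
  have hH : (0 : ℝ) < H := by exact_mod_cast hp.pos
  have hkey : ∀ j < len, ∀ v : Fin n, m (50 + j) = ((v : ℕ) : ℝ) →
      entryScore x u (fun i => m (50 + i)) len j = empAvgCov x u v ((listed n m).erase v) * H := by
    intro j hj v hv
    have hcov : Covers (Function.update (fun i => m (50 + i)) j (-1)) len ((listed n m).erase v) := by
      intro w
      rw [Finset.mem_erase, hl.mem_listed]
      constructor
      · rintro ⟨hwv, i, hi, hiw⟩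
        refine ⟨i, hi, ?_⟩
        rw [Function.update_of_ne, hiw]
        rintro rfl
        rw [hv] at hiw
        exact hwv (Fin.ext (by exact_mod_cast hiw.symm))
      · rintro ⟨i, hi, hiw⟩
        have hij : i ≠ j := by
          rintro rfl
          rw [Function.update_self] at hiw
          have : (0 : ℝ) ≤ ((w : ℕ) : ℝ) := Nat.cast_nonneg _
          linarith
        rw [Function.update_of_ne hij] at hiw
        refine ⟨?_, i, hi, hiw⟩
        rintro rfl
        exact hij (hl.inj i hi j hj (hiw.trans hv.symm))
    rw [entryScore, hv, score_weightOf hcov u v hp.pos]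
  ext v
  rw [prune, Finset.mem_filter, hl.mem_listed, QBranch.output, Finset.mem_filter]
  simp only [Finset.mem_univ, true_and, h0, h1, Nat.floor_natCast, Finset.mem_range]
  constructor
  · rintro ⟨j, hj, hjv⟩
    rw [hr j hj, resultEntry] at hjv
    split_ifs at hjv with hle
    · refine ⟨⟨j, hj, hjv⟩, ?_⟩
      rw [hp.u_eq, hkey j hj v hjv, hp.thr_eq] at hle
      exact le_of_mul_le_mul_right hle hH
    · have : (0 : ℝ) ≤ ((v : ℕ) : ℝ) := Nat.cast_nonneg _
      linarith
  · rintro ⟨⟨j, hj, hjv⟩, hτ⟩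
    refine ⟨j, hj, ?_⟩
    rw [hr j hj, resultEntry, if_pos, hjv]
    rw [hp.u_eq, hkey j hj v hjv, hp.thr_eq]
    exact mul_le_mul_of_nonneg_right hτ hH.le

end

/-! ### The program -/

namespace Algo

open QProg in
/-- Stores in `r` the least exponent for which the power of the number in `b` is at least the number
in register `22`. The power ends up in register `20`. -/
def logarithm (r b : Addr) : QProg :=
  const r 0 ;; const 20 1 ;;
  loop 18 (ifLe 22 20 (const 24 0) (arith .times 20 20 b ;; arith .plus r r 9))

open QProg in
/-- Computes the constants that do not depend on the logarithms. -/
def setup : QProg :=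
  const 9 1 ;; const 10 0 ;; const 11 2 ;; const 12 3 ;; const 15 16 ;; const 17 50 ;; const 19 10 ;;
  arith .plus 16 17 0 ;; arith .plus 13 16 0 ;; arith .times 14 3 1 ;; const 20 8 ;;
  arith .times 21 3 3 ;; arith .divide 5 20 21 ;; arith .times 18 1 5

open QProg in
/-- Computes the constants. -/
def prepare : QProg :=
  setup ;; arith .times 22 11 0 ;; logarithm 6 11 ;; arith .times 22 15 20 ;; const 23 4 ;;
  logarithm 7 23 ;; arith .times 22 11 5 ;; arith .divide 22 22 4 ;; logarithm 8 11

/-- The quantum algorithm. -/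
def main : QProg := prepare ;; select ;; pruneList

end Algo

section

variable {n H : ℕ} {x : Fin H → SpinConfig n} {u : Fin n} {m : Registers} {ψ : QState} {t : ℕ}
  {p : Params}

/-- The number of passes is fixed in advance by `X`, but multiplication stops once `A` is reached;
`hA` says that the passes suffice. The last clause, minimality of the exponent, serves the bound for
the running time. -/
theorem det_logarithm {r b β : ℕ} {A X : ℝ} (hr : r < 9) (hb : b ≠ r ∧ b ≠ 20 ∧ b ≠ 24)
    (h22 : m 22 = A) (hβ : m b = β) (h9 : m 9 = 1) (h18 : m 18 = X) (hA : A ≤ (β : ℝ) ^ ⌊X⌋₊) :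
    Det x (Algo.logarithm (.direct r) (.direct b)) ⟨m, ψ, t⟩ fun b' => b'.state = ψ ∧
      b'.time ≤ t + (4 * ⌊X⌋₊ + 3) ∧ (∀ k, k ≠ r → k ≠ 20 → k ≠ 24 → b'.mem k = m k) ∧
      ∃ c : ℕ, b'.mem r = c ∧ b'.mem 20 = (β : ℝ) ^ c ∧ A ≤ (β : ℝ) ^ c ∧
        (c = 0 ∨ (β : ℝ) ^ (c - 1) < A) := by
  unfold Algo.logarithm
  refine Det.seq (Det.const_to r rfl (Det.seq (Det.const_to 20 rfl ?_)))
  refine (Det.loop (fun i b' => b'.state = ψ ∧ b'.time ≤ t + 3 + i * 4 ∧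
    (∀ k, k ≠ r → k ≠ 20 → k ≠ 24 → b'.mem k = m k) ∧
      ∃ c : ℕ, b'.mem r = c ∧ b'.mem 20 = (β : ℝ) ^ c ∧ (A ≤ (β : ℝ) ^ c ∨ c = i) ∧
        (c = 0 ∨ (β : ℝ) ^ (c - 1) < A)) ⌊X⌋₊ ?_ ?_ ?_).mono ?_
  · simp only [Addr.eval_ofNat]
    rw [Function.update_of_ne (by omega), Function.update_of_ne (by omega), h18]
  · refine ⟨rfl, le_rfl, fun k h1 h2 h3 => ?_, 0, ?_, ?_, Or.inr rfl, Or.inl rfl⟩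
    · simp only [QBranch.tick]
      rw [Function.update_of_ne h2, Function.update_of_ne h1]
    · simp only [QBranch.tick]
      rw [Function.update_of_ne (by omega), Function.update_self]
    · simp [QBranch.tick]
  · rintro i hi ⟨m', ψ', t'⟩ ⟨rfl, ht, hk, c, hc, h20, hA', hc'⟩
    simp only at ht hk hc h20
    have e22 : m' 22 = A := by rw [hk 22 (by omega) (by omega) (by omega), h22]
    have e9 : m' 9 = 1 := by rw [hk 9 (by omega) (by omega) (by omega), h9]
    have eb : m' b = β := by rw [hk b hb.1 hb.2.1 hb.2.2, hβ]
    refine Det.ifLe ?_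
    simp only [Addr.eval_ofNat, QBranch.tick, e22, h20]
    split_ifs with hle
    · refine Det.const_to 24 rfl ⟨rfl, by dsimp only; omega, fun k h1 h2 h3 => ?_, c, ?_, ?_,
        Or.inl hle, hc'⟩
      · dsimp only
        rw [Function.update_of_ne h3, hk k h1 h2 h3]
      · dsimp only
        rw [Function.update_of_ne (by omega), hc]
      · dsimp only
        rw [Function.update_of_ne (by omega), h20]
    · have hci := hA'.resolve_left hle
      refine Det.seq (Det.arith_to 20 ((β : ℝ) ^ (c + 1)) rfl ?_ (Det.arith_to r (c + 1 : ℕ) rfl ?_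
        ⟨rfl, by dsimp only; omega, fun k h1 h2 h3 => ?_, c + 1, by simp, ?_, Or.inr (by omega),
          Or.inr ?_⟩))
      · have e : Addr.eval m' (.direct b) = b := rfl
        simp only [Addr.eval_ofNat, ArithOp.eval, e, eb, h20, pow_succ]
      · have e : ∀ m'', Addr.eval m'' (.direct r) = r := fun _ => rfl
        simp only [Addr.eval_ofNat, ArithOp.eval, e]
        rw [Function.update_of_ne (by omega), Function.update_of_ne (by omega), hc, e9]
        push_cast
        rfl
      · dsimp only
        rw [Function.update_of_ne h1, Function.update_of_ne h2, hk k h1 h2 h3]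
      · dsimp only
        rw [Function.update_of_ne (by omega), Function.update_self]
      · rw [Nat.add_sub_cancel]
        exact not_le.1 hle
  · rintro b' ⟨h1, h2, h3, c, h4, h5, h6, h7⟩
    refine ⟨h1, by omega, h3, c, h4, h5, ?_, h7⟩
    rcases h6 with h6 | rfl
    · exact h6
    · exact hA

/-- What is known about the parameters. -/
structure Params.Suits (p : Params) (n H : ℕ) (u : Fin n) (τ ζ : ℝ) : Prop where
  n_eq : p.n = n
  H_eq : p.H = H
  u_eq : p.u = u
  T_eq : p.T = 8 / (τ * τ)
  thr_eq : p.thr = τ * H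
  q_ge : 2 * n ≤ 2 ^ p.q
  q_le : p.q = 0 ∨ 2 ^ (p.q - 1) < 2 * n
  levels_ge : 16 * 2 ^ p.q ≤ 4 ^ p.levels
  levels_le : p.levels = 0 ∨ 4 ^ (p.levels - 1) < 16 * 2 ^ p.q
  reps_ge : 2 * p.T / ζ ≤ 2 ^ p.reps
  reps_le : p.reps = 0 ∨ 2 ^ (p.reps - 1) < 2 * p.T / ζ

/-- The three logarithms are computed later, so the conclusion concerns any later memory that agrees
with the present one on the other constant registers. -/
theorem det_setup {τ : ℝ} (h0 : m 0 = n) (h1 : m 1 = H) (h2 : m 2 = (u : ℕ)) (h3 : m 3 = τ) :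
    Det x Algo.setup ⟨m, ψ, t⟩ fun b => b.state = ψ ∧ b.time = t + 14 ∧ b.mem 0 = n ∧
      b.mem 4 = m 4 ∧ b.mem 18 = H * (8 / (τ * τ)) ∧
      ∀ (q l r : ℕ) (m' : Registers), m' 6 = (q : ℝ) → m' 7 = (l : ℝ) → m' 8 = (r : ℝ) →
        (∀ k < 20, k ≠ 6 → k ≠ 7 → k ≠ 8 → m' k = b.mem k) →
        Consts ⟨n, H, u, q, l, r, 8 / (τ * τ), τ * H⟩ m' := by
  unfold Algo.setup
  iterate 7 refine Det.seq (Det.const ?_)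
  iterate 3 refine Det.seq (Det.arith ?_)
  refine Det.seq (Det.const ?_)
  iterate 2 refine Det.seq (Det.arith ?_)
  refine Det.arith ?_
  refine ⟨rfl, rfl, ?_, ?_, ?_, ?_⟩
  · simp [h0]
  · simp
  · simp [ArithOp.eval, h1, h3]
  · intro q l r m' h6 h7 h8 hk
    constructor
    · rw [hk 1 (by omega) (by omega) (by omega) (by omega)]; simp [h1]
    · rw [hk 2 (by omega) (by omega) (by omega) (by omega)]; simp [h2]
    · rw [hk 5 (by omega) (by omega) (by omega) (by omega)]; simp [ArithOp.eval, h3]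
    · exact h6
    · exact h7
    · exact h8
    · rw [hk 9 (by omega) (by omega) (by omega) (by omega)]; simp
    · rw [hk 10 (by omega) (by omega) (by omega) (by omega)]; simp
    · rw [hk 11 (by omega) (by omega) (by omega) (by omega)]; simp
    · rw [hk 12 (by omega) (by omega) (by omega) (by omega)]; simp
    · rw [hk 13 (by omega) (by omega) (by omega) (by omega)]
      simp [ArithOp.eval, h0, Params.base]
      ring
    · rw [hk 14 (by omega) (by omega) (by omega) (by omega)]; simp [ArithOp.eval, h1, h3]
    · rw [hk 15 (by omega) (by omega) (by omega) (by omega)]; simp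
    · rw [hk 16 (by omega) (by omega) (by omega) (by omega)]; simp [ArithOp.eval, h0]
    · rw [hk 17 (by omega) (by omega) (by omega) (by omega)]; simp
    · rw [hk 19 (by omega) (by omega) (by omega) (by omega)]; simp

theorem det_prepare {τ ζ : ℝ} (h0 : m 0 = n) (h1 : m 1 = H) (h2 : m 2 = (u : ℕ)) (h3 : m 3 = τ)
    (h4 : m 4 = ζ) {N : ℕ} (hN : N = ⌊H * (8 / (τ * τ))⌋₊) (hn : 64 * n ≤ 2 ^ N)
    (hζ : 2 * (8 / (τ * τ)) / ζ ≤ 2 ^ N) :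
    Det x Algo.prepare ⟨m, ψ, t⟩ fun b => b.state = ψ ∧ b.time ≤ t + (12 * N + 28) ∧
      ∃ p : Params, Consts p b.mem ∧ p.Suits n H u τ ζ := by
  unfold Algo.prepare
  have hn0 : 0 < n := u.pos
  refine Det.seq ((det_setup h0 h1 h2 h3).mono ?_)
  rintro ⟨m₁, ψ₁, t₁⟩ ⟨rfl, ht₁, e0, e4, e18, hcon⟩
  simp only at ht₁ e0 e4 e18 hcon
  rw [h4] at e4
  have hc₁ : Consts ⟨n, H, u, 0, 0, 0, 8 / (τ * τ), τ * H⟩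
      (Function.update (Function.update (Function.update m₁ 6 ((0 : ℕ) : ℝ)) 7 ((0 : ℕ) : ℝ)) 8
        ((0 : ℕ) : ℝ)) := hcon 0 0 0 _ (by simp) (by simp) (by simp) fun k _ h6 h7 h8 => by
    rw [Function.update_of_ne h8, Function.update_of_ne h7, Function.update_of_ne h6]
  have e9 : m₁ 9 = 1 := by simpa using hc₁.r9
  have e11 : m₁ 11 = 2 := by simpa using hc₁.r11
  have e15 : m₁ 15 = 16 := by simpa using hc₁.r15
  have e5 : m₁ 5 = 8 / (τ * τ) := by simpa using hc₁.r5
  refine Det.seq (Det.arith_to 22 (2 * n) rfl ?_ (Det.seq ((det_logarithm (r := 6) (b := 11)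
    (β := 2) (A := 2 * n) (X := H * (8 / (τ * τ))) (by omega) (by omega) ?_ ?_ ?_ ?_ ?_).mono ?_)))
  · simp [ArithOp.eval, e11, e0]
  · simp
  · simp [e11]
  · simp [e9]
  · simp [e18]
  · rw [← hN]
    have : 2 * n ≤ 2 ^ N := by omega
    exact_mod_cast this
  rintro ⟨m₂, ψ₂, t₂⟩ ⟨rfl, ht₂, hk₂, q, hq, hq20, hqA, hqm⟩
  simp only at ht₂ hk₂ hq hq20
  have hq_ge : 2 * n ≤ 2 ^ q := by exact_mod_cast hqA
  have hq_le : q = 0 ∨ 2 ^ (q - 1) < 2 * n := hqm.imp_right fun h => by exact_mod_cast h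
  have hq4 : 2 ^ q ≤ 4 * n := by
    rcases hq_le with h | h
    · subst h
      simp
      omega
    · rcases q with _ | q
      · simp
        omega
      · rw [pow_succ]
        simp only [Nat.add_sub_cancel] at h
        omega
  have k₂ : ∀ k, k ≠ 6 → k ≠ 20 → k ≠ 24 → k ≠ 22 → m₂ k = m₁ k := fun k a b c d => by
    rw [hk₂ k a b c, Function.update_of_ne d]
  refine Det.seq (Det.arith_to 22 (16 * 2 ^ q) rfl ?_ (Det.seq (Det.const_to 23 rfl (Det.seq
    ((det_logarithm (r := 7) (b := 23) (β := 4) (A := 16 * 2 ^ q) (X := H * (8 / (τ * τ)))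
      (by omega) (by omega) ?_ ?_ ?_ ?_ ?_).mono ?_)))))
  · simp only [Addr.eval_ofNat, ArithOp.eval]
    rw [k₂ 15 (by omega) (by omega) (by omega) (by omega), e15, hq20]
    norm_num
  · simp
  · simp
  · simp only [ne_eq, Nat.reduceEqDiff, not_false_eq_true, Function.update_of_ne]
    rw [k₂ 9 (by omega) (by omega) (by omega) (by omega), e9]
  · simp only [ne_eq, Nat.reduceEqDiff, not_false_eq_true, Function.update_of_ne]
    rw [k₂ 18 (by omega) (by omega) (by omega) (by omega), e18]
  · rw [← hN]
    -- Minimality of `q` gives `2 ^ q ≤ 4 * n`, so `16 * 2 ^ q ≤ 64 * n`; this is the origin of the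
    -- constant in `hn`.
    have h4 : 2 ^ N ≤ 4 ^ N := Nat.pow_le_pow_left (by norm_num) N
    have : 16 * 2 ^ q ≤ 4 ^ N := by omega
    exact_mod_cast this
  rintro ⟨m₃, ψ₃, t₃⟩ ⟨rfl, ht₃, hk₃, l, hl, -, hlA, hlm⟩
  simp only at ht₃ hk₃ hl
  have hl_ge : 16 * 2 ^ q ≤ 4 ^ l := by exact_mod_cast hlA
  have hl_le : l = 0 ∨ 4 ^ (l - 1) < 16 * 2 ^ q := hlm.imp_right fun h => by exact_mod_cast h
  have k₃ : ∀ k, k ≠ 7 → k ≠ 20 → k ≠ 24 → k ≠ 22 → k ≠ 23 → m₃ k = m₂ k := fun k a b c d e => by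
    rw [hk₃ k a b c, Function.update_of_ne e, Function.update_of_ne d]
  refine Det.seq (Det.arith_to 22 (2 * (8 / (τ * τ))) rfl ?_ (Det.seq (Det.arith_to 22
    (2 * (8 / (τ * τ)) / ζ) rfl ?_ ((det_logarithm (r := 8) (b := 11) (β := 2)
      (A := 2 * (8 / (τ * τ)) / ζ) (X := H * (8 / (τ * τ))) (by omega) (by omega)
        ?_ ?_ ?_ ?_ ?_).mono ?_))))
  · simp only [Addr.eval_ofNat, ArithOp.eval]
    rw [k₃ 11 (by omega) (by omega) (by omega) (by omega) (by omega),
      k₂ 11 (by omega) (by omega) (by omega) (by omega), e11,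
      k₃ 5 (by omega) (by omega) (by omega) (by omega) (by omega),
      k₂ 5 (by omega) (by omega) (by omega) (by omega), e5]
  · simp only [Addr.eval_ofNat, ArithOp.eval]
    rw [Function.update_self, Function.update_of_ne (by omega),
      k₃ 4 (by omega) (by omega) (by omega) (by omega) (by omega),
      k₂ 4 (by omega) (by omega) (by omega) (by omega), e4]
  · simp
  · rw [Function.update_of_ne (by omega), Function.update_of_ne (by omega),
      k₃ 11 (by omega) (by omega) (by omega) (by omega) (by omega),
      k₂ 11 (by omega) (by omega) (by omega) (by omega), e11]
    norm_num
  · rw [Function.update_of_ne (by omega), Function.update_of_ne (by omega),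
      k₃ 9 (by omega) (by omega) (by omega) (by omega) (by omega),
      k₂ 9 (by omega) (by omega) (by omega) (by omega), e9]
  · rw [Function.update_of_ne (by omega), Function.update_of_ne (by omega),
      k₃ 18 (by omega) (by omega) (by omega) (by omega) (by omega),
      k₂ 18 (by omega) (by omega) (by omega) (by omega), e18]
  · rw [← hN]
    exact_mod_cast hζ
  rintro ⟨m₄, ψ₄, t₄⟩ ⟨rfl, ht₄, hk₄, r, hr, -, hrA, hrm⟩
  simp only at ht₄ hk₄ hr
  refine ⟨rfl, ?_, ⟨n, H, u, q, l, r, 8 / (τ * τ), τ * H⟩, hcon q l r m₄ ?_ ?_ hr ?_,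
    ⟨rfl, rfl, rfl, rfl, rfl, hq_ge, hq_le, hl_ge, hl_le, by exact_mod_cast hrA,
      by exact_mod_cast hrm⟩⟩
  · rw [← hN] at ht₂ ht₃ ht₄
    dsimp only
    omega
  · rw [hk₄ 6 (by omega) (by omega) (by omega), Function.update_of_ne (by omega),
      Function.update_of_ne (by omega), k₃ 6 (by omega) (by omega) (by omega) (by omega) (by omega),
      hq]
  · rw [hk₄ 7 (by omega) (by omega) (by omega), Function.update_of_ne (by omega),
      Function.update_of_ne (by omega), hl]
  · intro k hk h6 h7 h8
    rw [hk₄ k h8 (by omega) (by omega), Function.update_of_ne (by omega),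
      Function.update_of_ne (by omega), k₃ k h7 (by omega) (by omega) (by omega) (by omega),
      k₂ k h6 (by omega) (by omega) (by omega)]

/-- A bound for the running time. -/
def Params.totalCost (p : Params) : ℕ :=
  12 * ⌊p.H * p.T⌋₊ + 35 + ⌊p.T⌋₊ * (p.extendCost ⌊p.T⌋₊ + 1) + ⌊p.T⌋₊ * examineCost p.H ⌊p.T⌋₊

open Classical in
-- The errors of the at most `⌊T⌋₊` searches are the only randomness that matters: after a faithful
-- selection the flag must be set by `hT`, and pruning is deterministic.
theorem spec_main {τ ζ : ℝ} (hτ : 0 < τ) (hH : 0 < H) (hn : 64 * n ≤ 2 ^ ⌊H * (8 / (τ * τ))⌋₊)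
    (hζ : 2 * (8 / (τ * τ)) / ζ ≤ 2 ^ ⌊H * (8 / (τ * τ))⌋₊) (hT : 1 < ⌊8 / (τ * τ)⌋₊ * τ ^ 2)
    (x : Fin H → SpinConfig n) (u : Fin n) :
    ∃ p : Params, p.Suits n H u τ ζ ∧ Spec x Algo.main (QBranch.initial H u τ ζ)
      (fun b => b.time ≤ p.totalCost)
      (fun b => if GreedyResult x u τ (b.output n) then 0 else 1) (⌊p.T⌋₊ * (1 / 2) ^ p.reps) := by
  have hini := det_prepare (x := x) (u := u) (m := (QBranch.initial H u τ ζ).mem)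
    (ψ := (QBranch.initial H u τ ζ).state) (t := 0) (τ := τ) (ζ := ζ) rfl rfl rfl rfl rfl rfl hn hζ
  obtain ⟨⟨m₁, ψ₁, t₁⟩, hrun, rfl, ht₁, p, hc, hp⟩ := hini
  simp only at ht₁ hc
  refine ⟨p, hp, ?_⟩
  have hv : p.Valid H u τ := ⟨hp.n_eq, hp.H_eq, hp.u_eq, hp.thr_eq, hp.q_ge, hp.levels_ge, hH, hτ⟩
  have hst : (QBranch.initial H u τ ζ).state = Finsupp.single (enc 0) 1 := by
    have : enc 0 = fun _ => (0 : ℝ) := by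
      funext r
      rcases r with _ | _ | _ | _ | _ | _ | _ | _ | _ | _ | r <;> simp [enc, qcfg]
    rw [this]
    rfl
  unfold Algo.main
  refine Spec.seq_det ⟨_, hrun, ?_⟩
  rw [hst]
  refine Spec.seq _ (spec_select (x := x) (t := t₁) hv hc one_ne_zero) ?_
  rintro ⟨m₂, ψ, t₂⟩ ⟨⟨len, hs⟩, ht₂⟩
  obtain ⟨hconst, ⟨z, hz, rfl : ψ = _⟩, hl, hlen, hflag⟩ := hs
  simp only at hconst hl hflag ht₂
  have hlt := hl.lt
  have hT' : p.T = 8 / (τ * τ) := hp.T_eq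
  refine Spec.of_det ((det_pruneList (x := x) (t := t₂) hp.H_eq (hc.congr hconst)
    (e := fun i => m₂ (50 + i)) (len := len) (by rw [hp.n_eq]; exact hlt.le)
      ⟨hl.length, fun _ _ => rfl⟩ hz).mono ?_)
  rintro b ⟨hb0, hb1, hbr, hbt⟩
  constructor
  · have h1 : len * examineCost H len ≤ ⌊p.T⌋₊ * examineCost p.H ⌊p.T⌋₊ := by
      rw [hp.H_eq]
      unfold examineCost weightCost
      gcongr
    have h2 : p.totalCost = 12 * ⌊p.H * p.T⌋₊ + 35 + ⌊p.T⌋₊ * (p.extendCost ⌊p.T⌋₊ + 1)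
      + ⌊p.T⌋₊ * examineCost p.H ⌊p.T⌋₊ := rfl
    rw [← hT', ← hp.H_eq] at ht₁
    omega
  · have ho := output_eq_prune hv hl hb0 hb1 hbr
    unfold unfaithful
    by_cases hf : Faithful x u τ ⌊p.T⌋₊ m₂
    · have hg := hf.greedyLoop hflag hH (by rw [hT']; exact hT)
      rw [if_pos ⟨_, hg, ho⟩]
      exact (if_pos hf).ge
    · refine le_trans ?_ (if_neg hf).ge
      split_ifs <;> norm_num

end

/-! ### The running time -/

/-- By minimality of the exponent, `4 ^ l` is at most `4 * 16 * (4 * n) = 256 * n`. -/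
theorem le_sixteen_mul_sqrt {n q l : ℕ} (hn : 1 ≤ n) (hq : 2 ^ q ≤ 4 * n)
    (hl : l = 0 ∨ 4 ^ (l - 1) < 16 * 2 ^ q) : (2 : ℝ) ^ l ≤ 16 * Real.sqrt n := by
  have h : 4 ^ l ≤ 256 * n := by
    rcases l with _ | l
    · simp
      omega
    · rcases hl with hl | hl
      · omega
      · rw [Nat.add_sub_cancel] at hl
        rw [pow_succ]
        omega
  have h' : ((2 : ℝ) ^ l) ^ 2 ≤ 256 * n := by
    rw [← pow_mul, mul_comm, pow_mul]
    norm_num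
    exact_mod_cast h
  refine le_of_sq_le_sq ?_ (by positivity)
  rw [mul_pow, Real.sq_sqrt (by positivity)]
  linarith

theorem two_le_log_eight : (2 : ℝ) ≤ Real.log 8 := by
  have h : Real.log 8 = 3 * Real.log 2 := by
    rw [show (8 : ℝ) = 2 ^ 3 by norm_num, Real.log_pow]
    norm_num
  have := Real.log_two_gt_d9
  linarith

theorem reps_le_log {A : ℝ} (hA : 8 ≤ A) {r : ℕ} (hr : r = 0 ∨ (2 : ℝ) ^ (r - 1) < 2 * A) :
    (r : ℝ) ≤ 3 * Real.log A := by
  have h8 : 2 ≤ Real.log A := two_le_log_eight.trans (Real.log_le_log (by norm_num) hA)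
  rcases r with _ | r
  · simp
    linarith
  · rcases hr with hr | hr
    · omega
    · rw [Nat.add_sub_cancel] at hr
      have h := Real.log_lt_log (by positivity) hr
      rw [Real.log_pow, Real.log_mul (by norm_num) (by linarith)] at h
      have h2 := Real.log_two_gt_d9
      have h3 := Real.log_two_lt_d9
      push_cast
      have : (r : ℝ) * (1 / 2) ≤ r * Real.log 2 := by gcongr; linarith
      have hr0 : (0 : ℝ) ≤ r := by positivity
      nlinarith

theorem climbCost_succ_le (H q l : ℕ) : climbCost H q l + 1 ≤ 34 * groverCost H q * 2 ^ l := by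
  have hG : 43 ≤ groverCost H q := by
    unfold groverCost
    omega
  -- The extra term on the left is the one in `∑_{k<l} 2^k = 2^l - 1`. Sixteen rounds of at most `2
  -- * 2^k` iterations account for `32` of the `34`, and the rest absorbs the overhead.
  have h : ∀ l, climbCost H q l + 1 + 34 * groverCost H q ≤ 34 * groverCost H q * 2 ^ l + 3 := by
    intro l
    unfold climbCost
    induction l with
    | zero => simp; omega
    | succ l ih =>
      rw [Finset.sum_range_succ, pow_succ]
      have h1 : l + 1 ≤ 2 ^ l := l.lt_two_pow_self
      have h2 : 16 * (roundCost H q l + 1) + 3 ≤ 34 * groverCost H q * 2 ^ l := by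
        unfold roundCost
        nlinarith
      rw [← mul_assoc]
      omega
  have := h l
  omega

theorem Params.Suits.totalCost_le {p : Params} {n H : ℕ} {u : Fin n} {τ ζ T : ℝ}
    (hp : p.Suits n H u τ ζ) (hT : p.T = T) (hT8 : 8 ≤ T) (hH : 1 ≤ H) (hζ : 0 < ζ) (hζ1 : ζ < 1)
    (hn : n ≤ 2 ^ H) :
    (p.totalCost : ℝ) ≤
      300000 * (H * T ^ 2 + H * Real.sqrt n * T * Real.log (T / ζ)) := by
  have hn0 : 1 ≤ n := u.pos
  have hq4 : 2 ^ p.q ≤ 4 * n := by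
    rcases hp.q_le with h | h
    · rw [h]
      simp
      omega
    · rcases hq : p.q with _ | q
      · simp
        omega
      · rw [hq, Nat.add_sub_cancel] at h
        rw [pow_succ]
        omega
  -- Since `n ≤ 2 ^ H`, the number of qubits is at most of order `H`, so that decoding and Hadamard
  -- gates are not more expensive than reading the samples.
  have hqH : p.q ≤ H + 2 := by
    refine (Nat.pow_le_pow_iff_right (a := 2) (by norm_num)).1 (hq4.trans ?_)
    rw [pow_add]
    omega
  have hH' : (1 : ℝ) ≤ H := by exact_mod_cast hH
  have hA : 8 ≤ T / ζ := by
    rw [le_div_iff₀ hζ]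
    nlinarith
  have hreps : (p.reps : ℝ) ≤ 3 * Real.log (T / ζ) := by
    refine reps_le_log hA ?_
    rw [← mul_div_assoc, ← hT]
    exact hp.reps_le
  have hlev := le_sixteen_mul_sqrt hn0 hq4 hp.levels_le
  have hG : (groverCost H p.q : ℝ) ≤ 149 * H := by
    have : groverCost H p.q ≤ 149 * H := by
      unfold groverCost
      omega
    exact_mod_cast this
  have hclimb : ((climbCost H p.q p.levels + 1 : ℕ) : ℝ) ≤ 34 * (149 * H) * (16 * Real.sqrt n) := by
    refine le_trans (Nat.cast_le.2 (climbCost_succ_le H p.q p.levels)) ?_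
    push_cast
    gcongr
  have ht : (⌊T⌋₊ : ℝ) ≤ T := Nat.floor_le (by linarith)
  have hHT : (⌊(H : ℝ) * T⌋₊ : ℝ) ≤ H * T := Nat.floor_le (by positivity)
  have hw : (weightCost H ⌊T⌋₊ : ℝ) ≤ H * (33 * T + 53) := by
    unfold weightCost
    push_cast
    have : (H : ℝ) * (33 * ⌊T⌋₊ + 46) ≤ H * (33 * T + 46) := by gcongr
    linarith
  have hlog : 0 ≤ Real.log (T / ζ) := Real.log_nonneg (by linarith)
  have hrc : (p.reps : ℝ) * ((climbCost H p.q p.levels + 1 : ℕ) : ℝ) ≤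
      3 * Real.log (T / ζ) * (34 * (149 * H) * (16 * Real.sqrt n)) := by gcongr
  have he : (p.extendCost ⌊T⌋₊ : ℝ) + 1 ≤ H * (33 * T + 61) +
      3 * Real.log (T / ζ) * (34 * (149 * H) * (16 * Real.sqrt n)) := by
    unfold Params.extendCost
    rw [hp.H_eq]
    push_cast at hrc ⊢
    linarith
  have hx : (examineCost H ⌊T⌋₊ : ℝ) ≤ H * (33 * T + 87) := by
    unfold examineCost
    push_cast
    linarith
  have h1 : (⌊T⌋₊ : ℝ) * ((p.extendCost ⌊T⌋₊ : ℝ) + 1) ≤ T * (H * (33 * T + 61) +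
      3 * Real.log (T / ζ) * (34 * (149 * H) * (16 * Real.sqrt n))) := by gcongr
  have h2 : (⌊T⌋₊ : ℝ) * (examineCost H ⌊T⌋₊ : ℝ) ≤ T * (H * (33 * T + 87)) := by gcongr
  have h3 : (8 : ℝ) * (H * T) ≤ H * T ^ 2 := by
    rw [show (H : ℝ) * T ^ 2 = T * (H * T) by ring]
    gcongr
  have h4 : (8 : ℝ) ≤ H * T := by nlinarith
  have h5 : 0 ≤ H * Real.sqrt n * T * Real.log (T / ζ) := by positivity
  -- The dominant coefficient is `3 * 34 * 149 * 16 = 243168`, for the searches. All terms of lower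
  -- order are absorbed by `H * T ^ 2` because `T ≥ 8`.
  unfold Params.totalCost
  rw [hp.H_eq, hT]
  push_cast
  nlinarith

/-! ### The probability of success -/

open Classical in
-- `Spec` yields upper bounds for expectations, so the probability of success is read off from that
-- of the complementary event.
theorem outputProb_add_wt (A : QProg) {n H : ℕ} (x : Fin H → SpinConfig n) (u : Fin n) (τ ζ : ℝ)
    (E : Finset (Fin n) → Prop) :
    A.outputProb x u τ ζ E
      + wt (fun b => if E (b.output n) then 0 else 1) (A.run x (QBranch.initial H u τ ζ)) = 1 := by
  have h : A.outputProb x u τ ζ E =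
      wt (fun b => if E (b.output n) then 1 else 0) (A.run x (QBranch.initial H u τ ζ)) := by
    unfold QProg.outputProb QProg.outcomes wt
    induction A.run x (QBranch.initial H u τ ζ) using Multiset.induction with
    | empty => simp
    | cons b s ih =>
      by_cases hb : E (b.output n)
      · simp [hb, ih]
      · simp [hb, ih]
  rw [h, ← wt_add]
  have h1 : (fun b : QBranch => ((if E (b.output n) then 1 else 0)
      + if E (b.output n) then 0 else 1 : ℝ)) = fun _ => 1 := by
    funext b
    split_ifs <;> simp
  rw [h1, QProg.wt_one_run]
  simp [QBranch.prob, QBranch.initial]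

theorem outputProb_mono (A : QProg) {n H : ℕ} (x : Fin H → SpinConfig n) (u : Fin n) (τ ζ : ℝ)
    {E F : Finset (Fin n) → Prop} (h : ∀ N, E N → F N) :
    A.outputProb x u τ ζ E ≤ A.outputProb x u τ ζ F := by
  classical
  have h1 := outputProb_add_wt A x u τ ζ E
  have h2 := outputProb_add_wt A x u τ ζ F
  have h3 : wt (fun b => if F (b.output n) then 0 else 1) (A.run x (QBranch.initial H u τ ζ)) ≤
      wt (fun b => if E (b.output n) then 0 else 1) (A.run x (QBranch.initial H u τ ζ)) := by
    refine wt_mono fun b _ => ?_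
    by_cases hE : E (b.output n)
    · simp [hE, h _ hE]
    · rw [if_neg hE]
      split_ifs <;> norm_num
  linarith

theorem outputProb_nonneg (A : QProg) {n H : ℕ} (x : Fin H → SpinConfig n) (u : Fin n) (τ ζ : ℝ)
    (E : Finset (Fin n) → Prop) : 0 ≤ A.outputProb x u τ ζ E :=
  Multiset.sum_nonneg fun a ha => by
    obtain ⟨b, -, rfl⟩ := Multiset.mem_map.1 ha
    exact b.prob_nonneg

/-! ### The number of samples -/

/-- For `n ≥ 2` one has `n + 1 ≤ n²`, so the number of events is at most a power of `n` with
exponent `3s + 5 ≤ T`, which `T * log n` compensates. For `n = 1` the factor `n - 1` vanishes. -/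
theorem inaccuracy_le {n s : ℕ} {T X ζ : ℝ} (hn : 1 ≤ n) (hζ : 0 < ζ) (hT : 8 ≤ T)
    (hs : (s : ℝ) ≤ T / 8) (hX : Real.log (1 / ζ) + T * Real.log n ≤ X) :
    ((n : ℝ) + 1) ^ s * (n - 1) * 2 ^ s * 8 * Real.exp (-X) ≤ ζ / 2 := by
  rcases hn.eq_or_lt with rfl | hn2
  · simp
    linarith
  have hN : (2 : ℝ) ≤ n := by exact_mod_cast hn2
  have hN0 : (0 : ℝ) < n := by linarith
  have h1 : Real.exp (-X) ≤ ζ / (n : ℝ) ^ T := by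
    rw [le_div_iff₀ (by positivity), Real.rpow_def_of_pos hN0, ← Real.exp_add]
    calc Real.exp (-X + Real.log n * T) ≤ Real.exp (Real.log ζ) := by
          refine Real.exp_le_exp.2 ?_
          rw [one_div, Real.log_inv] at hX
          linarith
      _ = ζ := Real.exp_log hζ
  have h2 : ((n : ℝ) + 1) ^ s ≤ n ^ (2 * s) := by
    rw [pow_mul]
    gcongr
    nlinarith
  have h3 : (2 : ℝ) ^ s ≤ n ^ s := by gcongr
  have h4 : (16 : ℝ) ≤ n ^ 4 := by
    calc (16 : ℝ) = 2 ^ 4 := by norm_num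
      _ ≤ n ^ 4 := by gcongr
  have h5 : ((n : ℝ) + 1) ^ s * (n - 1) * 2 ^ s * 16 ≤ n ^ T := by
    calc ((n : ℝ) + 1) ^ s * (n - 1) * 2 ^ s * 16 ≤ n ^ (2 * s) * n * n ^ s * n ^ 4 := by
          gcongr <;> linarith
      _ = n ^ (3 * s + 5) := by ring
      _ = (n : ℝ) ^ ((3 * s + 5 : ℕ) : ℝ) := (Real.rpow_natCast _ _).symm
      _ ≤ n ^ T := by
        refine Real.rpow_le_rpow_of_exponent_le (by linarith) ?_
        push_cast
        linarith
  have h6 : 0 ≤ ((n : ℝ) + 1) ^ s * (n - 1) * 2 ^ s * 8 := by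
    have : (0 : ℝ) ≤ n - 1 := by linarith
    positivity
  calc ((n : ℝ) + 1) ^ s * (n - 1) * 2 ^ s * 8 * Real.exp (-X)
      ≤ ((n : ℝ) + 1) ^ s * (n - 1) * 2 ^ s * 8 * (ζ / (n : ℝ) ^ T) := by gcongr
    _ = (((n : ℝ) + 1) ^ s * (n - 1) * 2 ^ s * 16) / n ^ T * (ζ / 2) := by ring
    _ ≤ 1 * (ζ / 2) := by
      gcongr
      rw [div_le_one (by positivity)]
      exact h5
    _ = ζ / 2 := one_mul _

/-- As `δ ≤ 1/2`, the power of `δ` in the denominator supplies a second factor `2^(2T)`. One of the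
two dominates `4^s` and the other dominates `T`. -/
theorem sampleFactor_ge {T τ δ : ℝ} {s : ℕ} (hτ : 0 < τ) (hT : 8 ≤ T) (hs : (s : ℝ) ≤ T) (hδ : 0 < δ)
    (hδ1 : δ ≤ 1 / 2) : T * 4 ^ s / τ ^ 2 ≤ (2 : ℝ) ^ (2 * T) / (τ ^ 2 * δ ^ (2 * T)) := by
  have h1 : δ ^ (2 * T) ≤ ((2 : ℝ) ^ (2 * T))⁻¹ := by
    rw [← Real.inv_rpow (by norm_num)]
    exact Real.rpow_le_rpow hδ.le (by linarith) (by linarith)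
  have h2 : (4 : ℝ) ^ s ≤ 2 ^ (2 * T) := by
    rw [Real.rpow_mul (by norm_num), ← Real.rpow_natCast,
      show (2 : ℝ) ^ (2 : ℝ) = 4 by norm_num]
    exact Real.rpow_le_rpow_of_exponent_le (by norm_num : (1 : ℝ) ≤ 4) hs
  have h3 : T ≤ 2 ^ (2 * T) := by
    have h := one_add_mul_self_le_rpow_one_add (s := (1 : ℝ)) (p := 2 * T) (by norm_num) (by linarith)
    norm_num at h
    linarith
  have h4 : (0 : ℝ) < 2 ^ (2 * T) := by positivity
  calc T * 4 ^ s / τ ^ 2 ≤ 2 ^ (2 * T) * 2 ^ (2 * T) / τ ^ 2 := by gcongr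
    _ = (2 : ℝ) ^ (2 * T) / (τ ^ 2 * ((2 : ℝ) ^ (2 * T))⁻¹) := by
      field_simp
    _ ≤ _ := by gcongr

theorem threshold_le_one {α β : ℝ} (hα : 0 < α) (h : α ≤ β) :
    α ^ 2 * Real.exp (-12 * β) ≤ 1 := by
  have h1 : α ≤ Real.exp β := by linarith [Real.add_one_le_exp β]
  calc α ^ 2 * Real.exp (-12 * β) ≤ Real.exp β ^ 2 * Real.exp (-12 * β) := by gcongr
    _ = Real.exp (-10 * β) := by
      rw [← Real.exp_nat_mul, ← Real.exp_add]
      congr 1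
      push_cast
      ring
    _ ≤ 1 := Real.exp_le_one_iff.2 (by linarith)

/-- With `y = e^{-6β}` the claim reduces to `y (1 + α² y²) ≤ 1`. It follows from `y (1 + 6β) ≤ 1`,
since `α² y² ≤ (β y)² ≤ β`. -/
theorem threshold_add_sq_le {α β : ℝ} (hα : 0 < α) (h : α ≤ β) :
    α ^ 2 * Real.exp (-12 * β) + (α ^ 2 * Real.exp (-12 * β)) ^ 2
      ≤ α ^ 2 * Real.exp (-6 * β) := by
  set y := Real.exp (-6 * β) with hy
  have hβ : 0 < β := hα.trans_le h
  have hy0 : 0 < y := Real.exp_pos _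
  have h12 : Real.exp (-12 * β) = y ^ 2 := by
    rw [hy, ← Real.exp_nat_mul]
    congr 1
    push_cast
    ring
  have h1 : y * (1 + 6 * β) ≤ 1 := by
    have := Real.add_one_le_exp (6 * β)
    calc y * (1 + 6 * β) ≤ y * Real.exp (6 * β) := by gcongr; linarith
      _ = 1 := by
        rw [hy, ← Real.exp_add]
        simp
  have hy1 : y ≤ 1 := by nlinarith
  have h2 : y * β ≤ 1 := by nlinarith
  have h3 : α ^ 2 * y ^ 2 ≤ 6 * β := by
    have : α ^ 2 ≤ β ^ 2 := by gcongr
    have : α ^ 2 * y ^ 2 ≤ β ^ 2 * y ^ 2 := by gcongr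
    have : β ^ 2 * y ^ 2 = (y * β) * (y * β) := by ring
    have : (y * β) * (y * β) ≤ 1 * (1 * β) := by gcongr
    linarith
  rw [h12]
  have h4 : y * (1 + α ^ 2 * y ^ 2) ≤ 1 := by
    refine le_trans ?_ h1
    gcongr
  calc α ^ 2 * y ^ 2 + (α ^ 2 * y ^ 2) ^ 2 = α ^ 2 * y * (y * (1 + α ^ 2 * y ^ 2)) := by ring
    _ ≤ α ^ 2 * y * 1 := by gcongr
    _ = α ^ 2 * y := mul_one _

/-- This guarantees that the bounded loop for the logarithm runs long enough. With `⌊T⌋₊ = 8 + d`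
one has `2T ≤ 2^(7+d)`, and `H * ⌊T⌋₊ ≥ 7 + d + H`. -/
theorem two_mul_div_le_two_pow {T ζ : ℝ} {H : ℕ} (hT : 8 ≤ T) (hH : 1 ≤ H) (hζ : 0 < ζ)
    (h : 1 / ζ ≤ 2 ^ H) : 2 * T / ζ ≤ 2 ^ ⌊H * T⌋₊ := by
  have ht : 8 ≤ ⌊T⌋₊ := Nat.le_floor (by exact_mod_cast hT)
  have hle : H * ⌊T⌋₊ ≤ ⌊H * T⌋₊ := by
    refine Nat.le_floor ?_
    push_cast
    gcongr
    exact Nat.floor_le (by linarith)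
  generalize ht' : ⌊T⌋₊ = t at *
  have hTt : T ≤ t + 1 := by
    rw [← ht']
    exact (Nat.lt_floor_add_one T).le
  obtain ⟨d, rfl⟩ := Nat.exists_eq_add_of_le ht
  have h1 : 2 * (8 + d + 1) ≤ 2 ^ (7 + d) := by
    rw [pow_add]
    have := d.lt_two_pow_self
    omega
  have h1' : 2 * ((8 + d : ℕ) + 1 : ℝ) ≤ 2 ^ (7 + d) := by exact_mod_cast h1
  have h2 : 7 + d + H ≤ ⌊H * T⌋₊ := by
    refine le_trans ?_ hle
    nlinarith
  calc 2 * T / ζ = 2 * T * (1 / ζ) := by ring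
    _ ≤ 2 ^ (7 + d) * 2 ^ H := by
      gcongr
      linarith
    _ = 2 ^ (7 + d + H) := (pow_add _ _ _).symm
    _ ≤ 2 ^ ⌊H * T⌋₊ := pow_le_pow_right₀ (by norm_num) h2

theorem le_two_pow_of_log_le {a : ℝ} {H : ℕ} (ha : 0 < a) (h : 2 * Real.log a ≤ H) :
    a ≤ 2 ^ H := by
  rw [← Real.log_le_log_iff ha (by positivity), Real.log_pow]
  have := Real.log_two_gt_d9
  have : (H : ℝ) * (1 / 2) ≤ H * Real.log 2 := by gcongr; linarith
  linarith

/-- The error budget is split evenly between inaccurate samples and unlucky measurements. -/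
theorem RBM.one_sub_le_sum_samplesProb_mul {n m H : ℕ} (R : RBM n m) {ζ : ℝ} (hζ : 0 ≤ ζ)
    {bad : (Fin H → SpinConfig n) → Prop} {φ : (Fin H → SpinConfig n) → ℝ} (hφ : ∀ x, 0 ≤ φ x)
    (hgood : ∀ x, ¬ bad x → 1 - ζ / 2 ≤ φ x) (hbad : R.samplesPr bad ≤ ζ / 2) :
    1 - ζ ≤ ∑ x, R.samplesProb x * φ x := by
  classical
  have hsum : ∀ x, R.samplesProb x * (1 - ζ / 2) - (if bad x then R.samplesProb x else 0) ≤
      R.samplesProb x * φ x := by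
    intro x
    have h0 := R.samplesProb_nonneg x
    by_cases hx : bad x
    · rw [if_pos hx]
      have := mul_nonneg h0 (hφ x)
      nlinarith
    · rw [if_neg hx, sub_zero]
      exact mul_le_mul_of_nonneg_left (hgood x hx) h0
  have htot := Finset.sum_le_sum fun x (_ : x ∈ Finset.univ) => hsum x
  rw [Finset.sum_sub_distrib, ← Finset.sum_mul, R.sum_samplesProb] at htot
  have hb : ∑ x : Fin H → SpinConfig n, (if bad x then R.samplesProb x else 0) ≤ ζ / 2 := by
    refine le_trans (le_of_eq ?_) hbad
    unfold RBM.samplesPr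
    refine Finset.sum_congr rfl fun x _ => ?_
    congr
  linarith

end

/-! ### Running time, simulation of the greedy algorithm, and recovery of the neighborhood -/

theorem theorem6 :
    ∃ (A : QProg) (C K : ℝ), 0 < C ∧ 0 < K ∧
      ∀ (n m H : ℕ) (R : RBM n m) (α β ζ τ T δ : ℝ) (u : Fin n),
        0 < α → α ≤ β → R.NonDegenerate α β → R.LocallyConsistent →
        0 < ζ → ζ < 1 →
        τ = α ^ 2 * Real.exp (-12 * β) → T = 8 / τ ^ 2 → δ = 1 / 2 * Real.exp (-2 * β) →
        C * ((Real.log (1 / ζ) + T * Real.log n) *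
            ((2 : ℝ) ^ (2 * T) / (τ ^ 2 * δ ^ (2 * T)))) ≤ H →
        -- the running time, for all samples and all measurement outcomes
        (∀ (x : Fin H → SpinConfig n), ∀ b ∈ A.outcomes x u τ ζ,
          (b.time : ℝ) ≤
            K * (H * T ^ 2 + H * Real.sqrt n * T * Real.log (T / ζ))) ∧
        -- on all samples, the algorithm carries out the greedy maximization up to an error `ζ / 2`
        (∀ x : Fin H → SpinConfig n, 1 - ζ / 2 ≤ A.outputProb x u τ ζ (GreedyResult x u τ)) ∧
        -- on independent samples of the RBM, it recovers the two-hop neighborhood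
        ∃ N : Finset (Fin n), R.IsTwoHopNeighborhood u N ∧
          1 - ζ ≤ ∑ x : Fin H → SpinConfig n,
            R.samplesProb x * A.outputProb x u τ ζ (fun S => S = N) := by
  classical
  -- The factor `32` is what Hoeffding's exponent `ε² H / 4` needs in order to reach `L`, for the
  -- accuracy `ε = τ² / (8 * 2^s)` chosen below and `T τ² = 8`.
  refine ⟨Algo.main, 32, 300000, by norm_num, by norm_num, ?_⟩
  intro n m H R α β ζ τ T δ u hα hαβ hR hL hζ hζ1 hτ hT hδ hH
  have hn0 : 1 ≤ n := u.pos
  have hτ0 : 0 < τ := by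
    rw [hτ]
    positivity
  have hτ1 : τ ≤ 1 := by
    rw [hτ]
    exact threshold_le_one hα hαβ
  have hgap : τ + τ ^ 2 ≤ α ^ 2 * Real.exp (-6 * β) := by
    rw [hτ]
    exact threshold_add_sq_le hα hαβ
  have hδ0 : 0 < δ := by
    rw [hδ]
    positivity
  have hδ1 : δ ≤ 1 / 2 := by
    rw [hδ]
    have : Real.exp (-2 * β) ≤ 1 := Real.exp_le_one_iff.2 (by linarith)
    linarith
  have hτ2 : τ ^ 2 ≤ 1 := pow_le_one₀ hτ0.le hτ1
  have hTτ : T * τ ^ 2 = 8 := by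
    rw [hT]
    field_simp
  have hT8 : 8 ≤ T := by
    rw [hT, le_div_iff₀ (by positivity)]
    linarith
  have hT' : 8 / (τ * τ) = T := by rw [hT, pow_two]
  set L := Real.log (1 / ζ) + T * Real.log n with hLdef
  have hlogζ : 0 < Real.log (1 / ζ) := Real.log_pos (by rw [lt_div_iff₀ hζ]; linarith)
  have hlogn : 0 ≤ Real.log n := Real.log_natCast_nonneg n
  have hL0 : 0 < L := by positivity
  -- The largest number of nodes that the greedy loop can select; accuracy is needed only for
  -- conditioning sets of this size.
  set s := ⌊1 / τ ^ 2⌋₊ with hsdef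
  have hsT : (s : ℝ) ≤ T / 8 := by
    refine (Nat.floor_le (by positivity)).trans_eq ?_
    rw [hT]
    ring
  have hHL : 32 * (L * (T * 4 ^ s / τ ^ 2)) ≤ H := by
    refine le_trans ?_ hH
    have h := sampleFactor_ge hτ0 hT8 (by linarith : (s : ℝ) ≤ T) hδ0 hδ1
    exact mul_le_mul_of_nonneg_left (mul_le_mul_of_nonneg_left h hL0.le) (by norm_num)
  have h4s : (1 : ℝ) ≤ 4 ^ s := one_le_pow₀ (by norm_num)
  have hHL2 : 2 * L ≤ H := by
    refine le_trans ?_ hHL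
    have : 1 ≤ T * 4 ^ s / τ ^ 2 := by
      rw [le_div_iff₀ (by positivity)]
      nlinarith
    nlinarith
  have hH0 : 0 < H := by
    have : (0 : ℝ) < H := by linarith
    exact_mod_cast this
  have hn2 : n ≤ 2 ^ H := by
    have : (n : ℝ) ≤ 2 ^ H := le_two_pow_of_log_le (by positivity) (by nlinarith)
    exact_mod_cast this
  have hζ2 : 1 / ζ ≤ 2 ^ H := le_two_pow_of_log_le (by positivity) (by nlinarith)
  have hHT : 7 + H ≤ ⌊(H : ℝ) * T⌋₊ := by
    refine Nat.le_floor ?_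
    push_cast
    have : (1 : ℝ) ≤ H := by exact_mod_cast hH0
    nlinarith
  have hmain := spec_main (n := n) (H := H) (τ := τ) (ζ := ζ) hτ0 hH0
    (by
      rw [hT']
      refine le_trans ?_ (Nat.pow_le_pow_right (by norm_num) hHT)
      rw [pow_add]
      omega)
    (by
      rw [hT']
      exact two_mul_div_le_two_pow hT8 hH0 hζ hζ2)
    (by
      rw [hT']
      have := Nat.lt_floor_add_one T
      nlinarith [sq_nonneg τ])
  have hinit : (QBranch.initial H u τ ζ).prob = 1 := by simp [QBranch.prob, QBranch.initial]
  have hprob : ∀ x : Fin H → SpinConfig n,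
      1 - ζ / 2 ≤ Algo.main.outputProb x u τ ζ (GreedyResult x u τ) := by
    intro x
    obtain ⟨p, hp, -, hw⟩ := hmain x u
    rw [hinit, mul_one] at hw
    have h1 := outputProb_add_wt Algo.main x u τ ζ (GreedyResult x u τ)
    have hpT : p.T = T := by rw [hp.T_eq, hT']
    have h2 : (⌊p.T⌋₊ : ℝ) * (1 / 2) ^ p.reps ≤ ζ / 2 := by
      have h3 := hp.reps_ge
      rw [hpT] at h3 ⊢
      rw [div_le_iff₀ hζ] at h3
      have h4 : (⌊T⌋₊ : ℝ) ≤ T := Nat.floor_le (by linarith)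
      rw [one_div, inv_pow, ← div_eq_mul_inv, div_le_iff₀ (by positivity)]
      linarith
    linarith
  refine ⟨?_, hprob, R.coupled u, R.isTwoHopNeighborhood_coupled hα hR hL u, ?_⟩
  · intro x b hb
    obtain ⟨p, hp, ht, -⟩ := hmain x u
    have h1 : b.time ≤ p.totalCost := ht b hb
    have h2 := hp.totalCost_le (T := T) (by rw [hp.T_eq, hT']) hT8 hH0 hζ hζ1 hn2
    exact (Nat.cast_le.2 h1).trans h2
  -- With this accuracy of the moments, covariances given at most `s` nodes are accurate up to `2^s
  -- * 4ε = τ² / 2`, strictly below the margin `τ²`.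
  · set ε := τ ^ 2 / (8 * 2 ^ s) with hε
    have h2s : (1 : ℝ) ≤ 2 ^ s := one_le_pow₀ (by norm_num)
    have hε0 : 0 ≤ ε := by positivity
    have hε1 : ε ≤ 1 := by
      rw [hε, div_le_one (by positivity)]
      linarith
    have hbad := R.samplesPr_inaccurate_le u s hε0 hε1 hH0
    have hX : L ≤ ε ^ 2 / 4 * H := by
      have h4 : (4 : ℝ) ^ s = (2 ^ s) ^ 2 := by
        rw [← pow_mul, mul_comm, pow_mul]
        norm_num
      have h5 : ε ^ 2 / 4 * (32 * (L * (T * 4 ^ s / τ ^ 2))) = L := by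
        rw [hε, h4]
        field_simp
        linear_combination 32 * hTτ
      calc L = ε ^ 2 / 4 * (32 * (L * (T * 4 ^ s / τ ^ 2))) := h5.symm
        _ ≤ ε ^ 2 / 4 * H := by gcongr
    have hbad' := hbad.trans (inaccuracy_le hn0 hζ hT8 hsT hX)
    refine R.one_sub_le_sum_samplesProb_mul (bad := fun x => ∃ S : Finset (Fin n), S.card ≤ s ∧
      ∃ v, v ≠ u ∧ 2 ^ S.card * (4 * ε) < |empAvgCov x u v S - R.avgCov u v S|) hζ.le
      (fun x => outputProb_nonneg _ x u τ ζ _) ?_ hbad'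
    intro x hx
    refine (hprob x).trans (outputProb_mono _ x u τ ζ fun N hN => ?_)
    refine greedyResult_eq_coupled R hα hR hL hτ0 hτ1 hgap hH0 (s := s) ?_ x u ?_ hN
    · intro c hc
      exact Nat.le_floor (by rwa [le_div_iff₀ (by positivity)])
    · intro S hS v hv
      by_contra hlt
      refine hx ⟨S, hS, v, hv, lt_of_lt_of_le ?_ (not_lt.1 hlt)⟩
      calc (2 : ℝ) ^ S.card * (4 * ε) ≤ 2 ^ s * (4 * ε) := by
            gcongr
            norm_num
        _ = τ ^ 2 / 2 := by
          rw [hε]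
          field_simp
          norm_num
        _ < τ ^ 2 := by
          have : 0 < τ ^ 2 := by positivity
          linarith
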